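/- **Setting.** A *marked binary tree* $(\Gamma,\mathcal C,M)$ in $\mathbb C$ is a finite tree with at least one edge, embedded in the plane with (piecewise linear) arcs as edges, in which every inner vertex (a vertex on more than one edge) has valency three, together with a colouring $\mathcal C$ of its vertices in white and black such that the two ends of each edge have different colours, and the choice $M$ of one edge at each inner vertex. $V(\Gamma)$ is the set of inner vertices; the other vertices are the terminals $\Sigma=\{\lambda_1,\dots,\lambda_m\}$. Put $a_k=1,\ b_k=2$ if $\lambda_k$ is white and $a_k=2,\ b_k=1$ if $\lambda_k$ is black. Let $C$ be the curve $y_1^3=\prod_k(x-\lambda_k)^{a_k}$, put $y_2=\prod_k(x-\lambda_k)/y_1$ (so $y_2^3=\prod_k(x-\lambda_k)^{b_k}$), and let $\rho(x,y_1)=(x,\omega y_1)$ with $\omega=\frac{-1+\sqrt{-3}}2$. Over $\mathbb C\setminus\Gamma$ the curve splits into three sheets $C^{(0)},C^{(1)},C^{(2)}$ with $\rho:C^{(0)}\to C^{(1)}\to C^{(2)}\to C^{(0)}$ (the choice of $C^{(0)}$ is arbitrary). For $v\in V(\Gamma)$ let $E_1,E_2,E_3$ be the edges at $v$ in anti-clockwise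 order with $E_3$ marked, and $\mathbf B_1,\mathbf B_2,\mathbf B_3$ the corresponding components of $\Gamma\setminus\{v\}$. $A_v$ is the class in $H_1(C,\mathbb Z)$ of the following closed path on $C$. It starts on $C^{(1)}$ if $v$ is black, on $C^{(2)}$ if $v$ is white; it turns anti-clockwise around $\mathbf B_2$, meeting $\Gamma$ only in one interior point of $E_2$, where it passes to $C^{(2)}$ (resp. $C^{(1)}$); it then turns clockwise around $\mathbf B_1$, meeting $\Gamma$ only in one interior point of $E_1$, where it returns to the first sheet. Put $B_v=\rho^2(A_v)$ if $v$ is white and $B_v=\rho(A_v)$ if $v$ is black. Let $d_1=\frac13\sum_k a_k-1$, $d_2=\frac13\sum_k b_k-1$; then $d_1+d_2=m-2=\#V(\Gamma)$. Put $\eta_j=x^{j-1}dx/y_1$ for $1\le j\le d_1$ and $\eta_{d_1+j}=x^{j-1}dx/y_2$ for $1\le j\le d_2$. Given an ordering of $V(\Gamma)$, let $P_B(\Sigma,\Gamma,\mathcal C,M)=\bigl(\int_{B_v}\eta_j\bigr)_{v\in V(\Gamma),\,1\le j\le d_1+d_2}$. **The degeneration.** Suppose that two white terminals $\lambda_i,\lambda_{i+1}$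 are adjacent to a common inner vertex $p$, that $q$ is the third neighbour of $p$, that the edge $pq$ is marked for $p$, and that the edges from $p$ to $\lambda_i,\lambda_{i+1},q$ are in anti-clockwise order. Let $\lambda_1,\dots,\lambda_m$ be distinct, and $\tilde\lambda\in\mathbb C$ with $\tilde\lambda\neq\lambda_k$ for $k\neq i,i+1$. For $t\in\mathbb C$ put $\lambda_k(t)=\tilde\lambda+t(\lambda_k-\tilde\lambda)$ for $k=i,i+1$, $\lambda_k(t)=\lambda_k$ otherwise, and $\Sigma(t)=\{\lambda_1(t),\dots,\lambda_m(t)\}$. Let $(\Gamma',\mathcal C',M')$ be the marked binary tree, embedded in $\mathbb C$, obtained by deleting $\lambda_i,\lambda_{i+1}$ and their edges, so that $p$ becomes a black terminal, placed at $\tilde\lambda$; its set of terminals is $\Sigma'=\{\tilde\lambda\}\cup\{\lambda_k:k\ne i,i+1\}$. Let $D$ be an open disc about $\tilde\lambda$ whose closure meets no edge of $\Gamma'$ except $pq$, and such that this edge, followed from $q$, stays outside $\overline D$ until it enters $D$ and then remains in $D$. For all small $t\neq0$ let $\Gamma(t)$ be an embedding of $(\Gamma,\mathcal C,M)$ with terminals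 $\Sigma(t)$ that coincides with $\Gamma'$ outside $D$ (the edge $qp$ of $\Gamma(t)$ coinciding with that of $\Gamma'$ until it enters $D$ and staying in $D$ from there on), whose edges from $p$ to $\lambda_i(t)$ and $\lambda_{i+1}(t)$ lie in $D$, and in which the edges from $p$ to $\lambda_i(t),\lambda_{i+1}(t),q$ are in anti-clockwise order. Write $P_B(\Sigma(t),\Gamma,\mathcal C,M)$ for the period matrix of $\Gamma(t)$. Choose any ordering of $V(\Gamma')$, and order $V(\Gamma)=V(\Gamma')\cup\{p\}$ by inserting $p$ at place number $d_1+1$. **Proposition.** The limit on the left exists and $$\lim_{t\to0}t(\lambda_i-\lambda_{i+1})\det\bigl(P_B(\Sigma(t),\Gamma,\mathcal C,M)\bigr)^3 =B^*\!\left(\tfrac13,\tfrac13\right)^3\prod_{k\neq i,i+1}(\tilde\lambda-\lambda_k)^{-b_k}\cdot\det\bigl(P_B(\Sigma',\Gamma',\mathcal C',M')\bigr)^3,$$ where $B^*(\frac13,\frac13)=(\omega-1)B(\frac13,\frac13)$ with Euler's beta function $B$, and the determinant of the empty matrix is $1$. -/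

import Mathlib

open Filter Topology

noncomputable section

namespace TripleCover

/-- The primitive cube root of unity `(-1 + √-3) / 2`. -/
def ω : ℂ := (-1 + (Real.sqrt 3 : ℂ) * Complex.I) / 2

lemma omega_cube : ω ^ 3 = 1 := by
  have h : ((Real.sqrt 3 : ℝ) : ℂ) ^ 2 = 3 := by
    rw [← Complex.ofReal_pow, Real.sq_sqrt (by norm_num)]; norm_num
  have hI : Complex.I ^ 2 = -1 := Complex.I_sq
  have e : ω ^ 3 = (-1 + 3 * ((Real.sqrt 3 : ℂ) * Complex.I)
      - 3 * ((Real.sqrt 3 : ℂ) ^ 2 * Complex.I ^ 2)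
      + (Real.sqrt 3 : ℂ) ^ 2 * Complex.I ^ 2 * ((Real.sqrt 3 : ℂ) * Complex.I)) / 8 := by
    unfold ω; ring
  rw [e, h, hI]; ring

/-! ### Marked binary trees -/

/-- A marked binary tree, as a combinatorial object: a finite tree (with at least one edge) all of
whose inner vertices (those adjacent to more than one edge) have valency three, a proper colouring
of all vertices by white and black, and the choice of one edge `{v, mark v}` at every inner vertex
`v` (the value of `mark` at a terminal is irrelevant). The planar structure is part of
`PlaneEmbedding` below. -/
structure MarkedBinaryTree (V : Type*) [Fintype V] where
  graph : SimpleGraph V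
  isTree : graph.IsTree
  nontrivial : Nontrivial V
  trivalent : ∀ v, 1 < (graph.neighborSet v).ncard → (graph.neighborSet v).ncard = 3
  white : V → Bool
  proper : ∀ u v, graph.Adj u v → white u ≠ white v
  mark : V → V
  mark_adj : ∀ v, 1 < (graph.neighborSet v).ncard → graph.Adj v (mark v)

namespace MarkedBinaryTree

variable {V : Type*} [Fintype V] (T : MarkedBinaryTree V)

/-- Inner vertices: adjacent to more than one edge. -/
def IsInner (v : V) : Prop := 1 < (T.graph.neighborSet v).ncard

/-- The set `V(Γ)` of inner vertices. -/
abbrev Inner : Type _ := {v : V // T.IsInner v}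

open Classical in
/-- The terminals: the vertices that are not inner. -/
def terminals : Finset V := Finset.univ.filter fun v => ¬ T.IsInner v

/-- The numerator `a` of the branching index `a / 3` of a terminal: `1` if white, `2` if black. -/
def a (v : V) : ℕ := if T.white v then 1 else 2

/-- The complementary numerator `b = 3 - a`. -/
def b (v : V) : ℕ := if T.white v then 2 else 1

/-- The number of holomorphic forms of the shape `x ^ (j - 1) dx / y₁`. -/
def d₁ : ℕ := (∑ v ∈ T.terminals, T.a v) / 3 - 1

/-- The genus `g = #V(Γ)`. -/
def genus : ℕ := Nat.card T.Inner

end MarkedBinaryTree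

/-! ### Embedded trees in the plane -/

/-- An injective polygonal arc, parametrized by `[0, 1]`: off a finite set `S` of break points it is
affine (on the closed intervals between break points, so it is continuous on `[0, 1]`). -/
def IsPolygonalArc (γ : ℝ → ℂ) : Prop :=
  Set.InjOn γ (Set.Icc 0 1) ∧
  ∃ S : Finset ℝ, ∀ a b : ℝ, 0 ≤ a → a < b → b ≤ 1 → (∀ s ∈ S, s ∉ Set.Ioo a b) →
    ∀ s ∈ Set.Icc a b, γ s = AffineMap.lineMap (γ a) (γ b) ((s - a) / (b - a))

/-- An embedding of the tree in the plane `ℂ` with polygonal edges. The arc `arc u v` runs along the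
edge `{u, v}` from `u` (at time `0`) to `v` (at time `1`); distinct edges meet only at a common
vertex. Values of `arc u v` for non-adjacent `u`, `v`, or outside `[0, 1]`, are irrelevant. -/
structure PlaneEmbedding {V : Type*} [Fintype V] (T : MarkedBinaryTree V) where
  pos : V → ℂ
  pos_injective : Function.Injective pos
  arc : V → V → ℝ → ℂ
  arc_zero : ∀ u v, T.graph.Adj u v → arc u v 0 = pos u
  arc_symm : ∀ u v, T.graph.Adj u v → ∀ s ∈ Set.Icc (0 : ℝ) 1, arc v u s = arc u v (1 - s)
  arc_polygonal : ∀ u v, T.graph.Adj u v → IsPolygonalArc (arc u v)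
  arc_disjoint : ∀ u v u' v', T.graph.Adj u v → T.graph.Adj u' v' → s(u, v) ≠ s(u', v') →
    ∀ s ∈ Set.Icc (0 : ℝ) 1, ∀ s' ∈ Set.Icc (0 : ℝ) 1, arc u v s = arc u' v' s' →
      ∃ w, w ∈ s(u, v) ∧ w ∈ s(u', v') ∧ arc u v s = pos w

namespace PlaneEmbedding

variable {V : Type*} [Fintype V] {T : MarkedBinaryTree V} (Γ : PlaneEmbedding T)

/-- The embedded tree as a subset of the plane. -/
def carrier : Set ℂ := {z | ∃ u v, T.graph.Adj u v ∧ ∃ s ∈ Set.Icc (0 : ℝ) 1, z = Γ.arc u v s}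

/-- The edge `{u, v}` without its end points. -/
def openEdge (u v : V) : Set ℂ := Γ.arc u v '' Set.Ioo (0 : ℝ) 1

/-- The direction in which the edge `{u, v}` leaves `u`. -/
def direction (u v : V) : ℂ := derivWithin (Γ.arc u v) (Set.Icc 0 1) 0

/-- The edges from `v` to `n₁`, `n₂`, `n₃` leave `v` in this anti-clockwise cyclic order. -/
def Anticlockwise (v n₁ n₂ n₃ : V) : Prop :=
  ∃ θ₁ θ₂ θ₃ : ℝ, θ₁ < θ₂ ∧ θ₂ < θ₃ ∧ θ₃ < θ₁ + 2 * Real.pi ∧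
    Γ.direction v n₁ = ‖Γ.direction v n₁‖ * Complex.exp (θ₁ * Complex.I) ∧
    Γ.direction v n₂ = ‖Γ.direction v n₂‖ * Complex.exp (θ₂ * Complex.I) ∧
    Γ.direction v n₃ = ‖Γ.direction v n₃‖ * Complex.exp (θ₃ * Complex.I)

/-- The right-hand side `∏ (x - λ) ^ a_λ` of the equation of the curve. -/
def rhs (x : ℂ) : ℂ := ∏ v ∈ T.terminals, (x - Γ.pos v) ^ T.a v

/-! ### The triple covering, its sheets and its cycles -/

/-- `y₀` is a continuous branch, on the complement of the tree, of the cube root of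
`∏ (x - λ) ^ a_λ`. -/
def IsBranch (y₀ : ℂ → ℂ) : Prop :=
  ContinuousOn y₀ Γ.carrierᶜ ∧ ∀ x ∉ Γ.carrier, y₀ x ^ 3 = Γ.rhs x

/-- The sheet `C⁽ᵏ⁾` of the curve `y ^ 3 = ∏ (x - λ) ^ a_λ` over the complement of the tree, when
`y₀` is the branch of `y` on `C⁽⁰⁾`. The automorphism `(x, y) ↦ (x, ω y)` maps
`C⁽⁰⁾ → C⁽¹⁾ → C⁽²⁾ → C⁽⁰⁾`. As `y` is multiplied by `ω` along a small anti-clockwise loop around a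
white terminal, a point of the curve that moves across an edge with the white end on its left
changes sheets `C⁽⁰⁾ → C⁽¹⁾ → C⁽²⁾ → C⁽⁰⁾`, and conversely with the white end on its right. -/
def sheet (y₀ : ℂ → ℂ) (k : ℕ) : Set (ℂ × ℂ) := {P | P.1 ∉ Γ.carrier ∧ P.2 = ω ^ k * y₀ P.1}

/-- A closed path `s ↦ (x s, y s)`, `0 ≤ s ≤ 1`, on the affine curve `y ^ 3 = ∏ (x - λ) ^ a_λ`
without its branch points, whose projection to the `x`-plane is continuously differentiable. -/
structure Loop where
  x : ℝ → ℂ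
  y : ℝ → ℂ
  x_contDiffOn : ContDiffOn ℝ 1 x (Set.Icc 0 1)
  y_continuousOn : ContinuousOn y (Set.Icc 0 1)
  x_closed : x 0 = x 1
  y_closed : y 0 = y 1
  avoids : ∀ s ∈ Set.Icc (0 : ℝ) 1, ∀ v ∈ T.terminals, x s ≠ Γ.pos v
  on_curve : ∀ s ∈ Set.Icc (0 : ℝ) 1, y s ^ 3 = Γ.rhs (x s)

namespace Loop

variable {Γ} (c : Γ.Loop)

/-- The image of a closed path under the `k`-th power of `ρ : (x, y) ↦ (x, ω y)`. -/
def rho (k : ℕ) : Γ.Loop where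
  x := c.x
  y := fun s => ω ^ k * c.y s
  x_contDiffOn := c.x_contDiffOn
  y_continuousOn := continuousOn_const.mul c.y_continuousOn
  x_closed := c.x_closed
  y_closed := by rw [c.y_closed]
  avoids := c.avoids
  on_curve := fun s hs => by
    rw [mul_pow, ← pow_mul, mul_comm k 3, pow_mul, omega_cube, one_pow, one_mul, c.on_curve s hs]

/-- The integral along the closed path of the form number `k`, counted from `0`. With `y₁ = y` and
`y₂ = ∏ (x - λ) / y`, so that `y₁ ^ 3 = ∏ (x - λ) ^ a_λ` and `y₂ ^ 3 = ∏ (x - λ) ^ b_λ`, this form is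
`x ^ k dx / y₁` for `k < d₁` and `x ^ (k - d₁) dx / y₂` for `k ≥ d₁`. -/
def period (k : ℕ) : ℂ :=
  if k < T.d₁ then ∫ s in (0 : ℝ)..1, c.x s ^ k / c.y s * deriv c.x s
  else ∫ s in (0 : ℝ)..1,
    c.x s ^ (k - T.d₁) / ((∏ v ∈ T.terminals, (c.x s - Γ.pos v)) / c.y s) * deriv c.x s

/-- The closed path `c` represents the cycle `A_v`. Let `n₁`, `n₂`, `mark v` be the neighbours of
the inner vertex `v`, in anti-clockwise order, and `𝐁₁`, `𝐁₂` the blocks of the tree beyond `n₁`,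
`n₂`. The cycle starts on the sheet `C⁽¹⁾` (if `v` is black) or `C⁽²⁾` (if `v` is white), turns
anti-clockwise around `𝐁₂`, crossing the tree just once, on the edge `{v, n₂}`, into the sheet
`C⁽²⁾` (resp. `C⁽¹⁾`), and then turns clockwise around `𝐁₁`, crossing the tree just once, on the
edge `{v, n₁}`, back to the first sheet. (The directions of the two crossings are determined by the
changes of sheets.) -/
def IsCycleA (y₀ : ℂ → ℂ) (v : V) : Prop :=
  ∃ n₁ n₂ : V, T.graph.Adj v n₁ ∧ T.graph.Adj v n₂ ∧ Γ.Anticlockwise v n₁ n₂ (T.mark v) ∧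
  ∃ s₁ s₂ : ℝ, 0 < s₁ ∧ s₁ < s₂ ∧ s₂ < 1 ∧
    c.x s₁ ∈ Γ.openEdge v n₂ ∧ c.x s₂ ∈ Γ.openEdge v n₁ ∧
    (∀ s, 0 ≤ s → s < s₁ → (c.x s, c.y s) ∈ Γ.sheet y₀ (if T.white v then 2 else 1)) ∧
    (∀ s, s₁ < s → s < s₂ → (c.x s, c.y s) ∈ Γ.sheet y₀ (if T.white v then 1 else 2)) ∧
    (∀ s, s₂ < s → s ≤ 1 → (c.x s, c.y s) ∈ Γ.sheet y₀ (if T.white v then 2 else 1))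

end Loop

/-- A system of closed paths representing the cycles `A_v` attached to the marked embedded tree,
for some choice of the sheet `C⁽⁰⁾`. -/
structure CycleSystem where
  y₀ : ℂ → ℂ
  isBranch : Γ.IsBranch y₀
  A : T.Inner → Γ.Loop
  isCycleA : ∀ v, (A v).IsCycleA y₀ v.1

namespace CycleSystem

variable {Γ} (S : Γ.CycleSystem)

/-- `B_v = ρ² (A_v)` if `v` is white, `B_v = ρ (A_v)` if `v` is black. -/
def B (v : T.Inner) : Γ.Loop := (S.A v).rho (if T.white v.1 then 2 else 1)

/-- The period matrix `P_B`, its rows being numbered by an ordering `σ` of the inner vertices. -/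
def PB (σ : Fin T.genus ≃ T.Inner) : Matrix (Fin T.genus) (Fin T.genus) ℂ :=
  Matrix.of fun r k => (S.B (σ r)).period k

end CycleSystem

end PlaneEmbedding

/-! ### The simple degeneration -/

section Degeneration

variable {V V' : Type*} [Fintype V] [Fintype V'] (T : MarkedBinaryTree V)
  (T' : MarkedBinaryTree V') (ι : V' ↪ V) (i j : V) (p q : V')

/-- `T'` is the part containing `q` in the decomposition of `T` along the edge from `p` to `q`,
where `p` is an inner vertex of `T` adjacent to the white terminals `i` and `j` and the edge from
`p` to `q` is marked for `p`. The vertices of `T'` are those of `T` other than `i` and `j`; the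
vertex `p` is the black terminal of `T'` that the cutting of the edge creates. -/
structure IsSimpleDecomposition : Prop where
  ne : i ≠ j
  range : ∀ v, v ∈ Set.range ι ↔ v ≠ i ∧ v ≠ j
  adj_iff : ∀ u v, T'.graph.Adj u v ↔ T.graph.Adj (ι u) (ι v)
  terminal_i : i ∈ T.terminals
  terminal_j : j ∈ T.terminals
  adj_i : T.graph.Adj (ι p) i
  adj_j : T.graph.Adj (ι p) j
  adj_q : T'.graph.Adj p q
  white_i : T.white i = true
  white_j : T.white j = true
  white_eq : ∀ v, T'.white v = T.white (ι v)
  mark_p : T.mark (ι p) = ι q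
  mark_eq : ∀ v, T'.IsInner v → T.mark (ι v) = ι (T'.mark v)

variable {T T'}

/-- The embedded tree `Γ` (with underlying tree `T`) differs from `Γ'` (with underlying tree `T'`)
only in the disc `D` of radius `r` about the position of `p` in `Γ'`: all edges other than the three
at `p` are the same and do not meet the closed disc; the edges from `q` to `p` in `Γ` and `Γ'`
coincide until they enter `D`, where they stay; the edges from `p` to `i` and `j` are contained in
`D`, and the edges from `p` to `i`, `j`, `q` are in anti-clockwise order. -/
structure IsLocalModification (Γ' : PlaneEmbedding T') (Γ : PlaneEmbedding T) (r : ℝ) : Prop where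
  outer : ∀ u v, T'.graph.Adj u v → s(u, v) ≠ s(p, q) → ∀ s ∈ Set.Icc (0 : ℝ) 1,
    Γ.arc (ι u) (ι v) s = Γ'.arc u v s ∧ r < dist (Γ'.arc u v s) (Γ'.pos p)
  connecting : ∃ s₀ ∈ Set.Ioo (0 : ℝ) 1,
    (∀ s ∈ Set.Icc 0 s₀, Γ.arc (ι q) (ι p) s = Γ'.arc q p s) ∧
    (∀ s ∈ Set.Ico 0 s₀, r < dist (Γ'.arc q p s) (Γ'.pos p)) ∧
    (∀ s ∈ Set.Ioc s₀ 1, dist (Γ.arc (ι q) (ι p) s) (Γ'.pos p) < r ∧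
      dist (Γ'.arc q p s) (Γ'.pos p) < r)
  leg_i : ∀ s ∈ Set.Icc (0 : ℝ) 1, dist (Γ.arc (ι p) i s) (Γ'.pos p) < r
  leg_j : ∀ s ∈ Set.Icc (0 : ℝ) 1, dist (Γ.arc (ι p) j s) (Γ'.pos p) < r
  orientation : Γ.Anticlockwise (ι p) i j (ι q)

end Degeneration

open Classical in
/-- The moving branch points: `λ_k(t) = λ̃ + t (λ_k - λ̃)` for `k = i, j`, and `λ_k(t) = λ_k`
otherwise. -/
def movingPoint {V : Type*} (lam : V → ℂ) (lam₀ : ℂ) (i j : V) (t : ℂ) (k : V) : ℂ :=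
  if k = i ∨ k = j then lam₀ + t * (lam k - lam₀) else lam k

/-- `B*(1/3, 1/3) = (ω - 1) B(1/3, 1/3)`. -/
def betaStar : ℂ := (ω - 1) * Complex.betaIntegral (1 / 3) (1 / 3)

end TripleCover

end

/-! After column operations that make every later form of the second type vanish at $\tilde\lambda$
(`det_periods`), the forms are $x^kdx/y_1$, then $dx/y_2$, then $x^l(x-\tilde\lambda)dx/y_2$. The
determinant is expanded along the row of $p$. The entry of $dx/y_2$ in this row grows like
$t^{-1/3}$; multiplied by $t(\lambda_i-\lambda_{i+1})$, its cube tends to a beta value times the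
product of the other factors at $\tilde\lambda$, while the other entries of the row are of smaller
order (`tendsto_row_p`). In the other rows $dx/y_1$ tends to $dx/y_1'$ and $dx/y_2$ to
$dx/((x-\tilde\lambda)y_2')$, so that the complementary minor tends to the period determinant of the
smaller tree (`IsDegeneration.exists_unit`, `integral_limitFactor`). `tendsto_det_cube` puts this
together. The cube is what makes a limit possible: the sheet $C^{(0)}$ is chosen anew for every $t$,
and this choice multiplies each column by a cube root of unity.

No homotopy of cycles is used. The tree is connected and the forms have no residue at infinity, so
on each sheet over the complement of the tree a form has a single-valued primitive $F$
(`exists_primitive_compl`, by Dixon's argument). Hence a period is the difference of two jumps of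
the primitive, one for each crossing (`integral_eq_sub_jumps`), and a jump is the same at all points
of an edge (`holdsAt_edge_iff`). A loop enters only through the two edges that it crosses. Jumps are
expressed through germs: a branch $Y$ of $1/y$ near a point of the cut and a primitive $\Phi$ of
$hY$ satisfy $Y=rg$, $\Phi=rF+B$ on each side, and only those properties of the set of pairs $(r,B)$
are used that survive a change of the germ (`ActInvariant`).

Near a terminal $F=F_0+W$, where $W$ is the integral from the terminal and is multiplied by $\rho$
when the branch is. The jump across the edge of the terminal is therefore $(u_1-u_2)F_0$, and the
period at $p$ is $\zeta-\zeta^2$ times the difference $\alpha$ of the values $F_0$ at the two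
colliding terminals. The edges inside $D$ may wind about arbitrarily, but $\alpha^3$ does not depend
on them: all constants $B$ on the cut in $D$ are congruent modulo $(1-\omega)\mathbb
Z[\omega]\alpha$. Comparing with the cut along the two opposite rays from the colliding points, for
which the difference of end values is $\beta$, shows that $\alpha$ and $\beta$ are multiples of each
other by Eisenstein integers congruent to $1$ modulo $1-\omega$. Units of this kind are cube roots
of unity (`cube_eq_cube_of_eisenstein`). For the rays, $\beta$ is the integral along the segment,
whose limit is a beta integral (`cube_eq_legIntegral`, `tendsto_legIntegral`).

For the other rows, the two trees coincide outside $D$, and the tree together with $D$ has connected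
complement there. On it the branches differ by a cube root of unity and a factor that tends to $1$
uniformly; primitives normalised at one point converge, and so do their jumps (`tendsto_jump`). The
connectedness statements come from removing one polygonal arc at a time (`isPreconnected_diff_arc`),
which replaces any appeal to the Jordan curve theorem. -/

namespace TripleCover
open Set Metric MeasureTheory

/-! ### Cauchy's theorem in the complement of a connected compact set -/

/-- The integral of `f` along the oriented segment from `a` to `b`. -/
noncomputable def segInt (f : ℂ → ℂ) (a b : ℂ) : ℂ :=
  ∫ s in (0 : ℝ)..1, f (a + s * (b - a)) * (b - a)

lemma lineMap_mem_segment (a b : ℂ) {s : ℝ} (hs : s ∈ Icc (0 : ℝ) 1) :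
    a + s * (b - a) ∈ segment ℝ a b := by
  rw [segment_eq_image']
  exact ⟨s, hs, by simp⟩

lemma continuousOn_segInt_integrand {f : ℂ → ℂ} {a b : ℂ} (hf : ContinuousOn f (segment ℝ a b)) :
    ContinuousOn (fun s : ℝ => f (a + s * (b - a)) * (b - a)) (Icc 0 1) := by
  refine ContinuousOn.mul (hf.comp (by fun_prop) ?_) continuousOn_const
  intro s hs
  exact lineMap_mem_segment a b hs

lemma intervalIntegrable_segInt {f : ℂ → ℂ} {a b : ℂ} (hf : ContinuousOn f (segment ℝ a b)) :
    IntervalIntegrable (fun s : ℝ => f (a + s * (b - a)) * (b - a)) volume 0 1 := by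
  apply ContinuousOn.intervalIntegrable
  rw [uIcc_of_le zero_le_one]
  exact continuousOn_segInt_integrand hf

lemma segInt_eq_sub {f G : ℂ → ℂ} {a b : ℂ}
    (hG : ∀ z ∈ segment ℝ a b, HasDerivAt G (f z) z) (hf : ContinuousOn f (segment ℝ a b)) :
    segInt f a b = G b - G a := by
  have h := intervalIntegral.integral_eq_sub_of_hasDerivAt (a := (0 : ℝ)) (b := 1)
    (f := fun s : ℝ => G (a + s * (b - a))) (f' := fun s : ℝ => f (a + s * (b - a)) * (b - a)) ?_
    (intervalIntegrable_segInt hf)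
  · rw [segInt, h]; simp
  · intro s hs
    rw [uIcc_of_le zero_le_one] at hs
    have h1 : HasDerivAt (fun s : ℝ => a + (s : ℂ) * (b - a)) (b - a) s := by
      simpa using ((Complex.ofRealCLM.hasDerivAt (x := s)).mul_const (b - a)).const_add a
    exact (hG _ (lineMap_mem_segment a b hs)).comp s h1

lemma segInt_swap (f : ℂ → ℂ) (a b : ℂ) : segInt f b a = - segInt f a b := by
  have h := intervalIntegral.integral_comp_sub_left (a := 0) (b := 1)
    (fun s : ℝ => f (a + s * (b - a)) * (b - a)) 1
  simp only [sub_self, sub_zero] at h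
  rw [segInt, segInt, ← h, ← intervalIntegral.integral_neg]
  congr 1
  ext s
  push_cast
  rw [show a + (1 - (s : ℂ)) * (b - a) = b + s * (a - b) by ring]
  ring

lemma segInt_sub {f g : ℂ → ℂ} {a b : ℂ} (hf : ContinuousOn f (segment ℝ a b))
    (hg : ContinuousOn g (segment ℝ a b)) :
    segInt (fun z => f z - g z) a b = segInt f a b - segInt g a b := by
  rw [segInt, segInt, segInt, ← intervalIntegral.integral_sub (intervalIntegrable_segInt hf)
    (intervalIntegrable_segInt hg)]
  simp only [sub_mul]

lemma segInt_const_mul (c : ℂ) (f : ℂ → ℂ) (a b : ℂ) :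
    segInt (fun z => c * f z) a b = c * segInt f a b := by
  rw [segInt, segInt, ← intervalIntegral.integral_const_mul]
  simp only [mul_assoc]

lemma segInt_congr {f g : ℂ → ℂ} {a b : ℂ} (h : ∀ z ∈ segment ℝ a b, f z = g z) :
    segInt f a b = segInt g a b := by
  rw [segInt, segInt]
  apply intervalIntegral.integral_congr
  intro s hs
  rw [uIcc_of_le zero_le_one] at hs
  simp only [h _ (lineMap_mem_segment a b hs)]

lemma norm_segInt_le {f : ℂ → ℂ} {a b : ℂ} {C : ℝ} (h : ∀ z ∈ segment ℝ a b, ‖f z‖ ≤ C) :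
    ‖segInt f a b‖ ≤ C * ‖b - a‖ := by
  have := intervalIntegral.norm_integral_le_of_norm_le_const (a := (0 : ℝ)) (b := 1)
    (C := C * ‖b - a‖) (f := fun s : ℝ => f (a + s * (b - a)) * (b - a)) ?_
  · simpa [segInt] using this
  · intro s hs
    rw [uIoc_of_le zero_le_one] at hs
    rw [norm_mul]
    gcongr
    exact h _ (lineMap_mem_segment a b ⟨hs.1.le, hs.2⟩)

/-- An integral over `[0, 1]` of holomorphic functions that are bounded locally uniformly in the
parameter is holomorphic. -/
lemma differentiableAt_intervalIntegral {ψ : ℂ → ℝ → ℂ} {z₀ : ℂ} {ε C : ℝ} (hε : 0 < ε)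
    (hd : ∀ s ∈ Icc (0 : ℝ) 1, DifferentiableOn ℂ (fun z => ψ z s) (ball z₀ ε))
    (hc : ∀ z ∈ ball z₀ ε, ContinuousOn (ψ z) (Icc 0 1))
    (hb : ∀ z ∈ ball z₀ ε, ∀ s ∈ Icc (0 : ℝ) 1, ‖ψ z s‖ ≤ C) :
    DifferentiableAt ℂ (fun z => ∫ s in (0 : ℝ)..1, ψ z s) z₀ := by
  have hsub : ball z₀ (ε / 2) ⊆ ball z₀ ε := ball_subset_ball (by linarith)
  have hmeas : ∀ z ∈ ball z₀ ε, AEStronglyMeasurable (ψ z) (volume.restrict (uIoc (0 : ℝ) 1)) := by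
    intro z hz
    rw [uIoc_of_le zero_le_one]
    exact ((hc z hz).mono Ioc_subset_Icc_self).aestronglyMeasurable measurableSet_Ioc
  have hder : ∀ s ∈ Icc (0 : ℝ) 1, ∀ z ∈ ball z₀ ε,
      HasDerivAt (fun z => ψ z s) (deriv (fun z => ψ z s) z) z := fun s hs z hz =>
    ((hd s hs).differentiableAt (isOpen_ball.mem_nhds hz)).hasDerivAt
  have hz₀ : z₀ ∈ ball z₀ ε := mem_ball_self hε
  refine (intervalIntegral.hasDerivAt_integral_of_dominated_loc_of_deriv_le
    (μ := volume) (a := 0) (b := 1) (F := ψ) (F' := fun z s => deriv (fun z => ψ z s) z)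
    (x₀ := z₀) (s := ball z₀ (ε / 2)) (bound := fun _ => C / (ε / 4))
    (ball_mem_nhds _ (by linarith)) ?_ ?_ ?_ ?_ ?_ ?_).2.differentiableAt
  · filter_upwards [ball_mem_nhds z₀ hε] with z hz using hmeas z hz
  · apply ContinuousOn.intervalIntegrable
    rw [uIcc_of_le zero_le_one]
    exact hc z₀ hz₀
  -- Measurability in `s` of the derivative at `z₀`: it is a limit of difference quotients along the
  -- sequence `u n → z₀`.
  · set u : ℕ → ℂ := fun n => z₀ + (ε / 2 : ℝ) * ((1 : ℂ) / (n + 1)) with hu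
    have hu0 : Tendsto (fun n : ℕ => ((1 : ℂ) / (n + 1))) atTop (𝓝 0) :=
      tendsto_one_div_add_atTop_nhds_zero_nat
    have hut : Tendsto u atTop (𝓝[≠] z₀) := by
      rw [tendsto_nhdsWithin_iff]
      constructor
      · simpa [hu] using (hu0.const_mul ((ε / 2 : ℝ) : ℂ)).const_add z₀
      · filter_upwards with n
        have h1 : ((n : ℂ) + 1) ≠ 0 := by exact_mod_cast Nat.succ_ne_zero n
        have h2 : (((ε / 2 : ℝ)) : ℂ) ≠ 0 := by exact_mod_cast (by linarith : ε / 2 ≠ 0)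
        simp only [hu, mem_compl_iff, mem_singleton_iff, add_eq_left]
        exact mul_ne_zero h2 (one_div_ne_zero h1)
    have hev : ∀ᶠ n in atTop, u n ∈ ball z₀ ε :=
      (hut.mono_right nhdsWithin_le_nhds) (ball_mem_nhds z₀ hε)
    obtain ⟨n₀, hn₀⟩ := eventually_atTop.1 hev
    refine aestronglyMeasurable_of_tendsto_ae atTop
      (f := fun (n : ℕ) (s : ℝ) => slope (fun z => ψ z s) z₀ (u (n + n₀))) ?_ ?_
    · intro n
      simp only [slope_def_field]
      simp_rw [div_eq_mul_inv]
      exact ((hmeas (u (n + n₀)) (hn₀ (n + n₀) (by omega))).sub (hmeas _ hz₀)).mul_const _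
    · rw [uIoc_of_le zero_le_one, ae_restrict_iff' measurableSet_Ioc]
      filter_upwards with s hs
      have := (hasDerivAt_iff_tendsto_slope.1 (hder s ⟨hs.1.le, hs.2⟩ z₀ hz₀)).comp hut
      exact this.comp (tendsto_add_atTop_nat n₀)
  · filter_upwards with s hs z hz
    rw [uIoc_of_le zero_le_one] at hs
    have hlt : closedBall z (ε / 4) ⊆ ball z₀ ε := by
      intro y hy
      rw [mem_ball] at *
      rw [mem_closedBall] at hy
      linarith [dist_triangle y z z₀]
    -- Cauchy's estimate on a circle of radius `ε / 4`, which stays in the large ball for every `z`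
    -- in the half-sized one; this supplies the dominating constant.
    refine (Complex.norm_deriv_le_of_forall_mem_sphere_norm_le (R := ε / 4) (C := C) (by linarith)
      ?_ ?_).trans ?_
    · refine DifferentiableOn.diffContOnCl ?_
      rw [closure_ball _ (by linarith : ε / 4 ≠ 0)]
      exact (hd s ⟨hs.1.le, hs.2⟩).mono hlt
    · intro y hy
      exact hb y (hlt (sphere_subset_closedBall hy)) s ⟨hs.1.le, hs.2⟩
    · exact le_rfl
  · exact intervalIntegrable_const
  · filter_upwards with s hs z hz
    rw [uIoc_of_le zero_le_one] at hs
    exact hder s ⟨hs.1.le, hs.2⟩ z (hsub hz)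

/-- The sum of the integrals of `f` along the oriented segments of the chain `L`. -/
noncomputable def chainInt (f : ℂ → ℂ) (L : List (ℂ × ℂ)) : ℂ :=
  (L.map fun e => segInt f e.1 e.2).sum

/-- The union of the segments of a chain. -/
def chainSupp (L : List (ℂ × ℂ)) : Set ℂ := {z | ∃ e ∈ L, z ∈ segment ℝ e.1 e.2}

lemma isCompact_chainSupp (L : List (ℂ × ℂ)) : IsCompact (chainSupp L) := by
  induction L with
  | nil => simp [chainSupp]
  | cons e L ih =>
    have : chainSupp (e :: L) = segment ℝ e.1 e.2 ∪ chainSupp L := by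
      ext z; simp [chainSupp]
    rw [this]
    refine IsCompact.union ?_ ih
    rw [segment_eq_image']
    exact isCompact_Icc.image (by fun_prop)

lemma segment_subset_chainSupp {L : List (ℂ × ℂ)} {e : ℂ × ℂ} (he : e ∈ L) :
    segment ℝ e.1 e.2 ⊆ chainSupp L := fun _ hz => ⟨e, he, hz⟩

lemma chainInt_congr {f g : ℂ → ℂ} {L : List (ℂ × ℂ)} (h : ∀ z ∈ chainSupp L, f z = g z) :
    chainInt f L = chainInt g L := by
  unfold chainInt
  congr 1
  refine List.map_congr_left fun e he => segInt_congr fun z hz => h z ⟨e, he, hz⟩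

/-- The sum on the right pairs `G` with the formal boundary of the chain. Closedness of a chain is
expressed below by the vanishing of this pairing for every function `G`, so the segments never have
to be ordered into polygons. -/
lemma chainInt_eq_sum_sub {f G : ℂ → ℂ} {L : List (ℂ × ℂ)}
    (hG : ∀ z ∈ chainSupp L, HasDerivAt G (f z) z) (hf : ContinuousOn f (chainSupp L)) :
    chainInt f L = (L.map fun e => G e.2 - G e.1).sum := by
  unfold chainInt
  congr 1
  exact List.map_congr_left fun e he => segInt_eq_sub (fun z hz => hG z ⟨e, he, hz⟩)
    (hf.mono (segment_subset_chainSupp he))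

lemma chainInt_sub {f g : ℂ → ℂ} {L : List (ℂ × ℂ)} (hf : ContinuousOn f (chainSupp L))
    (hg : ContinuousOn g (chainSupp L)) :
    chainInt (fun z => f z - g z) L = chainInt f L - chainInt g L := by
  unfold chainInt
  induction L with
  | nil => simp
  | cons e L ih =>
    have hsub : chainSupp L ⊆ chainSupp (e :: L) := fun z ⟨e', he', hz⟩ => ⟨e', by simp [he'], hz⟩
    have hseg : segment ℝ e.1 e.2 ⊆ chainSupp (e :: L) := segment_subset_chainSupp (by simp)
    simp only [List.map_cons, List.sum_cons, ih (hf.mono hsub) (hg.mono hsub),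
      segInt_sub (hf.mono hseg) (hg.mono hseg)]
    ring

lemma chainInt_const_mul (c : ℂ) (f : ℂ → ℂ) (L : List (ℂ × ℂ)) :
    chainInt (fun z => c * f z) L = c * chainInt f L := by
  unfold chainInt
  simp_rw [segInt_const_mul]
  rw [List.sum_map_mul_left]

lemma norm_chainInt_le {f : ℂ → ℂ} {L : List (ℂ × ℂ)} {C : ℝ} (h : ∀ z ∈ chainSupp L, ‖f z‖ ≤ C) :
    ‖chainInt f L‖ ≤ C * (L.map fun e => ‖e.2 - e.1‖).sum := by
  unfold chainInt
  induction L with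
  | nil => simp
  | cons e L ih =>
    simp only [List.map_cons, List.sum_cons, mul_add]
    refine (norm_add_le _ _).trans (add_le_add (norm_segInt_le fun z hz => h z ⟨e, by simp, hz⟩)
      (ih fun z ⟨e', he', hz⟩ => h z ⟨e', by simp [he'], hz⟩))

lemma differentiableAt_chainInt {φ : ℂ → ℂ → ℂ} {L : List (ℂ × ℂ)} {z₀ : ℂ} {ε C : ℝ} (hε : 0 < ε)
    (hd : ∀ w ∈ chainSupp L, DifferentiableOn ℂ (fun z => φ z w) (ball z₀ ε))
    (hc : ∀ z ∈ ball z₀ ε, ContinuousOn (φ z) (chainSupp L))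
    (hb : ∀ z ∈ ball z₀ ε, ∀ w ∈ chainSupp L, ‖φ z w‖ ≤ C) :
    DifferentiableAt ℂ (fun z => chainInt (φ z) L) z₀ := by
  unfold chainInt
  induction L with
  | nil => simp
  | cons e L ih =>
    simp only [List.map_cons, List.sum_cons]
    have hsub : chainSupp L ⊆ chainSupp (e :: L) := fun z ⟨e', he', hz⟩ => ⟨e', by simp [he'], hz⟩
    have hseg : segment ℝ e.1 e.2 ⊆ chainSupp (e :: L) := segment_subset_chainSupp (by simp)
    refine DifferentiableAt.add ?_ (ih (fun w hw => hd w (hsub hw)) (fun z hz => (hc z hz).mono hsub)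
      fun z hz w hw => hb z hz w (hsub hw))
    refine differentiableAt_intervalIntegral (C := C * ‖e.2 - e.1‖) hε ?_ ?_ ?_
    · intro s hs
      exact (hd _ (hseg (lineMap_mem_segment _ _ hs))).mul_const _
    · intro z hz
      exact continuousOn_segInt_integrand ((hc z hz).mono hseg)
    · intro z hz s hs
      rw [norm_mul]
      gcongr
      exact hb z hz _ (hseg (lineMap_mem_segment _ _ hs))

/-- The denominator is at least `‖z‖ - R` on a chain contained in the disc of radius `R`. -/
lemma tendsto_chainInt_div_sub {g : ℂ → ℂ} {L : List (ℂ × ℂ)} (hg : ContinuousOn g (chainSupp L)) :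
    Tendsto (fun z => chainInt (fun w => g w / (w - z)) L) (cocompact ℂ) (𝓝 0) := by
  obtain ⟨M, hM⟩ := (isCompact_chainSupp L).exists_bound_of_continuousOn hg
  obtain ⟨R, hR⟩ := (isCompact_chainSupp L).isBounded.exists_norm_le
  have hn : Tendsto (fun z : ℂ => ‖z‖) (cocompact ℂ) atTop := tendsto_norm_cocompact_atTop
  have hlim : Tendsto (fun z : ℂ => M / (‖z‖ - R) * (L.map fun e => ‖e.2 - e.1‖).sum)
      (cocompact ℂ) (𝓝 0) := by
    have := ((tendsto_const_nhds (x := M)).div_atTop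
      (tendsto_atTop_add_const_right _ (-R) hn)).mul_const (L.map fun e => ‖e.2 - e.1‖).sum
    simpa [sub_eq_add_neg] using this
  refine squeeze_zero_norm' ?_ hlim
  filter_upwards [hn.eventually_gt_atTop R] with z hz
  refine norm_chainInt_le fun w hw => ?_
  rw [norm_div]
  have h1 : ‖z‖ - R ≤ ‖w - z‖ := by
    have := norm_sub_norm_le z w
    rw [norm_sub_rev] at this
    linarith [hR w hw]
  have h2 : 0 < ‖z‖ - R := by linarith
  have h3 : 0 ≤ M := (norm_nonneg _).trans (hM w hw)
  exact div_le_div₀ h3 (hM w hw) h2 h1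

lemma continuousOn_div_sub {g : ℂ → ℂ} {S : Set ℂ} (hg : ContinuousOn g S) {z : ℂ} (hz : z ∉ S) :
    ContinuousOn (fun w => g w / (w - z)) S :=
  hg.div (by fun_prop) fun w hw h => hz (by rwa [← sub_eq_zero.1 h])

lemma differentiableAt_chainInt_div_sub {g : ℂ → ℂ} {L : List (ℂ × ℂ)}
    (hg : ContinuousOn g (chainSupp L)) {z₀ : ℂ} (hz₀ : z₀ ∉ chainSupp L) :
    DifferentiableAt ℂ (fun z => chainInt (fun w => g w / (w - z)) L) z₀ := by
  obtain ⟨M, hM⟩ := (isCompact_chainSupp L).exists_bound_of_continuousOn hg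
  obtain ⟨ε, hε, hball⟩ := Metric.isOpen_iff.1 (isCompact_chainSupp L).isClosed.isOpen_compl z₀ hz₀
  have hd : ∀ z ∈ ball z₀ (ε / 2), ∀ w ∈ chainSupp L, ε / 2 ≤ ‖w - z‖ := by
    intro z hz w hw
    by_contra! h
    refine hball (a := w) ?_ hw
    rw [mem_ball, dist_eq_norm] at *
    have := norm_add_le (w - z) (z - z₀)
    rw [sub_add_sub_cancel] at this
    linarith
  have hne : ∀ z ∈ ball z₀ (ε / 2), ∀ w ∈ chainSupp L, w - z ≠ 0 := fun z hz w hw h => by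
    have := hd z hz w hw
    rw [h, norm_zero] at this
    linarith
  refine differentiableAt_chainInt (ε := ε / 2) (C := M / (ε / 2)) (by linarith) ?_ ?_ ?_
  · intro w hw z hz
    exact ((differentiableAt_const _).div (by fun_prop) (hne z hz w hw)).differentiableWithinAt
  · intro z hz
    exact hg.div (by fun_prop) fun w hw => hne z hz w hw
  · intro z hz w hw
    rw [norm_div]
    exact div_le_div₀ ((norm_nonneg _).trans (hM w hw)) (hM w hw) (by linarith) (hd z hz w hw)

/-- By symmetry of `dslope` the integrand is holomorphic in `z` for fixed `w`, also across `z = w`.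
The bound for domination comes from the mean value inequality if `w` is near `z₀`, and from a
denominator of size at least `ε / 4` otherwise. -/
lemma differentiableAt_chainInt_dslope {f : ℂ → ℂ} {U : Set ℂ} (hU : IsOpen U)
    (hf : DifferentiableOn ℂ f U) {L : List (ℂ × ℂ)} (hL : chainSupp L ⊆ U) {z₀ : ℂ} (hz₀ : z₀ ∈ U) :
    DifferentiableAt ℂ (fun z => chainInt (dslope f z) L) z₀ := by
  obtain ⟨ε, hε, hball⟩ := Metric.isOpen_iff.1 hU z₀ hz₀
  have hcb : closedBall z₀ (ε / 2) ⊆ U := (closedBall_subset_ball (by linarith)).trans hball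
  have hK : IsCompact (chainSupp L ∪ closedBall z₀ (ε / 2)) :=
    (isCompact_chainSupp L).union (isCompact_closedBall _ _)
  have hKU : chainSupp L ∪ closedBall z₀ (ε / 2) ⊆ U := union_subset hL hcb
  obtain ⟨M, hM⟩ := hK.exists_bound_of_continuousOn (hf.continuousOn.mono hKU)
  obtain ⟨M', hM'⟩ := hK.exists_bound_of_continuousOn
    ((hf.deriv hU).continuousOn.mono hKU)
  have hsymm : ∀ z w, dslope f z w = dslope f w z := by
    intro z w
    rcases eq_or_ne z w with rfl | h
    · rfl
    · rw [dslope_of_ne _ h.symm, dslope_of_ne _ h, slope_comm]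
  refine differentiableAt_chainInt (ε := ε / 4) (C := max M' ((M + M) / (ε / 4))) (by linarith)
    ?_ ?_ ?_
  · intro w hw
    simp_rw [hsymm _ w]
    exact ((Complex.differentiableOn_dslope (hU.mem_nhds (hL hw))).2 hf).mono
      ((ball_subset_closedBall.trans (closedBall_subset_closedBall (by linarith))).trans hcb)
  · intro z hz
    have hzU : z ∈ U :=
      hcb (closedBall_subset_closedBall (by linarith) (ball_subset_closedBall hz))
    exact ((Complex.differentiableOn_dslope (hU.mem_nhds hzU)).2 hf).continuousOn.mono hL
  · intro z hz w hw
    have hz2 : z ∈ closedBall z₀ (ε / 2) :=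
      closedBall_subset_closedBall (by linarith) (ball_subset_closedBall hz)
    by_cases hwz : w ∈ closedBall z₀ (ε / 2)
    · refine le_max_of_le_left ?_
      rcases eq_or_ne w z with rfl | h
      · rw [dslope_same]
        exact hM' _ (Or.inr hwz)
      · rw [dslope_of_ne _ h, slope_def_field, norm_div]
        refine div_le_of_le_mul₀ (norm_nonneg _) ((norm_nonneg _).trans (hM' _ (Or.inr hwz))) ?_
        exact (convex_closedBall z₀ (ε / 2)).norm_image_sub_le_of_norm_deriv_le
          (fun x hx => hf.differentiableAt (hU.mem_nhds (hcb hx))) (fun x hx => hM' x (Or.inr hx))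
          hz2 hwz
    · refine le_max_of_le_right ?_
      have h1 : ε / 4 ≤ ‖w - z‖ := by
        rw [mem_closedBall, dist_eq_norm, not_le] at hwz
        rw [mem_ball, dist_eq_norm] at hz
        have := norm_add_le (w - z) (z - z₀)
        rw [sub_add_sub_cancel] at this
        linarith
      have h : w ≠ z := by
        rintro rfl
        rw [sub_self, norm_zero] at h1
        linarith
      rw [dslope_of_ne _ h, slope_def_field, norm_div]
      refine div_le_div₀ ?_ ?_ (by linarith) h1
      · have := (norm_nonneg _).trans (hM w (Or.inl hw)); linarith
      · exact (norm_sub_le _ _).trans (add_le_add (hM w (Or.inl hw)) (hM z (Or.inr hz2)))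

/-- The integral of `1 / (w - z)` along a closed chain is a locally constant function of `z`. -/
lemma chainInt_inv_sub_eventually_eq {L : List (ℂ × ℂ)}
    (hcl : ∀ G : ℂ → ℂ, (L.map fun e => G e.2 - G e.1).sum = 0) {z₀ : ℂ} (hz₀ : z₀ ∉ chainSupp L) :
    ∀ᶠ z in 𝓝 z₀, chainInt (fun w => 1 / (w - z)) L = chainInt (fun w => 1 / (w - z₀)) L := by
  obtain ⟨ε, hε, hball⟩ := Metric.isOpen_iff.1 (isCompact_chainSupp L).isClosed.isOpen_compl z₀ hz₀
  filter_upwards [ball_mem_nhds z₀ hε] with z hz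
  have hz' : z ∉ chainSupp L := hball hz
  rw [← sub_eq_zero, ← chainInt_sub (continuousOn_div_sub continuousOn_const hz')
    (continuousOn_div_sub continuousOn_const hz₀)]
  have hne : ∀ w ∈ chainSupp L, w - z ≠ 0 ∧ w - z₀ ≠ 0 := fun w hw =>
    ⟨fun h => hz' (by rwa [← sub_eq_zero.1 h]), fun h => hz₀ (by rwa [← sub_eq_zero.1 h])⟩
  -- The difference of the integrands has a single-valued primitive on the chain: the quotient
  -- differs from `1` by less than `1`, because `z` is closer to `z₀` than the chain is.
  rw [chainInt_eq_sum_sub (G := fun w => Complex.log ((w - z) / (w - z₀)))]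
  · exact hcl fun w => Complex.log ((w - z) / (w - z₀))
  · intro w hw
    obtain ⟨h1, h2⟩ := hne w hw
    have hlt : ‖z - z₀‖ < ‖w - z₀‖ := by
      have hw' : w ∉ ball z₀ ε := fun h => hball h hw
      rw [mem_ball, dist_eq_norm] at hw' hz
      linarith
    have hsl : (w - z) / (w - z₀) ∈ Complex.slitPlane := by
      have : (w - z) / (w - z₀) = 1 + -((z - z₀) / (w - z₀)) := by field_simp; ring
      rw [this]
      apply Complex.mem_slitPlane_of_norm_lt_one
      rw [norm_neg, norm_div, div_lt_one (norm_pos_iff.2 h2)]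
      exact hlt
    have hd : HasDerivAt (fun w => (w - z) / (w - z₀)) ((1 * (w - z₀) - (w - z) * 1) / (w - z₀) ^ 2)
        w := ((hasDerivAt_id w).sub_const z).div ((hasDerivAt_id w).sub_const z₀) h2
    convert hd.clog hsl using 1
    field_simp
  · exact (continuousOn_div_sub continuousOn_const hz').sub
      (continuousOn_div_sub continuousOn_const hz₀)

/-- For large `z` the function `log (1 - w / z)` is a primitive on the whole chain; the winding
number vanishes near infinity. -/
lemma chainInt_inv_sub_eq_zero {L : List (ℂ × ℂ)}
    (hcl : ∀ G : ℂ → ℂ, (L.map fun e => G e.2 - G e.1).sum = 0) :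
    ∀ᶠ z in cocompact ℂ, chainInt (fun w => 1 / (w - z)) L = 0 := by
  obtain ⟨R, hR⟩ := (isCompact_chainSupp L).isBounded.exists_norm_le
  have hn : Tendsto (fun z : ℂ => ‖z‖) (cocompact ℂ) atTop := tendsto_norm_cocompact_atTop
  filter_upwards [hn.eventually_gt_atTop (max R 0)] with z hz
  have hz0 : z ≠ 0 := norm_pos_iff.1 ((le_max_right _ _).trans_lt hz)
  have hlt : ∀ w ∈ chainSupp L, ‖w / z‖ < 1 := by
    intro w hw
    rw [norm_div, div_lt_one (norm_pos_iff.2 hz0)]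
    exact (hR w hw).trans_lt ((le_max_left _ _).trans_lt hz)
  have hz' : z ∉ chainSupp L := fun h => by
    have := hlt z h
    rw [div_self hz0, norm_one] at this
    exact lt_irrefl _ this
  rw [chainInt_eq_sum_sub (G := fun w => Complex.log (1 + -(w / z)))]
  · exact hcl fun w => Complex.log (1 + -(w / z))
  · intro w hw
    have hsl : 1 + -(w / z) ∈ Complex.slitPlane :=
      Complex.mem_slitPlane_of_norm_lt_one (by rw [norm_neg]; exact hlt w hw)
    have hd : HasDerivAt (fun w => 1 + -(w / z)) (-(1 / z)) w :=
      (((hasDerivAt_id w).div_const z).neg).const_add 1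
    have h2 : w - z ≠ 0 := fun h => hz' (by rwa [← sub_eq_zero.1 h])
    have h3 : z - w ≠ 0 := fun h => h2 (by rw [← neg_sub, h, neg_zero])
    convert hd.clog hsl using 1
    have : 1 + -(w / z) = (z - w) / z := by field_simp; ring
    rw [this]
    field_simp
    ring
  · exact continuousOn_div_sub continuousOn_const hz'

/-- Cauchy's theorem for a closed chain in the complement of a connected compact set and a
holomorphic function without residue at infinity. -/
theorem chainInt_eq_zero {K : Set ℂ} (hK : IsCompact K) (hKc : IsPreconnected K) (hKn : K.Nonempty)
    {f : ℂ → ℂ} (hf : DifferentiableOn ℂ f Kᶜ)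
    (h0 : Tendsto (fun z => z * f z) (cocompact ℂ) (𝓝 0)) {L : List (ℂ × ℂ)}
    (hL : chainSupp L ⊆ Kᶜ) (hcl : ∀ G : ℂ → ℂ, (L.map fun e => G e.2 - G e.1).sum = 0) :
    chainInt f L = 0 := by
  classical
  have hU : IsOpen Kᶜ := hK.isClosed.isOpen_compl
  have hfc : ContinuousOn f (chainSupp L) := hf.continuousOn.mono hL
  obtain ⟨k₀, hk₀⟩ := hKn
  set N : ℂ → ℂ := fun z => chainInt (fun w => 1 / (w - z)) L with hN
  set c := N k₀ with hc
  have hdisj : ∀ z ∈ K, z ∉ chainSupp L := fun z hz h => hL h hz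
  -- `N` is the winding number up to a constant factor. Connectedness of `K` enters only here.
  have hNK : ∀ z ∈ K, N z = c := by
    intro z hz
    refine hKc.induction₂ (fun x y => N x = N y) ?_ (fun x y z _ _ _ h1 h2 => h1.trans h2)
      (fun x y _ _ h => h.symm) hz hk₀
    intro x hx
    exact ((chainInt_inv_sub_eventually_eq hcl (hdisj x hx)).filter_mono nhdsWithin_le_nhds).mono
      fun y hy => hy.symm
  -- Dixon's function. Near `K` the winding number equals `c`, so the two formulas agree and `H` is
  -- entire; near infinity the winding number is zero and `H` tends to zero, so `H = 0`.
  set H : ℂ → ℂ := fun z => if z ∈ Kᶜ then chainInt (dslope f z) L + c * f z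
    else chainInt (fun w => f w / (w - z)) L with hH
  have hform : ∀ z ∉ chainSupp L,
      chainInt (dslope f z) L = chainInt (fun w => f w / (w - z)) L - f z * N z := by
    intro z hz
    have hconst : ContinuousOn (fun w => f z * (1 / (w - z))) (chainSupp L) :=
      continuousOn_const.mul (continuousOn_div_sub continuousOn_const hz)
    rw [hN, ← chainInt_const_mul, ← chainInt_sub (continuousOn_div_sub hfc hz) hconst]
    refine chainInt_congr fun w hw => ?_
    have h : w ≠ z := fun h => hz (h ▸ hw)
    rw [dslope_of_ne _ h, slope_def_field]
    ring
  have hHd : Differentiable ℂ H := by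
    intro z₀
    by_cases hz₀ : z₀ ∈ Kᶜ
    · have h1 : DifferentiableAt ℂ (fun z => chainInt (dslope f z) L + c * f z) z₀ :=
        (differentiableAt_chainInt_dslope hU hf hL hz₀).add
          ((hf.differentiableAt (hU.mem_nhds hz₀)).const_mul c)
      refine h1.congr_of_eventuallyEq ?_
      filter_upwards [hU.mem_nhds hz₀] with z hz
      simp only [hH, if_pos hz]
    · have hzK : z₀ ∈ K := by simpa using hz₀
      refine (differentiableAt_chainInt_div_sub hfc (hdisj _ hzK)).congr_of_eventuallyEq ?_
      filter_upwards [chainInt_inv_sub_eventually_eq hcl (hdisj _ hzK),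
        (isCompact_chainSupp L).isClosed.isOpen_compl.mem_nhds (hdisj _ hzK)] with z hz hz2
      by_cases h : z ∈ Kᶜ
      · simp only [hH, if_pos h]
        rw [hform z hz2]
        have : N z = c := by
          rw [← hNK z₀ hzK]; exact hz
        rw [this]; ring
      · simp only [hH, if_neg h]
  have hKc' : ∀ᶠ z in cocompact ℂ, z ∈ Kᶜ := hK.compl_mem_cocompact
  have hSc' : ∀ᶠ z in cocompact ℂ, z ∉ chainSupp L := (isCompact_chainSupp L).compl_mem_cocompact
  have hN0 := chainInt_inv_sub_eq_zero hcl
  have hHinf : ∀ᶠ z in cocompact ℂ, H z = chainInt (fun w => f w / (w - z)) L + c * f z := by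
    filter_upwards [hKc', hSc', hN0] with z h1 h2 h3
    simp only [hH, if_pos h1]
    rw [hform z h2]
    have : N z = 0 := h3
    rw [this]; ring
  have hne0 : ∀ᶠ z : ℂ in cocompact ℂ, z ≠ 0 := by
    have := (isCompact_singleton (x := (0 : ℂ))).compl_mem_cocompact
    filter_upwards [this] with z hz using hz
  have hf0 : Tendsto f (cocompact ℂ) (𝓝 0) := by
    have hinv : Tendsto (fun z : ℂ => z⁻¹) (cocompact ℂ) (𝓝 0) := by
      rw [← Metric.cobounded_eq_cocompact]; exact tendsto_inv₀_cobounded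
    have := hinv.mul h0
    rw [zero_mul] at this
    refine this.congr' ?_
    filter_upwards [hne0] with z hz
    field_simp
  have hH0 : Tendsto H (cocompact ℂ) (𝓝 0) := by
    have := (tendsto_chainInt_div_sub hfc).add (hf0.const_mul c)
    rw [mul_zero, add_zero] at this
    exact this.congr' (hHinf.mono fun z hz => hz.symm)
  have hzero : ∀ z, H z = 0 := fun z => hHd.apply_eq_of_tendsto_cocompact z hH0
  -- Multiplying `H = 0` by `z` and writing `z = w - (w - z)` under the integral expresses the
  -- integral of `f` by quantities that tend to zero; the term `c * (z * f z)` needs the hypothesis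
  -- at infinity.
  have hlim : Tendsto (fun z => chainInt (fun w => (w * f w) / (w - z)) L + c * (z * f z))
      (cocompact ℂ) (𝓝 0) := by
    have := (tendsto_chainInt_div_sub (g := fun w => w * f w) (continuousOn_id.mul hfc)).add
      (h0.const_mul c)
    rwa [mul_zero, add_zero] at this
  have hev : ∀ᶠ z in cocompact ℂ,
      chainInt (fun w => (w * f w) / (w - z)) L + c * (z * f z) = chainInt f L := by
    filter_upwards [hHinf, hSc'] with z h1 h2
    rw [hzero z] at h1
    have h3 : chainInt (fun w => (w * f w) / (w - z)) L - z * chainInt (fun w => f w / (w - z)) L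
        = chainInt f L := by
      have hconst : ContinuousOn (fun w => z * (f w / (w - z))) (chainSupp L) :=
        continuousOn_const.mul (continuousOn_div_sub hfc h2)
      have hmul : ContinuousOn (fun w => w * f w) (chainSupp L) := continuousOn_id.mul hfc
      rw [← chainInt_const_mul, ← chainInt_sub (continuousOn_div_sub hmul h2) hconst]
      refine chainInt_congr fun w hw => ?_
      have h : w - z ≠ 0 := fun h => h2 (by rwa [← sub_eq_zero.1 h])
      field_simp
    rw [← h3]
    linear_combination (-z) * h1
  exact tendsto_nhds_unique (tendsto_const_nhds.congr' (hev.mono fun z hz => hz.symm)) hlim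

/-- A holomorphic function without residue at infinity in the complement of a connected compact set
has a primitive. -/
theorem exists_primitive_compl {K : Set ℂ} (hK : IsCompact K) (hKc : IsPreconnected K)
    (hKn : K.Nonempty) {f : ℂ → ℂ} (hf : DifferentiableOn ℂ f Kᶜ)
    (h0 : Tendsto (fun z => z * f z) (cocompact ℂ) (𝓝 0)) :
    ∃ F : ℂ → ℂ, ∀ z ∈ Kᶜ, HasDerivAt F (f z) z := by
  classical
  -- `P a x L`: the chain `L` avoids `K` and has formal boundary `x - a`.
  let P : ℂ → ℂ → List (ℂ × ℂ) → Prop := fun a x L =>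
    chainSupp L ⊆ Kᶜ ∧ ∀ G : ℂ → ℂ, (L.map fun e => G e.2 - G e.1).sum = G x - G a
  have happ : ∀ {a x y L L'}, P a x L → P x y L' → P a y (L ++ L') := by
    intro a x y L L' h h'
    refine ⟨?_, fun G => ?_⟩
    · rintro z ⟨e, he, hz⟩
      rcases List.mem_append.1 he with he | he
      · exact h.1 ⟨e, he, hz⟩
      · exact h'.1 ⟨e, he, hz⟩
    · rw [List.map_append, List.sum_append, h.2, h'.2]; ring
  have hneg : ∀ (L : List (ℂ × ℂ)) (g : ℂ × ℂ → ℂ),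
      (L.map fun e => -g e).sum = -(L.map g).sum := by
    intro L g
    induction L with
    | nil => simp
    | cons e L ih => simp only [List.map_cons, List.sum_cons, ih]; ring
  have hswap : ∀ {a x L}, P a x L → P x a (L.map Prod.swap) := by
    intro a x L h
    refine ⟨?_, fun G => ?_⟩
    · rintro z ⟨e, he, hz⟩
      obtain ⟨e', he', rfl⟩ := List.mem_map.1 he
      refine h.1 ⟨e', he', ?_⟩
      rw [segment_symm]; exact hz
    · have := h.2 G
      rw [List.map_map]
      have h2 : ((fun e : ℂ × ℂ => G e.2 - G e.1) ∘ Prod.swap) = fun e => -(G e.2 - G e.1) := by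
        ext e; simp
      rw [h2, hneg, this]; ring
  have hIapp : ∀ L L', chainInt f (L ++ L') = chainInt f L + chainInt f L' := by
    intro L L'; simp [chainInt]
  have hIswap : ∀ L, chainInt f (L.map Prod.swap) = - chainInt f L := by
    intro L
    unfold chainInt
    rw [List.map_map, ← hneg]
    congr 1
    exact List.map_congr_left fun e _ => segInt_swap f e.1 e.2
  have hrefl : ∀ a, P a a [] := fun a => ⟨by simp [chainSupp], by simp⟩
  have hseg : ∀ x y, segment ℝ x y ⊆ Kᶜ → P x y [(x, y)] := by
    intro x y h
    refine ⟨?_, by simp⟩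
    rintro z ⟨e, he, hz⟩
    rw [List.mem_singleton] at he
    subst he
    exact h hz
  have huniq : ∀ {a x L L'}, P a x L → P a x L' → chainInt f L = chainInt f L' := by
    intro a x L L' h h'
    have h2 := happ h (hswap h')
    have := chainInt_eq_zero hK hKc hKn hf h0 h2.1 (fun G => by rw [h2.2, sub_self])
    rw [hIapp, hIswap] at this
    linear_combination this
  -- Connectedness of the complement is not assumed. One base point is chosen in every class of
  -- points that can be joined by chains.
  let st : Setoid ℂ := ⟨fun a x => ∃ L, P a x L, ⟨fun a => ⟨[], hrefl a⟩,
    fun ⟨L, h⟩ => ⟨_, hswap h⟩, fun ⟨L, h⟩ ⟨L', h'⟩ => ⟨_, happ h h'⟩⟩⟩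
  let base : ℂ → ℂ := fun x => (Quotient.mk st x).out
  have hbase : ∀ x, ∃ L, P (base x) x L := fun x => Quotient.exact (s := st) (Quotient.out_eq _)
  choose C hC using hbase
  refine ⟨fun x => chainInt f (C x), fun x hx => ?_⟩
  obtain ⟨ε, hε, hball⟩ := Metric.isOpen_iff.1 hK.isClosed.isOpen_compl x hx
  obtain ⟨G, hG⟩ := (hf.mono hball).isExactOn_ball
  have hev : (fun y => chainInt f (C y)) =ᶠ[𝓝 x] fun y => chainInt f (C x) + (G y - G x) := by
    filter_upwards [ball_mem_nhds x hε] with y hy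
    have hs : segment ℝ x y ⊆ ball x ε := (convex_ball x ε).segment_subset (mem_ball_self hε) hy
    have hP := hseg x y (hs.trans hball)
    have hb : base y = base x := by
      have : Quotient.mk st y = Quotient.mk st x := Quotient.sound (s := st) ⟨_, hswap hP⟩
      simp only [base, this]
    have h1 := happ (hC x) hP
    rw [← hb] at h1
    rw [huniq (hC y) h1, hIapp]
    congr 1
    have : chainInt f [(x, y)] = segInt f x y := by simp [chainInt]
    rw [this, segInt_eq_sub (fun z hz => hG z (hs hz)) (hf.continuousOn.mono (hs.trans hball))]
  refine HasDerivAt.congr_of_eventuallyEq ?_ hev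
  simpa using ((hG x (mem_ball_self hε)).sub_const (G x)).const_add (chainInt f (C x))

/-! ### Locally constant functions and connectedness -/

/-- The common tool of all continuation arguments below. No topology on `β` is required, so `b` may
be a pair of constants or a proposition. -/
lemma IsPreconnected.eq_of_eventually_eq {X β : Type*} [TopologicalSpace X] {s : Set X}
    (hs : IsPreconnected s) {b : X → β} (h : ∀ x ∈ s, ∀ᶠ y in 𝓝[s] x, b y = b x) {x y : X}
    (hx : x ∈ s) (hy : y ∈ s) : b x = b y := by
  refine hs.induction₂ (fun x y => b x = b y) ?_ (fun x y z _ _ _ h1 h2 => h1.trans h2)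
      (fun x y _ _ h => h.symm) hx hy
  intro x hx
  exact (h x hx).mono fun y hy => hy.symm

/-- The converse for open sets: a separation yields a locally constant proposition that is not
constant. -/
lemma isPreconnected_of_locally_constant {X : Type*} [TopologicalSpace X] {V : Set X}
    (hV : IsOpen V) (h : ∀ b : X → Prop, (∀ x ∈ V, ∀ᶠ y in 𝓝 x, b y = b x) →
      ∀ x ∈ V, ∀ y ∈ V, b x = b y) : IsPreconnected V := by
  rw [isPreconnected_iff_subset_of_disjoint]
  intro u v hu hv hsub hdisj
  have hex : ∀ y ∈ V, y ∈ v → y ∉ u := fun y hy hyv hyu => by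
    have : y ∈ V ∩ (u ∩ v) := ⟨hy, hyu, hyv⟩
    rw [hdisj] at this
    exact this
  have hb := h (fun x => x ∈ u) (fun x hx => by
    rcases hsub hx with hxu | hxv
    · filter_upwards [hu.mem_nhds hxu] with y hy
      exact propext (iff_of_true hy hxu)
    · filter_upwards [hv.mem_nhds hxv, hV.mem_nhds hx] with y hy hyV
      exact propext (iff_of_false (hex y hyV hy) (hex x hx hxv)))
  by_cases hne : ∃ x ∈ V, x ∈ u
  · obtain ⟨x, hx, hxu⟩ := hne
    left
    intro y hy
    have := hb x hx y hy
    exact this ▸ hxu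
  · push Not at hne
    right
    intro y hy
    exact (hsub hy).resolve_left (hne y hy)

/-! ### Sectors -/

/-- The point with polar coordinates `ρ`, `φ` about `P`. -/
noncomputable def polar (P : ℂ) (ρ φ : ℝ) : ℂ := P + ρ * Complex.exp (φ * Complex.I)

lemma continuous_polar (P : ℂ) : Continuous fun x : ℝ × ℝ => polar P x.1 x.2 := by
  unfold polar; fun_prop

lemma dist_polar (P : ℂ) {ρ : ℝ} (hρ : 0 ≤ ρ) (φ : ℝ) : dist (polar P ρ φ) P = ρ := by
  rw [dist_eq_norm, polar, add_sub_cancel_left, norm_mul, Complex.norm_exp_ofReal_mul_I,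
    Complex.norm_real, Real.norm_of_nonneg hρ, mul_one]

lemma polar_add_two_pi (P : ℂ) (ρ φ : ℝ) : polar P ρ (φ + 2 * Real.pi) = polar P ρ φ := by
  unfold polar
  push_cast
  rw [add_mul, Complex.exp_add, Complex.exp_two_pi_mul_I, mul_one]

lemma exists_polar (P z : ℂ) (θ : ℝ) :
    ∃ φ ∈ Ico θ (θ + 2 * Real.pi), z = polar P (dist z P) φ := by
  refine ⟨toIcoMod Real.two_pi_pos θ (Complex.arg (z - P)), toIcoMod_mem_Ico _ _ _, ?_⟩
  have h1 : toIcoMod Real.two_pi_pos θ (Complex.arg (z - P)) =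
      Complex.arg (z - P) - toIcoDiv Real.two_pi_pos θ (Complex.arg (z - P)) • (2 * Real.pi) := by
    rw [toIcoMod]
  rw [h1, polar, dist_eq_norm]
  have h2 : Complex.exp (((Complex.arg (z - P) -
      toIcoDiv Real.two_pi_pos θ (Complex.arg (z - P)) • (2 * Real.pi) : ℝ) : ℂ) * Complex.I) =
      Complex.exp (Complex.arg (z - P) * Complex.I) := by
    push_cast
    rw [sub_mul, zsmul_eq_mul, mul_assoc]
    exact Complex.exp_periodic.sub_int_mul_eq _
  rw [h2, Complex.norm_mul_exp_arg_mul_I]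
  ring

lemma polar_inj {P : ℂ} {ρ ρ' φ φ' : ℝ} (hρ : 0 < ρ) (hρ' : 0 < ρ') (h : polar P ρ φ = polar P ρ' φ')
    (h1 : φ < φ' + 2 * Real.pi) (h2 : φ' < φ + 2 * Real.pi) : ρ = ρ' ∧ φ = φ' := by
  have hr : ρ = ρ' := by rw [← dist_polar P hρ.le φ, h, dist_polar P hρ'.le]
  refine ⟨hr, ?_⟩
  subst hr
  have h3 : Complex.exp (φ * Complex.I) = Complex.exp (φ' * Complex.I) := by
    have : (ρ : ℂ) ≠ 0 := by exact_mod_cast hρ.ne'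
    exact mul_left_cancel₀ this (add_left_cancel h)
  rw [Complex.exp_eq_exp_iff_exists_int] at h3
  obtain ⟨n, hn⟩ := h3
  have h4 : φ = φ' + n * (2 * Real.pi) := by
    have h5 : ((φ : ℂ)) * Complex.I = ((φ' + n * (2 * Real.pi) : ℝ) : ℂ) * Complex.I := by
      rw [hn]; push_cast; ring
    exact_mod_cast mul_right_cancel₀ Complex.I_ne_zero h5
  have hpi := Real.two_pi_pos
  have hn0 : n = 0 := by
    by_contra hne
    rcases lt_or_gt_of_ne hne with h | h
    · have : (n : ℝ) ≤ -1 := by exact_mod_cast Int.le_sub_one_of_lt h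
      nlinarith
    · have : (1 : ℝ) ≤ n := by exact_mod_cast h
      nlinarith
  rw [h4, hn0]; simp

/-- The open sector of radius `δ` at `P` between the angles `α` and `β`. -/
def sector (P : ℂ) (δ α β : ℝ) : Set ℂ := (fun x : ℝ × ℝ => polar P x.1 x.2) '' (Ioo 0 δ ×ˢ Ioo α β)

lemma isPreconnected_sector (P : ℂ) (δ α β : ℝ) : IsPreconnected (sector P δ α β) :=
  (isPreconnected_Ioo.prod isPreconnected_Ioo).image _ (continuous_polar P).continuousOn

lemma mem_closure_sector (P : ℂ) {δ α β ρ φ : ℝ} (hδ : 0 < δ) (hαβ : α < β) (hρ : ρ ∈ Ico 0 δ)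
    (hφ : φ ∈ Icc α β) : polar P ρ φ ∈ closure (sector P δ α β) := by
  have h : (ρ, φ) ∈ closure (Ioo 0 δ ×ˢ Ioo α β) := by
    rw [closure_prod_eq, closure_Ioo hδ.ne, closure_Ioo hαβ.ne]
    exact ⟨⟨hρ.1, hρ.2.le⟩, hφ⟩
  exact image_closure_subset_closure_image (continuous_polar P) ⟨_, h, rfl⟩

lemma isPreconnected_compl_closedBall (c : ℂ) {r : ℝ} (hr : 0 ≤ r) :
    IsPreconnected (closedBall c r)ᶜ := by
  have : (closedBall c r)ᶜ = (fun x : ℝ × ℝ => polar c x.1 x.2) '' (Ioi r ×ˢ univ) := by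
    ext z
    simp only [mem_compl_iff, mem_closedBall, not_le, mem_image, Prod.exists, mem_prod, mem_Ioi,
      mem_univ, and_true]
    constructor
    · intro h
      obtain ⟨φ, -, h2⟩ := exists_polar c z 0
      exact ⟨_, _, h, h2.symm⟩
    · rintro ⟨ρ, φ, h, rfl⟩
      rwa [dist_polar c (hr.trans h.le)]
  rw [this]
  exact (isPreconnected_Ioi.prod isPreconnected_univ).image _ (continuous_polar c).continuousOn

/-! ### Local shape of a tree in the plane -/

/-- Near `P`, the set `K` consists of the rays from `P` with angles in `A`. -/
def StarAt (K : Set ℂ) (P : ℂ) (A : Set ℝ) : Prop :=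
  P ∈ K ∧ ∃ δ > 0, ∀ z ∈ ball P δ, z ≠ P → (z ∈ K ↔ ∃ θ ∈ A, ∃ ρ > 0, z = polar P ρ θ)

/-- In arbitrarily small discs about `P`, the set `K` has a connected complement. -/
def OneSided (K : Set ℂ) (P : ℂ) : Prop :=
  ∀ ε > 0, ∃ δ > 0, δ < ε ∧ IsPreconnected (ball P δ \ K) ∧
    ∀ z ∈ ball P δ, z ∈ K → z ∈ closure (ball P δ \ K)

/-- In arbitrarily small discs about `P`, the complement of the set `K` is the union of two
connected sets, the sides of `K`. -/
def TwoSided (K : Set ℂ) (P : ℂ) : Prop :=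
  ∀ ε > 0, ∃ δ > 0, δ < ε ∧ ∃ σ₁ σ₂ : Set ℂ, IsPreconnected σ₁ ∧ IsPreconnected σ₂ ∧
    ball P δ \ K = σ₁ ∪ σ₂ ∧ ∀ z ∈ ball P δ, z ∈ K → z ∈ closure σ₁ ∧ z ∈ closure σ₂

lemma StarAt.union {K₁ K₂ : Set ℂ} {P : ℂ} {A₁ A₂ : Set ℝ} (h₁ : StarAt K₁ P A₁)
    (h₂ : StarAt K₂ P A₂) : StarAt (K₁ ∪ K₂) P (A₁ ∪ A₂) := by
  obtain ⟨hP, δ₁, hδ₁, h1⟩ := h₁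
  obtain ⟨-, δ₂, hδ₂, h2⟩ := h₂
  refine ⟨Or.inl hP, min δ₁ δ₂, lt_min hδ₁ hδ₂, fun z hz hzP => ?_⟩
  have e1 := h1 z (ball_subset_ball (min_le_left _ _) hz) hzP
  have e2 := h2 z (ball_subset_ball (min_le_right _ _) hz) hzP
  rw [mem_union, e1, e2]
  constructor
  · rintro (⟨θ, h, h'⟩ | ⟨θ, h, h'⟩)
    · exact ⟨θ, Or.inl h, h'⟩
    · exact ⟨θ, Or.inr h, h'⟩
  · rintro ⟨θ, h | h, h'⟩
    · exact Or.inl ⟨θ, h, h'⟩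
    · exact Or.inr ⟨θ, h, h'⟩

lemma StarAt.congr {K K' : Set ℂ} {P : ℂ} {A : Set ℝ} (h : StarAt K P A)
    (hK : ∀ᶠ z in 𝓝 P, z ∈ K' ↔ z ∈ K) : StarAt K' P A := by
  obtain ⟨hP, δ, hδ, h1⟩ := h
  obtain ⟨ε, hε, h2⟩ := Metric.eventually_nhds_iff_ball.1 hK
  refine ⟨(h2 P (mem_ball_self hε)).2 hP, min δ ε, lt_min hδ hε, fun z hz hzP => ?_⟩
  rw [h2 z (ball_subset_ball (min_le_right _ _) hz)]
  exact h1 z (ball_subset_ball (min_le_left _ _) hz) hzP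

lemma StarAt.eq_sectors {K : Set ℂ} {P : ℂ} {A : Set ℝ} (h : StarAt K P A) :
    ∃ δ₀ > 0, ∀ δ ≤ δ₀, ∀ ρ φ, 0 < ρ → ρ < δ →
      (polar P ρ φ ∈ K ↔ ∃ θ ∈ A, ∃ ρ' > 0, polar P ρ φ = polar P ρ' θ) := by
  obtain ⟨hP, δ₀, hδ₀, h1⟩ := h
  refine ⟨δ₀, hδ₀, fun δ hδ ρ φ hρ hρδ => h1 _ ?_ ?_⟩
  · rw [mem_ball, dist_polar P hρ.le]; linarith
  · intro h
    have := dist_polar P hρ.le φ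
    rw [h, dist_self] at this
    linarith

/-- A disc without one ray from its centre is a single sector of angle `2π`. Two rays leave two
sectors, which is the content of `StarAt.twoSided`. -/
lemma StarAt.oneSided {K : Set ℂ} {P : ℂ} {θ : ℝ} (h : StarAt K P {θ}) : OneSided K P := by
  obtain ⟨δ₀, hδ₀, hmem⟩ := h.eq_sectors
  intro ε hε
  set δ := min (δ₀ / 2) (ε / 2) with hδdef
  have hδ : 0 < δ := lt_min (by linarith) (by linarith)
  have hδε : δ < ε := (min_le_right _ _).trans_lt (by linarith)
  have hδδ : δ ≤ δ₀ := (min_le_left _ _).trans (by linarith)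
  have hpi := Real.two_pi_pos
  have heq : ball P δ \ K = sector P δ θ (θ + 2 * Real.pi) := by
    ext z
    constructor
    · rintro ⟨hz, hzK⟩
      have hzP : z ≠ P := fun h' => hzK (h' ▸ h.1)
      obtain ⟨φ, hφ, hzφ⟩ := exists_polar P z θ
      have hd : 0 < dist z P := dist_pos.2 hzP
      refine ⟨(dist z P, φ), ⟨⟨hd, hz⟩, ⟨lt_of_le_of_ne hφ.1 ?_, hφ.2⟩⟩, hzφ.symm⟩
      intro h'
      change θ = φ at h'
      apply hzK
      rw [hzφ]
      exact (hmem δ hδδ _ _ hd hz).2 ⟨θ, rfl, _, hd, by rw [← h']⟩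
    · rintro ⟨⟨ρ, φ⟩, ⟨hρ, hφ⟩, rfl⟩
      refine ⟨by rw [mem_ball, dist_polar P hρ.1.le]; exact hρ.2, fun hK => ?_⟩
      obtain ⟨θ', hθ', ρ', hρ', he⟩ := (hmem δ hδδ ρ φ hρ.1 hρ.2).1 hK
      rw [mem_singleton_iff] at hθ'
      subst hθ'
      have := (polar_inj hρ.1 hρ' he hφ.2 (by linarith [hφ.1])).2
      exact hφ.1.ne' this
  refine ⟨δ, hδ, hδε, heq ▸ isPreconnected_sector _ _ _ _, fun z hz hzK => ?_⟩
  rw [heq]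
  rcases eq_or_ne z P with rfl | hzP
  · have := mem_closure_sector z hδ (by linarith : θ < θ + 2 * Real.pi) (ρ := 0) (φ := θ)
      ⟨le_rfl, hδ⟩ ⟨le_rfl, by linarith⟩
    simpa [polar] using this
  · obtain ⟨φ, hφ, hzφ⟩ := exists_polar P z θ
    rw [hzφ]
    exact mem_closure_sector P hδ (by linarith) ⟨dist_nonneg, hz⟩ ⟨hφ.1, hφ.2.le⟩

lemma StarAt.twoSided {K : Set ℂ} {P : ℂ} {θ₁ θ₂ : ℝ} (h : StarAt K P {θ₁, θ₂}) (h12 : θ₁ < θ₂)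
    (h21 : θ₂ < θ₁ + 2 * Real.pi) : TwoSided K P := by
  obtain ⟨δ₀, hδ₀, hmem⟩ := h.eq_sectors
  intro ε hε
  set δ := min (δ₀ / 2) (ε / 2) with hδdef
  have hδ : 0 < δ := lt_min (by linarith) (by linarith)
  have hδε : δ < ε := (min_le_right _ _).trans_lt (by linarith)
  have hδδ : δ ≤ δ₀ := (min_le_left _ _).trans (by linarith)
  have hpi := Real.two_pi_pos
  have heq : ball P δ \ K = sector P δ θ₁ θ₂ ∪ sector P δ θ₂ (θ₁ + 2 * Real.pi) := by
    ext z
    constructor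
    · rintro ⟨hz, hzK⟩
      have hzP : z ≠ P := fun h' => hzK (h' ▸ h.1)
      obtain ⟨φ, hφ, hzφ⟩ := exists_polar P z θ₁
      have hd : 0 < dist z P := dist_pos.2 hzP
      have hne : ∀ θ ∈ ({θ₁, θ₂} : Set ℝ), θ ≠ φ := by
        intro θ hθ h'
        apply hzK
        rw [hzφ]
        exact (hmem δ hδδ _ _ hd hz).2 ⟨θ, hθ, _, hd, by rw [← h']⟩
      rcases lt_or_gt_of_ne (hne θ₂ (by simp)) with h' | h'
      · exact Or.inr ⟨(dist z P, φ), ⟨⟨hd, hz⟩, ⟨h', hφ.2⟩⟩, hzφ.symm⟩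
      · exact Or.inl ⟨(dist z P, φ), ⟨⟨hd, hz⟩,
          ⟨lt_of_le_of_ne hφ.1 (hne θ₁ (by simp)), h'⟩⟩, hzφ.symm⟩
    · have key : ∀ ρ φ : ℝ, ρ ∈ Ioo 0 δ → φ ∈ Ioo θ₁ (θ₁ + 2 * Real.pi) → φ ≠ θ₂ →
          polar P ρ φ ∈ ball P δ \ K := by
        intro ρ φ hρ hφ hne
        refine ⟨by rw [mem_ball, dist_polar P hρ.1.le]; exact hρ.2, fun hK => ?_⟩
        obtain ⟨θ', hθ', ρ', hρ', he⟩ := (hmem δ hδδ ρ φ hρ.1 hρ.2).1 hK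
        rcases hθ' with rfl | rfl
        · exact hφ.1.ne' (polar_inj hρ.1 hρ' he hφ.2 (by linarith [hφ.1])).2
        · exact hne (polar_inj hρ.1 hρ' he (by linarith [hφ.2]) (by linarith [hφ.1])).2
      rintro (⟨⟨ρ, φ⟩, ⟨hρ, hφ⟩, rfl⟩ | ⟨⟨ρ, φ⟩, ⟨hρ, hφ⟩, rfl⟩)
      · exact key ρ φ hρ ⟨hφ.1, hφ.2.trans h21⟩ hφ.2.ne
      · exact key ρ φ hρ ⟨h12.trans hφ.1, hφ.2⟩ hφ.1.ne'
  refine ⟨δ, hδ, hδε, _, _, isPreconnected_sector _ _ _ _, isPreconnected_sector _ _ _ _, heq,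
    fun z hz hzK => ?_⟩
  rcases eq_or_ne z P with rfl | hzP
  · have h1 := mem_closure_sector z hδ h12 (ρ := 0) (φ := θ₁) ⟨le_rfl, hδ⟩ ⟨le_rfl, h12.le⟩
    have h2 := mem_closure_sector z hδ h21 (ρ := 0) (φ := θ₂) ⟨le_rfl, hδ⟩ ⟨le_rfl, h21.le⟩
    simp only [polar, Complex.ofReal_zero, zero_mul, add_zero] at h1 h2
    exact ⟨h1, h2⟩
  · obtain ⟨φ, hφ, hzφ⟩ := exists_polar P z θ₁
    have hd : 0 < dist z P := dist_pos.2 hzP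
    have hzK' := hzK
    rw [hzφ] at hzK'
    obtain ⟨θ', hθ', ρ', hρ', he⟩ := (hmem δ hδδ _ φ hd hz).1 hzK'
    rw [← hzφ] at he
    have hρz : ρ' = dist z P := by rw [he, dist_polar P hρ'.le]
    rcases hθ' with rfl | rfl
    · constructor
      · rw [he]
        exact mem_closure_sector P hδ h12 ⟨hρ'.le, hρz ▸ hz⟩ ⟨le_rfl, h12.le⟩
      · rw [he, ← polar_add_two_pi]
        exact mem_closure_sector P hδ h21 ⟨hρ'.le, hρz ▸ hz⟩ ⟨h21.le, le_rfl⟩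
    · constructor
      · rw [he]
        exact mem_closure_sector P hδ h12 ⟨hρ'.le, hρz ▸ hz⟩ ⟨h12.le, le_rfl⟩
      · rw [he]
        exact mem_closure_sector P hδ h21 ⟨hρ'.le, hρz ▸ hz⟩ ⟨le_rfl, h21.le⟩

/-- The complement of a star with three rays consists of three connected sectors; every ray is in
the closure of the two sectors that it bounds. -/
lemma StarAt.exists_three_sectors {K : Set ℂ} {P : ℂ} {θ₁ θ₂ θ₃ : ℝ} (h : StarAt K P {θ₁, θ₂, θ₃})
    (h12 : θ₁ < θ₂) (h23 : θ₂ < θ₃) (h31 : θ₃ < θ₁ + 2 * Real.pi) {ε : ℝ} (hε : 0 < ε) :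
    ∃ δ > 0, δ < ε ∧ ∃ σ₁ σ₂ σ₃ : Set ℂ, IsPreconnected σ₁ ∧ IsPreconnected σ₂ ∧ IsPreconnected σ₃ ∧
      ball P δ \ K = σ₁ ∪ σ₂ ∪ σ₃ ∧
      ∀ ρ ∈ Ico 0 δ, (polar P ρ θ₁ ∈ closure σ₃ ∧ polar P ρ θ₁ ∈ closure σ₁) ∧
        (polar P ρ θ₂ ∈ closure σ₁ ∧ polar P ρ θ₂ ∈ closure σ₂) ∧
        (polar P ρ θ₃ ∈ closure σ₂ ∧ polar P ρ θ₃ ∈ closure σ₃) := by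
  obtain ⟨δ₀, hδ₀, hmem⟩ := h.eq_sectors
  set δ := min (δ₀ / 2) (ε / 2) with hδdef
  have hδ : 0 < δ := lt_min (by linarith) (by linarith)
  have hδε : δ < ε := (min_le_right _ _).trans_lt (by linarith)
  have hδδ : δ ≤ δ₀ := (min_le_left _ _).trans (by linarith)
  have hpi := Real.two_pi_pos
  have heq : ball P δ \ K =
      sector P δ θ₁ θ₂ ∪ sector P δ θ₂ θ₃ ∪ sector P δ θ₃ (θ₁ + 2 * Real.pi) := by
    ext z
    constructor
    · rintro ⟨hz, hzK⟩
      have hzP : z ≠ P := fun h' => hzK (h' ▸ h.1)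
      obtain ⟨φ, hφ, hzφ⟩ := exists_polar P z θ₁
      have hd : 0 < dist z P := dist_pos.2 hzP
      have hne : ∀ θ ∈ ({θ₁, θ₂, θ₃} : Set ℝ), θ ≠ φ := by
        intro θ hθ h'
        apply hzK
        rw [hzφ]
        exact (hmem δ hδδ _ _ hd hz).2 ⟨θ, hθ, _, hd, by rw [← h']⟩
      rcases lt_or_gt_of_ne (hne θ₂ (by simp)) with h' | h'
      · rcases lt_or_gt_of_ne (hne θ₃ (by simp)) with h'' | h''
        · exact Or.inr ⟨(dist z P, φ), ⟨⟨hd, hz⟩, ⟨h'', hφ.2⟩⟩, hzφ.symm⟩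
        · exact Or.inl (Or.inr ⟨(dist z P, φ), ⟨⟨hd, hz⟩, ⟨h', h''⟩⟩, hzφ.symm⟩)
      · exact Or.inl (Or.inl ⟨(dist z P, φ), ⟨⟨hd, hz⟩,
          ⟨lt_of_le_of_ne hφ.1 (hne θ₁ (by simp)), h'⟩⟩, hzφ.symm⟩)
    · have key : ∀ ρ φ : ℝ, ρ ∈ Ioo 0 δ → φ ∈ Ioo θ₁ (θ₁ + 2 * Real.pi) → φ ≠ θ₂ → φ ≠ θ₃ →
          polar P ρ φ ∈ ball P δ \ K := by
        intro ρ φ hρ hφ hne hne3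
        refine ⟨by rw [mem_ball, dist_polar P hρ.1.le]; exact hρ.2, fun hK => ?_⟩
        obtain ⟨θ', hθ', ρ', hρ', he⟩ := (hmem δ hδδ ρ φ hρ.1 hρ.2).1 hK
        rcases hθ' with rfl | rfl | rfl
        · exact hφ.1.ne' (polar_inj hρ.1 hρ' he hφ.2 (by linarith [hφ.1])).2
        · exact hne (polar_inj hρ.1 hρ' he (by linarith [hφ.2]) (by linarith [hφ.1])).2
        · exact hne3 (polar_inj hρ.1 hρ' he (by linarith [hφ.2]) (by linarith [hφ.1])).2
      rintro ((⟨⟨ρ, φ⟩, ⟨hρ, hφ⟩, rfl⟩ | ⟨⟨ρ, φ⟩, ⟨hρ, hφ⟩, rfl⟩) | ⟨⟨ρ, φ⟩, ⟨hρ, hφ⟩, rfl⟩)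
      · exact key ρ φ hρ ⟨hφ.1, hφ.2.trans (h23.trans h31)⟩ hφ.2.ne (hφ.2.trans h23).ne
      · exact key ρ φ hρ ⟨h12.trans hφ.1, hφ.2.trans h31⟩ hφ.1.ne' hφ.2.ne
      · exact key ρ φ hρ ⟨(h12.trans h23).trans hφ.1, hφ.2⟩ (h23.trans hφ.1).ne' hφ.1.ne'
  refine ⟨δ, hδ, hδε, _, _, _, isPreconnected_sector _ _ _ _, isPreconnected_sector _ _ _ _,
    isPreconnected_sector _ _ _ _, heq, fun ρ hρ => ⟨⟨?_, ?_⟩, ⟨?_, ?_⟩, ?_, ?_⟩⟩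
  · rw [← polar_add_two_pi]
    exact mem_closure_sector P hδ h31 hρ ⟨h31.le, le_rfl⟩
  · exact mem_closure_sector P hδ h12 hρ ⟨le_rfl, h12.le⟩
  · exact mem_closure_sector P hδ h12 hρ ⟨h12.le, le_rfl⟩
  · exact mem_closure_sector P hδ h23 hρ ⟨le_rfl, h23.le⟩
  · exact mem_closure_sector P hδ h23 hρ ⟨h23.le, le_rfl⟩
  · exact mem_closure_sector P hδ h31 hρ ⟨le_rfl, h31.le⟩

/-! ### Polygonal arcs -/

lemma IsPolygonalArc.reverse {γ : ℝ → ℂ} (h : IsPolygonalArc γ) :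
    IsPolygonalArc fun s => γ (1 - s) := by
  obtain ⟨hinj, S, hS⟩ := h
  refine ⟨fun x hx y hy hxy => ?_, S.image fun s => 1 - s, fun a b ha hab hb hbr s hs => ?_⟩
  · have := hinj (x₁ := 1 - x) ⟨by linarith [hx.2], by linarith [hx.1]⟩ (x₂ := 1 - y)
      ⟨by linarith [hy.2], by linarith [hy.1]⟩ hxy
    linarith
  · have h1 := hS (1 - b) (1 - a) (by linarith) (by linarith) (by linarith) (fun t ht htm => by
      refine hbr (1 - t) (Finset.mem_image_of_mem _ ht) ⟨by linarith [htm.2], by linarith [htm.1]⟩)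
      (1 - s) ⟨by linarith [hs.2], by linarith [hs.1]⟩
    dsimp only
    rw [h1]
    have hne : b - a ≠ 0 := by linarith
    have e1 : (1 - s - (1 - b)) / (1 - a - (1 - b)) = 1 - (s - a) / (b - a) := by
      rw [show 1 - a - (1 - b) = b - a by ring]
      field_simp
      ring
    rw [e1, AffineMap.lineMap_apply_one_sub]

/-- A polygonal arc starts with a segment at each of its points. -/
lemma IsPolygonalArc.exists_right {γ : ℝ → ℂ} (h : IsPolygonalArc γ) {s : ℝ} (hs : s ∈ Ico (0 : ℝ) 1) :
    ∃ ε > 0, s + ε ≤ 1 ∧ ∃ d : ℂ, d ≠ 0 ∧ ∀ x ∈ Icc 0 ε, γ (s + x) = γ s + x * d := by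
  obtain ⟨hinj, S, hS⟩ := h
  -- The point `s` may itself be a break point, so only the others are avoided; the segment obtained
  -- lies on one side of `s`.
  have hfin : ((S : Set ℝ) \ {s}).Finite := S.finite_toSet.subset sdiff_subset
  obtain ⟨ε₀, hε₀, hball⟩ := Metric.isOpen_iff.1 hfin.isClosed.isOpen_compl s (by simp)
  set ε := min (ε₀ / 2) (1 - s) with hεdef
  have hε : 0 < ε := lt_min (by linarith) (by linarith [hs.2])
  have hε1 : s + ε ≤ 1 := by linarith [min_le_right (ε₀ / 2) (1 - s)]
  have hε2 : ε < ε₀ := (min_le_left _ _).trans_lt (by linarith)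
  have hlin := hS s (s + ε) hs.1 (by linarith) hε1 (fun t ht htm => by
    refine hball (a := t) ?_ ⟨ht, fun h' => htm.1.ne' h'⟩
    rw [mem_ball, Real.dist_eq, abs_lt]
    constructor <;> linarith [htm.1, htm.2])
  refine ⟨ε, hε, hε1, (γ (s + ε) - γ s) / ε, ?_, fun x hx => ?_⟩
  · refine div_ne_zero (fun h' => ?_) (by exact_mod_cast hε.ne')
    have := hinj ⟨by linarith [hs.1], hε1⟩ ⟨hs.1, hs.2.le⟩ (sub_eq_zero.1 h')
    linarith
  · rw [hlin (s + x) ⟨by linarith [hx.1], by linarith [hx.2]⟩, AffineMap.lineMap_apply]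
    have : (ε : ℂ) ≠ 0 := by exact_mod_cast hε.ne'
    simp only [add_sub_cancel_left, vsub_eq_sub, vadd_eq_add, Complex.real_smul]
    push_cast
    ring

lemma IsPolygonalArc.exists_left {γ : ℝ → ℂ} (h : IsPolygonalArc γ) {s : ℝ} (hs : s ∈ Ioc (0 : ℝ) 1) :
    ∃ ε > 0, 0 ≤ s - ε ∧ ∃ d : ℂ, d ≠ 0 ∧ ∀ x ∈ Icc 0 ε, γ (s - x) = γ s + x * d := by
  obtain ⟨ε, hε, h1, d, hd, h2⟩ := h.reverse.exists_right (s := 1 - s)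
    ⟨by linarith [hs.2], by linarith [hs.1]⟩
  refine ⟨ε, hε, by linarith, d, hd, fun x hx => ?_⟩
  have := h2 x hx
  simp only [sub_sub_cancel] at this
  rw [← this]
  congr 1
  ring

lemma IsPolygonalArc.continuousOn {γ : ℝ → ℂ} (h : IsPolygonalArc γ) : ContinuousOn γ (Icc 0 1) := by
  have hright : ∀ γ : ℝ → ℂ, IsPolygonalArc γ → ∀ s ∈ Ico (0 : ℝ) 1,
      ContinuousWithinAt γ (Ici s) s := by
    intro γ h s hs
    obtain ⟨ε, hε, h1, d, hd, h2⟩ := h.exists_right hs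
    have hc : ContinuousWithinAt (fun y : ℝ => γ s + ((y - s : ℝ) : ℂ) * d) (Ici s) s := by
      apply Continuous.continuousWithinAt; fun_prop
    refine hc.congr_of_eventuallyEq ?_ (by simp)
    filter_upwards [self_mem_nhdsWithin, mem_nhdsWithin_of_mem_nhds (Iio_mem_nhds
      (by linarith : s < s + ε))] with y hy hy2
    rw [mem_Ici] at hy
    rw [mem_Iio] at hy2
    rw [← h2 (y - s) ⟨by linarith, by linarith⟩]
    congr 1
    ring
  intro s hs
  have h1 : ContinuousWithinAt γ (Icc 0 1 ∩ Ici s) s := by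
    rcases eq_or_lt_of_le hs.2 with h1 | h1
    · have : Icc 0 1 ∩ Ici s ⊆ {s} := by
        rintro y ⟨hy, hy2⟩
        exact le_antisymm (h1 ▸ hy.2) hy2
      exact continuousWithinAt_singleton.mono this
    · exact (hright γ h s ⟨hs.1, h1⟩).mono inter_subset_right
  have h2 : ContinuousWithinAt γ (Icc 0 1 ∩ Iic s) s := by
    rcases eq_or_lt_of_le hs.1 with h1 | h1
    · have : Icc 0 1 ∩ Iic s ⊆ {s} := by
        rintro y ⟨hy, hy2⟩
        exact le_antisymm hy2 (h1 ▸ hy.1)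
      exact continuousWithinAt_singleton.mono this
    · have h3 := hright _ h.reverse (1 - s) ⟨by linarith [hs.2], by linarith⟩
      have h4 : ContinuousWithinAt (fun y : ℝ => 1 - y) (Icc 0 1 ∩ Iic s) s := by
        apply Continuous.continuousWithinAt; fun_prop
      have h5 := ContinuousWithinAt.comp (t := Ici (1 - s)) h3 h4
        (fun y hy => by rw [mem_Ici]; linarith [hy.2.out])
      refine h5.congr (fun y hy => by simp) (by simp)
  have h3 := h1.union h2
  rwa [← inter_union_distrib_left, Ici_union_Iic, inter_univ] at h3

lemma exists_angle {d : ℂ} (θ : ℝ) : ∃ φ ∈ Ico θ (θ + 2 * Real.pi), d = ‖d‖ * Complex.exp (φ * Complex.I) := by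
  obtain ⟨φ, hφ, h⟩ := exists_polar 0 d θ
  exact ⟨φ, hφ, by simpa [polar] using h⟩

lemma add_real_mul_eq_polar {P d : ℂ} {θ x : ℝ} (hd : d = ‖d‖ * Complex.exp (θ * Complex.I)) :
    P + x * d = polar P (x * ‖d‖) θ := by
  rw [polar, Complex.ofReal_mul, mul_assoc, ← hd]

/-- The image of a closed piece of an arc is closed, and misses the other points of the arc. -/
lemma IsPolygonalArc.exists_ball_disjoint {γ : ℝ → ℂ} (h : IsPolygonalArc γ) {s a b : ℝ}
    (hs : s ∈ Icc (0 : ℝ) 1) (ha : 0 ≤ a) (hb : b ≤ 1) (hsab : s ∉ Icc a b) :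
    ∃ δ > 0, ∀ x ∈ Icc a b, γ x ∉ ball (γ s) δ := by
  have hsub : Icc a b ⊆ Icc 0 1 := Icc_subset_Icc ha hb
  have hc : IsCompact (γ '' Icc a b) := isCompact_Icc.image_of_continuousOn (h.continuousOn.mono hsub)
  have hn : γ s ∉ γ '' Icc a b := by
    rintro ⟨x, hx, hxs⟩
    exact hsab (h.1 (hsub hx) hs hxs ▸ hx)
  obtain ⟨δ, hδ, hball⟩ := Metric.isOpen_iff.1 hc.isClosed.isOpen_compl _ hn
  exact ⟨δ, hδ, fun x hx hx' => hball hx' ⟨x, hx, rfl⟩⟩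

/-- Near its first point an arc is a ray. -/
lemma IsPolygonalArc.starAt_zero {γ : ℝ → ℂ} (h : IsPolygonalArc γ) {ε θ : ℝ} {d : ℂ} (hε : 0 < ε)
    (hε1 : ε ≤ 1) (hd0 : d ≠ 0) (hγ : ∀ x ∈ Icc 0 ε, γ x = γ 0 + x * d)
    (hd : d = ‖d‖ * Complex.exp (θ * Complex.I)) : StarAt (γ '' Icc 0 1) (γ 0) {θ} := by
  obtain ⟨δ, hδ, hdisj⟩ := h.exists_ball_disjoint (s := 0) (a := ε) (b := 1) ⟨le_rfl, zero_le_one⟩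
    hε.le le_rfl (fun h' => by linarith [h'.1])
  have hn : 0 < ‖d‖ := norm_pos_iff.2 hd0
  refine ⟨⟨0, ⟨le_rfl, zero_le_one⟩, rfl⟩, min δ (ε * ‖d‖), lt_min hδ (mul_pos hε hn),
    fun z hz hzP => ⟨?_, ?_⟩⟩
  · rintro ⟨x, hx, rfl⟩
    have hxε : x < ε := by
      by_contra! h'
      exact hdisj x ⟨h', hx.2⟩ (ball_subset_ball (min_le_left _ _) hz)
    have hx0 : 0 < x := lt_of_le_of_ne hx.1 (by rintro rfl; exact hzP rfl)
    exact ⟨θ, rfl, x * ‖d‖, mul_pos hx0 hn, by rw [hγ x ⟨hx.1, hxε.le⟩, add_real_mul_eq_polar hd]⟩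
  · rintro ⟨θ', rfl, ρ, hρ, rfl⟩
    rw [mem_ball, dist_polar _ hρ.le] at hz
    have hρε : ρ / ‖d‖ ≤ ε := by
      rw [div_le_iff₀ hn]
      exact (hz.trans_le (min_le_right _ _)).le
    have h0 : 0 ≤ ρ / ‖d‖ := by positivity
    refine ⟨ρ / ‖d‖, ⟨h0, hρε.trans hε1⟩, ?_⟩
    rw [hγ _ ⟨h0, hρε⟩, add_real_mul_eq_polar hd, div_mul_cancel₀ _ hn.ne']

lemma IsPolygonalArc.exists_starAt_zero {γ : ℝ → ℂ} (h : IsPolygonalArc γ) :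
    ∃ θ, StarAt (γ '' Icc 0 1) (γ 0) {θ} := by
  obtain ⟨ε, hε, h1, d, hd, h2⟩ := h.exists_right ⟨le_rfl, zero_lt_one⟩
  obtain ⟨θ, -, hθ⟩ := exists_angle (d := d) 0
  exact ⟨θ, h.starAt_zero hε (by linarith) hd (fun x hx => by simpa using h2 x hx) hθ⟩

/-- Near an interior point an arc consists of two rays. -/
lemma IsPolygonalArc.exists_starAt {γ : ℝ → ℂ} (h : IsPolygonalArc γ) {s : ℝ}
    (hs : s ∈ Ioo (0 : ℝ) 1) : ∃ θ₁ θ₂ : ℝ, θ₁ < θ₂ ∧ θ₂ < θ₁ + 2 * Real.pi ∧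
      StarAt (γ '' Icc 0 1) (γ s) {θ₁, θ₂} := by
  obtain ⟨ε₁, hε₁, h1, d₁, hd₁, hγ₁⟩ := h.exists_right ⟨hs.1.le, hs.2⟩
  obtain ⟨ε₂, hε₂, h2, d₂, hd₂, hγ₂⟩ := h.exists_left ⟨hs.1, hs.2.le⟩
  have hn₁ : 0 < ‖d₁‖ := norm_pos_iff.2 hd₁
  have hn₂ : 0 < ‖d₂‖ := norm_pos_iff.2 hd₂
  obtain ⟨θ₁, -, hθ₁⟩ := exists_angle (d := d₁) 0
  obtain ⟨θ₂, hθ₂m, hθ₂⟩ := exists_angle (d := d₂) θ₁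
  -- If the arc arrived and left along the same ray, it would pass twice through the point of that
  -- ray at the small distance `r`, against injectivity.
  have hne : θ₁ ≠ θ₂ := by
    intro heq
    set r := min (ε₁ * ‖d₁‖) (ε₂ * ‖d₂‖) with hr
    have hr0 : 0 < r := lt_min (mul_pos hε₁ hn₁) (mul_pos hε₂ hn₂)
    have hx1 : r / ‖d₁‖ ∈ Icc 0 ε₁ := ⟨by positivity, by rw [div_le_iff₀ hn₁]; exact min_le_left _ _⟩
    have hx2 : r / ‖d₂‖ ∈ Icc 0 ε₂ := ⟨by positivity, by rw [div_le_iff₀ hn₂]; exact min_le_right _ _⟩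
    have e1 := hγ₁ _ hx1
    have e2 := hγ₂ _ hx2
    rw [add_real_mul_eq_polar hθ₁, div_mul_cancel₀ _ hn₁.ne'] at e1
    rw [add_real_mul_eq_polar hθ₂, div_mul_cancel₀ _ hn₂.ne', ← heq, ← e1] at e2
    have h0 : 0 < r / ‖d₁‖ := by positivity
    have h0' : 0 < r / ‖d₂‖ := by positivity
    have := h.1 ⟨by linarith [hx2.2], by linarith [hs.2]⟩ ⟨by linarith [hs.1], by linarith [hx1.2]⟩ e2
    linarith
  refine ⟨θ₁, θ₂, lt_of_le_of_ne hθ₂m.1 hne, hθ₂m.2, ⟨s, ⟨hs.1.le, hs.2.le⟩, rfl⟩, ?_⟩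
  obtain ⟨δ₁, hδ₁, hdisj₁⟩ := h.exists_ball_disjoint (s := s) (a := s + ε₁) (b := 1)
    ⟨hs.1.le, hs.2.le⟩ (by linarith [hs.1]) le_rfl (fun h' => by linarith [h'.1])
  obtain ⟨δ₂, hδ₂, hdisj₂⟩ := h.exists_ball_disjoint (s := s) (a := 0) (b := s - ε₂)
    ⟨hs.1.le, hs.2.le⟩ le_rfl (by linarith [hs.2]) (fun h' => by linarith [h'.2])
  refine ⟨min (min δ₁ δ₂) (min (ε₁ * ‖d₁‖) (ε₂ * ‖d₂‖)), lt_min (lt_min hδ₁ hδ₂)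
    (lt_min (mul_pos hε₁ hn₁) (mul_pos hε₂ hn₂)), fun z hz hzP => ⟨?_, ?_⟩⟩
  · rintro ⟨x, hx, rfl⟩
    have hz1 : γ x ∈ ball (γ s) δ₁ := ball_subset_ball ((min_le_left _ _).trans (min_le_left _ _)) hz
    have hz2 : γ x ∈ ball (γ s) δ₂ := ball_subset_ball ((min_le_left _ _).trans (min_le_right _ _)) hz
    have hx1 : x < s + ε₁ := by
      by_contra! h'
      exact hdisj₁ x ⟨h', hx.2⟩ hz1
    have hx2 : s - ε₂ < x := by
      by_contra! h'
      exact hdisj₂ x ⟨hx.1, h'⟩ hz2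
    have hxs : x ≠ s := by rintro rfl; exact hzP rfl
    rcases lt_or_gt_of_ne hxs with hlt | hlt
    · refine ⟨θ₂, by simp, (s - x) * ‖d₂‖, mul_pos (by linarith) hn₂, ?_⟩
      rw [← add_real_mul_eq_polar hθ₂, ← hγ₂ _ ⟨by linarith, by linarith⟩, sub_sub_cancel]
    · refine ⟨θ₁, by simp, (x - s) * ‖d₁‖, mul_pos (by linarith) hn₁, ?_⟩
      rw [← add_real_mul_eq_polar hθ₁, ← hγ₁ _ ⟨by linarith, by linarith⟩, add_sub_cancel]
  · rintro ⟨θ, hθ, ρ, hρ, rfl⟩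
    rw [mem_ball, dist_polar _ hρ.le] at hz
    rcases hθ with rfl | rfl
    · have hρε : ρ / ‖d₁‖ ≤ ε₁ := by
        rw [div_le_iff₀ hn₁]
        exact (hz.trans_le ((min_le_right _ _).trans (min_le_left _ _))).le
      have h0 : 0 ≤ ρ / ‖d₁‖ := by positivity
      refine ⟨s + ρ / ‖d₁‖, ⟨by linarith [hs.1], by linarith⟩, ?_⟩
      rw [hγ₁ _ ⟨h0, hρε⟩, add_real_mul_eq_polar hθ₁, div_mul_cancel₀ _ hn₁.ne']
    · have hρε : ρ / ‖d₂‖ ≤ ε₂ := by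
        rw [div_le_iff₀ hn₂]
        exact (hz.trans_le ((min_le_right _ _).trans (min_le_right _ _))).le
      have h0 : 0 ≤ ρ / ‖d₂‖ := by positivity
      refine ⟨s - ρ / ‖d₂‖, ⟨by linarith [hs.1], by linarith [hs.2]⟩, ?_⟩
      rw [hγ₂ _ ⟨h0, hρε⟩, add_real_mul_eq_polar hθ₂, div_mul_cancel₀ _ hn₂.ne']

/-- Removing an arc that enters a connected open set from outside leaves a connected set. -/
lemma isPreconnected_diff_arc {V L : Set ℂ} {γ : ℝ → ℂ} {s₀ : ℝ} (hV : IsOpen V)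
    (hVc : IsPreconnected V) (hs₀ : s₀ < 1) (hγ : ContinuousOn γ (Ioc s₀ 1))
    (hL : ∀ z ∈ V, z ∈ L ↔ ∃ s ∈ Ioc s₀ 1, z = γ s) (hγV : ∀ s ∈ Ioc s₀ 1, γ s ∈ V)
    (hVL : IsOpen (V \ L)) (htwo : ∀ s ∈ Ioo s₀ 1, TwoSided L (γ s)) (hone : OneSided L (γ 1)) :
    IsPreconnected (V \ L) := by
  have hγL : ∀ s ∈ Ioc s₀ 1, γ s ∈ L := fun s hs => (hL _ (hγV s hs)).2 ⟨s, hs, rfl⟩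
  refine isPreconnected_of_locally_constant hVL fun b hb => ?_
  -- `E s`: near the arc point with parameter `s` the function `b` has the same value on both sides.
  -- This propagates from the free end, where there is only one side.
  let E : ℝ → Prop := fun s => ∃ ε > 0, ∃ c, ∀ y ∈ ball (γ s) ε, y ∉ L → b y = c
  have hbσ : ∀ σ : Set ℂ, IsPreconnected σ → σ ⊆ V \ L → ∀ x ∈ σ, ∀ y ∈ σ, b x = b y :=
    fun σ hσ hsub x hx y hy => IsPreconnected.eq_of_eventually_eq hσ
      (fun z hz => (hb z (hsub hz)).filter_mono nhdsWithin_le_nhds) hx hy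
  have hmono : ∀ s s' : ℝ, ∀ ε > 0, γ s' ∈ ball (γ s) ε →
      (∃ c, ∀ y ∈ ball (γ s) ε, y ∉ L → b y = c) → E s' := by
    rintro s s' ε hε hs' ⟨c, hc⟩
    refine ⟨ε - dist (γ s') (γ s), sub_pos.2 hs', c, fun y hy => hc y ?_⟩
    rw [mem_ball] at hy ⊢
    linarith [dist_triangle y (γ s') (γ s)]
  -- Each side is connected and carries one value of `b`. All arc points in the small disc are in
  -- the closure of both sides, so `E` means the same condition `b x₁ = b x₂` at all of them.
  have hloc : ∀ s ∈ Ioc s₀ 1, ∀ᶠ s' in 𝓝[Ioc s₀ 1] s, E s' = E s := by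
    intro s hs
    obtain ⟨ε, hε, hball⟩ := Metric.isOpen_iff.1 hV _ (hγV s hs)
    rcases eq_or_lt_of_le hs.2 with rfl | hs1
    · obtain ⟨δ, hδ, hδε, hpre, -⟩ := hone ε hε
      have hsub : ball (γ 1) δ \ L ⊆ V \ L :=
        sdiff_subset_sdiff_left ((ball_subset_ball hδε.le).trans hball)
      have hE : ∀ s', γ s' ∈ ball (γ 1) δ → E s' := by
        intro s' hs'
        refine hmono 1 s' δ hδ hs' ?_
        by_cases hne : (ball (γ 1) δ \ L).Nonempty
        · obtain ⟨x, hx⟩ := hne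
          exact ⟨b x, fun y hy hyL => hbσ _ hpre hsub y ⟨hy, hyL⟩ x hx⟩
        · exact ⟨True, fun y hy hyL => (hne ⟨y, hy, hyL⟩).elim⟩
      filter_upwards [hγ 1 hs (ball_mem_nhds _ hδ)] with s' hs'
      exact propext (iff_of_true (hE s' hs') (hE 1 (mem_ball_self hδ)))
    · obtain ⟨δ, hδ, hδε, σ₁, σ₂, hσ₁, hσ₂, heq, hcl⟩ := htwo s ⟨hs.1, hs1⟩ ε hε
      have hsub : ball (γ s) δ \ L ⊆ V \ L :=
        sdiff_subset_sdiff_left ((ball_subset_ball hδε.le).trans hball)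
      obtain ⟨hP1, hP2⟩ := hcl _ (mem_ball_self hδ) (hγL s hs)
      obtain ⟨x₁, hx₁⟩ : σ₁.Nonempty := closure_nonempty_iff.1 ⟨_, hP1⟩
      obtain ⟨x₂, hx₂⟩ : σ₂.Nonempty := closure_nonempty_iff.1 ⟨_, hP2⟩
      have hc1 := hbσ σ₁ hσ₁ ((subset_union_left.trans heq.symm.subset).trans hsub)
      have hc2 := hbσ σ₂ hσ₂ ((subset_union_right.trans heq.symm.subset).trans hsub)
      have hE : ∀ s' ∈ Ioc s₀ 1, γ s' ∈ ball (γ s) δ → (E s' ↔ b x₁ = b x₂) := by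
        intro s' hs'm hs'
        constructor
        · rintro ⟨η, hη, c, hc⟩
          obtain ⟨h1, h2⟩ := hcl _ hs' (hγL s' hs'm)
          obtain ⟨y₁, hy₁, hd1⟩ := Metric.mem_closure_iff.1 h1 η hη
          obtain ⟨y₂, hy₂, hd2⟩ := Metric.mem_closure_iff.1 h2 η hη
          rw [dist_comm] at hd1 hd2
          have m1 : y₁ ∈ ball (γ s) δ \ L := heq ▸ Or.inl hy₁
          have m2 : y₂ ∈ ball (γ s) δ \ L := heq ▸ Or.inr hy₂
          rw [hc1 x₁ hx₁ y₁ hy₁, hc2 x₂ hx₂ y₂ hy₂, hc y₁ hd1 m1.2, hc y₂ hd2 m2.2]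
        · intro h12
          refine hmono s s' δ hδ hs' ⟨b x₁, fun y hy hyL => ?_⟩
          have : y ∈ σ₁ ∪ σ₂ := heq ▸ ⟨hy, hyL⟩
          rcases this with hy1 | hy2
          · exact hc1 y hy1 x₁ hx₁
          · rw [h12]; exact hc2 y hy2 x₂ hx₂
      filter_upwards [hγ s hs (ball_mem_nhds _ hδ), self_mem_nhdsWithin] with s' hs' hs'm
      rw [eq_iff_iff, hE s' hs'm hs', hE s hs (mem_ball_self hδ)]
  have hE1 : E 1 := by
    obtain ⟨ε, hε, hball⟩ := Metric.isOpen_iff.1 hV _ (hγV 1 ⟨hs₀, le_rfl⟩)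
    obtain ⟨δ, hδ, hδε, hpre, -⟩ := hone ε hε
    have hsub : ball (γ 1) δ \ L ⊆ V \ L :=
      sdiff_subset_sdiff_left ((ball_subset_ball hδε.le).trans hball)
    by_cases hne : (ball (γ 1) δ \ L).Nonempty
    · obtain ⟨x, hx⟩ := hne
      exact ⟨δ, hδ, b x, fun y hy hyL => hbσ _ hpre hsub y ⟨hy, hyL⟩ x hx⟩
    · exact ⟨δ, hδ, True, fun y hy hyL => (hne ⟨y, hy, hyL⟩).elim⟩
  have hEs : ∀ s ∈ Ioc s₀ 1, E s := by
    intro s hs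
    rw [IsPreconnected.eq_of_eventually_eq isPreconnected_Ioc hloc hs ⟨hs₀, le_rfl⟩]
    exact hE1
  have hdense : ∀ s ∈ Ioc s₀ 1, ∀ ε > 0, ∃ y ∈ ball (γ s) ε, y ∉ L := by
    intro s hs ε hε
    have hfin : ∀ σ δ, γ s ∈ closure σ → σ ⊆ ball (γ s) δ \ L → ∃ y ∈ ball (γ s) ε, y ∉ L := by
      intro σ δ h1 h2
      obtain ⟨y, hy, hd⟩ := Metric.mem_closure_iff.1 h1 ε hε
      rw [dist_comm] at hd
      exact ⟨y, hd, (h2 hy).2⟩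
    rcases eq_or_lt_of_le hs.2 with rfl | hs1
    · obtain ⟨δ, hδ, -, -, hcl⟩ := hone ε hε
      exact hfin _ δ (hcl _ (mem_ball_self hδ) (hγL 1 hs)) subset_rfl
    · obtain ⟨δ, hδ, -, σ₁, σ₂, -, -, heq, hcl⟩ := htwo s ⟨hs.1, hs1⟩ ε hε
      exact hfin _ δ (hcl _ (mem_ball_self hδ) (hγL s hs)).1 (heq ▸ subset_union_left)
  -- The extension of `b` across the arc by its common boundary value. It is locally constant on all
  -- of `V`, which is connected.
  let b' : ℂ → Prop := fun x => ∃ᶠ y in 𝓝 x, y ∉ L ∧ b y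
  have hb'1 : ∀ x ∈ V \ L, b' x = b x := by
    intro x hx
    apply propext
    constructor
    · intro h
      obtain ⟨y, ⟨-, hy⟩, hy2⟩ := (h.and_eventually (hb x hx)).exists
      rwa [← hy2]
    · intro h
      refine Eventually.frequently ?_
      filter_upwards [hb x hx, hVL.mem_nhds hx] with y hy hy2
      exact ⟨hy2.2, hy.symm ▸ h⟩
  have hb'2 : ∀ s ∈ Ioc s₀ 1, ∃ c, ∀ᶠ y in 𝓝 (γ s), b' y = c := by
    intro s hs
    obtain ⟨ε, hε, c, hc⟩ := hEs s hs
    refine ⟨c, ?_⟩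
    filter_upwards [ball_mem_nhds _ hε, hV.mem_nhds (hγV s hs)] with y hy hyV
    apply propext
    constructor
    · intro h
      obtain ⟨y', ⟨hy'L, hy'⟩, hy'2⟩ := (h.and_eventually (isOpen_ball.mem_nhds hy)).exists
      rwa [← hc y' hy'2 hy'L]
    · intro h
      by_cases hyL : y ∈ L
      · obtain ⟨s', hs', rfl⟩ := (hL y hyV).1 hyL
        rw [show b' (γ s') = ∃ᶠ y in 𝓝 (γ s'), y ∉ L ∧ b y from rfl, Metric.nhds_basis_ball.frequently_iff]
        intro η hη
        obtain ⟨y', hy', hy'L⟩ := hdense s' hs' (min η (ε - dist (γ s') (γ s)))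
          (lt_min hη (sub_pos.2 hy))
        refine ⟨y', ball_subset_ball (min_le_left _ _) hy', hy'L, ?_⟩
        rw [hc y' ?_ hy'L]
        · exact h
        · have := ball_subset_ball (min_le_right _ _) hy'
          rw [mem_ball] at this ⊢
          linarith [dist_triangle y' (γ s') (γ s)]
      · rw [hb'1 y ⟨hyV, hyL⟩, hc y hy hyL]; exact h
  have hb' : ∀ x ∈ V, ∀ᶠ y in 𝓝 x, b' y = b' x := by
    intro x hx
    by_cases hxL : x ∈ L
    · obtain ⟨s, hs, rfl⟩ := (hL x hx).1 hxL
      obtain ⟨c, hc⟩ := hb'2 s hs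
      rw [hc.self_of_nhds]
      exact hc
    · filter_upwards [hb x ⟨hx, hxL⟩, hVL.mem_nhds ⟨hx, hxL⟩] with y hy hyV
      rw [hb'1 y hyV, hb'1 x ⟨hx, hxL⟩, hy]
  intro x hx y hy
  rw [← hb'1 x hx, ← hb'1 y hy]
  exact IsPreconnected.eq_of_eventually_eq hVc
    (fun z hz => (hb' z hz).filter_mono nhdsWithin_le_nhds) hx.1 hy.1

/-! ### Cube roots of functions -/

lemma exists_cube_root {c : ℂ} {δ : ℝ} {f : ℂ → ℂ} (hf : ContinuousOn f (ball c δ))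
    (h0 : ∀ x ∈ ball c δ, f x ≠ 0) : ∃ Y : ℂ → ℂ, ContinuousOn Y (ball c δ) ∧ ∀ x, Y x ^ 3 = f x := by
  rcases le_or_gt δ 0 with hδ | hδ
  · refine ⟨fun x => f x ^ (1 / 3 : ℂ), by simp [ball_eq_empty.2 hδ], fun x => ?_⟩
    rw [← Complex.cpow_nat_mul]
    norm_num
  have hs : IsSimplyConnected (ball c δ) := by
    have := (convex_ball c δ).contractibleSpace ⟨c, mem_ball_self hδ⟩
    unfold IsSimplyConnected
    infer_instance
  refine Complex.exists_continuousOn_pow_eq hs isOpen_ball hf ?_ three_ne_zero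
  rintro ⟨x, hx, hx0⟩
  exact h0 x hx hx0

/-- In the factorisation of the difference of the cubes, the quadratic factor tends to `3 * u x ^
2`, which is not zero. -/
lemma eventually_eq_of_cube_eq {X : Type*} [TopologicalSpace X] {s : Set X} {u : X → ℂ} {x : X}
    (hu : ContinuousWithinAt u s x) (h0 : u x ≠ 0) (h : ∀ y ∈ s, u y ^ 3 = u x ^ 3) :
    ∀ᶠ y in 𝓝[s] x, u y = u x := by
  have h1 : Tendsto (fun y => u y ^ 2 + u y * u x + u x ^ 2) (𝓝[s] x)
      (𝓝 (u x ^ 2 + u x * u x + u x ^ 2)) :=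
    ((hu.tendsto.pow 2).add (hu.tendsto.mul_const _)).add_const _
  have h2 : u x ^ 2 + u x * u x + u x ^ 2 ≠ 0 := by
    have : u x ^ 2 + u x * u x + u x ^ 2 = 3 * u x ^ 2 := by ring
    rw [this]
    exact mul_ne_zero three_ne_zero (pow_ne_zero 2 h0)
  filter_upwards [h1.eventually_ne h2, self_mem_nhdsWithin] with y hy hys
  have h3 : (u y - u x) * (u y ^ 2 + u y * u x + u x ^ 2) = 0 := by
    linear_combination h y hys
  exact sub_eq_zero.1 ((mul_eq_zero.1 h3).resolve_right hy)

/-- Two continuous functions with the same cube on a connected set differ by a cube root of unity. -/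
lemma exists_const_of_cube_eq {X : Type*} [TopologicalSpace X] {s : Set X} (hs : IsPreconnected s)
    {u v : X → ℂ} (hu : ContinuousOn u s) (hv : ContinuousOn v s) (h : ∀ x ∈ s, u x ^ 3 = v x ^ 3)
    (h0 : ∀ x ∈ s, v x ≠ 0) : ∃ c : ℂ, c ^ 3 = 1 ∧ ∀ x ∈ s, u x = c * v x := by
  rcases s.eq_empty_or_nonempty with rfl | ⟨x₀, hx₀⟩
  · exact ⟨1, by norm_num, by simp⟩
  have hq : ∀ x ∈ s, (u x / v x) ^ 3 = 1 := fun x hx => by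
    rw [div_pow, h x hx, div_self (pow_ne_zero 3 (h0 x hx))]
  refine ⟨u x₀ / v x₀, hq x₀ hx₀, fun x hx => ?_⟩
  have := IsPreconnected.eq_of_eventually_eq hs (b := fun x => u x / v x) (fun x hx => by
    refine eventually_eq_of_cube_eq ((hu.div hv h0) x hx) ?_ fun y hy => ?_
    · intro h'
      have := hq x hx
      rw [h'] at this
      norm_num at this
    · rw [hq x hx, hq y hy]) hx hx₀
  rw [← this, div_mul_cancel₀ _ (h0 x hx)]

/-- The same factorisation turns the difference quotients of `R` into those of `Y`; in particular
every continuous branch is holomorphic. -/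
lemma hasDerivAt_of_cube_eq {Y R : ℂ → ℂ} {x R' : ℂ} (hY : ContinuousAt Y x) (h0 : Y x ≠ 0)
    (h : ∀ᶠ y in 𝓝 x, Y y ^ 3 = R y) (hR : HasDerivAt R R' x) :
    HasDerivAt Y (R' / (3 * Y x ^ 2)) x := by
  rw [hasDerivAt_iff_tendsto_slope] at hR ⊢
  have h1 : Tendsto (fun y => Y y ^ 2 + Y y * Y x + Y x ^ 2) (𝓝[≠] x)
      (𝓝 (3 * Y x ^ 2)) := by
    have : Tendsto (fun y => Y y ^ 2 + Y y * Y x + Y x ^ 2) (𝓝 x)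
      (𝓝 (Y x ^ 2 + Y x * Y x + Y x ^ 2)) := ((hY.tendsto.pow 2).add (hY.tendsto.mul_const _)).add_const _
    rw [show Y x ^ 2 + Y x * Y x + Y x ^ 2 = 3 * Y x ^ 2 by ring] at this
    exact this.mono_left nhdsWithin_le_nhds
  have h2 : 3 * Y x ^ 2 ≠ 0 := mul_ne_zero three_ne_zero (pow_ne_zero 2 h0)
  refine (hR.div h1 h2).congr' ?_
  filter_upwards [h1.eventually_ne h2, h.filter_mono nhdsWithin_le_nhds] with y hy hy2
  rw [Pi.div_apply, slope_def_field, slope_def_field, ← hy2, ← h.self_of_nhds, div_eq_iff hy]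
  ring

lemma eventually_const_of_hasDerivAt_zero {f : ℂ → ℂ} {x : ℂ} (h : ∀ᶠ y in 𝓝 x, HasDerivAt f 0 y) :
    ∀ᶠ y in 𝓝 x, f y = f x := by
  obtain ⟨ε, hε, hball⟩ := Metric.eventually_nhds_iff_ball.1 h
  filter_upwards [ball_mem_nhds x hε] with y hy
  obtain ⟨a, ha⟩ := isOpen_ball.exists_is_const_of_deriv_eq_zero (isPreconnected_ball (x := x) (r := ε))
    (fun z hz => (hball z hz).differentiableAt.differentiableWithinAt) (fun z hz => (hball z hz).deriv)
  rw [ha y hy, ha x (mem_ball_self hε)]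

lemma exists_const_of_hasDerivAt_eq {f f' k : ℂ → ℂ} {s : Set ℂ} (hs : IsPreconnected s)
    (hso : IsOpen s) (hf : ∀ x ∈ s, HasDerivAt f (k x) x) (hf' : ∀ x ∈ s, HasDerivAt f' (k x) x) :
    ∃ c : ℂ, ∀ x ∈ s, f x = f' x + c := by
  have hd : ∀ x ∈ s, HasDerivAt (fun x => f x - f' x) 0 x := fun x hx =>
    ((hf x hx).fun_sub (hf' x hx)).congr_deriv (sub_self _)
  obtain ⟨a, ha⟩ := hso.exists_is_const_of_deriv_eq_zero hs
    (fun z hz => (hd z hz).differentiableAt.differentiableWithinAt) (fun z hz => (hd z hz).deriv)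
  exact ⟨a, fun x hx => by rw [← ha x hx]; ring⟩

/-! ### Branches of a cubic form and of its integral -/

/-- On the complement in `D` of the cuts `K`, `g` is a continuous branch of the cube root of `R`, and
`F` is a primitive of `h g`. -/
structure IsBranchPrimitive (D K : Set ℂ) (R h g F : ℂ → ℂ) : Prop where
  isOpen : IsOpen D
  isClosed : IsClosed K
  differentiableOn : DifferentiableOn ℂ R D
  ne_zero : ∀ x ∈ D, R x ≠ 0
  differentiable : Differentiable ℂ h
  continuousOn : ContinuousOn g (D \ K)
  cube : ∀ x ∈ D \ K, g x ^ 3 = R x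
  hasDerivAt : ∀ x ∈ D \ K, HasDerivAt F (h x * g x) x

/-- `Y` is a branch of the cube root of `R` and `Φ` is a primitive of `h Y` on the disc. -/
structure IsGerm (R h : ℂ → ℂ) (P : ℂ) (δ : ℝ) (Y Φ : ℂ → ℂ) : Prop where
  continuousOn : ContinuousOn Y (ball P δ)
  cube : ∀ x ∈ ball P δ, Y x ^ 3 = R x
  hasDerivAt : ∀ x ∈ ball P δ, HasDerivAt Φ (h x * Y x) x

/-- The affine relation `Y = r g`, `Φ = r F + B` between a germ and the branch `(g, F)`. -/
noncomputable def relVal (g F Y Φ : ℂ → ℂ) (x : ℂ) : ℂ × ℂ := (Y x / g x, Φ x - Y x / g x * F x)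

/-- `S` is the set of values near `P`, outside `K`, of the relation between the germ and the
branch. -/
def ExactVals (K : Set ℂ) (g F Y Φ : ℂ → ℂ) (P : ℂ) (S : Set (ℂ × ℂ)) : Prop :=
  (∀ᶠ x in 𝓝 P, x ∉ K → relVal g F Y Φ x ∈ S) ∧
    ∀ v ∈ S, ∃ᶠ x in 𝓝 P, x ∉ K ∧ relVal g F Y Φ x = v

/-- The action on relations of a change of the germ. -/
def affineAct (ρ κ : ℂ) (v : ℂ × ℂ) : ℂ × ℂ := (ρ * v.1, ρ * v.2 + κ)

/-- The property `Q` holds for the values near `P` of the relation between a germ and the branch. -/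
def HoldsAt (D K : Set ℂ) (R h g F : ℂ → ℂ) (Q : Set (ℂ × ℂ) → Prop) (P : ℂ) : Prop :=
  ∃ δ > 0, ball P δ ⊆ D ∧ ∃ Y Φ S, IsGerm R h P δ Y Φ ∧ ExactVals K g F Y Φ P S ∧ Q S

/-- Invariance under a change of the germ. -/
def ActInvariant (Q : Set (ℂ × ℂ) → Prop) : Prop :=
  ∀ (ρ κ : ℂ) (S : Set (ℂ × ℂ)), ρ ^ 3 = 1 → Q S → Q (affineAct ρ κ '' S)

variable {D K : Set ℂ} {R h g F Y Φ Y' Φ' : ℂ → ℂ} {P P' : ℂ} {δ δ' : ℝ} {S S' : Set (ℂ × ℂ)}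

lemma IsBranchPrimitive.isOpen_diff (H : IsBranchPrimitive D K R h g F) : IsOpen (D \ K) :=
  H.isOpen.sdiff H.isClosed

lemma IsBranchPrimitive.g_ne_zero (H : IsBranchPrimitive D K R h g F) {x : ℂ} (hx : x ∈ D \ K) :
    g x ≠ 0 := fun h0 => H.ne_zero x hx.1 (by rw [← H.cube x hx, h0]; norm_num)

lemma IsGerm.mono (hG : IsGerm R h P δ Y Φ) (hsub : ball P' δ' ⊆ ball P δ) : IsGerm R h P' δ' Y Φ :=
  ⟨hG.continuousOn.mono hsub, fun x hx => hG.cube x (hsub hx), fun x hx => hG.hasDerivAt x (hsub hx)⟩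

lemma IsGerm.act (hG : IsGerm R h P δ Y Φ) {ρ κ : ℂ} (hρ : ρ ^ 3 = 1) :
    IsGerm R h P δ (fun x => ρ * Y x) (fun x => ρ * Φ x + κ) :=
  ⟨continuousOn_const.mul hG.continuousOn, fun x hx => by rw [mul_pow, hρ, one_mul, hG.cube x hx],
    fun x hx => (((hG.hasDerivAt x hx).const_mul ρ).add_const κ).congr_deriv (by ring)⟩

lemma IsBranchPrimitive.exists_germ (H : IsBranchPrimitive D K R h g F) (hsub : ball P δ ⊆ D) :
    ∃ Y Φ, IsGerm R h P δ Y Φ := by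
  obtain ⟨Y, hY, hY3⟩ := exists_cube_root (H.differentiableOn.continuousOn.mono hsub)
    (fun x hx => H.ne_zero x (hsub hx))
  have hYd : DifferentiableOn ℂ Y (ball P δ) := by
    intro x hx
    have hY0 : Y x ≠ 0 := fun h0 => H.ne_zero x (hsub hx) (by rw [← hY3, h0]; norm_num)
    exact (hasDerivAt_of_cube_eq (hY.continuousAt (isOpen_ball.mem_nhds hx)) hY0
      (Eventually.of_forall hY3)
      (H.differentiableOn.differentiableAt (H.isOpen.mem_nhds (hsub hx))).hasDerivAt
      ).differentiableAt.differentiableWithinAt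
  obtain ⟨Φ, hΦ⟩ := (H.differentiable.differentiableOn.mul hYd).isExactOn_ball
  exact ⟨Y, Φ, hY, fun x _ => hY3 x, hΦ⟩

/-- Two germs with a common disc are related by the affine action. -/
lemma IsGerm.exists_act (H : IsBranchPrimitive D K R h g F) (hsub : ball P δ ⊆ D)
    (hG : IsGerm R h P δ Y Φ) (hG' : IsGerm R h P δ Y' Φ') :
    ∃ ρ κ : ℂ, ρ ^ 3 = 1 ∧ ∀ x ∈ ball P δ, Y' x = ρ * Y x ∧ Φ' x = ρ * Φ x + κ := by
  obtain ⟨ρ, hρ, hY⟩ := exists_const_of_cube_eq (isPreconnected_ball (x := P) (r := δ))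
    hG'.continuousOn hG.continuousOn (fun x hx => by rw [hG.cube x hx, hG'.cube x hx])
    (fun x hx h0 => H.ne_zero x (hsub hx) (by rw [← hG.cube x hx, h0]; norm_num))
  have h1 : IsGerm R h P δ (fun x => ρ * Y x) (fun x => ρ * Φ x + 0) := hG.act hρ
  obtain ⟨κ, hκ⟩ := exists_const_of_hasDerivAt_eq (isPreconnected_ball (x := P) (r := δ)) isOpen_ball
    hG'.hasDerivAt (fun x hx => by rw [hY x hx]; exact h1.hasDerivAt x hx)
  exact ⟨ρ, κ, hρ, fun x hx => ⟨hY x hx, by rw [hκ x hx]; ring⟩⟩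

lemma relVal_act {ρ κ x : ℂ} (hY : Y' x = ρ * Y x) (hΦ : Φ' x = ρ * Φ x + κ) :
    relVal g F Y' Φ' x = affineAct ρ κ (relVal g F Y Φ x) := by
  simp only [relVal, affineAct, hY, hΦ]
  ext
  · simp only; ring
  · simp only; ring

/-- The relation between a germ and the branch is locally constant. -/
lemma IsBranchPrimitive.relVal_eventually_eq (H : IsBranchPrimitive D K R h g F)
    (hG : IsGerm R h P δ Y Φ) {x : ℂ} (hx : x ∈ ball P δ) (hxD : x ∈ D \ K) :
    ∀ᶠ y in 𝓝 x, relVal g F Y Φ y = relVal g F Y Φ x := by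
  have hgx := H.g_ne_zero hxD
  have hYx : Y x ≠ 0 := fun h0 => H.ne_zero x hxD.1 (by rw [← hG.cube x hx, h0]; norm_num)
  have hW : ball P δ ∩ (D \ K) ∈ 𝓝 x := inter_mem (isOpen_ball.mem_nhds hx) (H.isOpen_diff.mem_nhds hxD)
  have hr : ∀ᶠ y in 𝓝 x, Y y / g y = Y x / g x := by
    have hc : ContinuousWithinAt (fun y => Y y / g y) (ball P δ ∩ (D \ K)) x :=
      ((hG.continuousOn x hx).mono inter_subset_left).div
        ((H.continuousOn x hxD).mono inter_subset_right) hgx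
    have := eventually_eq_of_cube_eq hc (div_ne_zero hYx hgx) (fun y hy => by
      rw [div_pow, div_pow, hG.cube y hy.1, hG.cube x hx, H.cube y hy.2, H.cube x hxD,
        div_self (H.ne_zero y hy.2.1), div_self (H.ne_zero x hxD.1)])
    rwa [nhdsWithin_eq_nhds.2 hW] at this
  have hder : ∀ᶠ y in 𝓝 x, HasDerivAt (fun y => Φ y - Y x / g x * F y) 0 y := by
    filter_upwards [hr, hW] with y hy hyW
    refine ((hG.hasDerivAt y hyW.1).fun_sub
      ((H.hasDerivAt y hyW.2).const_mul (Y x / g x))).congr_deriv ?_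
    rw [← hy]
    have := H.g_ne_zero hyW.2
    field_simp
    ring
  filter_upwards [hr, eventually_const_of_hasDerivAt_zero hder] with y h1 h2
  simp only [relVal]
  rw [h1, h2]

lemma IsBranchPrimitive.relVal_fst_cube (H : IsBranchPrimitive D K R h g F)
    (hG : IsGerm R h P δ Y Φ) {x : ℂ} (hx : x ∈ ball P δ) (hxD : x ∈ D \ K) :
    (relVal g F Y Φ x).1 ^ 3 = 1 := by
  simp only [relVal]
  rw [div_pow, hG.cube x hx, H.cube x hxD, div_self (H.ne_zero x hxD.1)]

lemma IsBranchPrimitive.relVal_eq_of_isPreconnected (H : IsBranchPrimitive D K R h g F)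
    (hG : IsGerm R h P δ Y Φ) {σ : Set ℂ} (hσ : IsPreconnected σ) (hσP : σ ⊆ ball P δ)
    (hσD : σ ⊆ D \ K) {x y : ℂ} (hx : x ∈ σ) (hy : y ∈ σ) :
    relVal g F Y Φ x = relVal g F Y Φ y :=
  IsPreconnected.eq_of_eventually_eq hσ (fun _ hz =>
    (H.relVal_eventually_eq hG (hσP hz) (hσD hz)).filter_mono nhdsWithin_le_nhds) hx hy

lemma ExactVals.act (hS : ExactVals K g F Y Φ P S) {ρ κ : ℂ}
    (h : ∀ᶠ x in 𝓝 P, Y' x = ρ * Y x ∧ Φ' x = ρ * Φ x + κ) :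
    ExactVals K g F Y' Φ' P (affineAct ρ κ '' S) := by
  constructor
  · filter_upwards [hS.1, h] with x hx hx2 hxK
    exact ⟨_, hx hxK, (relVal_act hx2.1 hx2.2).symm⟩
  · rintro _ ⟨v, hv, rfl⟩
    refine ((hS.2 v hv).and_eventually h).mono ?_
    rintro x ⟨⟨hxK, hxv⟩, hx2⟩
    exact ⟨hxK, by rw [relVal_act hx2.1 hx2.2, hxv]⟩

lemma ExactVals.unique (hS : ExactVals K g F Y Φ P S) (hS' : ExactVals K g F Y Φ P S') : S = S' := by
  have key : ∀ {S S'}, ExactVals K g F Y Φ P S → ExactVals K g F Y Φ P S' → S ⊆ S' := by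
    intro S S' hS hS' v hv
    obtain ⟨x, ⟨hxK, hxv⟩, hx⟩ := ((hS.2 v hv).and_eventually hS'.1).exists
    exact hxv ▸ hx hxK
  exact (key hS hS').antisymm (key hS' hS)

/-- `HoldsAt` asks for some germ. Any two germs differ by the affine action, so an invariant
property can be tested on whichever germ is at hand. -/
lemma IsGerm.holdsAt_iff (H : IsBranchPrimitive D K R h g F) (hG : IsGerm R h P δ Y Φ)
    (hsub : ball P δ ⊆ D) (hP' : P' ∈ ball P δ) (hS : ExactVals K g F Y Φ P' S)
    {Q : Set (ℂ × ℂ) → Prop} (hQ : ActInvariant Q) : HoldsAt D K R h g F Q P' ↔ Q S := by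
  have hsub' : ball P' (δ - dist P' P) ⊆ ball P δ := ball_subset_ball' (by linarith)
  have hpos : 0 < δ - dist P' P := sub_pos.2 hP'
  constructor
  · rintro ⟨δ', hδ', hsubD, Y', Φ', S', hG', hS', hQS'⟩
    set η := min δ' (δ - dist P' P) with hη
    have hη0 : 0 < η := lt_min hδ' hpos
    have h1 : IsGerm R h P' η Y Φ := hG.mono ((ball_subset_ball (min_le_right _ _)).trans hsub')
    have h2 : IsGerm R h P' η Y' Φ' := hG'.mono (ball_subset_ball (min_le_left _ _))
    obtain ⟨ρ, κ, hρ, hact⟩ := IsGerm.exists_act H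
      ((ball_subset_ball (min_le_left _ _)).trans hsubD) h2 h1
    have h3 := hS'.act (κ := κ) ((eventually_mem_nhds_iff.2 (ball_mem_nhds P' hη0)).mono
      fun x hx => hact x (mem_of_mem_nhds hx))
    rw [hS.unique h3]
    exact hQ ρ κ S' hρ hQS'
  · intro hQS
    exact ⟨δ - dist P' P, hpos, hsub'.trans hsub, Y, Φ, S, hG.mono hsub', hS, hQS⟩

/-- Near a two-sided point the relation between a germ and the branch takes two values, one on each
side, and these are the same at all points of the cut. -/
lemma IsBranchPrimitive.exists_two_vals (H : IsBranchPrimitive D K R h g F) (htwo : TwoSided K P)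
    (hPK : P ∈ K) {ε : ℝ} (hε : 0 < ε) (hsub : ball P ε ⊆ D) (hG : IsGerm R h P ε Y Φ) :
    ∃ δ > 0, δ < ε ∧ ∃ c₁ c₂ : ℂ × ℂ, (∀ x ∈ ball P δ \ K, relVal g F Y Φ x ∈ ({c₁, c₂} : Set (ℂ × ℂ))) ∧
      ∀ P' ∈ ball P δ, P' ∈ K → ExactVals K g F Y Φ P' {c₁, c₂} := by
  obtain ⟨δ, hδ, hδε, σ₁, σ₂, hσ₁, hσ₂, heq, hcl⟩ := htwo ε hε
  have hbε := ball_subset_ball (x := P) hδε.le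
  obtain ⟨hP1, hP2⟩ := hcl _ (mem_ball_self hδ) hPK
  obtain ⟨x₁, hx₁⟩ : σ₁.Nonempty := closure_nonempty_iff.1 ⟨_, hP1⟩
  obtain ⟨x₂, hx₂⟩ : σ₂.Nonempty := closure_nonempty_iff.1 ⟨_, hP2⟩
  have hs1 : σ₁ ⊆ ball P δ \ K := subset_union_left.trans heq.symm.subset
  have hs2 : σ₂ ⊆ ball P δ \ K := subset_union_right.trans heq.symm.subset
  have hc : ∀ σ : Set ℂ, IsPreconnected σ → σ ⊆ ball P δ \ K → ∀ x ∈ σ, ∀ y ∈ σ,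
      relVal g F Y Φ x = relVal g F Y Φ y := fun σ hσ hs x hx y hy =>
    H.relVal_eq_of_isPreconnected hG hσ (fun z hz => hbε (hs hz).1)
      (fun z hz => ⟨hsub (hbε (hs hz).1), (hs hz).2⟩) hx hy
  have hval : ∀ x ∈ ball P δ \ K, relVal g F Y Φ x ∈
      ({relVal g F Y Φ x₁, relVal g F Y Φ x₂} : Set (ℂ × ℂ)) := by
    intro x hx
    rw [heq] at hx
    rcases hx with hx | hx
    · exact Or.inl (hc σ₁ hσ₁ hs1 x hx x₁ hx₁)
    · exact Or.inr (hc σ₂ hσ₂ hs2 x hx x₂ hx₂)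
  refine ⟨δ, hδ, hδε, relVal g F Y Φ x₁, relVal g F Y Φ x₂, hval, fun P' hP' hP'K => ⟨?_, ?_⟩⟩
  · filter_upwards [isOpen_ball.mem_nhds hP'] with x hx hxK using hval x ⟨hx, hxK⟩
  · have hfreq : ∀ σ : Set ℂ, IsPreconnected σ → σ ⊆ ball P δ \ K → P' ∈ closure σ → ∀ x₁ ∈ σ,
        ∃ᶠ x in 𝓝 P', x ∉ K ∧ relVal g F Y Φ x = relVal g F Y Φ x₁ := by
      intro σ hσ hs hP' x₁ hx₁
      exact (mem_closure_iff_frequently.1 hP').mono fun x hx => ⟨(hs hx).2, hc σ hσ hs x hx x₁ hx₁⟩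
    rintro v (rfl | rfl)
    · exact hfreq σ₁ hσ₁ hs1 (hcl _ hP' hP'K).1 x₁ hx₁
    · exact hfreq σ₂ hσ₂ hs2 (hcl _ hP' hP'K).2 x₂ hx₂

/-- An invariant property of the relation between germs and branch is constant along an arc of
two-sided points. -/
lemma IsBranchPrimitive.holdsAt_iff_of_arc (H : IsBranchPrimitive D K R h g F)
    {Q : Set (ℂ × ℂ) → Prop} (hQ : ActInvariant Q) {γ : ℝ → ℂ} {a b : ℝ}
    (hγ : ContinuousOn γ (Ioo a b)) (hK : ∀ s ∈ Ioo a b, γ s ∈ K) (hD : ∀ s ∈ Ioo a b, γ s ∈ D)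
    (htwo : ∀ s ∈ Ioo a b, TwoSided K (γ s)) {s s' : ℝ} (hs : s ∈ Ioo a b) (hs' : s' ∈ Ioo a b) :
    HoldsAt D K R h g F Q (γ s) ↔ HoldsAt D K R h g F Q (γ s') := by
  rw [← eq_iff_iff]
  refine IsPreconnected.eq_of_eventually_eq isPreconnected_Ioo
    (b := fun s => HoldsAt D K R h g F Q (γ s)) ?_ hs hs'
  intro s hs
  obtain ⟨ε, hε, hball⟩ := Metric.isOpen_iff.1 H.isOpen _ (hD s hs)
  obtain ⟨Y, Φ, hG⟩ := H.exists_germ hball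
  obtain ⟨δ, hδ, hδε, c₁, c₂, -, hex⟩ := H.exists_two_vals (htwo s hs) (hK s hs) hε hball hG
  filter_upwards [hγ s hs (ball_mem_nhds _ hδ), self_mem_nhdsWithin] with s' hs' hs'm
  have hb := ball_subset_ball (x := γ s) hδε.le
  rw [eq_iff_iff, hG.holdsAt_iff H hball (hb hs') (hex _ hs' (hK s' hs'm)) hQ,
    hG.holdsAt_iff H hball (mem_ball_self hε) (hex _ (mem_ball_self hδ) (hK s hs)) hQ]

/-! ### Periods as differences of jumps -/

section Periods

variable {D K : Set ℂ} {R h g F Y Φ Y' Φ' : ℂ → ℂ} {P P' : ℂ} {δ δ' : ℝ} {S S' : Set (ℂ × ℂ)}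

lemma HoldsAt.exists_exactVals (H : IsBranchPrimitive D K R h g F) {Q : Set (ℂ × ℂ) → Prop}
    (hQ : ActInvariant Q) (hP : HoldsAt D K R h g F Q P') (hG : IsGerm R h P δ Y Φ)
    (hP' : P' ∈ ball P δ) : ∃ S, ExactVals K g F Y Φ P' S ∧ Q S := by
  obtain ⟨δ', hδ', hsubD, Y', Φ', S', hG', hS', hQS'⟩ := hP
  have hsub' : ball P' (δ - dist P' P) ⊆ ball P δ := ball_subset_ball' (by linarith)
  have hpos : 0 < δ - dist P' P := sub_pos.2 hP'
  set η := min δ' (δ - dist P' P) with hη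
  have hη0 : 0 < η := lt_min hδ' hpos
  have h1 : IsGerm R h P' η Y Φ := hG.mono ((ball_subset_ball (min_le_right _ _)).trans hsub')
  have h2 : IsGerm R h P' η Y' Φ' := hG'.mono (ball_subset_ball (min_le_left _ _))
  obtain ⟨ρ, κ, hρ, hact⟩ := IsGerm.exists_act H
    ((ball_subset_ball (min_le_left _ _)).trans hsubD) h2 h1
  exact ⟨_, hS'.act (κ := κ) ((eventually_mem_nhds_iff.2 (ball_mem_nhds P' hη0)).mono
    fun x hx => hact x (mem_of_mem_nhds hx)), hQ ρ κ S' hρ hQS'⟩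

lemma HoldsAt.and (H : IsBranchPrimitive D K R h g F) {Q Q' : Set (ℂ × ℂ) → Prop}
    (hQ' : ActInvariant Q') (h1 : HoldsAt D K R h g F Q P) (h2 : HoldsAt D K R h g F Q' P) :
    ∃ S, Q S ∧ Q' S := by
  obtain ⟨δ, hδ, -, Y, Φ, S, hG, hS, hQS⟩ := h1
  obtain ⟨S', hS', hQS'⟩ := h2.exists_exactVals H hQ' hG (mem_ball_self hδ)
  exact ⟨S, hQS, hS.unique hS' ▸ hQS'⟩

/-- The germs that pass from `u₁ y` to `u₂ y` jump by `J`. -/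
def QCross (u₁ u₂ J : ℂ) (S : Set (ℂ × ℂ)) : Prop :=
  ∃ ρ B₁ B₂ : ℂ, ρ ^ 3 = 1 ∧ S = {(ρ * u₁, B₁), (ρ * u₂, B₂)} ∧ B₂ - B₁ = ρ * J

lemma actInvariant_qCross (u₁ u₂ J : ℂ) : ActInvariant (QCross u₁ u₂ J) := by
  rintro ρ' κ S hρ' ⟨ρ, B₁, B₂, hρ, rfl, hJ⟩
  refine ⟨ρ' * ρ, ρ' * B₁ + κ, ρ' * B₂ + κ, by rw [mul_pow, hρ, hρ', one_mul], ?_, ?_⟩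
  · rw [image_pair]
    simp only [affineAct, mul_assoc]
  · linear_combination ρ' * hJ

lemma ne_zero_of_cube_eq_one {u : ℂ} (hu : u ^ 3 = 1) : u ≠ 0 := by
  rintro rfl
  norm_num at hu

lemma sq_ne_sq_of_cube_eq_one {u₁ u₂ : ℂ} (h₁ : u₁ ^ 3 = 1) (h₂ : u₂ ^ 3 = 1) (h : u₁ ≠ u₂) :
    u₁ ^ 2 ≠ u₂ ^ 2 := by
  intro h'
  apply h
  calc u₁ = u₁ ^ 2 * u₁ ^ 2 := by linear_combination (-u₁) * h₁
    _ = u₂ := by rw [h']; linear_combination u₂ * h₂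

/-- The set of values does not say which value belongs to which side. An exchange would force `u₁ ^
2 = u₂ ^ 2`, which is impossible for distinct cube roots of unity, so the jump is well defined. -/
lemma QCross.unique {u₁ u₂ J J' : ℂ} (h₁ : u₁ ^ 3 = 1) (h₂ : u₂ ^ 3 = 1) (h : u₁ ≠ u₂)
    (hS : QCross u₁ u₂ J S) (hS' : QCross u₁ u₂ J' S) : J = J' := by
  obtain ⟨ρ, B₁, B₂, hρ, rfl, hJ⟩ := hS
  obtain ⟨ρ', B₁', B₂', hρ', heq, hJ'⟩ := hS'
  have hρ0 := ne_zero_of_cube_eq_one hρ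
  have hρ0' := ne_zero_of_cube_eq_one hρ'
  rw [pair_eq_pair_iff] at heq
  rcases heq with ⟨e1, e2⟩ | ⟨e1, e2⟩ <;> rw [Prod.mk.injEq] at e1 e2
  · have hρe : ρ = ρ' := mul_right_cancel₀ (ne_zero_of_cube_eq_one h₁) e1.1
    rw [← e1.2, ← e2.2, hJ, ← hρe] at hJ'
    exact mul_left_cancel₀ hρ0 hJ'
  · exfalso
    refine sq_ne_sq_of_cube_eq_one h₁ h₂ h (mul_left_cancel₀ (mul_ne_zero hρ0 hρ0') ?_)
    linear_combination (ρ' * u₁) * e1.1 - (ρ' * u₂) * e2.1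

/-- A path that meets the cut in one point, where it passes from the branch `u₁ g` to the branch
`u₂ g`. -/
lemma IsBranchPrimitive.crossing (H : IsBranchPrimitive D K R h g F) {x w : ℝ → ℂ} {s₀ : ℝ}
    {u₁ u₂ : ℂ} (hu : u₁ ≠ u₂)
    (hx : ∀ᶠ s in 𝓝 s₀, ContinuousAt x s) (hw : ∀ᶠ s in 𝓝 s₀, ContinuousAt w s)
    (hwx : ∀ᶠ s in 𝓝 s₀, w s ^ 3 = R (x s)) (hD : x s₀ ∈ D) (hK : x s₀ ∈ K)
    (htwo : TwoSided K (x s₀)) (h1 : ∀ᶠ s in 𝓝[<] s₀, x s ∉ K ∧ w s = u₁ * g (x s))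
    (h2 : ∀ᶠ s in 𝓝[>] s₀, x s ∉ K ∧ w s = u₂ * g (x s)) :
    ∃ c B₁ B₂ : ℂ, HoldsAt D K R h g F (QCross u₁ u₂ (B₂ - B₁)) (x s₀) ∧
      Tendsto (fun s => u₁ * F (x s)) (𝓝[<] s₀) (𝓝 (c - B₁)) ∧
      Tendsto (fun s => u₂ * F (x s)) (𝓝[>] s₀) (𝓝 (c - B₂)) := by
  obtain ⟨ε, hε, hball⟩ := Metric.isOpen_iff.1 H.isOpen _ hD
  obtain ⟨Y₀, Φ₀, hG₀⟩ := H.exists_germ hball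
  have hc : ContinuousAt x s₀ := hx.self_of_nhds
  obtain ⟨η, hη, hηs⟩ := Metric.eventually_nhds_iff_ball.1
    (hx.and (hw.and (hwx.and (hc (ball_mem_nhds _ hε)))))
  -- The germ is rotated so that it continues the function `w` along the path through the crossing.
  -- Then its relation to `g` is `u₁` before and `u₂` after, and `u * F = Φ - B` holds with a
  -- continuous `Φ`.
  obtain ⟨ρ, hρ, hρw⟩ := exists_const_of_cube_eq (isPreconnected_ball (x := s₀) (r := η))
    (u := w) (v := fun s => Y₀ (x s))
    (fun s hs => (hηs s hs).2.1.continuousWithinAt)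
    (fun s hs => ((hG₀.continuousOn.continuousAt (isOpen_ball.mem_nhds (hηs s hs).2.2.2)).comp
      (hηs s hs).1).continuousWithinAt)
    (fun s hs => by rw [(hηs s hs).2.2.1, hG₀.cube _ (hηs s hs).2.2.2])
    (fun s hs h0 => H.ne_zero _ (hball (hηs s hs).2.2.2) (by
      rw [← hG₀.cube _ (hηs s hs).2.2.2, h0]; norm_num))
  have hG : IsGerm R h (x s₀) ε (fun z => ρ * Y₀ z) (fun z => ρ * Φ₀ z + 0) := hG₀.act hρ
  set Y := fun z => ρ * Y₀ z
  set Φ := fun z => ρ * Φ₀ z + 0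
  obtain ⟨δ, hδ, hδε, c₁, c₂, hval, hex⟩ := H.exists_two_vals htwo hK hε hball hG
  have hnear : ∀ᶠ s in 𝓝 s₀, x s ∈ ball (x s₀) δ ∧ w s = Y (x s) :=
    (hc.eventually (ball_mem_nhds _ hδ)).and (eventually_of_mem (ball_mem_nhds s₀ hη) hρw)
  have hrel : ∀ (l : Filter ℝ) (u : ℂ), l ≤ 𝓝 s₀ → (∀ᶠ s in l, x s ∉ K ∧ w s = u * g (x s)) →
      ∀ᶠ s in l, relVal g F Y Φ (x s) = (u, Φ (x s) - u * F (x s)) ∧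
        relVal g F Y Φ (x s) ∈ ({c₁, c₂} : Set (ℂ × ℂ)) := by
    intro l u hl hlu
    filter_upwards [hl hnear, hlu] with s hs hs2
    have hgs := H.g_ne_zero ⟨hball (ball_subset_ball hδε.le hs.1), hs2.1⟩
    refine ⟨?_, hval _ ⟨hs.1, hs2.1⟩⟩
    have : Y (x s) / g (x s) = u := by rw [← hs.2, hs2.2, mul_div_cancel_right₀ _ hgs]
    simp only [relVal, this]
  have r1 := hrel _ u₁ nhdsWithin_le_nhds h1
  have r2 := hrel _ u₂ nhdsWithin_le_nhds h2
  have hΦ : Tendsto (fun s => Φ (x s)) (𝓝 s₀) (𝓝 (Φ (x s₀))) :=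
    ((hG.hasDerivAt _ (mem_ball_self hε)).continuousAt.comp hc).tendsto
  -- The two values near the cut come without order; since `u₁ ≠ u₂`, the first components identify
  -- the one seen before and the one seen after the crossing.
  have key : ∀ a b : ℂ × ℂ, ({a, b} : Set (ℂ × ℂ)) = {c₁, c₂} → a.1 = u₁ → b.1 = u₂ →
      ∃ c B₁ B₂ : ℂ, HoldsAt D K R h g F (QCross u₁ u₂ (B₂ - B₁)) (x s₀) ∧
      Tendsto (fun s => u₁ * F (x s)) (𝓝[<] s₀) (𝓝 (c - B₁)) ∧
      Tendsto (fun s => u₂ * F (x s)) (𝓝[>] s₀) (𝓝 (c - B₂)) := by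
    intro a b hab ha hb
    refine ⟨Φ (x s₀), a.2, b.2, ⟨ε, hε, hball, Y, Φ, _, hG, hex _ (mem_ball_self hδ) hK, 1, a.2, b.2,
      one_pow 3, ?_, (one_mul _).symm⟩, ?_, ?_⟩
    · rw [← hab, one_mul, one_mul, ← ha, ← hb]
    · refine ((hΦ.mono_left nhdsWithin_le_nhds).sub_const a.2).congr' ?_
      filter_upwards [r1] with s hs
      rw [hs.1, ← hab] at hs
      rcases hs.2 with e | e
      · rw [← e]; ring
      · exact absurd ((congrArg Prod.fst (mem_singleton_iff.1 e)).trans hb) hu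
    · refine ((hΦ.mono_left nhdsWithin_le_nhds).sub_const b.2).congr' ?_
      filter_upwards [r2] with s hs
      rw [hs.1, ← hab] at hs
      rcases hs.2 with e | e
      · exact absurd ((congrArg Prod.fst e).trans ha).symm hu
      · rw [← mem_singleton_iff.1 e]; ring
  obtain ⟨s, hs, hs'⟩ := r1.exists
  obtain ⟨s', hs2, hs2'⟩ := r2.exists
  rw [hs] at hs'
  rw [hs2] at hs2'
  rcases hs' with e | e <;> rcases hs2' with e' | e'
  · exact absurd (congrArg Prod.fst (e.trans e'.symm)) hu
  · exact key c₁ c₂ rfl (congrArg Prod.fst e).symm (congrArg Prod.fst (mem_singleton_iff.1 e')).symm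
  · exact key c₂ c₁ (pair_comm _ _) (congrArg Prod.fst (mem_singleton_iff.1 e)).symm
      (congrArg Prod.fst e').symm
  · exact absurd (congrArg Prod.fst (e.trans (mem_singleton_iff.1 e').symm)) hu

/-- The integral of `h y dx` along a closed path that crosses the cut twice, passing from the branch
`u₁ g` to `u₂ g` and back, is the difference of the two jumps. -/
theorem IsBranchPrimitive.integral_eq_sub_jumps (H : IsBranchPrimitive D K R h g F) {x w : ℝ → ℂ}
    {s₁ s₂ : ℝ} {u₁ u₂ : ℂ} (hu : u₁ ≠ u₂)
    (hx : ContDiffOn ℝ 1 x (Icc 0 1)) (hw : ContinuousOn w (Icc 0 1))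
    (hwx : ∀ s ∈ Icc (0 : ℝ) 1, w s ^ 3 = R (x s)) (hD : ∀ s ∈ Icc (0 : ℝ) 1, x s ∈ D)
    (hclosed : x 0 = x 1) (h0 : 0 < s₁) (h12 : s₁ < s₂) (h1 : s₂ < 1)
    (hK₁ : x s₁ ∈ K) (hK₂ : x s₂ ∈ K) (htwo₁ : TwoSided K (x s₁)) (htwo₂ : TwoSided K (x s₂))
    (hA : ∀ s, 0 ≤ s → s < s₁ → x s ∉ K ∧ w s = u₁ * g (x s))
    (hB : ∀ s, s₁ < s → s < s₂ → x s ∉ K ∧ w s = u₂ * g (x s))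
    (hC : ∀ s, s₂ < s → s ≤ 1 → x s ∉ K ∧ w s = u₁ * g (x s)) :
    ∃ J₁ J₂ : ℂ, HoldsAt D K R h g F (QCross u₁ u₂ J₂) (x s₁) ∧
      HoldsAt D K R h g F (QCross u₁ u₂ J₁) (x s₂) ∧
      ∫ s in (0 : ℝ)..1, h (x s) * w s * deriv x s = J₂ - J₁ := by
  have hnhds : ∀ s ∈ Ioo (0 : ℝ) 1, Icc (0 : ℝ) 1 ∈ 𝓝 s := fun s hs => Icc_mem_nhds hs.1 hs.2
  have hint : ∀ s ∈ Ioo (0 : ℝ) 1, ∀ᶠ s' in 𝓝 s, s' ∈ Ioo (0 : ℝ) 1 :=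
    fun s hs => Ioo_mem_nhds hs.1 hs.2
  have hxd : ∀ s ∈ Ioo (0 : ℝ) 1, DifferentiableAt ℝ x s := fun s hs =>
    ((hx.differentiableOn one_ne_zero) s ⟨hs.1.le, hs.2.le⟩).differentiableAt (hnhds s hs)
  have hxc : ∀ s ∈ Ioo (0 : ℝ) 1, ContinuousAt x s := fun s hs => (hxd s hs).continuousAt
  have hwc : ∀ s ∈ Ioo (0 : ℝ) 1, ContinuousAt w s := fun s hs => hw.continuousAt (hnhds s hs)
  have m₁ : s₁ ∈ Ioo (0 : ℝ) 1 := ⟨h0, h12.trans h1⟩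
  have m₂ : s₂ ∈ Ioo (0 : ℝ) 1 := ⟨h0.trans h12, h1⟩
  obtain ⟨c, B₁, B₂, hc, hc1, hc2⟩ := H.crossing (x := x) (w := w) (s₀ := s₁) hu
    ((hint _ m₁).mono hxc) ((hint _ m₁).mono hwc)
    ((hint _ m₁).mono fun s hs => hwx s ⟨hs.1.le, hs.2.le⟩) (hD _ ⟨m₁.1.le, m₁.2.le⟩) hK₁ htwo₁
    (by filter_upwards [Ioo_mem_nhdsLT h0] with s hs using hA s hs.1.le hs.2)
    (by filter_upwards [Ioo_mem_nhdsGT h12] with s hs using hB s hs.1 hs.2)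
  obtain ⟨d, C₂, C₁, hd, hd1, hd2⟩ := H.crossing (x := x) (w := w) (s₀ := s₂) hu.symm
    ((hint _ m₂).mono hxc) ((hint _ m₂).mono hwc)
    ((hint _ m₂).mono fun s hs => hwx s ⟨hs.1.le, hs.2.le⟩) (hD _ ⟨m₂.1.le, m₂.2.le⟩) hK₂ htwo₂
    (by filter_upwards [Ioo_mem_nhdsLT h12] with s hs using hB s hs.1 hs.2)
    (by filter_upwards [Ioo_mem_nhdsGT h1] with s hs using hC s hs.1 hs.2.le)
  -- The second crossing leads from `u₂` back to `u₁`. Exchanging the two values changes the sign,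
  -- which produces the difference of jumps.
  have hd' : HoldsAt D K R h g F (QCross u₁ u₂ (C₂ - C₁)) (x s₂) := by
    obtain ⟨δ, hδ, hδD, Y, Φ, S, hG, hS, ρ, E₁, E₂, hρ, hSe, hE⟩ := hd
    exact ⟨δ, hδ, hδD, Y, Φ, S, hG, hS, ρ, E₂, E₁, hρ, by rw [hSe, pair_comm], by
      linear_combination -hE⟩
  refine ⟨C₂ - C₁, B₂ - B₁, hc, hd', ?_⟩
  have hFx : ∀ s ∈ Icc (0 : ℝ) 1, x s ∉ K → ∀ u, ContinuousWithinAt (fun s => u * F (x s)) (Icc 0 1) s :=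
    fun s hs hsK u => ((H.hasDerivAt _ ⟨hD s hs, hsK⟩).continuousAt.comp_continuousWithinAt
      (hx.continuousOn s hs)).const_mul u
  have hder : ∀ s ∈ Ioo (0 : ℝ) 1, ∀ u, x s ∉ K ∧ w s = u * g (x s) →
      HasDerivAt (fun s => u * F (x s)) (h (x s) * w s * deriv x s) s := by
    rintro s hs u ⟨hsK, hsw⟩
    have := ((H.hasDerivAt _ ⟨hD s ⟨hs.1.le, hs.2.le⟩, hsK⟩).comp_of_eq s (hxd s hs).hasDerivAt rfl).const_mul u
    exact this.congr_deriv (by rw [hsw]; ring)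
  have hii : IntervalIntegrable (fun s => h (x s) * w s * deriv x s) MeasureTheory.volume 0 1 := by
    have h2 : ContinuousOn (fun s => h (x s) * w s * derivWithin x (Icc 0 1) s) (Icc 0 1) :=
      ((H.differentiable.continuous.comp_continuousOn hx.continuousOn).mul hw).mul
        (hx.continuousOn_derivWithin (uniqueDiffOn_Icc zero_lt_one) le_rfl)
    rw [← uIcc_of_le zero_le_one] at h2
    refine h2.intervalIntegrable.congr_ae ?_
    rw [uIoc_of_le zero_le_one, ← MeasureTheory.restrict_Ioo_eq_restrict_Ioc]
    filter_upwards [MeasureTheory.ae_restrict_mem measurableSet_Ioo] with s hs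
    rw [uIcc_of_le zero_le_one, derivWithin_of_mem_nhds (hnhds s hs)]
  have hsub : ∀ a b : ℝ, 0 ≤ a → a ≤ b → b ≤ 1 →
      IntervalIntegrable (fun s => h (x s) * w s * deriv x s) MeasureTheory.volume a b :=
    fun a b ha hab hb => hii.mono_set (by
      rw [uIcc_of_le hab, uIcc_of_le zero_le_one]; exact Icc_subset_Icc ha hb)
  -- On each of the three pieces a multiple of `F` along the path is a primitive with one-sided
  -- limits. In the sum the germ values at the crossings and the values at the common end point
  -- cancel; only the constants remain.
  have i1 := intervalIntegral.integral_eq_sub_of_hasDerivAt_of_tendsto h0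
    (f := fun s => u₁ * F (x s)) (fa := u₁ * F (x 0))
    (fun s hs => hder s ⟨hs.1, hs.2.trans m₁.2⟩ u₁ (hA s hs.1.le hs.2))
    (hsub _ _ le_rfl h0.le m₁.2.le)
    ((hFx 0 ⟨le_rfl, zero_le_one⟩ (hA 0 le_rfl h0).1 u₁).mono_of_mem_nhdsWithin
      (mem_of_superset (Ioo_mem_nhdsGT zero_lt_one) Ioo_subset_Icc_self)).tendsto hc1
  have i2 := intervalIntegral.integral_eq_sub_of_hasDerivAt_of_tendsto h12
    (fun s hs => hder s ⟨m₁.1.trans hs.1, hs.2.trans h1⟩ u₂ (hB s hs.1 hs.2))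
    (hsub _ _ h0.le h12.le h1.le) hc2 hd1
  have i3 := intervalIntegral.integral_eq_sub_of_hasDerivAt_of_tendsto h1
    (f := fun s => u₁ * F (x s)) (fb := u₁ * F (x 1))
    (fun s hs => hder s ⟨m₂.1.trans hs.1, hs.2⟩ u₁ (hC s hs.1 hs.2.le))
    (hsub _ _ m₂.1.le h1.le le_rfl) hd2
    ((hFx 1 ⟨zero_le_one, le_rfl⟩ (hC 1 h1 le_rfl).1 u₁).mono_of_mem_nhdsWithin
      (mem_of_superset (Ioo_mem_nhdsLT zero_lt_one) Ioo_subset_Icc_self)).tendsto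
  rw [← intervalIntegral.integral_add_adjacent_intervals (hsub 0 s₁ le_rfl h0.le m₁.2.le)
    (hsub s₁ 1 h0.le m₁.2.le le_rfl), ← intervalIntegral.integral_add_adjacent_intervals
    (hsub s₁ s₂ h0.le h12.le h1.le) (hsub s₂ 1 m₂.1.le h1.le le_rfl), i1, i2, i3, hclosed]
  ring

end Periods

/-! ### The integral from a branch point -/

section Terminal

/-- For every branch `y` of the cube root of `R` near the branch point `l`, the function
`x ↦ W x (y x)` is the primitive of `h y` that vanishes at `l`. -/
structure IsEndIntegral (R h : ℂ → ℂ) (l : ℂ) (ε : ℝ) (W : ℂ → ℂ → ℂ) : Prop where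
  rotate : ∀ x ∈ ball l ε, x ≠ l → ∀ y ρ, y ^ 3 = R x → ρ ^ 3 = 1 → W x (ρ * y) = ρ * W x y
  small : ∀ η > 0, ∀ᶠ x in 𝓝[≠] l, ∀ y, y ^ 3 = R x → ‖W x y‖ < η
  exists_eq : ∀ s : Set ℂ, IsOpen s → IsPreconnected s → s ⊆ ball l ε → l ∉ s → ∀ g F : ℂ → ℂ,
    ContinuousOn g s → (∀ x ∈ s, g x ^ 3 = R x) → (∀ x ∈ s, HasDerivAt F (h x * g x) x) →
    ∃ F₀, ∀ x ∈ s, F x = F₀ + W x (g x)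

/-- In the local parameter `u` with `u ^ 3 = x - l` and `y * u ^ a = n x`, where `n` is a regular
cube root of `r`, the form `h y dx` becomes `3 u ^ (2 - a) h n du`, which is regular as `a ≤ 2`. Its
primitive `Ψ` that vanishes at `0` is multiplied by `η ^ (3 - a)` when `u` is multiplied by a cube
root of unity `η`. -/
lemma exists_endIntegral {R r h : ℂ → ℂ} {l : ℂ} {ε : ℝ} {a : ℕ} (ha : a = 1 ∨ a = 2) (hε : 0 < ε)
    (hr : DifferentiableOn ℂ r (ball l ε)) (hr0 : ∀ x ∈ ball l ε, r x ≠ 0)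
    (hR : ∀ x ∈ ball l ε, x ≠ l → R x * (x - l) ^ a = r x) (hh : Differentiable ℂ h) :
    ∃ W, IsEndIntegral R h l ε W := by
  obtain ⟨n, hnc, hn3⟩ := exists_cube_root hr.continuousOn hr0
  have hn0 : ∀ x ∈ ball l ε, n x ≠ 0 := fun x hx h0 => hr0 x hx (by rw [← hn3, h0]; norm_num)
  have hnd : DifferentiableOn ℂ n (ball l ε) := fun x hx =>
    (hasDerivAt_of_cube_eq (hnc.continuousAt (isOpen_ball.mem_nhds hx)) (hn0 x hx)
      (Eventually.of_forall hn3) (hr.differentiableAt (isOpen_ball.mem_nhds hx)).hasDerivAt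
      ).differentiableAt.differentiableWithinAt
  set ε' : ℝ := ε ^ (1 / 3 : ℝ) with hε'
  have hε'0 : 0 < ε' := Real.rpow_pos_of_pos hε _
  have hε'3 : ε' ^ 3 = ε := by
    rw [hε', ← Real.rpow_natCast, ← Real.rpow_mul hε.le]; norm_num
  have hball : ∀ u : ℂ, u ∈ ball (0 : ℂ) ε' ↔ l + u ^ 3 ∈ ball l ε := fun u => by
    rw [mem_ball_zero_iff, mem_ball, dist_eq_norm, add_sub_cancel_left, norm_pow, ← hε'3]
    exact (pow_lt_pow_iff_left₀ (norm_nonneg _) hε'0.le three_ne_zero).symm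
  have hin : DifferentiableOn ℂ (fun u : ℂ => 3 * u ^ (2 - a) * (h (l + u ^ 3) * n (l + u ^ 3)))
      (ball 0 ε') := by
    have e1 : Differentiable ℂ fun u : ℂ => l + u ^ 3 := by fun_prop
    have e2 : Differentiable ℂ fun u : ℂ => 3 * u ^ (2 - a) := by fun_prop
    exact e2.differentiableOn.mul ((hh.comp e1).differentiableOn.mul
      (hnd.comp e1.differentiableOn fun u hu => (hball u).1 hu))
  obtain ⟨Ψ, hΨ0, hΨ⟩ := hin.isExactOn_ball.with_val_at 0 0
  have hrot : ∀ η : ℂ, η ^ 3 = 1 → ∀ u ∈ ball (0 : ℂ) ε', Ψ (η * u) = η ^ (3 - a) * Ψ u := by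
    intro η hη u hu
    have hηn : ‖η‖ = 1 := by
      have := congrArg norm hη
      rw [norm_pow, norm_one] at this
      exact (pow_eq_one_iff_of_nonneg (norm_nonneg _) three_ne_zero).1 this
    have hm : ∀ v ∈ ball (0 : ℂ) ε', η * v ∈ ball (0 : ℂ) ε' := fun v hv => by
      rw [mem_ball_zero_iff] at hv ⊢
      rwa [norm_mul, hηn, one_mul]
    obtain ⟨c, hc⟩ := exists_const_of_hasDerivAt_eq (isPreconnected_ball (x := (0 : ℂ)) (r := ε'))
      isOpen_ball (f := fun v => Ψ (η * v)) (f' := fun v => η ^ (3 - a) * Ψ v)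
      (fun v hv => (hΨ _ (hm v hv)).comp v ((hasDerivAt_id v).const_mul η))
      (fun v hv => ((hΨ v hv).const_mul (η ^ (3 - a))).congr_deriv (by
        simp only [mul_pow, hη, one_mul, mul_one]
        rcases ha with rfl | rfl <;> ring))
    have h0 := hc 0 (mem_ball_self hε'0)
    simp only [mul_zero, hΨ0, zero_add] at h0
    rw [hc u hu, ← h0, add_zero]
  -- The parameter is determined by the point `(x, y)`: for `a = 1` from `y u = n`, for `a = 2` from
  -- `y u ^ 2 = n` and `u ^ 3 = x - l`.
  let uu : ℂ → ℂ → ℂ := fun x y => if a = 1 then n x / y else y * (x - l) / n x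
  have hRne : ∀ x ∈ ball l ε, x ≠ l → R x ≠ 0 := fun x hx hxl h0 => hr0 x hx (by
    rw [← hR x hx hxl, h0, zero_mul])
  have hy0 : ∀ x ∈ ball l ε, x ≠ l → ∀ y, y ^ 3 = R x → y ≠ 0 := fun x hx hxl y hy h0 =>
    hRne x hx hxl (by rw [← hy, h0]; norm_num)
  have huu3 : ∀ x ∈ ball l ε, x ≠ l → ∀ y, y ^ 3 = R x → uu x y ^ 3 = x - l := by
    intro x hx hxl y hy
    have h1 := hRne x hx hxl
    have h2 := sub_ne_zero.2 hxl
    rcases ha with rfl | rfl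
    · simp only [uu, if_true]
      rw [div_pow, hn3, hy, ← hR x hx hxl]
      field_simp
    · simp only [uu, OfNat.ofNat_ne_one, if_false]
      rw [div_pow, mul_pow, hn3, hy, ← hR x hx hxl]
      field_simp
  have huua : ∀ x ∈ ball l ε, x ≠ l → ∀ y, y ^ 3 = R x → y * uu x y ^ a = n x := by
    intro x hx hxl y hy
    have h1 := hy0 x hx hxl y hy
    have h2 := hn0 x hx
    rcases ha with rfl | rfl
    · simp only [uu, if_true]
      field_simp
    · simp only [uu, OfNat.ofNat_ne_one, if_false]
      rw [div_pow, mul_pow, mul_div_assoc', div_eq_iff (pow_ne_zero 2 h2), ← pow_succ', hn3,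
        ← hR x hx hxl, ← hy]
      ring
  have hmem : ∀ x ∈ ball l ε, x ≠ l → ∀ y, y ^ 3 = R x → uu x y ∈ ball (0 : ℂ) ε' := fun x hx hxl y hy =>
    (hball _).2 (by rw [huu3 x hx hxl y hy, add_sub_cancel]; exact hx)
  refine ⟨fun x y => Ψ (uu x y), ?_, ?_, ?_⟩
  · intro x hx hxl y ρ hy hρ
    have hρ0 := ne_zero_of_cube_eq_one hρ
    have hm := hmem x hx hxl y hy
    rcases ha with rfl | rfl
    -- For `a = 1` the parameter is multiplied by `ρ⁻¹ = ρ ^ 2`, hence `Ψ` by `ρ ^ 4 = ρ`. For `a =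
    -- 2` both are multiplied by `ρ`.
    · have e : uu x (ρ * y) = ρ ^ 2 * uu x y := by
        simp only [uu, if_true]
        have h1 := hy0 x hx hxl y hy
        field_simp
        linear_combination -n x * hρ
      simp only [e]
      rw [hrot (ρ ^ 2) (by rw [← pow_mul, mul_comm, pow_mul, hρ, one_pow]) _ hm]
      linear_combination (ρ * Ψ (uu x y)) * hρ
    · have e : uu x (ρ * y) = ρ * uu x y := by
        simp only [uu, OfNat.ofNat_ne_one, if_false]
        ring
      simp only [e]
      rw [hrot ρ hρ _ hm, pow_one]
  · intro η hη
    have hΨc : Tendsto Ψ (𝓝 0) (𝓝 0) := by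
      have := (hΨ 0 (mem_ball_self hε'0)).continuousAt.tendsto
      rwa [hΨ0] at this
    obtain ⟨τ, hτ, hτs⟩ := Metric.eventually_nhds_iff_ball.1 (hΨc.eventually (ball_mem_nhds 0 hη))
    have hsm : ∀ᶠ x in 𝓝[≠] l, x ∈ ball l (min ε (τ ^ 3)) :=
      nhdsWithin_le_nhds (ball_mem_nhds l (lt_min hε (pow_pos hτ 3)))
    filter_upwards [hsm, self_mem_nhdsWithin] with x hx hxl y hy
    have hxε : x ∈ ball l ε := ball_subset_ball (min_le_left _ _) hx
    have h3 := huu3 x hxε hxl y hy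
    have h4 : ‖uu x y‖ < τ := by
      refine lt_of_pow_lt_pow_left₀ 3 hτ.le ?_
      rw [← norm_pow, h3, ← dist_eq_norm]
      exact lt_of_lt_of_le (mem_ball.1 hx) (min_le_right _ _)
    have := hτs (uu x y) (mem_ball_zero_iff.2 h4)
    rwa [dist_zero_right] at this
  · intro s hso hs hsε hls g F hg hg3 hF
    have hxl : ∀ x ∈ s, x ≠ l := fun x hx h => hls (h ▸ hx)
    have hg0 : ∀ x ∈ s, g x ≠ 0 := fun x hx => hy0 x (hsε hx) (hxl x hx) _ (hg3 x hx)
    have huc : ContinuousOn (fun x => uu x (g x)) s := by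
      rcases ha with rfl | rfl
      · simp only [uu, if_true]
        exact (hnc.mono hsε).div hg hg0
      · simp only [uu, OfNat.ofNat_ne_one, if_false]
        exact (hg.mul (continuousOn_id.sub continuousOn_const)).div (hnc.mono hsε)
          fun x hx => hn0 x (hsε hx)
    have hud : ∀ x ∈ s, HasDerivAt (fun x => uu x (g x)) (1 / (3 * uu x (g x) ^ 2)) x := fun x hx => by
      have h3 := huu3 x (hsε hx) (hxl x hx) _ (hg3 x hx)
      refine hasDerivAt_of_cube_eq (R := fun x => x - l) (huc.continuousAt (hso.mem_nhds hx)) ?_ ?_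
        ((hasDerivAt_id x).sub_const l)
      · intro h0
        rw [h0] at h3
        exact sub_ne_zero.2 (hxl x hx) (by rw [← h3]; norm_num)
      · filter_upwards [hso.mem_nhds hx] with y hy using huu3 y (hsε hy) (hxl y hy) _ (hg3 y hy)
    obtain ⟨c, hc⟩ := exists_const_of_hasDerivAt_eq hs hso hF
      (f' := fun x => Ψ (uu x (g x))) (fun x hx => by
        have hm := hmem x (hsε hx) (hxl x hx) _ (hg3 x hx)
        refine ((hΨ _ hm).comp x (hud x hx)).congr_deriv ?_
        have h3 := huu3 x (hsε hx) (hxl x hx) _ (hg3 x hx)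
        have ha' := huua x (hsε hx) (hxl x hx) _ (hg3 x hx)
        have hu0 : uu x (g x) ≠ 0 := fun h0 => by
          rw [h0] at h3
          exact sub_ne_zero.2 (hxl x hx) (by rw [← h3]; norm_num)
        rw [h3, add_sub_cancel, ← ha']
        rcases ha with rfl | rfl
        · field_simp
          norm_num
          ring
        · field_simp
          norm_num)
    exact ⟨c, fun x hx => by rw [hc x hx, add_comm]⟩

end Terminal

/-! ### Relations between germs and a branch, seen from a branch point -/

section Adm

variable {D K : Set ℂ} {R h g F Y Φ Y' Φ' : ℂ → ℂ} {P P' : ℂ} {δ δ' : ℝ} {S S' : Set (ℂ × ℂ)}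

/-- The germs are multiples of the integral from a branch point at which `F` is `F₀`, up to a
constant. -/
def QTerm (F₀ : ℂ) (S : Set (ℂ × ℂ)) : Prop :=
  S.Nonempty ∧ ∃ c : ℂ, ∀ v ∈ S, v.1 ^ 3 = 1 ∧ v.2 + v.1 * F₀ = c

/-- The constants of integration are congruent modulo `Λ`. -/
def QAdm (Λ : AddSubgroup ℂ) (S : Set (ℂ × ℂ)) : Prop :=
  S.Nonempty ∧ ∀ v ∈ S, ∀ v' ∈ S, v.2 - v'.2 ∈ Λ

lemma actInvariant_qTerm (F₀ : ℂ) : ActInvariant (QTerm F₀) := by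
  rintro ρ κ S hρ ⟨hne, c, hc⟩
  refine ⟨hne.image _, ρ * c + κ, ?_⟩
  rintro _ ⟨v, hv, rfl⟩
  obtain ⟨h1, h2⟩ := hc v hv
  refine ⟨by simp only [affineAct]; rw [mul_pow, hρ, h1, one_mul], ?_⟩
  simp only [affineAct]
  linear_combination ρ * h2

lemma actInvariant_qAdm {Λ : AddSubgroup ℂ} (hΛ : ∀ ρ : ℂ, ρ ^ 3 = 1 → ∀ z ∈ Λ, ρ * z ∈ Λ) :
    ActInvariant (QAdm Λ) := by
  rintro ρ κ S hρ ⟨hne, hS⟩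
  refine ⟨hne.image _, ?_⟩
  rintro _ ⟨v, hv, rfl⟩ _ ⟨v', hv', rfl⟩
  have := hΛ ρ hρ _ (hS v hv v' hv')
  simp only [affineAct]
  convert this using 1
  ring

/-- The equations `B + r F₀ = c` on the two sides are subtracted, with `r = ρ u₁` and `r = ρ u₂`. So
the jump along an edge of a terminal is read off from the value of `F` at the terminal. -/
lemma QCross.eq_of_qTerm {u₁ u₂ J F₀ : ℂ} (hS : QCross u₁ u₂ J S) (hS' : QTerm F₀ S) :
    J = (u₁ - u₂) * F₀ := by
  obtain ⟨ρ, B₁, B₂, hρ, rfl, hJ⟩ := hS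
  obtain ⟨-, c, hc⟩ := hS'
  have e1 := (hc (ρ * u₁, B₁) (by simp)).2
  have e2 := (hc (ρ * u₂, B₂) (by simp)).2
  refine mul_left_cancel₀ (ne_zero_of_cube_eq_one hρ) ?_
  rw [← hJ]
  linear_combination e2 - e1

lemma HoldsAt.imp {Q Q' : Set (ℂ × ℂ) → Prop} (hP : HoldsAt D K R h g F Q P)
    (hQ : ∀ S, Q S → Q' S) : HoldsAt D K R h g F Q' P := by
  obtain ⟨δ, hδ, hδD, Y, Φ, S, hG, hS, hQS⟩ := hP
  exact ⟨δ, hδ, hδD, Y, Φ, S, hG, hS, hQ S hQS⟩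

/-- Near a branch point `l` the germs on the cut are of the form `QTerm`. -/
lemma IsBranchPrimitive.holdsAt_qTerm (H : IsBranchPrimitive D K R h g F) {l : ℂ} {ε : ℝ}
    (hsub : ball l ε \ {l} ⊆ D) {W : ℂ → ℂ → ℂ}
    (hW : IsEndIntegral R h l ε W)
    {F₀ : ℂ} (hF₀ : ∀ x ∈ ball l ε \ K, F x = F₀ + W x (g x)) {P : ℂ} (hP : P ∈ ball l ε)
    (hPl : P ≠ l) (hPK : P ∈ K) (htwo : TwoSided K P) : HoldsAt D K R h g F (QTerm F₀) P := by
  have hopen : IsOpen (ball l ε \ {l}) := isOpen_ball.sdiff isClosed_singleton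
  obtain ⟨ε', hε', hb⟩ := Metric.isOpen_iff.1 hopen P ⟨hP, hPl⟩
  obtain ⟨Y, Φ, hG⟩ := H.exists_germ (hb.trans hsub)
  -- The germ is itself a branch near `l`, so `Φ = c + W(Y)`. With `Y = r g` on one side of the cut
  -- this equals `c + r W(g) = r F + (c - r F₀)`.
  obtain ⟨c, hc⟩ := hW.exists_eq (ball P ε') isOpen_ball isPreconnected_ball (fun z hz => (hb hz).1)
    (fun hl => (hb hl).2 rfl) Y Φ hG.continuousOn hG.cube hG.hasDerivAt
  obtain ⟨δ, hδ, hδε, c₁, c₂, hval, hex⟩ := H.exists_two_vals htwo hPK hε' (hb.trans hsub) hG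
  have hS := hex P (mem_ball_self hδ) hPK
  refine ⟨ε', hε', hb.trans hsub, Y, Φ, _, hG, hS, ⟨c₁, by simp⟩, c, fun v hv => ?_⟩
  obtain ⟨x, ⟨hxK, rfl⟩, hx⟩ := ((hS.2 v hv).and_eventually (ball_mem_nhds P hε')).exists
  have hxD : x ∈ D \ K := ⟨hsub (hb hx), hxK⟩
  refine ⟨H.relVal_fst_cube hG hx hxD, ?_⟩
  have hg0 := H.g_ne_zero hxD
  have h1 := H.relVal_fst_cube hG hx hxD
  simp only [relVal] at h1 ⊢
  have h2 := hW.rotate x (hb hx).1 (hb hx).2 (g x) (Y x / g x) (H.cube x hxD) h1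
  rw [div_mul_cancel₀ _ hg0] at h2
  rw [hc x hx, hF₀ x ⟨(hb hx).1, hxK⟩, h2]
  ring

/-- If the constants are congruent at `P`, they are so at the nearby points of the cut. -/
lemma HoldsAt.qAdm_nearby (H : IsBranchPrimitive D K R h g F) {Λ : AddSubgroup ℂ}
    (hP : HoldsAt D K R h g F (QAdm Λ) P) :
    ∀ᶠ P' in 𝓝 P, P' ∈ K → TwoSided K P' → HoldsAt D K R h g F (QAdm Λ) P' := by
  obtain ⟨δ, hδ, hδD, Y, Φ, S, hG, hS, hQ⟩ := hP
  filter_upwards [eventually_eventually_nhds.2 hS.1, ball_mem_nhds P hδ] with P' h1 h2 hK htwo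
  obtain ⟨ε, hε, hb⟩ := Metric.isOpen_iff.1 isOpen_ball P' h2
  have hG' := hG.mono hb
  obtain ⟨η, hη, -, c₁, c₂, -, hex⟩ := H.exists_two_vals htwo hK hε (hb.trans hδD) hG'
  have hS' := hex P' (mem_ball_self hη) hK
  have hsub : ∀ v ∈ ({c₁, c₂} : Set (ℂ × ℂ)), v ∈ S := fun v hv => by
    obtain ⟨x, ⟨hxK, rfl⟩, hx⟩ := ((hS'.2 v hv).and_eventually h1).exists
    exact hx hxK
  exact ⟨ε, hε, hb.trans hδD, Y, Φ, _, hG', hS', ⟨c₁, by simp⟩,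
    fun v hv v' hv' => hQ.2 v (hsub v hv) v' (hsub v' hv')⟩

/-- At a triple point, congruence along two of the edges implies congruence at the point. -/
lemma IsBranchPrimitive.holdsAt_qAdm_of_star (H : IsBranchPrimitive D K R h g F)
    {Λ : AddSubgroup ℂ} (hΛ : ∀ ρ : ℂ, ρ ^ 3 = 1 → ∀ z ∈ Λ, ρ * z ∈ Λ) {θ₁ θ₂ θ₃ : ℝ}
    (hstar : StarAt K P {θ₁, θ₂, θ₃}) (h12 : θ₁ < θ₂) (h23 : θ₂ < θ₃)
    (h31 : θ₃ < θ₁ + 2 * Real.pi) (hPD : P ∈ D)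
    (h1 : ∀ᶠ ρ in 𝓝[>] (0 : ℝ), HoldsAt D K R h g F (QAdm Λ) (polar P ρ θ₁))
    (h2 : ∀ᶠ ρ in 𝓝[>] (0 : ℝ), HoldsAt D K R h g F (QAdm Λ) (polar P ρ θ₂)) :
    HoldsAt D K R h g F (QAdm Λ) P := by
  obtain ⟨ε, hε, hb⟩ := Metric.isOpen_iff.1 H.isOpen P hPD
  obtain ⟨Y, Φ, hG⟩ := H.exists_germ hb
  obtain ⟨δ, hδ, hδε, σ₁, σ₂, σ₃, hσ₁, hσ₂, hσ₃, heq, hcl⟩ := hstar.exists_three_sectors h12 h23 h31 hε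
  have hbε := ball_subset_ball (x := P) hδε.le
  have hs : ∀ σ ⊆ ball P δ \ K, IsPreconnected σ → ∀ x ∈ σ, ∀ y ∈ σ,
      relVal g F Y Φ x = relVal g F Y Φ y := fun σ hσ hσc x hx y hy =>
    H.relVal_eq_of_isPreconnected hG hσc (fun z hz => hbε (hσ hz).1)
      (fun z hz => ⟨hb (hbε (hσ hz).1), (hσ hz).2⟩) hx hy
  have k1 : σ₁ ⊆ ball P δ \ K := by rw [heq]; exact fun z hz => Or.inl (Or.inl hz)
  have k2 : σ₂ ⊆ ball P δ \ K := by rw [heq]; exact fun z hz => Or.inl (Or.inr hz)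
  have k3 : σ₃ ⊆ ball P δ \ K := by rw [heq]; exact fun z hz => Or.inr hz
  have c0 := hcl 0 ⟨le_rfl, hδ⟩
  have hp0 : ∀ θ, polar P 0 θ = P := fun θ => by simp [polar]
  simp only [hp0] at c0
  obtain ⟨x₁, hx₁⟩ : σ₁.Nonempty := closure_nonempty_iff.1 ⟨_, c0.1.2⟩
  obtain ⟨x₂, hx₂⟩ : σ₂.Nonempty := closure_nonempty_iff.1 ⟨_, c0.2.1.2⟩
  obtain ⟨x₃, hx₃⟩ : σ₃.Nonempty := closure_nonempty_iff.1 ⟨_, c0.1.1⟩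
  have hfreq : ∀ σ ⊆ ball P δ \ K, IsPreconnected σ → ∀ x ∈ σ, ∀ P' ∈ closure σ,
      ∃ᶠ z in 𝓝 P', z ∉ K ∧ relVal g F Y Φ z = relVal g F Y Φ x := fun σ hσ hσc x hx P' hP' =>
    (mem_closure_iff_frequently.1 hP').mono fun z hz => ⟨(hσ hz).2, hs σ hσ hσc z hz x hx⟩
  have key : ∀ θ, ∀ σ ⊆ ball P δ \ K, ∀ σ' ⊆ ball P δ \ K, IsPreconnected σ → IsPreconnected σ' →
      (∀ᶠ ρ in 𝓝[>] (0 : ℝ), HoldsAt D K R h g F (QAdm Λ) (polar P ρ θ)) →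
      (∀ ρ ∈ Ico 0 δ, polar P ρ θ ∈ closure σ ∧ polar P ρ θ ∈ closure σ') →
      ∀ x ∈ σ, ∀ x' ∈ σ', (relVal g F Y Φ x).2 - (relVal g F Y Φ x').2 ∈ Λ := by
    intro θ σ hσ σ' hσ' hσc hσc' hev hclo x hx x' hx'
    obtain ⟨ρ, hρ, hρδ⟩ := (hev.and (Ioo_mem_nhdsGT hδ)).exists
    have hm : polar P ρ θ ∈ ball P ε := hbε (by rw [mem_ball, dist_polar P hρδ.1.le]; exact hρδ.2)
    obtain ⟨S, hS, hQ⟩ := hρ.exists_exactVals H (actInvariant_qAdm hΛ) hG hm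
    have hcc := hclo ρ ⟨hρδ.1.le, hρδ.2⟩
    have hin : ∀ σ ⊆ ball P δ \ K, IsPreconnected σ → ∀ x ∈ σ, polar P ρ θ ∈ closure σ →
        relVal g F Y Φ x ∈ S := fun σ hσ hσc x hx hc => by
      obtain ⟨z, ⟨hzK, hz⟩, hz2⟩ := ((hfreq σ hσ hσc x hx _ hc).and_eventually hS.1).exists
      exact hz ▸ hz2 hzK
    exact hQ.2 _ (hin σ hσ hσc x hx hcc.1) _ (hin σ' hσ' hσc' x' hx' hcc.2)
  -- Three sectors give three constants. Crossing the first ray compares the third sector with the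
  -- first, crossing the second ray the first with the second; the third comparison follows.
  have d31 := key θ₁ σ₃ k3 σ₁ k1 hσ₃ hσ₁ h1 (fun ρ hρ => (hcl ρ hρ).1) x₃ hx₃ x₁ hx₁
  have d12 := key θ₂ σ₁ k1 σ₂ k2 hσ₁ hσ₂ h2 (fun ρ hρ => (hcl ρ hρ).2.1) x₁ hx₁ x₂ hx₂
  refine ⟨ε, hε, hb, Y, Φ, {relVal g F Y Φ x₁, relVal g F Y Φ x₂, relVal g F Y Φ x₃}, hG, ⟨?_, ?_⟩,
    ⟨relVal g F Y Φ x₁, by simp⟩, ?_⟩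
  · filter_upwards [ball_mem_nhds P hδ] with x hx hxK
    have : x ∈ σ₁ ∪ σ₂ ∪ σ₃ := heq ▸ ⟨hx, hxK⟩
    rcases this with (hx' | hx') | hx'
    · rw [hs σ₁ k1 hσ₁ x hx' x₁ hx₁]; simp
    · rw [hs σ₂ k2 hσ₂ x hx' x₂ hx₂]; simp
    · rw [hs σ₃ k3 hσ₃ x hx' x₃ hx₃]; simp
  · rintro v (rfl | rfl | rfl)
    · exact hfreq σ₁ k1 hσ₁ x₁ hx₁ P c0.1.2
    · exact hfreq σ₂ k2 hσ₂ x₂ hx₂ P c0.2.1.2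
    · exact hfreq σ₃ k3 hσ₃ x₃ hx₃ P c0.1.1
  · have e : ∀ v ∈ ({relVal g F Y Φ x₁, relVal g F Y Φ x₂, relVal g F Y Φ x₃} : Set (ℂ × ℂ)),
        v.2 - (relVal g F Y Φ x₁).2 ∈ Λ := by
      rintro v (rfl | rfl | rfl)
      · rw [sub_self]; exact Λ.zero_mem
      · rw [← neg_sub]; exact Λ.neg_mem d12
      · exact d31
    intro v hv v' hv'
    have := Λ.sub_mem (e v hv) (e v' hv')
    rwa [sub_sub_sub_cancel_right] at this

/-- If the constants of integration are congruent modulo `Λ` at all points of the cut `K₁`, then two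
primitives, with cuts `K₁` and `K₂`, are related by constants that are congruent modulo `Λ`. -/
theorem IsBranchPrimitive.sub_mem_of_adm {K₁ K₂ : Set ℂ} {g₁ F₁ g₂ F₂ : ℂ → ℂ}
    (H₁ : IsBranchPrimitive D K₁ R h g₁ F₁) (H₂ : IsBranchPrimitive D K₂ R h g₂ F₂)
    {Λ : AddSubgroup ℂ} (hΛ : ∀ ρ : ℂ, ρ ^ 3 = 1 → ∀ z ∈ Λ, ρ * z ∈ Λ)
    (hconn : IsPreconnected (D \ K₂))
    (hadm : ∀ P ∈ D, P ∈ K₁ → HoldsAt D K₁ R h g₁ F₁ (QAdm Λ) P) {x y : ℂ} (hxD : x ∈ D)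
    (hx₁ : x ∉ K₁) (hx₂ : x ∉ K₂) (hyD : y ∈ D) (hy₁ : y ∉ K₁) (hy₂ : y ∉ K₂) :
    (F₂ y - g₂ y / g₁ y * F₁ y) - (F₂ x - g₂ x / g₁ x * F₁ x) ∈ Λ := by
  set B : ℂ → ℂ := fun z => (relVal g₁ F₁ g₂ F₂ z).2 with hB
  have hloc : ∀ P ∈ D \ K₂, (∃ᶠ z in 𝓝 P, z ∉ K₁) ∧
      ∃ c, ∀ᶠ z in 𝓝 P, z ∉ K₁ → B z - c ∈ Λ := by
    intro P hP
    obtain ⟨δ, hδ, hb⟩ := Metric.isOpen_iff.1 H₂.isOpen_diff P hP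
    have hG : IsGerm R h P δ g₂ F₂ := ⟨H₂.continuousOn.mono hb, fun z hz => H₂.cube z (hb hz),
      fun z hz => H₂.hasDerivAt z (hb hz)⟩
    by_cases hPK : P ∈ K₁
    · obtain ⟨S, hS, ⟨v, hv⟩, hQ⟩ := (hadm P hP.1 hPK).exists_exactVals H₁ (actInvariant_qAdm hΛ) hG
        (mem_ball_self hδ)
      exact ⟨(hS.2 v hv).mono fun z hz => hz.1, v.2, hS.1.mono fun z hz hzK => hQ _ (hz hzK) v hv⟩
    · refine ⟨Eventually.frequently (H₁.isClosed.isOpen_compl.mem_nhds hPK), B P, ?_⟩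
      filter_upwards [H₁.relVal_eventually_eq hG (mem_ball_self hδ) ⟨hP.1, hPK⟩] with z hz _
      simp only [hB, hz, sub_self]
      exact Λ.zero_mem
  -- Off `K₂` the pair `(g₂, F₂)` is a germ everywhere, so `B` modulo `Λ` can be continued across
  -- `K₁`. Points of `K₁` carry no value of `B`; "frequently near `P`" lets the statement make sense
  -- there as well.
  have hconst := IsPreconnected.eq_of_eventually_eq hconn
    (b := fun P => ∃ᶠ z in 𝓝 P, z ∉ K₁ ∧ B z - B x ∈ Λ) (fun P hP => by
      obtain ⟨-, c, hc⟩ := hloc P hP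
      have hiff : ∀ P' ∈ D \ K₂, (∀ᶠ z in 𝓝 P', z ∉ K₁ → B z - c ∈ Λ) →
          ((∃ᶠ z in 𝓝 P', z ∉ K₁ ∧ B z - B x ∈ Λ) ↔ c - B x ∈ Λ) := by
        intro P' hP' hc'
        constructor
        · intro h'
          obtain ⟨z, hz, hz'⟩ := (h'.and_eventually hc').exists
          have := Λ.sub_mem hz.2 (hz' hz.1)
          rwa [sub_sub_sub_cancel_left] at this
        · intro h'
          refine ((hloc P' hP').1.and_eventually hc').mono fun z hz => ⟨hz.1, ?_⟩
          have := Λ.add_mem (hz.2 hz.1) h'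
          rwa [sub_add_sub_cancel] at this
      filter_upwards [(eventually_eventually_nhds.2 hc).filter_mono nhdsWithin_le_nhds,
        self_mem_nhdsWithin] with P' hP' hm
      rw [eq_iff_iff, hiff P' hm hP', hiff P hP hc]) ⟨hxD, hx₂⟩ ⟨hyD, hy₂⟩
  have hxx : ∃ᶠ z in 𝓝 x, z ∉ K₁ ∧ B z - B x ∈ Λ := by
    have : ∃ᶠ z in 𝓝 x, z = x := frequently_iff.2 fun hU => ⟨x, mem_of_mem_nhds hU, rfl⟩
    refine this.mono ?_
    rintro z rfl
    exact ⟨hx₁, by rw [sub_self]; exact Λ.zero_mem⟩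
  have hyy := hconst.mp hxx
  obtain ⟨δ, hδ, hb⟩ := Metric.isOpen_iff.1 H₂.isOpen_diff y ⟨hyD, hy₂⟩
  have hG : IsGerm R h y δ g₂ F₂ := ⟨H₂.continuousOn.mono hb, fun z hz => H₂.cube z (hb hz),
      fun z hz => H₂.hasDerivAt z (hb hz)⟩
  obtain ⟨z, hz, hz'⟩ := (hyy.and_eventually
    (H₁.relVal_eventually_eq hG (mem_ball_self hδ) ⟨hyD, hy₁⟩)).exists
  have := hz.2
  simp only [hB, hz'] at this
  exact this

end Adm

/-! ### Units of the Eisenstein integers -/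

lemma omega_sq_add : ω ^ 2 + ω + 1 = 0 := by
  have h : ((Real.sqrt 3 : ℝ) : ℂ) ^ 2 = 3 := by
    rw [← Complex.ofReal_pow, Real.sq_sqrt (by norm_num)]; norm_num
  have hI : Complex.I ^ 2 = -1 := Complex.I_sq
  have e : ω ^ 2 + ω + 1 = (3 + (Real.sqrt 3 : ℂ) ^ 2 * Complex.I ^ 2) / 4 := by
    unfold ω; ring
  rw [e, h, hI]; ring

lemma omega_im_ne_zero : ω.im ≠ 0 := by
  have : ω.im = Real.sqrt 3 / 2 := by simp [ω]
  rw [this]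
  positivity

lemma omega_ne_one : ω ≠ 1 := fun h => omega_im_ne_zero (by rw [h]; simp)

lemma eq_omega_pow_of_cube_eq_one {ρ : ℂ} (h : ρ ^ 3 = 1) : ρ = 1 ∨ ρ = ω ∨ ρ = ω ^ 2 := by
  have e : (ρ - 1) * ((ρ - ω) * (ρ - ω ^ 2)) = 0 := by
    have h2 := omega_sq_add
    have h3 := omega_cube
    linear_combination h + (-ρ ^ 2 + ρ) * h2 + (ρ - 1) * h3
  rcases mul_eq_zero.1 e with h | h
  · exact Or.inl (sub_eq_zero.1 h)
  rcases mul_eq_zero.1 h with h | h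
  · exact Or.inr (Or.inl (sub_eq_zero.1 h))
  · exact Or.inr (Or.inr (sub_eq_zero.1 h))

lemma int_omega_eq_zero {A B : ℤ} (h : (A : ℂ) + B * ω = 0) : A = 0 ∧ B = 0 := by
  have h1 := congrArg Complex.im h
  simp only [Complex.add_im, Complex.intCast_im, Complex.mul_im, Complex.intCast_re, zero_mul,
    add_zero, zero_add, Complex.zero_im] at h1
  have hB : B = 0 := by exact_mod_cast (mul_eq_zero.1 h1).resolve_right omega_im_ne_zero
  subst hB
  simp only [Int.cast_zero, zero_mul, add_zero] at h
  exact ⟨by exact_mod_cast h, rfl⟩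

/-- The multiples of `(1 - ω) α` by Eisenstein integers. -/
noncomputable def eisensteinMultiples (α : ℂ) : AddSubgroup ℂ where
  carrier := {z | ∃ c d : ℤ, z = (1 - ω) * (c + d * ω) * α}
  zero_mem' := ⟨0, 0, by simp⟩
  add_mem' := by
    rintro _ _ ⟨c, d, rfl⟩ ⟨c', d', rfl⟩
    exact ⟨c + c', d + d', by push_cast; ring⟩
  neg_mem' := by
    rintro _ ⟨c, d, rfl⟩
    exact ⟨-c, -d, by push_cast; ring⟩

lemma mul_omega_mem {α z : ℂ} (hz : z ∈ eisensteinMultiples α) : ω * z ∈ eisensteinMultiples α := by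
  obtain ⟨c, d, rfl⟩ := hz
  refine ⟨-d, c - d, ?_⟩
  push_cast
  linear_combination (1 - ω) * d * α * omega_sq_add

lemma mul_mem_of_cube_eq_one {α ρ : ℂ} (hρ : ρ ^ 3 = 1) (z : ℂ) (hz : z ∈ eisensteinMultiples α) :
    ρ * z ∈ eisensteinMultiples α := by
  rcases eq_omega_pow_of_cube_eq_one hρ with rfl | rfl | rfl
  · rwa [one_mul]
  · exact mul_omega_mem hz
  · rw [pow_two, mul_assoc]
    exact mul_omega_mem (mul_omega_mem hz)

lemma one_sub_mul_mem {α ρ : ℂ} (hρ : ρ ^ 3 = 1) : (1 - ρ) * α ∈ eisensteinMultiples α := by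
  rcases eq_omega_pow_of_cube_eq_one hρ with rfl | rfl | rfl
  · rw [sub_self, zero_mul]
    exact zero_mem _
  · exact ⟨1, 0, by push_cast; ring⟩
  · exact ⟨1, 1, by push_cast; ring⟩

/-- All cube roots of unity are congruent to `1` modulo `1 - ω`, so the constants `c - r F₀` differ
by multiples of `(1 - ω) F₀`. -/
lemma QTerm.qAdm {α F₀ : ℂ} (hF : F₀ = 0 ∨ F₀ = α) {S : Set (ℂ × ℂ)} (hS : QTerm F₀ S) :
    QAdm (eisensteinMultiples α) S := by
  obtain ⟨hne, c, hc⟩ := hS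
  refine ⟨hne, fun v hv v' hv' => ?_⟩
  obtain ⟨h1, h2⟩ := hc v hv
  obtain ⟨h1', h2'⟩ := hc v' hv'
  rcases hF with rfl | rfl
  · have : v.2 - v'.2 = 0 := by linear_combination h2 - h2'
    rw [this]
    exact zero_mem _
  · have e : v.2 - v'.2 = (1 - v.1) * F₀ - (1 - v'.1) * F₀ := by linear_combination h2 - h2'
    rw [e]
    exact sub_mem (one_sub_mul_mem h1) (one_sub_mul_mem h1')

/-- If each of two numbers is a cube root of unity times the other, up to Eisenstein multiples of
`1 - ω`, then they have the same cube. -/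
lemma cube_eq_cube_of_eisenstein {α β ρ ρ' : ℂ} (hρ : ρ ^ 3 = 1) (hρ' : ρ' ^ 3 = 1)
    (h : β - ρ * α ∈ eisensteinMultiples α) (h' : α - ρ' * β ∈ eisensteinMultiples β) :
    α ^ 3 = β ^ 3 := by
  -- As `ω ≡ 1` modulo `1 - ω` and the residue field has three elements, `A + B ≡ 1` modulo `3` says
  -- that `A + B ω` is congruent to `1`.
  have key : ∀ {α β ρ : ℂ}, ρ ^ 3 = 1 → β - ρ * α ∈ eisensteinMultiples α →
      ∃ A B d : ℤ, A + B = 1 + 3 * d ∧ β = (A + B * ω) * α := by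
    intro α β ρ hρ h
    have h2 : β - α ∈ eisensteinMultiples α := by
      have := sub_mem h (one_sub_mul_mem (α := α) hρ)
      convert this using 1
      ring
    obtain ⟨c, d, hcd⟩ := h2
    refine ⟨1 + c + d, 2 * d - c, d, by ring, ?_⟩
    push_cast
    linear_combination hcd - d * α * omega_sq_add
  obtain ⟨A, B, d, hAB, hβ⟩ := key hρ h
  obtain ⟨A', B', d', -, hα⟩ := key hρ' h'
  by_cases hα0 : α = 0
  · rw [hβ, hα0]; ring
  -- Each factor is an Eisenstein integer, so `A + B ω` is a unit and its norm `A ^ 2 - A B + B ^ 2`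
  -- is `1`.
  have e1 : ((A : ℂ) + B * ω) * (A' + B' * ω) = 1 := by
    refine mul_right_cancel₀ hα0 ?_
    rw [one_mul]
    linear_combination -hα - (A' + B' * ω) * hβ
  have e2 : ((A * A' - B * B' - 1 : ℤ) : ℂ) + ((A * B' + A' * B - B * B' : ℤ) : ℂ) * ω = 0 := by
    push_cast
    linear_combination e1 - (B : ℂ) * B' * omega_sq_add
  obtain ⟨f1, f2⟩ := int_omega_eq_zero e2
  have hN : (A ^ 2 - A * B + B ^ 2) * (A' ^ 2 - A' * B' + B' ^ 2) = 1 := by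
    have : (A ^ 2 - A * B + B ^ 2) * (A' ^ 2 - A' * B' + B' ^ 2) =
      (A * A' - B * B') ^ 2 - (A * A' - B * B') * (A * B' + A' * B - B * B') +
        (A * B' + A' * B - B * B') ^ 2 := by ring
    rw [this, f2, show A * A' - B * B' = 1 by linarith]
    norm_num
  have hN1 : A ^ 2 - A * B + B ^ 2 = 1 := by
    rcases Int.eq_one_or_neg_one_of_mul_eq_one hN with h | h
    · exact h
    · nlinarith [sq_nonneg (2 * A - B), sq_nonneg B]
  have hB1 : B ≤ 1 := by nlinarith [sq_nonneg (2 * A - B)]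
  have hB2 : -1 ≤ B := by nlinarith [sq_nonneg (2 * A - B)]
  have hA1 : A ≤ 1 := by nlinarith [sq_nonneg (2 * B - A)]
  have hA2 : -1 ≤ A := by nlinarith [sq_nonneg (2 * B - A)]
  have hcube : ((A : ℂ) + B * ω) ^ 3 = 1 := by
    have h3 := omega_cube
    have h4 := omega_sq_add
    -- Of the six units only `1`, `ω` and `-1 - ω = ω ^ 2` are congruent to `1`; the negatives fail
    -- modulo `3`.
    have hcases : (A = 1 ∧ B = 0) ∨ (A = 0 ∧ B = 1) ∨ (A = -1 ∧ B = -1) := by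
      have hA : A = -1 ∨ A = 0 ∨ A = 1 := by omega
      have hB : B = -1 ∨ B = 0 ∨ B = 1 := by omega
      rcases hA with rfl | rfl | rfl <;> rcases hB with rfl | rfl | rfl <;>
        omega
    rcases hcases with ⟨rfl, rfl⟩ | ⟨rfl, rfl⟩ | ⟨rfl, rfl⟩
    · norm_num
    · push_cast
      rw [zero_add, one_mul, h3]
    · push_cast
      have : (-1 : ℂ) + -1 * ω = ω ^ 2 := by linear_combination -h4
      rw [this, ← pow_mul, mul_comm, pow_mul, h3, one_pow]
  rw [hβ, mul_pow, hcube, one_mul]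

/-! ### Comparison of two systems of cuts -/

section Compare

variable {D K : Set ℂ} {R h g F : ℂ → ℂ} {l : ℂ} {ε : ℝ} {W : ℂ → ℂ → ℂ}

lemma IsBranchPrimitive.sub_const (H : IsBranchPrimitive D K R h g F) (c : ℂ) :
    IsBranchPrimitive D K R h g (fun x => F x - c) :=
  ⟨H.isOpen, H.isClosed, H.differentiableOn, H.ne_zero, H.differentiable, H.continuousOn, H.cube,
    fun x hx => (H.hasDerivAt x hx).sub_const c⟩

lemma IsBranchPrimitive.mono {D' : Set ℂ} (H : IsBranchPrimitive D K R h g F) (hD' : IsOpen D')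
    (hsub : D' ⊆ D) : IsBranchPrimitive D' K R h g F :=
  ⟨hD', H.isClosed, H.differentiableOn.mono hsub, fun x hx => H.ne_zero x (hsub hx),
    H.differentiable, H.continuousOn.mono (sdiff_subset_sdiff_left hsub),
    fun x hx => H.cube x ⟨hsub hx.1, hx.2⟩, fun x hx => H.hasDerivAt x ⟨hsub hx.1, hx.2⟩⟩

/-- Along an edge that issues from the branch point `l` the germs are of the form `QTerm`. -/
lemma IsBranchPrimitive.holdsAt_qTerm_of_leg (H : IsBranchPrimitive D K R h g F)
    (hW : IsEndIntegral R h l ε W) (hε : 0 < ε) (hsub : ball l ε \ {l} ⊆ D) (hl : l ∉ D) {F₀ : ℂ}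
    (hF₀ : ∀ x ∈ ball l ε \ K, F x = F₀ + W x (g x)) {γ : ℝ → ℂ} {b : ℝ}
    (hγ : ContinuousOn γ (Ioo 0 b)) (hK : ∀ s ∈ Ioo 0 b, γ s ∈ K) (hD : ∀ s ∈ Ioo 0 b, γ s ∈ D)
    (htwo : ∀ s ∈ Ioo 0 b, TwoSided K (γ s)) (hlim : Tendsto γ (𝓝[>] 0) (𝓝 l)) {s : ℝ}
    (hs : s ∈ Ioo 0 b) : HoldsAt D K R h g F (QTerm F₀) (γ s) := by
  obtain ⟨s', hs', hs'm⟩ := ((hlim.eventually (ball_mem_nhds l hε)).and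
    (Ioo_mem_nhdsGT (hs.1.trans hs.2))).exists
  rw [H.holdsAt_iff_of_arc (actInvariant_qTerm F₀) hγ hK hD htwo hs hs'm]
  exact H.holdsAt_qTerm hsub hW hF₀ hs' (fun h => hl (h ▸ hD s' hs'm)) (hK s' hs'm) (htwo s' hs'm)

/-- Two systems of cuts in `D` with the same two branch points `l₁`, `l₂` at which they end give
the same cube of the integral from `l₁` to `l₂`. -/
theorem IsBranchPrimitive.cube_eq_cube {K₁ K₂ : Set ℂ} {g₁ F₁ g₂ F₂ : ℂ → ℂ} {l₁ l₂ : ℂ} {ε₁ ε₂ : ℝ}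
    {W₁ W₂ : ℂ → ℂ → ℂ} {α β : ℂ}
    (H₁ : IsBranchPrimitive D K₁ R h g₁ F₁) (H₂ : IsBranchPrimitive D K₂ R h g₂ F₂)
    (hW₁ : IsEndIntegral R h l₁ ε₁ W₁) (hW₂ : IsEndIntegral R h l₂ ε₂ W₂)
    (hsub₁ : ball l₁ ε₁ \ {l₁} ⊆ D) (hsub₂ : ball l₂ ε₂ \ {l₂} ⊆ D)
    (hl₁ : l₁ ∈ K₂) (hl₂ : l₂ ∈ K₂) (hne₁ : (ball l₁ ε₁ \ K₂).Nonempty)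
    (hne₂ : (ball l₂ ε₂ \ K₂).Nonempty)
    (e₁₁ : ∀ x ∈ ball l₁ ε₁ \ K₁, F₁ x = W₁ x (g₁ x))
    (e₁₂ : ∀ x ∈ ball l₂ ε₂ \ K₁, F₁ x = α + W₂ x (g₁ x))
    (e₂₁ : ∀ x ∈ ball l₁ ε₁ \ K₂, F₂ x = W₁ x (g₂ x))
    (e₂₂ : ∀ x ∈ ball l₂ ε₂ \ K₂, F₂ x = β + W₂ x (g₂ x))
    (hc₁ : IsPreconnected (D \ K₁)) (hc₂ : IsPreconnected (D \ K₂))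
    (hadm₁ : ∀ P ∈ D, P ∈ K₁ → HoldsAt D K₁ R h g₁ F₁ (QAdm (eisensteinMultiples α)) P)
    (hadm₂ : ∀ P ∈ D, P ∈ K₂ → HoldsAt D K₂ R h g₂ F₂ (QAdm (eisensteinMultiples β)) P) :
    α ^ 3 = β ^ 3 := by
  -- A point close to the branch point and off both cuts. The complement of `K₁` accumulates at
  -- every point of `K₁` in `D`, since the set of relations there is nonempty.
  have hpt : ∀ l ε, ball l ε \ {l} ⊆ D → l ∈ K₂ → (ball l ε \ K₂).Nonempty →
      ∃ x ∈ ball l ε, x ≠ l ∧ x ∈ D ∧ x ∉ K₁ ∧ x ∉ K₂ := by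
    intro l ε hsub hl ⟨x, hx, hxK⟩
    have hmem : ∀ z ∈ ball l ε \ K₂, z ≠ l ∧ z ∈ D := fun z hz =>
      have : z ≠ l := fun h => hz.2 (h ▸ hl)
      ⟨this, hsub ⟨hz.1, this⟩⟩
    by_cases hx₁ : x ∈ K₁
    · obtain ⟨δ, hδ, hδD, Y, Φ, S, hG, hS, ⟨v, hv⟩, -⟩ := hadm₁ x (hmem x ⟨hx, hxK⟩).2 hx₁
      obtain ⟨z, ⟨hz1, -⟩, hz2⟩ := ((hS.2 v hv).and_eventually
        ((isOpen_ball.sdiff H₂.isClosed).mem_nhds ⟨hx, hxK⟩)).exists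
      exact ⟨z, hz2.1, (hmem z hz2).1, (hmem z hz2).2, hz1, hz2.2⟩
    · exact ⟨x, hx, (hmem x ⟨hx, hxK⟩).1, (hmem x ⟨hx, hxK⟩).2, hx₁, hxK⟩
  obtain ⟨x₁, hx₁, hxl₁, hxD₁, hxK₁, hxK₁'⟩ := hpt l₁ ε₁ hsub₁ hl₁ hne₁
  obtain ⟨x₂, hx₂, hxl₂, hxD₂, hxK₂, hxK₂'⟩ := hpt l₂ ε₂ hsub₂ hl₂ hne₂
  have hq : ∀ x ∈ D, x ∉ K₁ → x ∉ K₂ → (g₂ x / g₁ x) ^ 3 = 1 ∧ (g₁ x / g₂ x) ^ 3 = 1 := by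
    intro x hxD h1 h2
    have := H₁.ne_zero x hxD
    rw [div_pow, div_pow, H₁.cube x ⟨hxD, h1⟩, H₂.cube x ⟨hxD, h2⟩, div_self this]
    exact ⟨rfl, rfl⟩
  have hg : ∀ x ∈ D, x ∉ K₁ → x ∉ K₂ → g₁ x ≠ 0 ∧ g₂ x ≠ 0 := fun x hxD h1 h2 =>
    ⟨H₁.g_ne_zero ⟨hxD, h1⟩, H₂.g_ne_zero ⟨hxD, h2⟩⟩
  have w1 : W₁ x₁ (g₂ x₁) = g₂ x₁ / g₁ x₁ * W₁ x₁ (g₁ x₁) := by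
    rw [← hW₁.rotate x₁ hx₁ hxl₁ _ _ (H₁.cube x₁ ⟨hxD₁, hxK₁⟩) (hq x₁ hxD₁ hxK₁ hxK₁').1,
      div_mul_cancel₀ _ (hg x₁ hxD₁ hxK₁ hxK₁').1]
  have w2 : W₂ x₂ (g₂ x₂) = g₂ x₂ / g₁ x₂ * W₂ x₂ (g₁ x₂) := by
    rw [← hW₂.rotate x₂ hx₂ hxl₂ _ _ (H₁.cube x₂ ⟨hxD₂, hxK₂⟩) (hq x₂ hxD₂ hxK₂ hxK₂').1,
      div_mul_cancel₀ _ (hg x₂ hxD₂ hxK₂ hxK₂').1]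
  have w1' : W₁ x₁ (g₁ x₁) = g₁ x₁ / g₂ x₁ * W₁ x₁ (g₂ x₁) := by
    rw [← hW₁.rotate x₁ hx₁ hxl₁ _ _ (H₂.cube x₁ ⟨hxD₁, hxK₁'⟩) (hq x₁ hxD₁ hxK₁ hxK₁').2,
      div_mul_cancel₀ _ (hg x₁ hxD₁ hxK₁ hxK₁').2]
  have w2' : W₂ x₂ (g₁ x₂) = g₁ x₂ / g₂ x₂ * W₂ x₂ (g₂ x₂) := by
    rw [← hW₂.rotate x₂ hx₂ hxl₂ _ _ (H₂.cube x₂ ⟨hxD₂, hxK₂'⟩) (hq x₂ hxD₂ hxK₂ hxK₂').2,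
      div_mul_cancel₀ _ (hg x₂ hxD₂ hxK₂ hxK₂').2]
  -- With `r = g₂ / g₁`, the constant `F₂ - r F₁` is zero near `l₁`, because both integrals start
  -- there, and `β - r α` near `l₂`. The second application, with the cuts exchanged, gives the
  -- opposite divisibility.
  have m1 := H₁.sub_mem_of_adm H₂ (fun _ => mul_mem_of_cube_eq_one) hc₂ hadm₁ hxD₁ hxK₁ hxK₁'
    hxD₂ hxK₂ hxK₂'
  have m2 := H₂.sub_mem_of_adm H₁ (fun _ => mul_mem_of_cube_eq_one) hc₁ hadm₂ hxD₁ hxK₁' hxK₁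
    hxD₂ hxK₂' hxK₂
  rw [e₁₁ x₁ ⟨hx₁, hxK₁⟩, e₁₂ x₂ ⟨hx₂, hxK₂⟩, e₂₁ x₁ ⟨hx₁, hxK₁'⟩, e₂₂ x₂ ⟨hx₂, hxK₂'⟩] at m1 m2
  refine cube_eq_cube_of_eisenstein (hq x₂ hxD₂ hxK₂ hxK₂').1 (hq x₂ hxD₂ hxK₂ hxK₂').2 ?_ ?_
  · convert m1 using 1
    linear_combination w1 - w2
  · convert m2 using 1
    linear_combination w1' - w2'

end Compare

/-! ### The plane cut along two rays -/

/-- The integral from the centre `m` is a primitive near `z`: a thin convex neighbourhood of the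
segment from `m` to `z` lies in `U` and has a primitive of its own. -/
lemma exists_primitive_starConvex {U : Set ℂ} {m : ℂ} (hU : IsOpen U) (hs : StarConvex ℝ m U)
    {f : ℂ → ℂ} (hf : DifferentiableOn ℂ f U) : ∃ F : ℂ → ℂ, ∀ z ∈ U, HasDerivAt F (f z) z := by
  refine ⟨segInt f m, fun z hz => ?_⟩
  have hsegU : segment ℝ m z ⊆ U := hs.segment_subset hz
  have hcpt : IsCompact (segment ℝ m z) := by
    rw [segment_eq_image']
    exact isCompact_Icc.image (by fun_prop)
  obtain ⟨η, hη, hsub⟩ := hcpt.exists_thickening_subset_open hU hsegU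
  set N := thickening η (segment ℝ m z) with hN
  have hNc : Convex ℝ N := (convex_segment m z).thickening η
  have hNo : IsOpen N := isOpen_thickening
  obtain ⟨G, hG⟩ := hNc.exists_forall_hasDerivWithinAt (𝕜 := ℂ) (hf.mono hsub)
  have hG' : ∀ w ∈ N, HasDerivAt G (f w) w := fun w hw => (hG w hw).hasDerivAt (hNo.mem_nhds hw)
  have hmN : m ∈ N := self_subset_thickening hη _ (left_mem_segment ℝ m z)
  have hzN : z ∈ N := self_subset_thickening hη _ (right_mem_segment ℝ m z)
  have heq : ∀ w ∈ N, segInt f m w = G w - G m := fun w hw =>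
    segInt_eq_sub (fun v hv => hG' v (hNc.segment_subset hmN hw hv))
      ((hf.continuousOn.mono hsub).mono (hNc.segment_subset hmN hw))
  exact ((hG' z hzN).sub_const (G m)).congr_of_eventuallyEq
    (eventually_of_mem (hNo.mem_nhds hzN) heq)

/-- The complement of the two rays that issue from `l₁` and `l₂` in opposite directions. -/
def slitDomain (l₁ l₂ : ℂ) : Set ℂ :=
  {z | (z - l₁) / (l₂ - l₁) ∈ Complex.slitPlane ∧ 1 - (z - l₁) / (l₂ - l₁) ∈ Complex.slitPlane}

section Slit

variable {l₁ l₂ : ℂ}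

lemma isOpen_slitDomain (l₁ l₂ : ℂ) : IsOpen (slitDomain l₁ l₂) :=
  (Complex.isOpen_slitPlane.preimage (by fun_prop)).inter
    (Complex.isOpen_slitPlane.preimage (by fun_prop))

/-- In the coordinate that sends `l₁`, `l₂` to `0`, `1`, the domain is the intersection of the slit
plane and its image under `u ↦ 1 - u`; both are starlike about each point of the open unit interval.
-/
lemma starConvex_slitDomain (hl : l₁ ≠ l₂) {x : ℝ} (hx : x ∈ Ioo (0 : ℝ) 1) :
    StarConvex ℝ (l₁ + x * (l₂ - l₁)) (slitDomain l₁ l₂) := by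
  intro z hz a b ha hb hab
  have hδ : l₂ - l₁ ≠ 0 := sub_ne_zero.2 hl.symm
  have habc : (a : ℂ) + b = 1 := by exact_mod_cast hab
  have e : (a • (l₁ + x * (l₂ - l₁)) + b • z - l₁) / (l₂ - l₁) =
      a • (x : ℂ) + b • ((z - l₁) / (l₂ - l₁)) := by
    simp only [Complex.real_smul]
    field_simp
    linear_combination l₁ * habc
  have e' : 1 - (a • (l₁ + x * (l₂ - l₁)) + b • z - l₁) / (l₂ - l₁) =
      a • (((1 - x : ℝ)) : ℂ) + b • (1 - (z - l₁) / (l₂ - l₁)) := by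
    rw [e]
    simp only [Complex.real_smul]
    push_cast
    linear_combination -habc
  refine ⟨?_, ?_⟩
  · rw [e]
    exact Complex.starConvex_ofReal_slitPlane hx.1 hz.1 ha hb hab
  · rw [e']
    exact Complex.starConvex_ofReal_slitPlane (sub_pos.2 hx.2) hz.2 ha hb hab

lemma add_mul_mem_slitDomain (hl : l₁ ≠ l₂) {x : ℝ} (hx : x ∈ Ioo (0 : ℝ) 1) :
    l₁ + x * (l₂ - l₁) ∈ slitDomain l₁ l₂ := by
  have hδ : l₂ - l₁ ≠ 0 := sub_ne_zero.2 hl.symm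
  have e : (l₁ + x * (l₂ - l₁) - l₁) / (l₂ - l₁) = x := by field_simp; ring
  refine ⟨?_, ?_⟩
  · rw [e]; exact Complex.ofReal_mem_slitPlane.2 hx.1
  · rw [e, ← Complex.ofReal_one, ← Complex.ofReal_sub]
    exact Complex.ofReal_mem_slitPlane.2 (sub_pos.2 hx.2)

lemma starConvex_ball_inter_slitDomain (hl : l₁ ≠ l₂) {x : ℝ} (hx : x ∈ Ioo (0 : ℝ) 1) {c : ℂ} {ρ : ℝ}
    (hc : l₁ + x * (l₂ - l₁) ∈ ball c ρ) :
    StarConvex ℝ (l₁ + x * (l₂ - l₁)) (ball c ρ ∩ slitDomain l₁ l₂) :=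
  ((convex_ball c ρ).starConvex hc).inter (starConvex_slitDomain hl hx)

lemma isPreconnected_ball_inter_slitDomain (hl : l₁ ≠ l₂) {x : ℝ} (hx : x ∈ Ioo (0 : ℝ) 1) {c : ℂ}
    {ρ : ℝ} (hc : l₁ + x * (l₂ - l₁) ∈ ball c ρ) :
    IsPreconnected (ball c ρ ∩ slitDomain l₁ l₂) :=
  ((starConvex_ball_inter_slitDomain hl hx hc).isPathConnected
    ⟨hc, add_mul_mem_slitDomain hl hx⟩).isConnected.isPreconnected

lemma not_mem_slitDomain_iff (hl : l₁ ≠ l₂) {z : ℂ} : z ∉ slitDomain l₁ l₂ ↔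
    ∃ s : ℝ, (s ≤ 0 ∨ 1 ≤ s) ∧ z = l₁ + s * (l₂ - l₁) := by
  have hδ : l₂ - l₁ ≠ 0 := sub_ne_zero.2 hl.symm
  constructor
  · intro h
    set u := (z - l₁) / (l₂ - l₁) with hu
    have hz : z = l₁ + u * (l₂ - l₁) := by rw [hu]; field_simp; ring
    have h' : ¬ (u ∈ Complex.slitPlane ∧ 1 - u ∈ Complex.slitPlane) := h
    rw [Complex.mem_slitPlane_iff, Complex.mem_slitPlane_iff] at h'
    simp only [Complex.sub_re, Complex.one_re, Complex.sub_im, Complex.one_im, zero_sub, ne_eq,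
      neg_eq_zero] at h'
    by_cases him : u.im = 0
    · refine ⟨u.re, ?_, ?_⟩
      · by_contra! hcon
        exact h' ⟨Or.inl hcon.1, Or.inl (by linarith)⟩
      · rw [hz]
        congr 2
        exact Complex.ext rfl (by simpa using him)
    · exact absurd ⟨Or.inr him, Or.inr him⟩ h'
  · rintro ⟨s, hs, rfl⟩ ⟨h1, h2⟩
    have e : (l₁ + s * (l₂ - l₁) - l₁) / (l₂ - l₁) = s := by field_simp; ring
    rw [e] at h1 h2
    rw [← Complex.ofReal_one, ← Complex.ofReal_sub, Complex.ofReal_mem_slitPlane] at h2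
    rw [Complex.ofReal_mem_slitPlane] at h1
    rcases hs with hs | hs <;> linarith

/-- Away from the ends of the rays the two sides are the half discs on which the imaginary part of
the affine coordinate is positive or negative. -/
lemma twoSided_compl_slitDomain (hl : l₁ ≠ l₂) {s : ℝ} (hs : s < 0 ∨ 1 < s) :
    TwoSided (slitDomain l₁ l₂)ᶜ (l₁ + s * (l₂ - l₁)) := by
  intro ε hε
  have hδ : l₂ - l₁ ≠ 0 := sub_ne_zero.2 hl.symm
  have hδn : 0 < ‖l₂ - l₁‖ := norm_pos_iff.2 hδ
  obtain ⟨τ, hτ, hτs⟩ : ∃ τ > 0, ∀ s' : ℝ, |s' - s| < τ → s' ≤ 0 ∨ 1 ≤ s' := by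
    rcases hs with hs | hs
    · exact ⟨-s, by linarith, fun s' h => Or.inl (by linarith [(abs_lt.1 h).2])⟩
    · exact ⟨s - 1, by linarith, fun s' h => Or.inr (by linarith [(abs_lt.1 h).1])⟩
  set P := l₁ + s * (l₂ - l₁) with hP
  set η := min (ε / 2) (τ * ‖l₂ - l₁‖) with hη
  let f : ℂ → ℝ := fun z => ((z - l₁) / (l₂ - l₁)).im
  have hf0 : ∀ z ∈ ball P η, z ∈ (slitDomain l₁ l₂)ᶜ ↔ f z = 0 := by
    intro z hz
    rw [mem_compl_iff, not_mem_slitDomain_iff hl]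
    constructor
    · rintro ⟨s', -, rfl⟩
      have e : (l₁ + s' * (l₂ - l₁) - l₁) / (l₂ - l₁) = s' := by field_simp; ring
      simp only [f, e, Complex.ofReal_im]
    · intro h0
      set u := (z - l₁) / (l₂ - l₁) with hu
      have hz' : z = l₁ + (u.re : ℂ) * (l₂ - l₁) := by
        have : u = (u.re : ℂ) := Complex.ext rfl (by simpa [f] using h0)
        rw [← this, hu]; field_simp; ring
      refine ⟨u.re, hτs _ ?_, hz'⟩
      have h1 : dist z P < τ * ‖l₂ - l₁‖ := lt_of_lt_of_le hz (min_le_right _ _)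
      rw [dist_eq_norm, hz', hP, show l₁ + (u.re : ℂ) * (l₂ - l₁) - (l₁ + s * (l₂ - l₁)) =
        ((u.re - s : ℝ) : ℂ) * (l₂ - l₁) by push_cast; ring, norm_mul, Complex.norm_real] at h1
      exact lt_of_mul_lt_mul_right h1 hδn.le
  have haff : ∀ (x y : ℂ) (a b : ℝ), a + b = 1 → f (a • x + b • y) = a * f x + b * f y := by
    intro x y a b hab
    have habc : (a : ℂ) + b = 1 := by exact_mod_cast hab
    have : (a • x + b • y - l₁) / (l₂ - l₁) = (a : ℂ) * ((x - l₁) / (l₂ - l₁)) + b * ((y - l₁) / (l₂ - l₁)) := by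
      simp only [Complex.real_smul]
      field_simp
      linear_combination l₁ * habc
    simp only [f, this, Complex.add_im, Complex.im_ofReal_mul]
  have hcl : ∀ (κ : ℝ) (z : ℂ), z ∈ ball P η → f z = 0 → κ ≠ 0 →
      Tendsto (fun x : ℝ => z + x * κ * Complex.I * (l₂ - l₁)) (𝓝[>] 0) (𝓝 z) ∧
      ∀ᶠ x : ℝ in 𝓝[>] (0 : ℝ), z + x * κ * Complex.I * (l₂ - l₁) ∈ ball P η ∧
        f (z + x * κ * Complex.I * (l₂ - l₁)) = x * κ := by
    intro κ z hz h0 hκ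
    have ht : Tendsto (fun x : ℝ => z + x * κ * Complex.I * (l₂ - l₁)) (𝓝[>] 0) (𝓝 z) := by
      have hc : Continuous fun x : ℝ => z + x * κ * Complex.I * (l₂ - l₁) := by fun_prop
      have := (hc.tendsto 0).mono_left (nhdsWithin_le_nhds (s := Ioi 0))
      simpa using this
    refine ⟨ht, (ht.eventually (isOpen_ball.mem_nhds hz)).mono fun x hx => ⟨hx, ?_⟩⟩
    have : (z + x * κ * Complex.I * (l₂ - l₁) - l₁) / (l₂ - l₁) =
        (z - l₁) / (l₂ - l₁) + ((x * κ : ℝ) : ℂ) * Complex.I := by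
      push_cast; field_simp; ring
    simp only [f, this, Complex.add_im, Complex.im_ofReal_mul, Complex.I_im, mul_one]
    simpa [f] using h0
  refine ⟨η, lt_min (by linarith) (by positivity), lt_of_le_of_lt (min_le_left _ _) (by linarith),
    {z | z ∈ ball P η ∧ 0 < f z}, {z | z ∈ ball P η ∧ f z < 0}, ?_, ?_, ?_, ?_⟩
  · refine Convex.isPreconnected ?_
    rintro x ⟨hx, hx'⟩ y ⟨hy, hy'⟩ a b ha hb hab
    refine ⟨convex_ball P η hx hy ha hb hab, ?_⟩
    rw [haff x y a b hab]
    rcases ha.eq_or_lt with rfl | ha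
    · rw [zero_add] at hab; subst hab; linarith
    · nlinarith [mul_pos ha hx', mul_nonneg hb hy'.le]
  · refine Convex.isPreconnected ?_
    rintro x ⟨hx, hx'⟩ y ⟨hy, hy'⟩ a b ha hb hab
    refine ⟨convex_ball P η hx hy ha hb hab, ?_⟩
    rw [haff x y a b hab]
    rcases ha.eq_or_lt with rfl | ha
    · rw [zero_add] at hab; subst hab; linarith
    · nlinarith [mul_pos ha (neg_pos.2 hx'), mul_nonneg hb (neg_pos.2 hy').le]
  · ext z
    constructor
    · rintro ⟨hz, hzK⟩
      rw [hf0 z hz] at hzK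
      rcases lt_or_gt_of_ne hzK with h | h
      · exact Or.inr ⟨hz, h⟩
      · exact Or.inl ⟨hz, h⟩
    · rintro (⟨hz, h⟩ | ⟨hz, h⟩)
      · exact ⟨hz, fun hK => h.ne' ((hf0 z hz).1 hK)⟩
      · exact ⟨hz, fun hK => h.ne ((hf0 z hz).1 hK)⟩
  · intro z hz hzK
    have h0 := (hf0 z hz).1 hzK
    constructor
    · obtain ⟨ht, hev⟩ := hcl 1 z hz h0 one_ne_zero
      refine mem_closure_of_tendsto ht ?_
      filter_upwards [hev, self_mem_nhdsWithin] with x hx hx0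
      exact ⟨hx.1, by rw [hx.2, mul_one]; exact hx0⟩
    · obtain ⟨ht, hev⟩ := hcl (-1) z hz h0 (by norm_num)
      refine mem_closure_of_tendsto ht ?_
      filter_upwards [hev, self_mem_nhdsWithin] with x hx hx0
      exact ⟨hx.1, by rw [hx.2]; linarith [mem_Ioi.1 hx0]⟩

end Slit

/-! ### Comparison of arbitrary cuts with the two rays -/

/-- The integral along the segment from `l₁` to `l₂`, without the constant factor. -/
noncomputable def legIntegral (h n : ℂ → ℂ) (a : ℕ) (l₁ l₂ : ℂ) : ℂ :=
  ∫ u in (0 : ℝ)..1, h (l₁ + u * (l₂ - l₁)) * n (l₁ + u * (l₂ - l₁)) *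
    ((u : ℂ) ^ (-(a / 3 : ℂ)) * (1 - (u : ℂ)) ^ (-(a / 3 : ℂ)))

lemma intervalIntegrable_beta {a : ℕ} (ha : a = 1 ∨ a = 2) :
    IntervalIntegrable (fun u : ℝ => (u : ℂ) ^ (-(a / 3 : ℂ)) * (1 - (u : ℂ)) ^ (-(a / 3 : ℂ)))
      MeasureTheory.volume 0 1 := by
  have h0 : 0 < (1 - (a / 3 : ℂ)).re := by
    rcases ha with rfl | rfl <;> norm_num
  have := Complex.betaIntegral_convergent h0 h0
  simpa using this

/-- The comparison of an arbitrary system of cuts that end at `l₁` and `l₂` with the two rays. -/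
theorem IsBranchPrimitive.cube_eq_legIntegral {K : Set ℂ} {R h g F n : ℂ → ℂ} {c l₁ l₂ α : ℂ}
    {r ε₁ ε₂ : ℝ} {W₁ W₂ : ℂ → ℂ → ℂ} {a : ℕ} (ha : a = 1 ∨ a = 2) (hl : l₁ ≠ l₂)
    (hl₁ : l₁ ∈ ball c r) (hl₂ : l₂ ∈ ball c r) (hε₁ : 0 < ε₁) (hε₂ : 0 < ε₂)
    (hn : DifferentiableOn ℂ n (ball c r))
    (hR : ∀ x ∈ ball c r, x ≠ l₁ → x ≠ l₂ → R x * ((x - l₁) * (x - l₂)) ^ a = n x ^ 3)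
    (H : IsBranchPrimitive (ball c r \ {l₁, l₂}) K R h g F)
    (hW₁ : IsEndIntegral R h l₁ ε₁ W₁) (hW₂ : IsEndIntegral R h l₂ ε₂ W₂)
    (hsub₁ : ball l₁ ε₁ \ {l₁} ⊆ ball c r \ {l₁, l₂}) (hsub₂ : ball l₂ ε₂ \ {l₂} ⊆ ball c r \ {l₁, l₂})
    (e₁ : ∀ x ∈ ball l₁ ε₁ \ K, F x = W₁ x (g x))
    (e₂ : ∀ x ∈ ball l₂ ε₂ \ K, F x = α + W₂ x (g x))
    (hconn : IsPreconnected ((ball c r \ {l₁, l₂}) \ K))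
    (hadm : ∀ P ∈ ball c r \ {l₁, l₂}, P ∈ K →
      HoldsAt (ball c r \ {l₁, l₂}) K R h g F (QAdm (eisensteinMultiples α)) P) :
    ∃ c₀ : ℂ, c₀ ^ 3 * (-(l₂ - l₁) ^ 2) ^ a = 1 ∧
      α ^ 3 = ((l₂ - l₁) * c₀ * legIntegral h n a l₁ l₂) ^ 3 := by
  set δ := l₂ - l₁ with hδdef
  have hδ : δ ≠ 0 := sub_ne_zero.2 hl.symm
  have hδn : 0 < ‖δ‖ := norm_pos_iff.2 hδ
  set K₂ := (slitDomain l₁ l₂)ᶜ with hK₂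
  have hrpos : 0 < r := pos_of_mem_ball hl₁
  -- The constant comes from `(z - l₁) (z - l₂) = -δ ^ 2 u (1 - u)`, where `u` is the affine
  -- coordinate. The choice of the cube root is immaterial, as the result concerns a cube.
  obtain ⟨c₀, hc₀⟩ : ∃ c₀ : ℂ, c₀ ^ 3 = ((-δ ^ 2) ^ a)⁻¹ := by
    refine ⟨(((-δ ^ 2) ^ a)⁻¹) ^ (1 / 3 : ℂ), ?_⟩
    rw [← Complex.cpow_nat_mul]
    norm_num
  have hδa : (-δ ^ 2) ^ a ≠ 0 := pow_ne_zero _ (neg_ne_zero.2 (pow_ne_zero 2 hδ))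
  have hc₀' : c₀ ^ 3 * (-δ ^ 2) ^ a = 1 := by rw [hc₀, inv_mul_cancel₀ hδa]
  refine ⟨c₀, hc₀', ?_⟩
  let u : ℂ → ℂ := fun z => (z - l₁) / δ
  have hu : ∀ z, z = l₁ + u z * δ := fun z => by simp only [u]; field_simp; ring
  let g₂ : ℂ → ℂ := fun z => c₀ * n z * (u z ^ (-(a / 3 : ℂ)) * (1 - u z) ^ (-(a / 3 : ℂ)))
  have hud : Differentiable ℂ u := by fun_prop
  have hg₂d : DifferentiableOn ℂ g₂ (ball c r ∩ slitDomain l₁ l₂) := by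
    refine ((differentiableOn_const c₀).mul (hn.mono inter_subset_left)).mul ?_
    refine DifferentiableOn.mul ?_ ?_
    · exact hud.differentiableOn.cpow_const fun z hz => hz.2.1
    · exact ((differentiable_const (1 : ℂ)).sub hud).differentiableOn.cpow_const fun z hz => hz.2.2
  have hsl : ∀ z, z ∈ slitDomain l₁ l₂ → u z ≠ 0 ∧ 1 - u z ≠ 0 := fun z hz =>
    ⟨Complex.slitPlane_ne_zero hz.1, Complex.slitPlane_ne_zero hz.2⟩
  have hpow : ∀ w : ℂ, (w ^ (-(a / 3 : ℂ))) ^ 3 = (w ^ a)⁻¹ := fun w => by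
    rw [← Complex.cpow_nat_mul, ← Complex.cpow_natCast w a, ← Complex.cpow_neg]
    congr 1
    push_cast
    ring
  have hg₂3 : ∀ z ∈ ball c r ∩ slitDomain l₁ l₂, g₂ z ^ 3 = R z := by
    intro z hz
    obtain ⟨h1, h2⟩ := hsl z hz.2
    have e : (z - l₁) * (z - l₂) = -δ ^ 2 * (u z * (1 - u z)) := by
      conv_lhs => rw [hu z]
      rw [hδdef]; ring
    have h3 := hR z hz.1 (by rintro rfl; exact h1 (by simp only [u, sub_self, zero_div]))
      (by rintro rfl; exact h2 (by simp only [u]; rw [← hδdef, div_self hδ, sub_self]))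
    rw [e, mul_pow, mul_pow] at h3
    simp only [g₂]
    rw [mul_pow, mul_pow, mul_pow, hpow, hpow, hc₀, ← h3]
    field_simp
  have hmid : l₁ + ((1 / 2 : ℝ) : ℂ) * (l₂ - l₁) ∈ ball c r := by
    have := convex_ball c r hl₁ hl₂ (show (0 : ℝ) ≤ 1 / 2 by norm_num) (show (0 : ℝ) ≤ 1 / 2 by norm_num)
      (by norm_num)
    convert this using 1
    simp only [Complex.real_smul]
    push_cast
    ring
  have hseg : ∀ s : ℝ, s ∈ Icc (0 : ℝ) 1 → l₁ + s * δ ∈ ball c r := fun s hs => by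
    have := convex_ball c r hl₁ hl₂ (sub_nonneg.2 hs.2) hs.1 (by ring)
    convert this using 1
    simp only [Complex.real_smul, hδdef]
    push_cast
    ring
  have hhalf : (1 / 2 : ℝ) ∈ Ioo (0 : ℝ) 1 := ⟨by norm_num, by norm_num⟩
  have hopen : IsOpen (ball c r ∩ slitDomain l₁ l₂) := isOpen_ball.inter (isOpen_slitDomain l₁ l₂)
  obtain ⟨F₀, hF₀⟩ := exists_primitive_starConvex hopen
    (starConvex_ball_inter_slitDomain hl hhalf hmid) (H.differentiable.differentiableOn.mul hg₂d)
  have hl₁K : l₁ ∈ K₂ := (not_mem_slitDomain_iff hl).2 ⟨0, Or.inl le_rfl, by simp⟩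
  have hl₂K : l₂ ∈ K₂ := (not_mem_slitDomain_iff hl).2 ⟨1, Or.inr le_rfl, by simp⟩
  have hDK : (ball c r \ {l₁, l₂}) \ K₂ = ball c r ∩ slitDomain l₁ l₂ := by
    ext z
    simp only [hK₂, Set.mem_sdiff, mem_compl_iff, not_not, mem_inter_iff, mem_insert_iff,
      mem_singleton_iff]
    constructor
    · exact fun hz => ⟨hz.1.1, hz.2⟩
    · refine fun hz => ⟨⟨hz.1, ?_⟩, hz.2⟩
      rintro (rfl | rfl)
      · exact hl₁K hz.2
      · exact hl₂K hz.2
  have hballs : ∀ {l ε}, l ∈ ball c r → ball l ε \ {l} ⊆ ball c r \ {l₁, l₂} → ball l ε ⊆ ball c r := by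
    intro l ε hlc hsub z hz
    by_cases hzl : z = l
    · rwa [hzl]
    · exact (hsub ⟨hz, hzl⟩).1
  have hb₁ := hballs hl₁ hsub₁
  have hb₂ := hballs hl₂ hsub₂
  have hnear₁ : ∃ x ∈ Ioo (0 : ℝ) 1, l₁ + x * (l₂ - l₁) ∈ ball l₁ ε₁ := by
    have ht : Tendsto (fun x : ℝ => l₁ + x * (l₂ - l₁)) (𝓝[>] 0) (𝓝 l₁) := by
      have hc : Continuous fun x : ℝ => l₁ + x * (l₂ - l₁) := by fun_prop
      simpa using (hc.tendsto 0).mono_left (nhdsWithin_le_nhds (s := Ioi 0))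
    obtain ⟨x, hx, hx'⟩ := ((ht.eventually (ball_mem_nhds l₁ hε₁)).and
      (Ioo_mem_nhdsGT zero_lt_one)).exists
    exact ⟨x, hx', hx⟩
  have htend₂ : Tendsto (fun x : ℝ => l₁ + x * (l₂ - l₁)) (𝓝[<] 1) (𝓝 l₂) := by
    have hc : Continuous fun x : ℝ => l₁ + x * (l₂ - l₁) := by fun_prop
    simpa using (hc.tendsto 1).mono_left (nhdsWithin_le_nhds (s := Iio 1))
  have htend₁ : Tendsto (fun x : ℝ => l₁ + x * (l₂ - l₁)) (𝓝[>] 0) (𝓝 l₁) := by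
    have hc : Continuous fun x : ℝ => l₁ + x * (l₂ - l₁) := by fun_prop
    simpa using (hc.tendsto 0).mono_left (nhdsWithin_le_nhds (s := Ioi 0))
  have hnear₂ : ∃ x ∈ Ioo (0 : ℝ) 1, l₁ + x * (l₂ - l₁) ∈ ball l₂ ε₂ := by
    obtain ⟨x, hx, hx'⟩ := ((htend₂.eventually (ball_mem_nhds l₂ hε₂)).and
      (Ioo_mem_nhdsLT zero_lt_one)).exists
    exact ⟨x, hx', hx⟩
  obtain ⟨x₁, hx₁, hx₁'⟩ := hnear₁
  obtain ⟨x₂, hx₂, hx₂'⟩ := hnear₂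
  -- The disc about an end of the segment remains connected when cut by the rays, so there the
  -- primitive is a constant plus the integral from that end.
  have hend : ∀ {l ε W x}, IsEndIntegral R h l ε W → l ∈ K₂ → ball l ε ⊆ ball c r → x ∈ Ioo (0 : ℝ) 1 →
      l₁ + x * (l₂ - l₁) ∈ ball l ε →
      ∃ E, ∀ z ∈ ball l ε ∩ slitDomain l₁ l₂, F₀ z = E + W z (g₂ z) := by
    intro l ε W x hW hlK hb hx hx'
    have hsub : ball l ε ∩ slitDomain l₁ l₂ ⊆ ball c r ∩ slitDomain l₁ l₂ :=
      inter_subset_inter_left _ hb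
    exact hW.exists_eq _ (isOpen_ball.inter (isOpen_slitDomain l₁ l₂))
      (isPreconnected_ball_inter_slitDomain hl hx hx') inter_subset_left (fun hl' => hlK hl'.2) g₂ F₀
      (hg₂d.continuousOn.mono hsub) (fun z hz => hg₂3 z (hsub hz)) (fun z hz => hF₀ z (hsub hz))
  obtain ⟨E₁, hE₁⟩ := hend hW₁ hl₁K hb₁ hx₁ hx₁'
  obtain ⟨E₂, hE₂⟩ := hend hW₂ hl₂K hb₂ hx₂ hx₂'
  set β := E₂ - E₁ with hβ
  have H₂ : IsBranchPrimitive (ball c r \ {l₁, l₂}) K₂ R h g₂ (fun z => F₀ z - E₁) := by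
    refine IsBranchPrimitive.sub_const ⟨H.isOpen, (isOpen_slitDomain l₁ l₂).isClosed_compl,
      H.differentiableOn, H.ne_zero, H.differentiable, ?_, ?_, ?_⟩ E₁
    · rw [hDK]; exact hg₂d.continuousOn
    · rw [hDK]; exact hg₂3
    · rw [hDK]; exact hF₀
  have hKc : ∀ z, z ∉ K₂ ↔ z ∈ slitDomain l₁ l₂ := fun z => by simp [hK₂]
  have e₁' : ∀ x ∈ ball l₁ ε₁ \ K₂, F₀ x - E₁ = W₁ x (g₂ x) := fun x hx => by
    rw [hE₁ x ⟨hx.1, (hKc x).1 hx.2⟩]; ring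
  have e₂' : ∀ x ∈ ball l₂ ε₂ \ K₂, F₀ x - E₁ = β + W₂ x (g₂ x) := fun x hx => by
    rw [hE₂ x ⟨hx.1, (hKc x).1 hx.2⟩, hβ]; ring
  -- Each ray is a leg that issues from one of the branch points, so the germs on it are of the form
  -- `QTerm` with `0` or `β`.
  have hadm₂ : ∀ P ∈ ball c r \ {l₁, l₂}, P ∈ K₂ → HoldsAt (ball c r \ {l₁, l₂}) K₂ R h g₂
      (fun z => F₀ z - E₁) (QAdm (eisensteinMultiples β)) P := by
    intro P hP hPK
    obtain ⟨s, hs, rfl⟩ := (not_mem_slitDomain_iff hl).1 hPK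
    have hs0 : s ≠ 0 := by
      rintro rfl
      exact hP.2 (by simp)
    have hs1 : s ≠ 1 := by
      rintro rfl
      exact hP.2 (by simp)
    have hcont : Continuous fun x : ℝ => l₁ + x * (l₂ - l₁) := by fun_prop
    obtain ⟨τ, hτ, hball⟩ := Metric.isOpen_iff.1 (isOpen_ball.preimage hcont) s hP.1
    have hinB : ∀ x : ℝ, ∀ p ∈ ({0, 1} : Set ℝ), ∀ q : ℝ, l₁ + q * (l₂ - l₁) ∈ ball c r → ∀ t ∈ Icc (0:ℝ) 1,
        x = (1 - t) * p + t * q → l₁ + x * (l₂ - l₁) ∈ ball c r := by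
      intro x p hp q hq t ht hx
      have hpb : l₁ + p * (l₂ - l₁) ∈ ball c r := by
        rcases hp with rfl | rfl
        · simpa using hl₁
        · simpa using hl₂
      have := convex_ball c r hpb hq (sub_nonneg.2 ht.2) ht.1 (by ring)
      convert this using 1
      simp only [Complex.real_smul, hx]
      push_cast
      ring
    rcases hs with hs | hs
    · have hs' : s < 0 := lt_of_le_of_ne hs hs0
      -- The leg is followed slightly beyond the given point, so that this point has an interior
      -- parameter; it stays in the disc by convexity.
      have hq : l₁ + ((s - τ / 2 : ℝ) : ℂ) * (l₂ - l₁) ∈ ball c r := hball (by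
        rw [mem_ball, Real.dist_eq, abs_lt]; constructor <;> linarith)
      have hγ : ∀ x ∈ Ioo 0 (-(s - τ / 2)), l₁ + ((-x : ℝ) : ℂ) * (l₂ - l₁) ∈ (ball c r \ {l₁, l₂}) ∩ K₂ := by
        intro x hx
        refine ⟨⟨hinB (-x) 0 (by simp) _ hq (x / (-(s - τ / 2)))
          ⟨by apply div_nonneg <;> linarith [hx.1, hx.2],
            by rw [div_le_one (by linarith [hx.1, hx.2])]; exact hx.2.le⟩ ?_, ?_⟩,
          (not_mem_slitDomain_iff hl).2 ⟨-x, Or.inl (by linarith [hx.1]), rfl⟩⟩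
        · have : s - τ / 2 ≠ 0 := by linarith
          rw [mul_zero, zero_add, div_neg, neg_mul, div_mul_cancel₀ _ this]
        · rintro (h | h)
          · have := mul_ne_zero (Complex.ofReal_ne_zero.2 (neg_ne_zero.2 hx.1.ne')) hδ
            exact this (by linear_combination h)
          · have h2 : ((-x - 1 : ℝ) : ℂ) * δ = 0 := by
              push_cast; rw [hδdef]; push_cast at h; linear_combination (mem_singleton_iff.1 h)
            rcases mul_eq_zero.1 h2 with h3 | h3
            · have := Complex.ofReal_eq_zero.1 h3
              linarith [hx.1]
            · exact hδ h3
      have := H₂.holdsAt_qTerm_of_leg (F₀ := 0) hW₁ hε₁ hsub₁ (by simp) (fun x hx => by rw [e₁' x hx, zero_add])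
        (γ := fun x : ℝ => l₁ + ((-x : ℝ) : ℂ) * (l₂ - l₁)) (b := -(s - τ / 2)) (by fun_prop)
        (fun x hx => (hγ x hx).2) (fun x hx => (hγ x hx).1)
        (fun x hx => twoSided_compl_slitDomain hl (Or.inl (by linarith [hx.1]))) (by
          have hc : Continuous fun x : ℝ => l₁ + ((-x : ℝ) : ℂ) * (l₂ - l₁) := by fun_prop
          simpa using (hc.tendsto 0).mono_left (nhdsWithin_le_nhds (s := Ioi 0)))
        (s := -s) ⟨by linarith, by linarith⟩
      simp only [neg_neg] at this
      exact this.imp fun S hS => hS.qAdm (Or.inl rfl)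
    · have hs' : 1 < s := lt_of_le_of_ne hs hs1.symm
      have hq : l₁ + ((s + τ / 2 : ℝ) : ℂ) * (l₂ - l₁) ∈ ball c r := hball (by
        rw [mem_ball, Real.dist_eq, abs_lt]; constructor <;> linarith)
      have hγ : ∀ x ∈ Ioo 0 (s + τ / 2 - 1), l₁ + ((1 + x : ℝ) : ℂ) * (l₂ - l₁) ∈ (ball c r \ {l₁, l₂}) ∩ K₂ := by
        intro x hx
        refine ⟨⟨hinB (1 + x) 1 (by simp) _ hq (x / (s + τ / 2 - 1))
          ⟨by apply div_nonneg <;> linarith [hx.1, hx.2],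
            by rw [div_le_one (by linarith [hx.1, hx.2])]; exact hx.2.le⟩ ?_, ?_⟩,
          (not_mem_slitDomain_iff hl).2 ⟨1 + x, Or.inr (by linarith [hx.1]), rfl⟩⟩
        · have : s + τ / 2 - 1 ≠ 0 := by linarith
          linear_combination -div_mul_cancel₀ x this
        · rintro (h | h)
          · have := mul_ne_zero (Complex.ofReal_ne_zero.2 (by linarith [hx.1] : (1 + x : ℝ) ≠ 0)) hδ
            exact this (by linear_combination h)
          · have h2 : ((x : ℝ) : ℂ) * δ = 0 := by
              rw [hδdef]; push_cast at h; linear_combination (mem_singleton_iff.1 h)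
            rcases mul_eq_zero.1 h2 with h3 | h3
            · have := Complex.ofReal_eq_zero.1 h3
              linarith [hx.1]
            · exact hδ h3
      have := H₂.holdsAt_qTerm_of_leg (F₀ := β) hW₂ hε₂ hsub₂ (by simp) e₂'
        (γ := fun x : ℝ => l₁ + ((1 + x : ℝ) : ℂ) * (l₂ - l₁)) (b := s + τ / 2 - 1) (by fun_prop)
        (fun x hx => (hγ x hx).2) (fun x hx => (hγ x hx).1)
        (fun x hx => twoSided_compl_slitDomain hl (Or.inr (by linarith [hx.1]))) (by
          have hc : Continuous fun x : ℝ => l₁ + ((1 + x : ℝ) : ℂ) * (l₂ - l₁) := by fun_prop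
          simpa using (hc.tendsto 0).mono_left (nhdsWithin_le_nhds (s := Ioi 0)))
        (s := s - 1) ⟨by linarith, by linarith⟩
      simp only [add_sub_cancel] at this
      exact this.imp fun S hS => hS.qAdm (Or.inr rfl)
  have hcube := H.cube_eq_cube H₂ hW₁ hW₂ hsub₁ hsub₂ hl₁K hl₂K
    ⟨_, hx₁', fun hK => hK (add_mul_mem_slitDomain hl hx₁)⟩
    ⟨_, hx₂', fun hK => hK (add_mul_mem_slitDomain hl hx₂)⟩ e₁ e₂ e₁' e₂' hconn
    (by rw [hDK]; exact isPreconnected_ball_inter_slitDomain hl hhalf hmid) hadm hadm₂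
  rw [hcube]
  congr 1
  -- The open segment avoids the rays. The primitive along it tends to `0` and to `β` at the ends,
  -- because `W` is small there whatever the branch; so `β` is the improper integral of its
  -- derivative.
  have hlim : ∀ (l : ℂ) (ε : ℝ) (W : ℂ → ℂ → ℂ) (E : ℂ) (f : Filter ℝ), 0 < ε → l ∈ K₂ → IsEndIntegral R h l ε W →
      ball l ε ⊆ ball c r →
      (∀ x ∈ ball l ε \ K₂, F₀ x - E₁ = E + W x (g₂ x)) → f ≤ 𝓟 (Ioo 0 1) →
      Tendsto (fun x : ℝ => l₁ + x * (l₂ - l₁)) f (𝓝 l) →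
      Tendsto (fun x : ℝ => F₀ (l₁ + x * (l₂ - l₁)) - E₁) f (𝓝 E) := by
    intro l ε W E f hε hlK hW hb hFE hf ht
    have hne : ∀ x ∈ Ioo (0 : ℝ) 1, l₁ + x * (l₂ - l₁) ≠ l := fun x hx h =>
      hlK (h ▸ add_mul_mem_slitDomain hl hx)
    have ht' : Tendsto (fun x : ℝ => l₁ + x * (l₂ - l₁)) f (𝓝[≠] l) :=
      tendsto_nhdsWithin_iff.2 ⟨ht, Eventually.mono (le_principal_iff.1 hf) hne⟩
    rw [Metric.tendsto_nhds]
    intro η hη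
    filter_upwards [ht'.eventually (hW.small η hη), le_principal_iff.1 hf,
      ht.eventually (ball_mem_nhds l hε)] with x h1 h2 h3
    rw [hFE _ ⟨h3, fun hK => hK (add_mul_mem_slitDomain hl h2)⟩, dist_eq_norm, add_sub_cancel_left]
    exact h1 _ (hg₂3 _ ⟨hb h3, add_mul_mem_slitDomain hl h2⟩)
  have hI := intervalIntegral.integral_eq_sub_of_hasDerivAt_of_tendsto (zero_lt_one (α := ℝ))
    (f := fun x : ℝ => F₀ (l₁ + x * (l₂ - l₁)) - E₁)
    (f' := fun x : ℝ => δ * c₀ * (h (l₁ + x * (l₂ - l₁)) * n (l₁ + x * (l₂ - l₁)) *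
      ((x : ℂ) ^ (-(a / 3 : ℂ)) * (1 - (x : ℂ)) ^ (-(a / 3 : ℂ))))) (fun x hx => by
        have h1 : HasDerivAt (fun x : ℝ => l₁ + (x : ℂ) * (l₂ - l₁)) (l₂ - l₁) x := by
          simpa using ((Complex.ofRealCLM.hasDerivAt (x := x)).mul_const (l₂ - l₁)).const_add l₁
        have hm := add_mul_mem_slitDomain hl hx
        have hm' : l₁ + x * (l₂ - l₁) ∈ ball c r := hseg x ⟨hx.1.le, hx.2.le⟩
        refine (((hF₀ _ ⟨hm', hm⟩).comp x h1).sub_const E₁).congr_deriv ?_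
        have e : u (l₁ + x * (l₂ - l₁)) = x := by simp only [u, hδdef]; field_simp; ring
        simp only [Pi.mul_apply, g₂, e]
        ring) (by
        refine IntervalIntegrable.const_mul ?_ _
        refine (intervalIntegrable_beta ha).continuousOn_mul ?_
        rw [uIcc_of_le zero_le_one]
        refine ContinuousOn.mul (H.differentiable.continuous.comp_continuousOn (by fun_prop)) ?_
        exact hn.continuousOn.comp (by fun_prop) fun x hx => hseg x hx)
    (hlim l₁ ε₁ W₁ 0 _ hε₁ hl₁K hW₁ hb₁ (fun x hx => by rw [e₁' x hx, zero_add])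
      (le_principal_iff.2 (Ioo_mem_nhdsGT zero_lt_one)) htend₁)
    (hlim l₂ ε₂ W₂ β _ hε₂ hl₂K hW₂ hb₂ e₂' (le_principal_iff.2 (Ioo_mem_nhdsLT zero_lt_one)) htend₂)
  rw [intervalIntegral.integral_const_mul, sub_zero] at hI
  exact hI.symm

/-! ### The shape of an embedded tree -/

lemma IsPolygonalArc.exists_derivWithin {γ : ℝ → ℂ} (h : IsPolygonalArc γ) :
    derivWithin γ (Icc 0 1) 0 ≠ 0 ∧ ∃ ε > 0, ε ≤ 1 ∧
      ∀ x ∈ Icc (0 : ℝ) ε, γ x = γ 0 + x * derivWithin γ (Icc 0 1) 0 := by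
  obtain ⟨ε, hε, h1, d, hd, h2⟩ := h.exists_right ⟨le_rfl, zero_lt_one⟩
  have hderiv : HasDerivWithinAt γ d (Icc 0 1) 0 := by
    have h3 : HasDerivWithinAt (fun x : ℝ => γ 0 + x * d) d (Icc 0 1) 0 := by
      simpa using (((Complex.ofRealCLM.hasDerivAt (x := (0 : ℝ))).mul_const d).const_add
        (γ 0)).hasDerivWithinAt (s := Icc (0 : ℝ) 1)
    refine h3.congr_of_eventuallyEq ?_ (by simp)
    filter_upwards [self_mem_nhdsWithin, mem_nhdsWithin_of_mem_nhds (Iio_mem_nhds hε)] with x hx hx2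
    simpa using h2 x ⟨hx.1, le_of_lt hx2⟩
  have e := hderiv.derivWithin (uniqueDiffOn_Icc zero_lt_one 0 ⟨le_rfl, zero_le_one⟩)
  rw [e]
  exact ⟨hd, ε, hε, by linarith, fun x hx => by simpa using h2 x hx⟩

/-- Removing an arc, of which an initial piece is outside the connected open set `V`. -/
lemma IsPolygonalArc.isPreconnected_diff {γ : ℝ → ℂ} (h : IsPolygonalArc γ) {V : Set ℂ}
    (hV : IsOpen V) (hVc : IsPreconnected V) {s₀ : ℝ} (hs₀ : s₀ ∈ Ico (0 : ℝ) 1)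
    (hout : ∀ s ∈ Icc 0 s₀, γ s ∉ V) (hin : ∀ s ∈ Ioc s₀ 1, γ s ∈ V) :
    IsPreconnected (V \ γ '' Icc 0 1) := by
  have hcl : IsClosed (γ '' Icc 0 1) := (isCompact_Icc.image_of_continuousOn h.continuousOn).isClosed
  refine isPreconnected_diff_arc hV hVc hs₀.2 (h.continuousOn.mono fun s hs => ⟨hs₀.1.trans hs.1.le, hs.2⟩)
    (fun z hz => ?_) hin (hV.sdiff hcl) (fun s hs => ?_) ?_
  · constructor
    · rintro ⟨s, hs, rfl⟩
      refine ⟨s, ⟨?_, hs.2⟩, rfl⟩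
      by_contra! h'
      exact hout s ⟨hs.1, h'⟩ hz
    · rintro ⟨s, hs, rfl⟩
      exact ⟨s, ⟨hs₀.1.trans hs.1.le, hs.2⟩, rfl⟩
  · obtain ⟨θ₁, θ₂, h1, h2, h3⟩ := h.exists_starAt ⟨hs₀.1.trans_lt hs.1, hs.2⟩
    exact h3.twoSided h1 h2
  · obtain ⟨θ, hθ⟩ := h.reverse.exists_starAt_zero
    have e : (fun s => γ (1 - s)) '' Icc (0 : ℝ) 1 = γ '' Icc 0 1 := by
      ext z
      constructor
      · rintro ⟨s, hs, rfl⟩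
        exact ⟨1 - s, ⟨by linarith [hs.2], by linarith [hs.1]⟩, rfl⟩
      · rintro ⟨s, hs, rfl⟩
        exact ⟨1 - s, ⟨by linarith [hs.2], by linarith [hs.1]⟩, by simp⟩
    rw [e, sub_zero] at hθ
    exact hθ.oneSided

namespace MarkedBinaryTree

variable {V : Type*} [Fintype V] {T : MarkedBinaryTree V}

lemma exists_adj (T : MarkedBinaryTree V) (v : V) : ∃ w, T.graph.Adj v w := by
  have := T.nontrivial
  obtain ⟨w, hw⟩ := T.isTree.connected.preconnected.exists_adj_of_nontrivial v
  exact ⟨w, hw⟩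

lemma exists_unique_adj_of_not_isInner {v : V} (hv : ¬ T.IsInner v) :
    ∃ w, ∀ u, T.graph.Adj v u ↔ u = w := by
  obtain ⟨w, hw⟩ := T.exists_adj v
  have h1 : (T.graph.neighborSet v).ncard ≤ 1 := not_lt.1 hv
  rw [Set.ncard_le_one_iff_subsingleton] at h1
  exact ⟨w, fun u => ⟨fun hu => h1 hu hw, fun hu => hu ▸ hw⟩⟩

/-- Both neighbours are the last but one vertex of a shortest path from `p` to `v`, and paths in a
tree are unique. -/
lemma parent_unique (T : MarkedBinaryTree V) {p u u' v : V} (hu : T.graph.Adj u v)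
    (hu' : T.graph.Adj u' v) (h : T.graph.dist p v = T.graph.dist p u + 1)
    (h' : T.graph.dist p v = T.graph.dist p u' + 1) : u = u' := by
  obtain ⟨w, hw⟩ := T.isTree.connected.exists_walk_length_eq_dist p u
  obtain ⟨w', hw'⟩ := T.isTree.connected.exists_walk_length_eq_dist p u'
  have p1 : (w.concat hu).IsPath := (w.concat hu).isPath_of_length_eq_dist (by
    rw [SimpleGraph.Walk.length_concat, hw, h])
  have p2 : (w'.concat hu').IsPath := (w'.concat hu').isPath_of_length_eq_dist (by
    rw [SimpleGraph.Walk.length_concat, hw', h'])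
  have := congrArg SimpleGraph.Walk.penultimate ((T.isTree.existsUnique_path p v).unique p1 p2)
  simpa using this

end MarkedBinaryTree

namespace PlaneEmbedding

variable {V : Type*} [Fintype V] {T : MarkedBinaryTree V} (Γ : PlaneEmbedding T)

/-- The edge `{u, v}` with its end points. -/
def edge (u v : V) : Set ℂ := Γ.arc u v '' Icc 0 1

variable {Γ}

lemma edge_symm {u v : V} (h : T.graph.Adj u v) : Γ.edge v u = Γ.edge u v := by
  ext z
  constructor
  · rintro ⟨s, hs, rfl⟩
    exact ⟨1 - s, ⟨by linarith [hs.2], by linarith [hs.1]⟩, (Γ.arc_symm u v h s hs).symm⟩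
  · rintro ⟨s, hs, rfl⟩
    have hs' : 1 - s ∈ Icc (0 : ℝ) 1 := ⟨by linarith [hs.2], by linarith [hs.1]⟩
    exact ⟨1 - s, hs', by rw [Γ.arc_symm u v h _ hs', sub_sub_cancel]⟩

lemma arc_one {u v : V} (h : T.graph.Adj u v) : Γ.arc u v 1 = Γ.pos v := by
  have := Γ.arc_symm v u h.symm 1 ⟨zero_le_one, le_rfl⟩
  rw [this, sub_self, Γ.arc_zero v u h.symm]

lemma isCompact_edge {u v : V} (h : T.graph.Adj u v) : IsCompact (Γ.edge u v) :=
  isCompact_Icc.image_of_continuousOn (Γ.arc_polygonal u v h).continuousOn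

lemma isPreconnected_edge {u v : V} (h : T.graph.Adj u v) : IsPreconnected (Γ.edge u v) :=
  isPreconnected_Icc.image _ (Γ.arc_polygonal u v h).continuousOn

lemma pos_mem_edge_left {u v : V} (h : T.graph.Adj u v) : Γ.pos u ∈ Γ.edge u v :=
  ⟨0, ⟨le_rfl, zero_le_one⟩, Γ.arc_zero u v h⟩

lemma pos_mem_edge_right {u v : V} (h : T.graph.Adj u v) : Γ.pos v ∈ Γ.edge u v :=
  ⟨1, ⟨zero_le_one, le_rfl⟩, arc_one h⟩

lemma mem_carrier {z : ℂ} : z ∈ Γ.carrier ↔ ∃ u v, T.graph.Adj u v ∧ z ∈ Γ.edge u v := by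
  constructor
  · rintro ⟨u, v, h, s, hs, rfl⟩
    exact ⟨u, v, h, s, hs, rfl⟩
  · rintro ⟨u, v, h, s, hs, rfl⟩
    exact ⟨u, v, h, s, hs, rfl⟩

lemma edge_subset_carrier {u v : V} (h : T.graph.Adj u v) : Γ.edge u v ⊆ Γ.carrier :=
  fun _ hz => mem_carrier.2 ⟨u, v, h, hz⟩

variable (Γ)

lemma carrier_eq_iUnion : Γ.carrier = ⋃ e ∈ {e : V × V | T.graph.Adj e.1 e.2}, Γ.edge e.1 e.2 := by
  ext z
  simp only [mem_carrier, mem_iUnion, mem_ofPred_eq, Prod.exists, exists_prop]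

lemma isCompact_carrier : IsCompact Γ.carrier := by
  rw [carrier_eq_iUnion]
  exact (toFinite _).isCompact_biUnion fun e he => isCompact_edge he

lemma isClosed_carrier : IsClosed Γ.carrier := Γ.isCompact_carrier.isClosed

lemma pos_mem_carrier (v : V) : Γ.pos v ∈ Γ.carrier := by
  obtain ⟨w, hw⟩ := T.exists_adj v
  exact edge_subset_carrier hw (pos_mem_edge_left hw)

lemma carrier_nonempty : Γ.carrier.Nonempty := by
  have := T.isTree.connected.nonempty
  exact ⟨_, Γ.pos_mem_carrier (Classical.arbitrary V)⟩

lemma isPreconnected_carrier : IsPreconnected Γ.carrier := by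
  obtain ⟨x₀⟩ := T.isTree.connected.nonempty
  have key : ∀ u : V, ∃ t ⊆ Γ.carrier, Γ.pos x₀ ∈ t ∧ Γ.pos u ∈ t ∧ IsPreconnected t := by
    intro u
    obtain ⟨w⟩ := T.isTree.connected.preconnected u x₀
    induction w with
    | nil => exact ⟨{Γ.pos _}, singleton_subset_iff.2 (Γ.pos_mem_carrier _), rfl, rfl,
        isPreconnected_singleton⟩
    | cons h w ih =>
      obtain ⟨t, ht, h1, h2, h3⟩ := ih
      exact ⟨t ∪ Γ.edge _ _, union_subset ht (edge_subset_carrier h), Or.inl h1,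
        Or.inr (pos_mem_edge_left h), h3.union _ h2 (pos_mem_edge_right h) (isPreconnected_edge h)⟩
  refine isPreconnected_of_forall (Γ.pos x₀) fun z hz => ?_
  obtain ⟨u, v, h, hz⟩ := mem_carrier.1 hz
  obtain ⟨t, ht, h1, h2, h3⟩ := key u
  exact ⟨t ∪ Γ.edge u v, union_subset ht (edge_subset_carrier h), Or.inl h1, Or.inr hz,
    h3.union _ h2 (pos_mem_edge_left h) (isPreconnected_edge h)⟩

/-- Near a point, only the edges through that point matter. -/
lemma eventually_mem_carrier (P : ℂ) : ∀ᶠ z in 𝓝 P, z ∈ Γ.carrier →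
    ∃ u v, T.graph.Adj u v ∧ P ∈ Γ.edge u v ∧ z ∈ Γ.edge u v := by
  have h : ∀ e : V × V, ∀ᶠ z in 𝓝 P, T.graph.Adj e.1 e.2 → z ∈ Γ.edge e.1 e.2 → P ∈ Γ.edge e.1 e.2 := by
    intro e
    by_cases hP : P ∈ Γ.edge e.1 e.2
    · exact Eventually.of_forall fun _ _ _ => hP
    · by_cases ha : T.graph.Adj e.1 e.2
      · filter_upwards [(isCompact_edge ha).isClosed.isOpen_compl.mem_nhds hP] with z hz _ hz'
        exact absurd hz' hz
      · exact Eventually.of_forall fun _ h' => absurd h' ha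
  filter_upwards [eventually_all.2 h] with z hz hzc
  obtain ⟨u, v, huv, hzuv⟩ := mem_carrier.1 hzc
  exact ⟨u, v, huv, hz (u, v) huv hzuv, hzuv⟩

variable {Γ}

lemma sym2_eq_of_mem_edge {u v u' v' : V} (h : T.graph.Adj u v) (h' : T.graph.Adj u' v') {s : ℝ}
    (hs : s ∈ Ioo (0 : ℝ) 1) (hm : Γ.arc u v s ∈ Γ.edge u' v') : s(u, v) = s(u', v') := by
  obtain ⟨s', hs', he⟩ := hm
  have hs2 : s ∈ Icc (0 : ℝ) 1 := ⟨hs.1.le, hs.2.le⟩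
  by_contra hne
  obtain ⟨w, hw, -, hpos⟩ := Γ.arc_disjoint u v u' v' h h' hne s hs2 s' hs' he.symm
  have hinj := (Γ.arc_polygonal u v h).1
  rcases Sym2.mem_iff.1 hw with rfl | rfl
  · rw [← Γ.arc_zero _ _ h] at hpos
    exact hs.1.ne' (hinj hs2 ⟨le_rfl, zero_le_one⟩ hpos)
  · rw [← arc_one h] at hpos
    exact hs.2.ne (hinj hs2 ⟨zero_le_one, le_rfl⟩ hpos)

lemma edge_eq_of_sym2_eq {u v u' v' : V} (h : T.graph.Adj u v) (he : s(u, v) = s(u', v')) :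
    Γ.edge u' v' = Γ.edge u v := by
  rcases Sym2.eq_iff.1 he with ⟨rfl, rfl⟩ | ⟨rfl, rfl⟩
  · rfl
  · exact edge_symm h

lemma mem_of_pos_mem_edge {v u' v' : V} (h' : T.graph.Adj u' v') (hm : Γ.pos v ∈ Γ.edge u' v') :
    v = u' ∨ v = v' := by
  obtain ⟨s', hs', he⟩ := hm
  obtain ⟨w, hw⟩ := T.exists_adj v
  by_cases hne : s(v, w) = s(u', v')
  · exact Sym2.mem_iff.1 (hne ▸ Sym2.mem_mk_left v w)
  · obtain ⟨x, -, hx, hpos⟩ := Γ.arc_disjoint v w u' v' hw h' hne 0 ⟨le_rfl, zero_le_one⟩ s' hs'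
      (by rw [Γ.arc_zero _ _ hw, he])
    rw [Γ.arc_zero _ _ hw] at hpos
    exact Sym2.mem_iff.1 (Γ.pos_injective hpos ▸ hx)

lemma twoSided_of_mem_openEdge {u v : V} (h : T.graph.Adj u v) {s : ℝ} (hs : s ∈ Ioo (0 : ℝ) 1) :
    TwoSided Γ.carrier (Γ.arc u v s) := by
  obtain ⟨θ₁, θ₂, h1, h2, h3⟩ := (Γ.arc_polygonal u v h).exists_starAt hs
  refine StarAt.twoSided (h3.congr ?_) h1 h2
  filter_upwards [Γ.eventually_mem_carrier (Γ.arc u v s)] with z hz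
  refine ⟨fun hzc => ?_, fun hze => edge_subset_carrier h hze⟩
  obtain ⟨u', v', h', hP, hz'⟩ := hz hzc
  have := edge_eq_of_sym2_eq (Γ := Γ) h (sym2_eq_of_mem_edge h h' hs hP)
  rw [this] at hz'
  exact hz'

lemma eventually_mem_carrier_pos (v : V) : ∀ᶠ z in 𝓝 (Γ.pos v), z ∈ Γ.carrier →
    ∃ u, T.graph.Adj v u ∧ z ∈ Γ.edge v u := by
  filter_upwards [Γ.eventually_mem_carrier (Γ.pos v)] with z hz hzc
  obtain ⟨u', v', h', hP, hz'⟩ := hz hzc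
  rcases mem_of_pos_mem_edge h' hP with rfl | rfl
  · exact ⟨v', h', hz'⟩
  · exact ⟨u', h'.symm, by rwa [edge_symm h']⟩

lemma starAt_edge {u v : V} (h : T.graph.Adj u v) {θ : ℝ}
    (hθ : Γ.direction u v = ‖Γ.direction u v‖ * Complex.exp (θ * Complex.I)) :
    StarAt (Γ.edge u v) (Γ.pos u) {θ} := by
  obtain ⟨hd, ε, hε, hε1, hlin⟩ := (Γ.arc_polygonal u v h).exists_derivWithin
  have := (Γ.arc_polygonal u v h).starAt_zero hε hε1 hd hlin hθ
  rwa [Γ.arc_zero u v h] at this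

lemma oneSided_of_not_isInner {v : V} (hv : ¬ T.IsInner v) : OneSided Γ.carrier (Γ.pos v) := by
  obtain ⟨w, hw⟩ := T.exists_unique_adj_of_not_isInner hv
  have ha : T.graph.Adj v w := (hw w).2 rfl
  obtain ⟨θ, -, hθ⟩ := exists_angle (d := Γ.direction v w) 0
  refine StarAt.oneSided ((starAt_edge ha hθ).congr ?_)
  filter_upwards [eventually_mem_carrier_pos (Γ := Γ) v] with z hz
  refine ⟨fun hzc => ?_, fun hze => edge_subset_carrier ha hze⟩
  obtain ⟨u, hu, hzu⟩ := hz hzc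
  rwa [(hw u).1 hu] at hzu

lemma direction_ne_zero {u v : V} (h : T.graph.Adj u v) : Γ.direction u v ≠ 0 :=
  (Γ.arc_polygonal u v h).exists_derivWithin.1

lemma exp_eq_of_direction {d : ℂ} (hd : d ≠ 0) {θ φ : ℝ}
    (hθ : d = ‖d‖ * Complex.exp (θ * Complex.I)) (hφ : d = ‖d‖ * Complex.exp (φ * Complex.I)) :
    ∃ n : ℤ, φ = θ + n * (2 * Real.pi) := by
  have h1 : Complex.exp (φ * Complex.I) = Complex.exp (θ * Complex.I) :=
    mul_left_cancel₀ (Complex.ofReal_ne_zero.2 (norm_ne_zero_iff.2 hd)) (hφ.symm.trans hθ)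
  obtain ⟨n, hn⟩ := Complex.exp_eq_exp_iff_exists_int.1 h1
  refine ⟨n, ?_⟩
  have h2 : ((φ : ℂ)) = ((θ + n * (2 * Real.pi) : ℝ) : ℂ) := by
    push_cast
    refine mul_right_cancel₀ Complex.I_ne_zero ?_
    linear_combination hn
  exact_mod_cast h2

lemma Anticlockwise.ne₁₂ {v a b c : V} (h : Γ.Anticlockwise v a b c) (ha : T.graph.Adj v a) : a ≠ b := by
  rintro rfl
  obtain ⟨θ₁, θ₂, θ₃, h1, h2, h3, e1, e2, -⟩ := h
  obtain ⟨n, hn⟩ := exp_eq_of_direction (direction_ne_zero ha) e1 e2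
  have hpi := Real.pi_pos
  have n1 : (0 : ℝ) < n := by
    by_contra! h'
    nlinarith
  have n2 : (n : ℝ) < 1 := by
    by_contra! h'
    nlinarith
  have : (0 : ℤ) < n := by exact_mod_cast n1
  have : n < (1 : ℤ) := by exact_mod_cast n2
  omega

lemma Anticlockwise.rotate {v a b c : V} (h : Γ.Anticlockwise v a b c) : Γ.Anticlockwise v b c a := by
  obtain ⟨θ₁, θ₂, θ₃, h1, h2, h3, e1, e2, e3⟩ := h
  refine ⟨θ₂, θ₃, θ₁ + 2 * Real.pi, h2, h3, by linarith, e2, e3, ?_⟩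
  have : Complex.exp ((θ₁ + 2 * Real.pi : ℝ) * Complex.I) = Complex.exp (θ₁ * Complex.I) := by
    push_cast
    rw [add_mul, Complex.exp_add, Complex.exp_two_pi_mul_I, mul_one]
  rw [this]
  exact e1

/-- Both families of angles are compared with the third direction: the first two angles lie within
one turn below it, so all three change by the same number of turns and their order is preserved. -/
lemma Anticlockwise.not_swap {v a b c : V} (ha : T.graph.Adj v a) (hb : T.graph.Adj v b)
    (hc : T.graph.Adj v c) (h : Γ.Anticlockwise v a b c) (h' : Γ.Anticlockwise v b a c) : False := by
  obtain ⟨θ₁, θ₂, θ₃, h1, h2, h3, e1, e2, e3⟩ := h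
  obtain ⟨φ₂, φ₁, φ₃, k1, k2, k3, f2, f1, f3⟩ := h'
  obtain ⟨n₁, hn₁⟩ := exp_eq_of_direction (direction_ne_zero ha) e1 f1
  obtain ⟨n₂, hn₂⟩ := exp_eq_of_direction (direction_ne_zero hb) e2 f2
  obtain ⟨n₃, hn₃⟩ := exp_eq_of_direction (direction_ne_zero hc) e3 f3
  have hpi := Real.pi_pos
  have key : ∀ (θ φ : ℝ) (n : ℤ), φ = θ + n * (2 * Real.pi) → θ < θ₃ → θ₃ < θ + 2 * Real.pi → φ < φ₃ →
      φ₃ < φ + 2 * Real.pi → n = n₃ := by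
    intro θ φ n hn a1 a2 a3 a4
    have b1 : ((n : ℝ) - n₃) < 1 := by
      by_contra! h'
      nlinarith
    have b2 : -1 < ((n : ℝ) - n₃) := by
      by_contra! h'
      nlinarith
    have c1 : n - n₃ < 1 := by exact_mod_cast b1
    have c2 : -1 < n - n₃ := by exact_mod_cast b2
    omega
  have g1 := key θ₁ φ₁ n₁ hn₁ (by linarith) (by linarith) k2 (by linarith)
  have g2 := key θ₂ φ₂ n₂ hn₂ (by linarith) (by linarith) (by linarith) (by linarith)
  rw [hn₁, hn₂, g1, g2] at k1
  linarith

lemma Anticlockwise.neighbor_eq {v a b c : V} (h : Γ.Anticlockwise v a b c) (hv : T.IsInner v)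
    (ha : T.graph.Adj v a) (hb : T.graph.Adj v b) (hc : T.graph.Adj v c) (u : V) :
    T.graph.Adj v u ↔ u = a ∨ u = b ∨ u = c := by
  have hab := h.ne₁₂ ha
  have hbc := h.rotate.ne₁₂ hb
  have hca := h.rotate.rotate.ne₁₂ hc
  have h3 := T.trivalent v hv
  have hsub : ({a, b, c} : Set V) ⊆ T.graph.neighborSet v := by
    rintro x (rfl | rfl | rfl) <;> assumption
  have hcard : ({a, b, c} : Set V).ncard = 3 :=
    Set.ncard_eq_three.2 ⟨a, b, c, hab, hca.symm, hbc, rfl⟩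
  have := Set.eq_of_subset_of_ncard_le hsub (by rw [h3, hcard])
  rw [← SimpleGraph.mem_neighborSet, ← this]
  simp

/-- The marked edge and the orientation determine which edges a cycle crosses and in which order.
This is all that is retained of a cycle. -/
lemma Anticlockwise.unique {v a b c a' b' : V} (h : Γ.Anticlockwise v a b c) (hv : T.IsInner v)
    (ha : T.graph.Adj v a) (hb : T.graph.Adj v b) (hc : T.graph.Adj v c)
    (ha' : T.graph.Adj v a') (hb' : T.graph.Adj v b') (h' : Γ.Anticlockwise v a' b' c) :
    a' = a ∧ b' = b := by
  have hab := h'.ne₁₂ ha'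
  have hbc := h'.rotate.ne₁₂ hb'
  have hca := h'.rotate.rotate.ne₁₂ hc
  have e1 := (h.neighbor_eq hv ha hb hc a').1 ha'
  have e2 := (h.neighbor_eq hv ha hb hc b').1 hb'
  rcases e1 with rfl | rfl | rfl
  · rcases e2 with rfl | rfl | rfl
    · exact absurd rfl hab
    · exact ⟨rfl, rfl⟩
    · exact absurd rfl hbc
  · rcases e2 with rfl | rfl | rfl
    · exact (h.not_swap ha hb hc h').elim
    · exact absurd rfl hab
    · exact absurd rfl hbc
  · exact absurd rfl hca

/-- The shape of the tree at an inner vertex. -/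
lemma Anticlockwise.exists_starAt {v a b c : V} (h : Γ.Anticlockwise v a b c) (hv : T.IsInner v)
    (ha : T.graph.Adj v a) (hb : T.graph.Adj v b) (hc : T.graph.Adj v c) :
    ∃ θ₁ θ₂ θ₃ : ℝ, θ₁ < θ₂ ∧ θ₂ < θ₃ ∧ θ₃ < θ₁ + 2 * Real.pi ∧
      StarAt Γ.carrier (Γ.pos v) {θ₁, θ₂, θ₃} ∧ StarAt (Γ.edge v a) (Γ.pos v) {θ₁} ∧
      StarAt (Γ.edge v b) (Γ.pos v) {θ₂} := by
  have hn := h.neighbor_eq hv ha hb hc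
  obtain ⟨θ₁, θ₂, θ₃, h1, h2, h3, e1, e2, e3⟩ := h
  have s1 := starAt_edge ha e1
  have s2 := starAt_edge hb e2
  have s3 := starAt_edge hc e3
  refine ⟨θ₁, θ₂, θ₃, h1, h2, h3, ?_, s1, s2⟩
  have := s1.union (s2.union s3)
  rw [show ({θ₁} ∪ ({θ₂} ∪ {θ₃}) : Set ℝ) = {θ₁, θ₂, θ₃} from rfl] at this
  refine this.congr ?_
  filter_upwards [eventually_mem_carrier_pos (Γ := Γ) v] with z hz
  constructor
  · intro hzc
    obtain ⟨u, hu, hzu⟩ := hz hzc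
    rcases (hn u).1 hu with rfl | rfl | rfl
    · exact Or.inl hzu
    · exact Or.inr (Or.inl hzu)
    · exact Or.inr (Or.inr hzu)
  · rintro (hz | hz | hz)
    · exact edge_subset_carrier ha hz
    · exact edge_subset_carrier hb hz
    · exact edge_subset_carrier hc hz

end PlaneEmbedding

/-! ### Combinatorics of the degeneration -/

namespace MarkedBinaryTree

variable {V : Type*} [Fintype V] (T : MarkedBinaryTree V)

lemma mem_terminals {v : V} : v ∈ T.terminals ↔ ¬ T.IsInner v := by
  simp [terminals]

lemma a_add_b (v : V) : T.a v + T.b v = 3 := by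
  unfold a b; split_ifs <;> simp

/-- The number of terminals exceeds the number of inner vertices by two. -/
lemma card_terminals : T.terminals.card = T.genus + 2 := by
  classical
  -- The sum of the degrees is twice the number of edges, which is one less than the number of
  -- vertices; terminals have degree `1` and inner vertices degree `3`.
  have h1 := T.isTree.card_edgeFinset
  have h2 := T.graph.sum_degrees_eq_twice_card_edges
  have hdeg : ∀ v, T.graph.degree v = (T.graph.neighborSet v).ncard := fun v => by
    rw [Set.ncard_eq_toFinset_card', Set.toFinset_card, SimpleGraph.card_neighborSet_eq_degree]
  have h3 : ∀ v ∈ T.terminals, T.graph.degree v = 1 := fun v hv => by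
    obtain ⟨w, hw⟩ := T.exists_adj v
    have e1 : 0 < T.graph.degree v := (T.graph.degree_pos_iff_exists_adj v).2 ⟨w, hw⟩
    have e2 : (T.graph.neighborSet v).ncard ≤ 1 := not_lt.1 (T.mem_terminals.1 hv)
    rw [← hdeg] at e2
    omega
  have h4 : ∀ v ∈ T.terminalsᶜ, T.graph.degree v = 3 := fun v hv => by
    rw [hdeg]
    refine T.trivalent v ?_
    by_contra h'
    exact Finset.mem_compl.1 hv (T.mem_terminals.2 h')
  have h5 := Finset.sum_add_sum_compl T.terminals fun v => T.graph.degree v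
  rw [Finset.sum_congr rfl h3, Finset.sum_congr rfl h4, h2] at h5
  simp only [Finset.sum_const, smul_eq_mul, mul_one] at h5
  have h6 := Finset.card_add_card_compl T.terminals
  have h7 : T.genus = T.terminalsᶜ.card := by
    rw [genus, Nat.card_eq_fintype_card, Fintype.card_subtype]
    congr 1
    ext v
    simp [mem_terminals]
  omega

/-- With `sum_a_ge` this bounds the degrees of the polynomial factors in the forms. Rounding in the
definition of `d₁` costs at most `2`, and the strict inequality needed later survives, so the
divisibility of the sum of the `a` by `3` plays no role. -/
lemma sum_b_ge : 3 * T.genus + 1 ≤ ∑ v ∈ T.terminals, T.b v + 3 * T.d₁ := by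
  have h1 : ∑ v ∈ T.terminals, T.a v + ∑ v ∈ T.terminals, T.b v = 3 * (T.genus + 2) := by
    rw [← Finset.sum_add_distrib, Finset.sum_congr rfl fun v _ => T.a_add_b v, Finset.sum_const,
      card_terminals, smul_eq_mul, mul_comm]
  unfold d₁
  omega

lemma sum_a_ge {k : ℕ} (hk : k < T.d₁) : 3 * (k + 2) ≤ ∑ v ∈ T.terminals, T.a v := by
  unfold d₁ at hk
  omega

end MarkedBinaryTree

namespace IsSimpleDecomposition

variable {V V' : Type*} [Fintype V] [Fintype V'] {T : MarkedBinaryTree V}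
  {T' : MarkedBinaryTree V'} {ι : V' ↪ V} {i j : V} {p q : V'}
  (hd : IsSimpleDecomposition T T' ι i j p q)

include hd

lemma ne_i (v : V') : ι v ≠ i := ((hd.range (ι v)).1 ⟨v, rfl⟩).1

lemma ne_j (v : V') : ι v ≠ j := ((hd.range (ι v)).1 ⟨v, rfl⟩).2

lemma adj_pq : T.graph.Adj (ι p) (ι q) := (hd.adj_iff p q).1 hd.adj_q

lemma isInner_p : T.IsInner (ι p) := by
  unfold MarkedBinaryTree.IsInner
  rw [Set.one_lt_ncard_iff]
  exact ⟨i, j, hd.adj_i, hd.adj_j, hd.ne⟩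

lemma adj_p_iff (u : V) : T.graph.Adj (ι p) u ↔ u = i ∨ u = j ∨ u = ι q := by
  have hsub : ({i, j, ι q} : Set V) ⊆ T.graph.neighborSet (ι p) := by
    rintro x (rfl | rfl | rfl)
    · exact hd.adj_i
    · exact hd.adj_j
    · exact hd.adj_pq
  have hcard : ({i, j, ι q} : Set V).ncard = 3 :=
    Set.ncard_eq_three.2 ⟨i, j, ι q, hd.ne, (hd.ne_i q).symm, (hd.ne_j q).symm, rfl⟩
  have := Set.eq_of_subset_of_ncard_le hsub (by rw [T.trivalent _ hd.isInner_p, hcard])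
  rw [← SimpleGraph.mem_neighborSet, ← this]
  simp

lemma adj_p_iff' (u : V') : T'.graph.Adj p u ↔ u = q := by
  rw [hd.adj_iff, hd.adj_p_iff]
  constructor
  · rintro (h | h | h)
    · exact absurd h (hd.ne_i u)
    · exact absurd h (hd.ne_j u)
    · exact ι.injective h
  · rintro rfl
    exact Or.inr (Or.inr rfl)

lemma not_isInner_p : ¬ T'.IsInner p := by
  unfold MarkedBinaryTree.IsInner
  rw [not_lt, Set.ncard_le_one_iff_subsingleton]
  intro x hx y hy
  rw [(hd.adj_p_iff' x).1 hx, (hd.adj_p_iff' y).1 hy]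

lemma adj_i_iff (u : V) : T.graph.Adj i u ↔ u = ι p := by
  obtain ⟨w, hw⟩ := T.exists_unique_adj_of_not_isInner (T.mem_terminals.1 hd.terminal_i)
  rw [hw, (hw (ι p)).1 hd.adj_i.symm]

lemma adj_j_iff (u : V) : T.graph.Adj j u ↔ u = ι p := by
  obtain ⟨w, hw⟩ := T.exists_unique_adj_of_not_isInner (T.mem_terminals.1 hd.terminal_j)
  rw [hw, (hw (ι p)).1 hd.adj_j.symm]

lemma exists_adj_of_ne {v : V'} (hv : v ≠ p) {u : V} (h : T.graph.Adj (ι v) u) :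
    ∃ w, u = ι w ∧ T'.graph.Adj v w := by
  have h1 : u ≠ i := by
    rintro rfl
    exact hv (ι.injective ((hd.adj_i_iff _).1 h.symm))
  have h2 : u ≠ j := by
    rintro rfl
    exact hv (ι.injective ((hd.adj_j_iff _).1 h.symm))
  obtain ⟨w, rfl⟩ := (hd.range u).2 ⟨h1, h2⟩
  exact ⟨w, rfl, (hd.adj_iff v w).2 h⟩

lemma isInner_iff {v : V'} (hv : v ≠ p) : T.IsInner (ι v) ↔ T'.IsInner v := by
  have : T.graph.neighborSet (ι v) = ι '' T'.graph.neighborSet v := by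
    ext u
    constructor
    · intro h
      obtain ⟨w, rfl, hw⟩ := hd.exists_adj_of_ne hv h
      exact ⟨w, hw, rfl⟩
    · rintro ⟨w, hw, rfl⟩
      exact (hd.adj_iff v w).1 hw
  unfold MarkedBinaryTree.IsInner
  rw [this, Set.ncard_image_of_injective _ ι.injective]

lemma ne_p_of_isInner {v : V'} (hv : T'.IsInner v) : v ≠ p := fun h => hd.not_isInner_p (h ▸ hv)

lemma white_p : T'.white p = false := by
  have := T.proper _ _ hd.adj_i
  rw [hd.white_i, ← hd.white_eq] at this
  simpa using this

lemma a_i : T.a i = 1 := by simp [MarkedBinaryTree.a, hd.white_i]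

lemma a_j : T.a j = 1 := by simp [MarkedBinaryTree.a, hd.white_j]

lemma a_p : T'.a p = 2 := by simp [MarkedBinaryTree.a, hd.white_p]

lemma a_eq (v : V') : T.a (ι v) = T'.a v := by simp [MarkedBinaryTree.a, hd.white_eq]

lemma b_eq (v : V') : T.b (ι v) = T'.b v := by simp [MarkedBinaryTree.b, hd.white_eq]

open Classical in
lemma terminals_eq :
    T.terminals = insert i (insert j ((T'.terminals.erase p).map ι)) := by
  ext u
  simp only [Finset.mem_insert, Finset.mem_map, Finset.mem_erase]
  constructor
  · intro hu
    by_cases h1 : u = i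
    · exact Or.inl h1
    by_cases h2 : u = j
    · exact Or.inr (Or.inl h2)
    obtain ⟨w, rfl⟩ := (hd.range u).2 ⟨h1, h2⟩
    have hw : w ≠ p := by
      rintro rfl
      exact T.mem_terminals.1 hu hd.isInner_p
    refine Or.inr (Or.inr ⟨w, ⟨hw, T'.mem_terminals.2 fun h => ?_⟩, rfl⟩)
    exact T.mem_terminals.1 hu ((hd.isInner_iff hw).2 h)
  · rintro (rfl | rfl | ⟨w, ⟨hw, hwT⟩, rfl⟩)
    · exact hd.terminal_i
    · exact hd.terminal_j
    · exact T.mem_terminals.2 fun h => T'.mem_terminals.1 hwT ((hd.isInner_iff hw).1 h)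

lemma mem_terminals_p : p ∈ T'.terminals := T'.mem_terminals.2 hd.not_isInner_p

open Classical in
lemma prod_terminals {M : Type*} [CommMonoid M] (f : V → M) :
    ∏ v ∈ T.terminals, f v = f i * f j * ∏ v ∈ T'.terminals.erase p, f (ι v) := by
  rw [hd.terminals_eq, Finset.prod_insert, Finset.prod_insert, Finset.prod_map, mul_assoc]
  · simp only [Finset.mem_map, not_exists, not_and]
    exact fun v _ => hd.ne_j v
  · simp only [Finset.mem_insert, Finset.mem_map, not_or, not_exists, not_and]
    exact ⟨hd.ne, fun v _ => hd.ne_i v⟩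

open Classical in
lemma prod_terminals' {M : Type*} [CommMonoid M] (f : V' → M) :
    ∏ v ∈ T'.terminals, f v = f p * ∏ v ∈ T'.terminals.erase p, f v :=
  (Finset.mul_prod_erase _ _ hd.mem_terminals_p).symm

/-- Two white terminals with `a = 1` are replaced by one black terminal with `a = 2`. -/
lemma d₁_eq : T.d₁ = T'.d₁ := by
  classical
  unfold MarkedBinaryTree.d₁
  have h1 : ∑ v ∈ T.terminals, T.a v = ∑ v ∈ T'.terminals, T'.a v := by
    have e1 := hd.prod_terminals (M := Multiplicative ℕ) fun v => Multiplicative.ofAdd (T.a v)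
    have e2 := hd.prod_terminals' (M := Multiplicative ℕ) fun v => Multiplicative.ofAdd (T'.a v)
    rw [← ofAdd_sum] at e1 e2
    apply Multiplicative.ofAdd.injective
    rw [e1, e2]
    simp only [hd.a_i, hd.a_j, hd.a_p, hd.a_eq]
    rfl
  rw [h1]

lemma genus_eq : T.genus = T'.genus + 1 := by
  classical
  have h1 := T.card_terminals
  have h2 := T'.card_terminals
  have h3 : T.terminals.card = 2 + (T'.terminals.erase p).card := by
    rw [hd.terminals_eq, Finset.card_insert_of_notMem, Finset.card_insert_of_notMem, Finset.card_map]
    · ring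
    · simp only [Finset.mem_map, not_exists, not_and]
      exact fun v _ => hd.ne_j v
    · simp only [Finset.mem_insert, Finset.mem_map, not_or, not_exists, not_and]
      exact ⟨hd.ne, fun v _ => hd.ne_i v⟩
  have h4 := Finset.card_erase_add_one hd.mem_terminals_p
  omega

end IsSimpleDecomposition

/-! ### Geometry of the degeneration -/

namespace PlaneEmbedding

variable {V : Type*} [Fintype V] {T : MarkedBinaryTree V} {Γ : PlaneEmbedding T}

lemma arc_notMem_edge {u v u' v' : V} (h : T.graph.Adj u v) (h' : T.graph.Adj u' v')
    (h1 : v ≠ u') (h2 : v ≠ v') {s : ℝ} (hs : s ∈ Ioc (0 : ℝ) 1) : Γ.arc u v s ∉ Γ.edge u' v' := by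
  intro hm
  rcases hs.2.lt_or_eq with hs1 | rfl
  · have := sym2_eq_of_mem_edge h h' ⟨hs.1, hs1⟩ hm
    have hv : v ∈ s(u', v') := this ▸ Sym2.mem_mk_right u v
    rcases Sym2.mem_iff.1 hv with h3 | h3
    · exact h1 h3
    · exact h2 h3
  · rw [arc_one h] at hm
    rcases mem_of_pos_mem_edge h' hm with h3 | h3
    · exact h1 h3
    · exact h2 h3

/-- The complement of a tree together with a disc about a terminal is connected. -/
lemma isPreconnected_compl_carrier_union_closedBall {p q : V} {r : ℝ} (hr : 0 < r)
    (hp : ∀ u, T.graph.Adj p u ↔ u = q)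
    (houter : ∀ u v, T.graph.Adj u v → s(u, v) ≠ s(p, q) → ∀ s ∈ Icc (0 : ℝ) 1,
      r < dist (Γ.arc u v s) (Γ.pos p)) {s₀ : ℝ} (hs₀ : s₀ ∈ Ioo (0 : ℝ) 1)
    (hc1 : ∀ s ∈ Ico 0 s₀, r < dist (Γ.arc q p s) (Γ.pos p))
    (hc2 : ∀ s ∈ Ioc s₀ 1, dist (Γ.arc q p s) (Γ.pos p) < r) :
    IsPreconnected (Γ.carrier ∪ closedBall (Γ.pos p) r)ᶜ := by
  classical
  have hpq : T.graph.Adj p q := (hp q).2 rfl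
  -- The disc together with the edges from the vertices of `S` to their parents, the tree being
  -- rooted at `p`.
  let E : Finset V → Set ℂ := fun S => {z | z ∈ closedBall (Γ.pos p) r ∨
    ∃ u v, v ∈ S ∧ T.graph.Adj u v ∧ T.graph.dist p v = T.graph.dist p u + 1 ∧ z ∈ Γ.edge u v}
  have hEcl : ∀ S, IsClosed (E S) := by
    intro S
    have : E S = closedBall (Γ.pos p) r ∪ ⋃ e ∈ {e : V × V | e.2 ∈ S ∧ T.graph.Adj e.1 e.2 ∧
        T.graph.dist p e.2 = T.graph.dist p e.1 + 1}, Γ.edge e.1 e.2 := by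
      ext z
      simp only [E, mem_ofPred_eq, mem_union, mem_iUnion, Prod.exists, exists_prop]
      refine or_congr Iff.rfl (exists_congr fun u => exists_congr fun v => ?_)
      tauto
    rw [this]
    exact isClosed_closedBall.union ((toFinite _).isClosed_biUnion fun e he =>
      (isCompact_edge he.2.1).isClosed)
  have hparent : ∀ v, v ≠ p → ∃ u, T.graph.Adj u v ∧ T.graph.dist p v = T.graph.dist p u + 1 := by
    intro v hv
    obtain ⟨w, hw⟩ := T.isTree.connected.exists_walk_length_eq_dist v p
    cases w with
    | nil => exact absurd rfl hv
    | cons h w =>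
      rename_i u
      refine ⟨u, h.symm, ?_⟩
      rw [SimpleGraph.Walk.length_cons, SimpleGraph.dist_comm] at hw
      have h1 := SimpleGraph.dist_le w
      rw [SimpleGraph.dist_comm] at h1
      have h2 := T.isTree.dist_eq_dist_add_one_of_adj p h
      omega
  have key : ∀ S : Finset V, p ∉ S → (∀ u v, v ∈ S → T.graph.Adj u v →
      T.graph.dist p v = T.graph.dist p u + 1 → u ≠ p → u ∈ S) → IsPreconnected (E S)ᶜ := by
    intro S
    -- The new vertex is at maximal distance from `p`, so its parent edge is a free arc attached to
    -- what is already removed, and `S` stays closed under taking parents.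
    induction S using Finset.induction_on_max_value (fun v => T.graph.dist p v) with
    | empty =>
      intro _ _
      have : (E ∅)ᶜ = (closedBall (Γ.pos p) r)ᶜ := by
        ext z
        simp [E]
      rw [this]
      exact isPreconnected_compl_closedBall _ hr.le
    | insert v S hv hmax ih =>
      intro hpS hdown
      have hvp : v ≠ p := fun h => hpS (h ▸ Finset.mem_insert_self v S)
      have hS := ih (fun h => hpS (Finset.mem_insert_of_mem h)) (fun u w hw huw hdist hup => by
        have := hdown u w (Finset.mem_insert_of_mem hw) huw hdist hup
        rcases Finset.mem_insert.1 this with rfl | h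
        · have := hmax w hw
          omega
        · exact h)
      obtain ⟨u, huv, hdist⟩ := hparent v hvp
      have heq : (E (insert v S))ᶜ = (E S)ᶜ \ Γ.arc u v '' Icc 0 1 := by
        ext z
        simp only [E, mem_compl_iff, mem_ofPred_eq, Set.mem_sdiff, ← not_or]
        refine not_congr ?_
        constructor
        · rintro (h | ⟨u', v', hv', h1, h2, h3⟩)
          · exact Or.inl (Or.inl h)
          · rcases Finset.mem_insert.1 hv' with rfl | hv'
            · right
              rw [T.parent_unique huv h1 hdist h2]
              exact h3
            · exact Or.inl (Or.inr ⟨u', v', hv', h1, h2, h3⟩)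
        · rintro ((h | ⟨u', v', hv', h1, h2, h3⟩) | h)
          · exact Or.inl h
          · exact Or.inr ⟨u', v', Finset.mem_insert_of_mem hv', h1, h2, h3⟩
          · exact Or.inr ⟨u, v, Finset.mem_insert_self v S, huv, hdist, h⟩
      have hother : ∀ s ∈ Ioc (0 : ℝ) 1, ∀ u' v', v' ∈ S → T.graph.Adj u' v' →
          T.graph.dist p v' = T.graph.dist p u' + 1 → Γ.arc u v s ∉ Γ.edge u' v' := by
        intro s hs u' v' hv' h1 h2
        refine arc_notMem_edge huv h1 ?_ ?_ hs
        · rintro rfl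
          have := hmax v' hv'
          omega
        · rintro rfl
          exact hv hv'
      have hpol := Γ.arc_polygonal u v huv
      rw [heq]
      -- The edge `pq` starts inside the disc and leaves it once, so its part up to the parameter `1
      -- - s₀` is already removed. Any other edge is attached only at its first point.
      by_cases hup : u = p
      · subst hup
        have hvq : v = q := (hp v).1 huv
        subst hvq
        have hsym : ∀ s ∈ Icc (0 : ℝ) 1, Γ.arc u v s = Γ.arc v u (1 - s) := Γ.arc_symm v u huv.symm
        refine hpol.isPreconnected_diff (hEcl S).isOpen_compl hS (s₀ := 1 - s₀)
          ⟨by linarith [hs₀.2], by linarith [hs₀.1]⟩ ?_ ?_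
        · have hle : ∀ s ∈ Ico 0 (1 - s₀), Γ.arc u v s ∈ closedBall (Γ.pos u) r := by
            intro s hs
            rw [hsym s ⟨hs.1, by linarith [hs.2, hs₀.1]⟩, mem_closedBall]
            exact (hc2 _ ⟨by linarith [hs.2], by linarith [hs.1]⟩).le
          have hcl : Icc 0 (1 - s₀) ⊆ closure (Ico 0 (1 - s₀)) := by
            rw [closure_Ico (by linarith [hs₀.2])]
          have hcont : ContinuousOn (Γ.arc u v) (closure (Ico 0 (1 - s₀))) := by
            rw [closure_Ico (by linarith [hs₀.2])]
            exact hpol.continuousOn.mono (Icc_subset_Icc le_rfl (by linarith [hs₀.1]))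
          intro s hs hsE
          refine hsE (Or.inl ?_)
          have := hcont.image_closure (mem_image_of_mem _ (hcl hs))
          rw [← isClosed_closedBall.closure_eq]
          exact closure_mono (by rintro _ ⟨x, hx, rfl⟩; exact hle x hx) this
        · intro s hs hsE
          have hs0 : 0 < s := by linarith [hs.1, hs₀.2]
          rcases hsE with h | ⟨u', v', hv', h1, h2, h3⟩
          · rw [hsym s ⟨hs0.le, hs.2⟩, mem_closedBall] at h
            linarith [hc1 (1 - s) ⟨by linarith [hs.2], by linarith [hs.1]⟩]
          · exact hother s ⟨hs0, hs.2⟩ u' v' hv' h1 h2 h3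
      · refine hpol.isPreconnected_diff (hEcl S).isOpen_compl hS (s₀ := 0) ⟨le_rfl, zero_lt_one⟩ ?_ ?_
        · intro s hs hsE
          have hs0 : s = 0 := le_antisymm hs.2 hs.1
          subst hs0
          have huS : u ∈ S := by
            have := hdown u v (Finset.mem_insert_self v S) huv hdist hup
            rcases Finset.mem_insert.1 this with rfl | h
            · exact absurd huv T.graph.irrefl
            · exact h
          obtain ⟨w, hwu, hdw⟩ := hparent u hup
          refine hsE (Or.inr ⟨w, u, huS, hwu, hdw, ?_⟩)
          rw [Γ.arc_zero u v huv]
          exact pos_mem_edge_right hwu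
        · intro s hs hsE
          rcases hsE with h | ⟨u', v', hv', h1, h2, h3⟩
          · refine (houter u v huv ?_ s ⟨hs.1.le, hs.2⟩).not_ge (mem_closedBall.1 h)
            intro he
            rcases Sym2.eq_iff.1 he with ⟨h1, -⟩ | ⟨-, h1⟩
            · exact hup h1
            · exact hvp h1
          · exact hother s hs u' v' hv' h1 h2 h3
  have hfin := key (Finset.univ.erase p) (by simp) (fun u v _ _ _ hup => by simp [hup])
  have : E (Finset.univ.erase p) = Γ.carrier ∪ closedBall (Γ.pos p) r := by
    ext z
    constructor
    · rintro (h | ⟨u, v, -, h, -, hz⟩)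
      · exact Or.inr h
      · exact Or.inl (edge_subset_carrier h hz)
    · rintro (h | h)
      · obtain ⟨u, v, huv, hz⟩ := mem_carrier.1 h
        right
        have hne : ∀ {a b : V}, T.graph.dist p a = T.graph.dist p b + 1 → a ∈ Finset.univ.erase p := by
          intro a b hab
          simp only [Finset.mem_erase, Finset.mem_univ, and_true]
          rintro rfl
          rw [SimpleGraph.dist_self] at hab
          omega
        rcases T.isTree.dist_eq_dist_add_one_of_adj p huv with h1 | h1
        · exact ⟨v, u, hne h1, huv.symm, h1, by rwa [edge_symm huv]⟩
        · exact ⟨u, v, hne h1, huv, h1, hz⟩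
      · exact Or.inl h
  rw [← this]
  exact hfin

end PlaneEmbedding

namespace IsLocalModification

variable {V V' : Type*} [Fintype V] [Fintype V'] {T : MarkedBinaryTree V}
  {T' : MarkedBinaryTree V'} {ι : V' ↪ V} {i j : V} {p q : V'} {Γ' : PlaneEmbedding T'}
  {Γ : PlaneEmbedding T} {r : ℝ}
  (hm : IsLocalModification ι i j p q Γ' Γ r) (hd : IsSimpleDecomposition T T' ι i j p q)

include hd in
lemma _root_.TripleCover.IsSimpleDecomposition.arc_connecting_notMem_ball {s₀ : ℝ} (hs₀ : s₀ ∈ Ioo (0 : ℝ) 1)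
    (h1 : ∀ s ∈ Icc 0 s₀, Γ.arc (ι q) (ι p) s = Γ'.arc q p s)
    (h2 : ∀ s ∈ Ico 0 s₀, r < dist (Γ'.arc q p s) (Γ'.pos p)) :
    ∀ s ∈ Icc 0 s₀, Γ.arc (ι q) (ι p) s ∉ ball (Γ'.pos p) r := by
  have hpol := Γ.arc_polygonal _ _ hd.adj_pq.symm
  -- At the moment of entry itself nothing is assumed about the distance; continuity puts that point
  -- in the closed complement of the disc.
  have hcl : Icc 0 s₀ ⊆ closure (Ico 0 s₀) := by rw [closure_Ico hs₀.1.ne]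
  have hcont : ContinuousOn (Γ.arc (ι q) (ι p)) (closure (Ico 0 s₀)) := by
    rw [closure_Ico hs₀.1.ne]
    exact hpol.continuousOn.mono (Icc_subset_Icc le_rfl hs₀.2.le)
  intro s hs
  have h4 := hcont.image_closure (mem_image_of_mem _ (hcl hs))
  have h5 : Γ.arc (ι q) (ι p) '' Ico 0 s₀ ⊆ (ball (Γ'.pos p) r)ᶜ := by
    rintro _ ⟨x, hx, rfl⟩ hx2
    rw [h1 x ⟨hx.1, hx.2.le⟩] at hx2
    exact (h2 x hx).not_gt hx2
  have := closure_mono h5 h4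
  rwa [isOpen_ball.isClosed_compl.closure_eq] at this

include hm

include hd

lemma edge_cases {u v : V} (h : T.graph.Adj u v) :
    (∃ u' v', u = ι u' ∧ v = ι v' ∧ T'.graph.Adj u' v' ∧ s(u', v') ≠ s(p, q)) ∨
      s(u, v) = s(ι q, ι p) ∨ s(u, v) = s(ι p, i) ∨ s(u, v) = s(ι p, j) := by
  by_cases hu : u = i
  · subst hu
    rw [(hd.adj_i_iff v).1 h]
    exact Or.inr (Or.inr (Or.inl Sym2.eq_swap))
  by_cases hu' : u = j
  · subst hu'
    rw [(hd.adj_j_iff v).1 h]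
    exact Or.inr (Or.inr (Or.inr Sym2.eq_swap))
  by_cases hv : v = i
  · subst hv
    rw [(hd.adj_i_iff u).1 h.symm]
    exact Or.inr (Or.inr (Or.inl rfl))
  by_cases hv' : v = j
  · subst hv'
    rw [(hd.adj_j_iff u).1 h.symm]
    exact Or.inr (Or.inr (Or.inr rfl))
  obtain ⟨u', rfl⟩ := (hd.range u).2 ⟨hu, hu'⟩
  obtain ⟨v', rfl⟩ := (hd.range v).2 ⟨hv, hv'⟩
  by_cases he : s(u', v') = s(p, q)
  · rcases Sym2.eq_iff.1 he with ⟨rfl, rfl⟩ | ⟨rfl, rfl⟩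
    · exact Or.inr (Or.inl Sym2.eq_swap)
    · exact Or.inr (Or.inl rfl)
  · exact Or.inl ⟨u', v', rfl, rfl, (hd.adj_iff u' v').2 h, he⟩

lemma mem_carrier_ball_iff {z : ℂ} (hz : z ∈ closedBall (Γ'.pos p) r) :
    z ∈ Γ.carrier ↔ z ∈ Γ.edge (ι q) (ι p) ∨ z ∈ Γ.edge (ι p) i ∨ z ∈ Γ.edge (ι p) j := by
  constructor
  · intro h
    obtain ⟨u, v, huv, hzuv⟩ := PlaneEmbedding.mem_carrier.1 h
    rcases hm.edge_cases hd huv with ⟨u', v', rfl, rfl, h1, h2⟩ | h1 | h1 | h1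
    · obtain ⟨s, hs, rfl⟩ := hzuv
      obtain ⟨e1, e2⟩ := hm.outer u' v' h1 h2 s hs
      rw [mem_closedBall, e1] at hz
      exact absurd hz e2.not_ge
    · exact Or.inl (by rwa [PlaneEmbedding.edge_eq_of_sym2_eq huv h1])
    · exact Or.inr (Or.inl (by rwa [PlaneEmbedding.edge_eq_of_sym2_eq huv h1]))
    · exact Or.inr (Or.inr (by rwa [PlaneEmbedding.edge_eq_of_sym2_eq huv h1]))
  · rintro (h | h | h)
    · exact PlaneEmbedding.edge_subset_carrier hd.adj_pq.symm h
    · exact PlaneEmbedding.edge_subset_carrier hd.adj_i h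
    · exact PlaneEmbedding.edge_subset_carrier hd.adj_j h

/-- Outside the closed disc the two trees coincide. -/
lemma mem_carrier_iff_of_lt {z : ℂ} (hz : r < dist z (Γ'.pos p)) : z ∈ Γ.carrier ↔ z ∈ Γ'.carrier := by
  obtain ⟨s₀, hs₀, h1, h2, h3⟩ := hm.connecting
  constructor
  · intro h
    obtain ⟨u, v, huv, hzuv⟩ := PlaneEmbedding.mem_carrier.1 h
    rcases hm.edge_cases hd huv with ⟨u', v', rfl, rfl, e1, e2⟩ | e1 | e1 | e1
    · obtain ⟨s, hs, rfl⟩ := hzuv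
      rw [(hm.outer u' v' e1 e2 s hs).1]
      exact PlaneEmbedding.edge_subset_carrier e1 ⟨s, hs, rfl⟩
    · rw [← PlaneEmbedding.edge_eq_of_sym2_eq huv e1] at hzuv
      obtain ⟨s, hs, rfl⟩ := hzuv
      rcases le_or_gt s s₀ with hss | hss
      · rw [h1 s ⟨hs.1, hss⟩]
        exact PlaneEmbedding.edge_subset_carrier hd.adj_q.symm ⟨s, hs, rfl⟩
      · exact absurd hz (h3 s ⟨hss, hs.2⟩).1.not_gt
    · rw [← PlaneEmbedding.edge_eq_of_sym2_eq huv e1] at hzuv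
      obtain ⟨s, hs, rfl⟩ := hzuv
      exact absurd hz (hm.leg_i s hs).not_gt
    · rw [← PlaneEmbedding.edge_eq_of_sym2_eq huv e1] at hzuv
      obtain ⟨s, hs, rfl⟩ := hzuv
      exact absurd hz (hm.leg_j s hs).not_gt
  · intro h
    obtain ⟨u, v, huv, hzuv⟩ := PlaneEmbedding.mem_carrier.1 h
    by_cases he : s(u, v) = s(q, p)
    · rw [← PlaneEmbedding.edge_eq_of_sym2_eq huv he] at hzuv
      obtain ⟨s, hs, rfl⟩ := hzuv
      rcases le_or_gt s s₀ with hss | hss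
      · rw [← h1 s ⟨hs.1, hss⟩]
        exact PlaneEmbedding.edge_subset_carrier hd.adj_pq.symm ⟨s, hs, rfl⟩
      · exact absurd hz (h3 s ⟨hss, hs.2⟩).2.not_gt
    · obtain ⟨s, hs, rfl⟩ := hzuv
      rw [← (hm.outer u v huv (by rwa [Sym2.eq_swap (a := p)]) s hs).1]
      exact PlaneEmbedding.edge_subset_carrier ((hd.adj_iff u v).1 huv) ⟨s, hs, rfl⟩

/-- The three arcs are removed in turn: the edge `qp` enters the disc from outside and ends at `p`,
and each leg then issues from the removed point `p`. -/
lemma isPreconnected_ball_diff : IsPreconnected (ball (Γ'.pos p) r \ Γ.carrier) := by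
  obtain ⟨s₀, hs₀, h1, h2, h3⟩ := hm.connecting
  have hqp := hd.adj_pq.symm
  have c1 := (Γ.arc_polygonal _ _ hqp).isPreconnected_diff isOpen_ball isPreconnected_ball
    ⟨hs₀.1.le, hs₀.2⟩ (hd.arc_connecting_notMem_ball hs₀ h1 h2) (fun s hs => (h3 s hs).1)
  have o1 : IsOpen (ball (Γ'.pos p) r \ Γ.edge (ι q) (ι p)) :=
    isOpen_ball.sdiff (PlaneEmbedding.isCompact_edge hqp).isClosed
  have c2 := (Γ.arc_polygonal _ _ hd.adj_i).isPreconnected_diff o1 c1 (s₀ := 0) ⟨le_rfl, zero_lt_one⟩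
    (fun s hs => by
      rw [le_antisymm hs.2 hs.1, Γ.arc_zero _ _ hd.adj_i]
      exact fun h => h.2 (PlaneEmbedding.pos_mem_edge_right hqp))
    (fun s hs => ⟨hm.leg_i s ⟨hs.1.le, hs.2⟩, PlaneEmbedding.arc_notMem_edge hd.adj_i hqp
      (hd.ne_i q).symm (hd.ne_i p).symm hs⟩)
  have o2 : IsOpen ((ball (Γ'.pos p) r \ Γ.edge (ι q) (ι p)) \ Γ.edge (ι p) i) :=
    o1.sdiff (PlaneEmbedding.isCompact_edge hd.adj_i).isClosed
  have c3 := (Γ.arc_polygonal _ _ hd.adj_j).isPreconnected_diff o2 c2 (s₀ := 0) ⟨le_rfl, zero_lt_one⟩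
    (fun s hs => by
      rw [le_antisymm hs.2 hs.1, Γ.arc_zero _ _ hd.adj_j]
      exact fun h => h.1.2 (PlaneEmbedding.pos_mem_edge_right hqp))
    (fun s hs => ⟨⟨hm.leg_j s ⟨hs.1.le, hs.2⟩, PlaneEmbedding.arc_notMem_edge hd.adj_j hqp
      (hd.ne_j q).symm (hd.ne_j p).symm hs⟩, PlaneEmbedding.arc_notMem_edge hd.adj_j hd.adj_i
      (hd.ne_j p).symm hd.ne.symm hs⟩)
  convert c3 using 1
  ext z
  constructor
  · rintro ⟨hz, hzc⟩
    rw [hm.mem_carrier_ball_iff hd (ball_subset_closedBall hz)] at hzc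
    push Not at hzc
    exact ⟨⟨⟨hz, hzc.1⟩, hzc.2.1⟩, hzc.2.2⟩
  · rintro ⟨⟨⟨hz, e1⟩, e2⟩, e3⟩
    refine ⟨hz, ?_⟩
    rw [hm.mem_carrier_ball_iff hd (ball_subset_closedBall hz)]
    push Not
    exact ⟨e1, e2, e3⟩

lemma isPreconnected_compl (hr : 0 < r) : IsPreconnected (Γ'.carrier ∪ closedBall (Γ'.pos p) r)ᶜ := by
  obtain ⟨s₀, hs₀, h1, h2, h3⟩ := hm.connecting
  exact PlaneEmbedding.isPreconnected_compl_carrier_union_closedBall hr hd.adj_p_iff'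
    (fun u v huv hne s hs => (hm.outer u v huv hne s hs).2) hs₀ h2 (fun s hs => (h3 s hs).2)

end IsLocalModification

/-! ### The integrands and their primitives -/

/-- Degrees are compared after cubing: `|z h g| ^ 3` is of order at most `3 (m + 1)` minus the sum
of the exponents, hence at most `-1`. This is the absence of a residue at infinity. -/
lemma tendsto_mul_of_cube {ι : Type*} (s : Finset ι) (l : ι → ℂ) (e : ι → ℕ) {h g : ℂ → ℂ} {m : ℕ}
    {C : ℝ} (hh : ∀ᶠ z in cocompact ℂ, ‖h z‖ ≤ C * ‖z‖ ^ m)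
    (hg : ∀ᶠ z in cocompact ℂ, g z ^ 3 * ∏ i ∈ s, (z - l i) ^ e i = 1)
    (hN : 3 * (m + 1) < ∑ i ∈ s, e i) :
    Tendsto (fun z => z * (h z * g z)) (cocompact ℂ) (𝓝 0) := by
  set N := ∑ i ∈ s, e i
  have hcob := Metric.cobounded_eq_cocompact (α := ℂ)
  have hnorm : Tendsto (fun z : ℂ => ‖z‖) (cocompact ℂ) atTop := tendsto_norm_cocompact_atTop
  have h1 : ∀ᶠ z in cocompact ℂ, ∀ i ∈ s, ‖z‖ / 2 ≤ ‖z - l i‖ := by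
    rw [eventually_all_finset]
    intro i _
    filter_upwards [hnorm.eventually_ge_atTop (2 * ‖l i‖)] with z hz
    have := norm_sub_norm_le z (l i)
    linarith
  have key : ∀ᶠ z in cocompact ℂ, ‖z * (h z * g z)‖ ^ 3 ≤ C ^ 3 * 2 ^ N * ‖z‖⁻¹ := by
    filter_upwards [hh, hg, h1, hnorm.eventually_ge_atTop 1] with z hh hg h1 hz
    have hz0 : 0 < ‖z‖ := by linarith
    have hC : 0 ≤ C := by
      by_contra hC
      have : C * ‖z‖ ^ m < 0 := mul_neg_of_neg_of_pos (not_le.1 hC) (by positivity)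
      linarith [norm_nonneg (h z)]
    have h2 : (‖z‖ / 2) ^ N ≤ ‖∏ i ∈ s, (z - l i) ^ e i‖ := by
      rw [norm_prod, ← Finset.prod_pow_eq_pow_sum]
      refine Finset.prod_le_prod (fun i _ => by positivity) fun i hi => ?_
      rw [norm_pow]
      exact pow_le_pow_left₀ (by positivity) (h1 i hi) _
    have h3 : ‖g z‖ ^ 3 * ‖∏ i ∈ s, (z - l i) ^ e i‖ = 1 := by
      rw [← norm_pow, ← norm_mul, hg, norm_one]
    have h4 : ‖g z‖ ^ 3 * (‖z‖ / 2) ^ N ≤ 1 :=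
      h3 ▸ mul_le_mul_of_nonneg_left h2 (by positivity)
    have h5 : ‖g z‖ ^ 3 * ‖z‖ ^ N ≤ 2 ^ N := by
      rwa [div_pow, ← mul_div_assoc, div_le_one (by positivity)] at h4
    have h6 : ‖z‖ ^ (3 * (m + 1) + 1) ≤ ‖z‖ ^ N := pow_le_pow_right₀ hz hN
    rw [← div_eq_mul_inv, le_div_iff₀ hz0]
    calc ‖z * (h z * g z)‖ ^ 3 * ‖z‖ = ‖h z‖ ^ 3 * (‖g z‖ ^ 3 * ‖z‖ ^ 4) := by
          rw [norm_mul, norm_mul]; ring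
      _ ≤ (C * ‖z‖ ^ m) ^ 3 * (‖g z‖ ^ 3 * ‖z‖ ^ 4) := by gcongr
      _ = C ^ 3 * (‖g z‖ ^ 3 * ‖z‖ ^ (3 * (m + 1) + 1)) := by ring
      _ ≤ C ^ 3 * (‖g z‖ ^ 3 * ‖z‖ ^ N) := by gcongr
      _ ≤ C ^ 3 * 2 ^ N := by gcongr
  have hcube : Tendsto (fun z => ‖z * (h z * g z)‖ ^ 3) (cocompact ℂ) (𝓝 0) := by
    refine squeeze_zero' (Eventually.of_forall fun z => by positivity) key ?_
    simpa using (tendsto_inv_atTop_zero.comp hnorm).const_mul (C ^ 3 * 2 ^ N)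
  rw [tendsto_zero_iff_norm_tendsto_zero]
  rw [Metric.tendsto_nhds] at hcube ⊢
  intro ε hε
  filter_upwards [hcube (ε ^ 3) (by positivity)] with z hz
  rw [dist_zero_right, Real.norm_of_nonneg (by positivity)] at hz ⊢
  exact lt_of_pow_lt_pow_left₀ 3 hε.le hz

namespace PlaneEmbedding

variable {V : Type*} [Fintype V] {T : MarkedBinaryTree V} (Γ : PlaneEmbedding T)

/-- The product `∏ (x - λ) ^ e_λ` over the terminals. -/
noncomputable def weight (e : V → ℕ) (x : ℂ) : ℂ := ∏ v ∈ T.terminals, (x - Γ.pos v) ^ e v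

/-- The plane without the terminals. -/
def domain : Set ℂ := {x | ∀ v ∈ T.terminals, x ≠ Γ.pos v}

variable {Γ}

lemma isOpen_domain : IsOpen Γ.domain := by
  have : Γ.domain = (Γ.pos '' T.terminals)ᶜ := by
    ext x
    simp only [domain, mem_ofPred_eq, mem_compl_iff, mem_image, not_exists, not_and]
    exact ⟨fun h v hv e => h v hv e.symm, fun h v hv e => h v hv e.symm⟩
  rw [this]
  exact (T.terminals.finite_toSet.image _).isClosed.isOpen_compl

lemma compl_carrier_subset_domain : Γ.carrierᶜ ⊆ Γ.domain :=
  fun _ hx v _ e => hx (e ▸ Γ.pos_mem_carrier v)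

lemma weight_ne_zero (e : V → ℕ) {x : ℂ} (hx : x ∈ Γ.domain) : Γ.weight e x ≠ 0 :=
  Finset.prod_ne_zero_iff.2 fun v hv => pow_ne_zero _ (sub_ne_zero.2 (hx v hv))

lemma differentiable_weight (e : V → ℕ) : Differentiable ℂ (Γ.weight e) := by
  unfold weight
  fun_prop

/-- A branch of the cube root of `∏ (x - λ) ^ (-e_λ)` outside the tree, multiplied by a function
that does not grow too fast, has a primitive. -/
lemma exists_branchPrimitive {e : V → ℕ} {h g : ℂ → ℂ} {m : ℕ} {C : ℝ} (hh : Differentiable ℂ h)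
    (hC : ∀ᶠ z in cocompact ℂ, ‖h z‖ ≤ C * ‖z‖ ^ m) (hg : ContinuousOn g Γ.carrierᶜ)
    (hg3 : ∀ x ∉ Γ.carrier, g x ^ 3 * Γ.weight e x = 1)
    (hN : 3 * (m + 1) < ∑ v ∈ T.terminals, e v) :
    ∃ F, IsBranchPrimitive Γ.domain Γ.carrier (fun x => (Γ.weight e x)⁻¹) h g F := by
  have hR : DifferentiableOn ℂ (fun x => (Γ.weight e x)⁻¹) Γ.domain :=
    (differentiable_weight e).differentiableOn.inv fun x hx => weight_ne_zero e hx
  have hcube : ∀ x ∉ Γ.carrier, g x ^ 3 = (Γ.weight e x)⁻¹ := fun x hx => eq_inv_of_mul_eq_one_left (hg3 x hx)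
  have hopen : IsOpen Γ.carrierᶜ := Γ.isClosed_carrier.isOpen_compl
  have hgd : DifferentiableOn ℂ g Γ.carrierᶜ := by
    intro x hx
    have hxd := compl_carrier_subset_domain hx
    refine (hasDerivAt_of_cube_eq (hg.continuousAt (hopen.mem_nhds hx)) ?_
      ((hopen.eventually_mem hx).mono fun y hy => hcube y hy)
      (hR.differentiableAt (isOpen_domain.mem_nhds hxd)).hasDerivAt).differentiableAt.differentiableWithinAt
    intro h0
    have := hg3 x hx
    rw [h0] at this
    norm_num at this
  obtain ⟨F, hF⟩ := exists_primitive_compl Γ.isCompact_carrier Γ.isPreconnected_carrier Γ.carrier_nonempty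
    (hh.differentiableOn.mul hgd) (tendsto_mul_of_cube T.terminals Γ.pos e hC (by
      filter_upwards [Γ.isCompact_carrier.compl_mem_cocompact] with z hz using hg3 z hz) hN)
  exact ⟨F, isOpen_domain, Γ.isClosed_carrier, hR, fun x hx => inv_ne_zero (weight_ne_zero e hx), hh,
    hg.mono fun x hx => hx.2, fun x hx => hcube x hx.2, fun x hx => hF x hx.2⟩

end PlaneEmbedding

/-! ### Periods as integrals of branches -/

/-- The exponents `a` or `b`. -/
def MarkedBinaryTree.exponent {V : Type*} [Fintype V] (T : MarkedBinaryTree V) (τ : Bool) (v : V) : ℕ :=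
  if τ then T.a v else T.b v

/-- The factor by which `ρ` multiplies `1 / y₁` or `1 / y₂`. -/
noncomputable def zeta (τ : Bool) : ℂ := if τ then ω ^ 2 else ω

lemma zeta_cube (τ : Bool) : zeta τ ^ 3 = 1 := by
  cases τ
  · simp [zeta, omega_cube]
  · simp only [zeta, if_true]
    rw [← pow_mul, mul_comm, pow_mul, omega_cube, one_pow]

lemma zeta_ne_one (τ : Bool) : zeta τ ≠ 1 := by
  cases τ
  · simp [zeta, omega_ne_one]
  · intro h
    simp only [zeta, if_true] at h
    have := omega_cube
    rw [pow_succ, h, one_mul] at this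
    exact omega_ne_one this

lemma zeta_ne_zero (τ : Bool) : zeta τ ≠ 0 := ne_zero_of_cube_eq_one (zeta_cube τ)

lemma zeta_sq_ne (τ : Bool) : zeta τ ^ 2 ≠ zeta τ ^ 1 := fun h =>
  zeta_ne_one τ (mul_right_cancel₀ (zeta_ne_zero τ) (by rw [one_mul, ← sq, h, pow_one]))

namespace PlaneEmbedding

variable {V : Type*} [Fintype V] {T : MarkedBinaryTree V} (Γ : PlaneEmbedding T)

/-- `1 / y₁` or `1 / y₂` at the point `(x, y)` of the curve. -/
noncomputable def invY (τ : Bool) (x y : ℂ) : ℂ := if τ then 1 / y else y / Γ.weight 1 x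

variable {Γ}

lemma weight_one (x : ℂ) : Γ.weight 1 x = ∏ v ∈ T.terminals, (x - Γ.pos v) := by simp [weight]

/-- For `y₂` this rests on `a + b = 3`, which makes the product of the two weights a cube. -/
lemma invY_cube (τ : Bool) {x y : ℂ} (hx : x ∈ Γ.domain) (hy : y ^ 3 = Γ.rhs x) :
    Γ.invY τ x y ^ 3 * Γ.weight (T.exponent τ) x = 1 := by
  have h1 : Γ.rhs x = Γ.weight T.a x := rfl
  have h2 := weight_ne_zero T.a hx
  have h3 := weight_ne_zero 1 hx
  have h4 : Γ.weight T.a x * Γ.weight T.b x = Γ.weight 1 x ^ 3 := by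
    simp only [weight, ← Finset.prod_mul_distrib, ← Finset.prod_pow, ← pow_add, T.a_add_b, Pi.one_apply,
      pow_one]
  cases τ
  · have : T.exponent false = T.b := by ext; simp [MarkedBinaryTree.exponent]
    simp only [invY, this, Bool.false_eq_true, if_false]
    rw [div_pow, hy, h1, div_mul_eq_mul_div, h4, div_self (pow_ne_zero _ h3)]
  · have : T.exponent true = T.a := by ext; simp [MarkedBinaryTree.exponent]
    simp only [invY, this, if_true]
    rw [div_pow, one_pow, hy, h1, one_div_mul_cancel h2]

lemma invY_omega_mul (τ : Bool) (x y : ℂ) (k : ℕ) :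
    Γ.invY τ x (ω ^ k * y) = zeta τ ^ k * Γ.invY τ x y := by
  cases τ
  · simp [invY, zeta, mul_div_assoc]
  · simp only [invY, zeta, if_true]
    have : ω ^ k * (ω ^ 2) ^ k = 1 := by
      rw [← pow_mul, ← pow_add, show k + 2 * k = 3 * k by ring, pow_mul, omega_cube, one_pow]
    rw [one_div, mul_inv, one_div, eq_comm, eq_inv_of_mul_eq_one_right this]

lemma continuousOn_invY (τ : Bool) {X : Type*} [TopologicalSpace X] {s : Set X} {x y : X → ℂ}
    (hx : ContinuousOn x s) (hy : ContinuousOn y s) (hd : ∀ t ∈ s, x t ∈ Γ.domain)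
    (hc : ∀ t ∈ s, y t ^ 3 = Γ.rhs (x t)) : ContinuousOn (fun t => Γ.invY τ (x t) (y t)) s := by
  cases τ
  · simp only [invY, Bool.false_eq_true, if_false]
    exact hy.div ((differentiable_weight 1).continuous.comp_continuousOn hx)
      fun t ht => weight_ne_zero 1 (hd t ht)
  · simp only [invY, if_true]
    refine continuousOn_const.div hy fun t ht h0 => ?_
    have := hc t ht
    rw [h0, zero_pow (by norm_num)] at this
    exact weight_ne_zero T.a (hd t ht) this.symm

lemma IsBranch.continuousOn_invY {y₀ : ℂ → ℂ} (hy : Γ.IsBranch y₀) (τ : Bool) :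
    ContinuousOn (fun x => Γ.invY τ x (y₀ x)) Γ.carrierᶜ :=
  PlaneEmbedding.continuousOn_invY τ continuousOn_id hy.1
    (fun _ hx => compl_carrier_subset_domain hx) fun x hx => hy.2 x hx

lemma IsBranch.invY_cube {y₀ : ℂ → ℂ} (hy : Γ.IsBranch y₀) (τ : Bool) (x : ℂ) (hx : x ∉ Γ.carrier) :
    Γ.invY τ x (y₀ x) ^ 3 * Γ.weight (T.exponent τ) x = 1 :=
  PlaneEmbedding.invY_cube τ (compl_carrier_subset_domain hx) (hy.2 x hx)

namespace Loop

variable (c : Γ.Loop)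

/-- The integral of `h dx / y₁` or `h dx / y₂`. -/
noncomputable def integral (τ : Bool) (h : ℂ → ℂ) : ℂ :=
  ∫ s in (0 : ℝ)..1, h (c.x s) * Γ.invY τ (c.x s) (c.y s) * deriv c.x s

lemma period_eq_integral (k : ℕ) : c.period k =
    c.integral (decide (k < T.d₁)) (fun x => x ^ (if k < T.d₁ then k else k - T.d₁)) := by
  unfold period integral
  split_ifs with hk
  · simp [hk, invY, div_eq_mul_inv]
  · simp [hk, invY, weight_one, div_eq_mul_inv, mul_comm]

lemma integral_rho (τ : Bool) (h : ℂ → ℂ) (k : ℕ) :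
    (c.rho k).integral τ h = zeta τ ^ k * c.integral τ h := by
  unfold integral rho
  simp only [invY_omega_mul]
  rw [← intervalIntegral.integral_const_mul]
  congr 1
  ext s
  ring

lemma intervalIntegrable {τ : Bool} {h : ℂ → ℂ} (hh : Continuous h) :
    IntervalIntegrable (fun s => h (c.x s) * Γ.invY τ (c.x s) (c.y s) * deriv c.x s)
      MeasureTheory.volume 0 1 := by
  have hx := c.x_contDiffOn.continuousOn
  have h1 : ContinuousOn (fun s => h (c.x s) * Γ.invY τ (c.x s) (c.y s) *
      derivWithin c.x (Icc 0 1) s) (Icc 0 1) :=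
    ((hh.comp_continuousOn hx).mul (continuousOn_invY τ hx c.y_continuousOn c.avoids c.on_curve)).mul
      (c.x_contDiffOn.continuousOn_derivWithin (uniqueDiffOn_Icc zero_lt_one) le_rfl)
  -- A loop is differentiable only within `[0, 1]`; `deriv` and `derivWithin` agree in the interior,
  -- hence almost everywhere.
  refine (h1.mono (by rw [uIcc_of_le zero_le_one])).intervalIntegrable.congr_ae ?_
  rw [uIoc_of_le zero_le_one, ← MeasureTheory.Measure.restrict_congr_set
    MeasureTheory.Ioo_ae_eq_Ioc]
  filter_upwards [MeasureTheory.ae_restrict_mem measurableSet_Ioo] with s hs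
  rw [derivWithin_of_mem_nhds (Icc_mem_nhds hs.1 hs.2)]

lemma integral_sub_const_mul {τ : Bool} {h h' : ℂ → ℂ} (hh : Continuous h) (hh' : Continuous h') (a : ℂ) :
    c.integral τ (fun x => h x - a * h' x) = c.integral τ h - a * c.integral τ h' := by
  unfold integral
  rw [← intervalIntegral.integral_const_mul, ← intervalIntegral.integral_sub (c.intervalIntegrable hh)
    ((c.intervalIntegrable hh').const_mul a)]
  congr 1
  ext s
  ring

/-- The sheet on which the cycle `A_v` starts. -/
def _root_.TripleCover.MarkedBinaryTree.startSheet {V : Type*} [Fintype V] (T : MarkedBinaryTree V)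
    (v : V) : ℕ := if T.white v then 2 else 1

/-- The sheet on which the cycle `A_v` is continued. -/
def _root_.TripleCover.MarkedBinaryTree.midSheet {V : Type*} [Fintype V] (T : MarkedBinaryTree V)
    (v : V) : ℕ := if T.white v then 1 else 2

lemma _root_.TripleCover.MarkedBinaryTree.zeta_start_ne_mid (τ : Bool) (v : V) :
    zeta τ ^ T.startSheet v ≠ zeta τ ^ T.midSheet v := by
  unfold MarkedBinaryTree.startSheet MarkedBinaryTree.midSheet
  split_ifs
  · exact zeta_sq_ne τ
  · exact (zeta_sq_ne τ).symm

/-- The factor `f` converts `1 / y` into a cube root with other exponents. It is used with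
`limitFactor`, with the constant `κ t`, and with `1`. The jumps are returned as properties of points
of the two edges, so that the loop can be forgotten. -/
lemma IsCycleA.integral_mul_eq {c : Γ.Loop} {y₀ : ℂ → ℂ} {v : V} (hc : c.IsCycleA y₀ v) (τ : Bool)
    {e : V → ℕ} {f h F : ℂ → ℂ} (hf : ContinuousOn f Γ.domain)
    (hf3 : ∀ x ∈ Γ.domain, f x ^ 3 * Γ.weight e x = Γ.weight (T.exponent τ) x)
    (H : IsBranchPrimitive Γ.domain Γ.carrier (fun x => (Γ.weight e x)⁻¹) h
      (fun x => f x * Γ.invY τ x (y₀ x)) F) :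
    ∃ n₁ n₂ : V, T.graph.Adj v n₁ ∧ T.graph.Adj v n₂ ∧ Γ.Anticlockwise v n₁ n₂ (T.mark v) ∧
    ∃ s₁ ∈ Ioo (0 : ℝ) 1, ∃ s₂ ∈ Ioo (0 : ℝ) 1, ∃ J₁ J₂ : ℂ,
      HoldsAt Γ.domain Γ.carrier (fun x => (Γ.weight e x)⁻¹) h (fun x => f x * Γ.invY τ x (y₀ x)) F
        (QCross (zeta τ ^ T.startSheet v) (zeta τ ^ T.midSheet v) J₁) (Γ.arc v n₁ s₁) ∧
      HoldsAt Γ.domain Γ.carrier (fun x => (Γ.weight e x)⁻¹) h (fun x => f x * Γ.invY τ x (y₀ x)) F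
        (QCross (zeta τ ^ T.startSheet v) (zeta τ ^ T.midSheet v) J₂) (Γ.arc v n₂ s₂) ∧
      c.integral τ (fun x => h x * f x) = J₂ - J₁ := by
  obtain ⟨n₁, n₂, h1, h2, hac, s₁, s₂, e0, e1, e2, ⟨q₂, hq₂, hx₂⟩, ⟨q₁, hq₁, hx₁⟩, hA, hB, hC⟩ := hc
  have hsh : ∀ k s, (c.x s, c.y s) ∈ Γ.sheet y₀ k → c.x s ∉ Γ.carrier ∧
      f (c.x s) * Γ.invY τ (c.x s) (c.y s) = zeta τ ^ k * (f (c.x s) * Γ.invY τ (c.x s) (y₀ (c.x s))) := by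
    rintro k s ⟨ha, hb⟩
    refine ⟨ha, ?_⟩
    rw [show c.y s = ω ^ k * y₀ (c.x s) from hb, invY_omega_mul]
    ring
  have hcar : ∀ {n q}, T.graph.Adj v n → q ∈ Ioo (0 : ℝ) 1 → Γ.arc v n q ∈ Γ.carrier :=
    fun hn hq => edge_subset_carrier hn ⟨_, Ioo_subset_Icc_self hq, rfl⟩
  obtain ⟨J₁, J₂, a1, a2, a3⟩ := H.integral_eq_sub_jumps (x := c.x)
    (w := fun s => f (c.x s) * Γ.invY τ (c.x s) (c.y s)) (T.zeta_start_ne_mid τ v)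
    c.x_contDiffOn ((hf.comp c.x_contDiffOn.continuousOn c.avoids).mul
      (continuousOn_invY τ c.x_contDiffOn.continuousOn c.y_continuousOn c.avoids c.on_curve))
    (fun s hs => by
      have hd := c.avoids s hs
      have := PlaneEmbedding.invY_cube τ hd (c.on_curve s hs)
      rw [← hf3 _ hd] at this
      rw [mul_pow]
      exact eq_inv_of_mul_eq_one_left (by rw [← this]; ring))
    c.avoids c.x_closed e0 e1 e2 (hx₂ ▸ hcar h2 hq₂) (hx₁ ▸ hcar h1 hq₁)
    (hx₂ ▸ twoSided_of_mem_openEdge h2 hq₂) (hx₁ ▸ twoSided_of_mem_openEdge h1 hq₁)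
    (fun s hs hs' => hsh _ s (hA s hs hs')) (fun s hs hs' => hsh _ s (hB s hs hs'))
    (fun s hs hs' => hsh _ s (hC s hs hs'))
  rw [← hx₂] at a1
  rw [← hx₁] at a2
  refine ⟨n₁, n₂, h1, h2, hac, q₁, hq₁, q₂, hq₂, J₁, J₂, a2, a1, ?_⟩
  rw [← a3]
  simp only [integral, mul_assoc]

lemma IsCycleA.integral_eq {c : Γ.Loop} {y₀ : ℂ → ℂ} {v : V} (hc : c.IsCycleA y₀ v) (τ : Bool)
    {h F : ℂ → ℂ} (H : IsBranchPrimitive Γ.domain Γ.carrier (fun x => (Γ.weight (T.exponent τ) x)⁻¹) h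
      (fun x => Γ.invY τ x (y₀ x)) F) :
    ∃ n₁ n₂ : V, T.graph.Adj v n₁ ∧ T.graph.Adj v n₂ ∧ Γ.Anticlockwise v n₁ n₂ (T.mark v) ∧
    ∃ s₁ ∈ Ioo (0 : ℝ) 1, ∃ s₂ ∈ Ioo (0 : ℝ) 1, ∃ J₁ J₂ : ℂ,
      HoldsAt Γ.domain Γ.carrier (fun x => (Γ.weight (T.exponent τ) x)⁻¹) h (fun x => Γ.invY τ x (y₀ x)) F
        (QCross (zeta τ ^ T.startSheet v) (zeta τ ^ T.midSheet v) J₁) (Γ.arc v n₁ s₁) ∧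
      HoldsAt Γ.domain Γ.carrier (fun x => (Γ.weight (T.exponent τ) x)⁻¹) h (fun x => Γ.invY τ x (y₀ x)) F
        (QCross (zeta τ ^ T.startSheet v) (zeta τ ^ T.midSheet v) J₂) (Γ.arc v n₂ s₂) ∧
      c.integral τ h = J₂ - J₁ := by
  simpa only [one_mul, mul_one] using hc.integral_mul_eq τ (f := fun _ => 1) continuousOn_const
    (fun x _ => by rw [one_pow, one_mul]) (by simpa only [one_mul] using H)

end Loop

end PlaneEmbedding

/-! ### Primitives along the edges of the tree -/

lemma HoldsAt.restrict {D D' K : Set ℂ} {R h g F : ℂ → ℂ} {Q : Set (ℂ × ℂ) → Prop} {P : ℂ}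
    (hP : HoldsAt D K R h g F Q P) (hD' : IsOpen D') (hPD : P ∈ D') : HoldsAt D' K R h g F Q P := by
  obtain ⟨δ, hδ, -, Y, Φ, S, hG, hS, hQ⟩ := hP
  obtain ⟨δ', hδ', hsub⟩ := Metric.isOpen_iff.1 hD' P hPD
  exact ⟨min δ δ', lt_min hδ hδ', (ball_subset_ball (min_le_right _ _)).trans hsub, Y, Φ, S,
    hG.mono (ball_subset_ball (min_le_left _ _)), hS, hQ⟩

namespace PlaneEmbedding

variable {V : Type*} [Fintype V] {T : MarkedBinaryTree V} {Γ : PlaneEmbedding T} {e : V → ℕ}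
  {h g F : ℂ → ℂ}

lemma pos_ne_arc {u v w : V} (huv : T.graph.Adj u v) {s : ℝ} (hs : s ∈ Ioo (0 : ℝ) 1) :
    Γ.arc u v s ≠ Γ.pos w := by
  intro he
  have hinj := (Γ.arc_polygonal u v huv).1
  have hs' : s ∈ Icc (0 : ℝ) 1 := Ioo_subset_Icc_self hs
  have hmem : Γ.pos w ∈ Γ.edge u v := he ▸ ⟨s, hs', rfl⟩
  rcases mem_of_pos_mem_edge huv hmem with rfl | rfl
  · rw [← Γ.arc_zero _ _ huv] at he
    exact hs.1.ne' (hinj hs' ⟨le_rfl, zero_le_one⟩ he)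
  · rw [← arc_one huv] at he
    exact hs.2.ne (hinj hs' ⟨zero_le_one, le_rfl⟩ he)

lemma arc_mem_domain {u v : V} (huv : T.graph.Adj u v) {s : ℝ} (hs : s ∈ Ioo (0 : ℝ) 1) :
    Γ.arc u v s ∈ Γ.domain := fun _ _ => pos_ne_arc huv hs

lemma pos_mem_domain {v : V} (hv : T.IsInner v) : Γ.pos v ∈ Γ.domain := fun _ hw he =>
  T.mem_terminals.1 hw (Γ.pos_injective he ▸ hv)

/-- The point of crossing may be moved freely along an edge. -/
lemma holdsAt_edge_iff
    (H : IsBranchPrimitive Γ.domain Γ.carrier (fun x => (Γ.weight e x)⁻¹) h g F)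
    {Q : Set (ℂ × ℂ) → Prop} (hQ : ActInvariant Q) {u v : V} (huv : T.graph.Adj u v) {s s' : ℝ}
    (hs : s ∈ Ioo (0 : ℝ) 1) (hs' : s' ∈ Ioo (0 : ℝ) 1) :
    HoldsAt Γ.domain Γ.carrier (fun x => (Γ.weight e x)⁻¹) h g F Q (Γ.arc u v s) ↔
      HoldsAt Γ.domain Γ.carrier (fun x => (Γ.weight e x)⁻¹) h g F Q (Γ.arc u v s') :=
  H.holdsAt_iff_of_arc hQ ((Γ.arc_polygonal u v huv).continuousOn.mono Ioo_subset_Icc_self)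
    (fun s hs => edge_subset_carrier huv ⟨s, Ioo_subset_Icc_self hs, rfl⟩)
    (fun _ hs => arc_mem_domain huv hs) (fun _ hs => twoSided_of_mem_openEdge huv hs) hs hs'

/-- At a terminal the primitive has a limit, the integral from the terminal being subtracted. -/
lemma exists_endIntegral_of_terminal
    (H : IsBranchPrimitive Γ.domain Γ.carrier (fun x => (Γ.weight e x)⁻¹) h g F) {v : V}
    (hv : v ∈ T.terminals) (he : e v = 1 ∨ e v = 2) {ε₀ : ℝ} (hε₀ : 0 < ε₀) :
    ∃ ε > 0, ε < ε₀ ∧ ball (Γ.pos v) ε \ {Γ.pos v} ⊆ Γ.domain ∧ ∃ W F₀,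
      IsEndIntegral (fun x => (Γ.weight e x)⁻¹) h (Γ.pos v) ε W ∧
      ∀ x ∈ ball (Γ.pos v) ε \ Γ.carrier, F x = F₀ + W x (g x) := by
  classical
  have hopen : IsOpen {x | ∀ w ∈ T.terminals.erase v, x ≠ Γ.pos w} := by
    have : {x | ∀ w ∈ T.terminals.erase v, x ≠ Γ.pos w} = (Γ.pos '' (T.terminals.erase v))ᶜ := by
      ext x
      simp only [mem_ofPred_eq, mem_compl_iff, mem_image, not_exists, not_and]
      exact ⟨fun h v hv e => h v hv e.symm, fun h v hv e => h v hv e.symm⟩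
    rw [this]
    exact ((T.terminals.erase v).finite_toSet.image _).isClosed.isOpen_compl
  obtain ⟨ε₁, hε₁, hsub⟩ := Metric.isOpen_iff.1 hopen (Γ.pos v) fun w hw he =>
    Finset.ne_of_mem_erase hw (Γ.pos_injective he).symm
  obtain ⟨ε, hε, hεlt, hconn, -⟩ :=
    oneSided_of_not_isInner (Γ := Γ) (T.mem_terminals.1 hv) (min ε₁ ε₀) (lt_min hε₁ hε₀)
  have hsub' : ball (Γ.pos v) ε ⊆ {x | ∀ w ∈ T.terminals.erase v, x ≠ Γ.pos w} :=
    (ball_subset_ball (hεlt.le.trans (min_le_left _ _))).trans hsub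
  have hdom : ball (Γ.pos v) ε \ {Γ.pos v} ⊆ Γ.domain := by
    intro x hx w hw
    by_cases hwv : w = v
    · rw [hwv]
      exact hx.2
    · exact hsub' hx.1 w (Finset.mem_erase.2 ⟨hwv, hw⟩)
  have hprod : ∀ x ∈ ball (Γ.pos v) ε, ∏ w ∈ T.terminals.erase v, (x - Γ.pos w) ^ e w ≠ 0 :=
    fun x hx => Finset.prod_ne_zero_iff.2 fun w hw => pow_ne_zero _ (sub_ne_zero.2 (hsub' hx w hw))
  obtain ⟨W, hW⟩ := exists_endIntegral (R := fun x => (Γ.weight e x)⁻¹)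
    (r := fun x => (∏ w ∈ T.terminals.erase v, (x - Γ.pos w) ^ e w)⁻¹) he hε
    (DifferentiableOn.inv (by fun_prop) hprod) (fun x hx => inv_ne_zero (hprod x hx))
    (fun x hx hxv => by
      have : (x - Γ.pos v) ^ e v ≠ 0 := pow_ne_zero _ (sub_ne_zero.2 hxv)
      rw [weight, ← Finset.mul_prod_erase _ _ hv, mul_inv, mul_comm, ← mul_assoc,
        mul_inv_cancel₀ this, one_mul]) H.differentiable
  have hs : ball (Γ.pos v) ε \ Γ.carrier ⊆ Γ.domain \ Γ.carrier := fun x hx =>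
    ⟨compl_carrier_subset_domain hx.2, hx.2⟩
  obtain ⟨F₀, hF₀⟩ := hW.exists_eq _ (isOpen_ball.sdiff Γ.isClosed_carrier) hconn sdiff_subset
    (fun h => h.2 (Γ.pos_mem_carrier v)) g F (H.continuousOn.mono hs) (fun x hx => H.cube x (hs hx))
    (fun x hx => H.hasDerivAt x (hs hx))
  exact ⟨ε, hε, hεlt.trans_le (min_le_right _ _), hdom, W, F₀, hW, hF₀⟩

lemma holdsAt_qTerm_edge
    (H : IsBranchPrimitive Γ.domain Γ.carrier (fun x => (Γ.weight e x)⁻¹) h g F) {v u : V}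
    (hv : v ∈ T.terminals) {ε : ℝ} (hε : 0 < ε) (hdom : ball (Γ.pos v) ε \ {Γ.pos v} ⊆ Γ.domain)
    {W : ℂ → ℂ → ℂ} {F₀ : ℂ} (hW : IsEndIntegral (fun x => (Γ.weight e x)⁻¹) h (Γ.pos v) ε W)
    (hF₀ : ∀ x ∈ ball (Γ.pos v) ε \ Γ.carrier, F x = F₀ + W x (g x)) (hu : T.graph.Adj v u) {s : ℝ}
    (hs : s ∈ Ioo (0 : ℝ) 1) :
    HoldsAt Γ.domain Γ.carrier (fun x => (Γ.weight e x)⁻¹) h g F (QTerm F₀) (Γ.arc v u s) := by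
  have hc := (Γ.arc_polygonal v u hu).continuousOn
  refine H.holdsAt_qTerm_of_leg hW hε hdom (fun h => h v hv rfl) hF₀ (hc.mono Ioo_subset_Icc_self)
    (fun s hs => edge_subset_carrier hu ⟨s, Ioo_subset_Icc_self hs, rfl⟩)
    (fun s hs => arc_mem_domain hu hs) (fun s hs => twoSided_of_mem_openEdge hu hs) ?_ hs
  have := (hc 0 ⟨le_rfl, zero_le_one⟩).mono_left (nhdsWithin_mono 0 Ioc_subset_Icc_self)
  rwa [nhdsWithin_Ioc_eq_nhdsGT zero_lt_one, Γ.arc_zero v u hu] at this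

lemma arc_reverse {u v : V} (huv : T.graph.Adj u v) {s : ℝ} (hs : s ∈ Ioo (0 : ℝ) 1) :
    Γ.arc u v s = Γ.arc v u (1 - s) :=
  Γ.arc_symm v u huv.symm s (Ioo_subset_Icc_self hs)

lemma eventually_polar_of_edge {v a : V} {θ : ℝ} (ha : T.graph.Adj v a)
    (hst : StarAt (Γ.edge v a) (Γ.pos v) {θ}) {A : ℂ → Prop}
    (hA : ∀ s ∈ Ioo (0 : ℝ) 1, A (Γ.arc v a s)) :
    ∀ᶠ ρ in 𝓝[>] (0 : ℝ), A (polar (Γ.pos v) ρ θ) := by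
  obtain ⟨-, δ, hδ, hz⟩ := hst
  have hne : Γ.pos a ≠ Γ.pos v := fun h => ha.ne (Γ.pos_injective h).symm
  filter_upwards [Ioo_mem_nhdsGT (lt_min hδ (dist_pos.2 hne))] with ρ hρ
  have hd := dist_polar (Γ.pos v) hρ.1.le θ
  have hρ1 := hρ.2.trans_le (min_le_left _ _)
  have hρ2 := hρ.2.trans_le (min_le_right _ _)
  obtain ⟨s, hs, he⟩ := (hz (polar (Γ.pos v) ρ θ) (by rwa [mem_ball, hd])
    (by intro h; rw [h, dist_self] at hd; exact hρ.1.ne hd)).2 ⟨θ, rfl, ρ, hρ.1, rfl⟩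
  rw [← he] at hd ⊢
  refine hA s ⟨lt_of_le_of_ne hs.1 ?_, lt_of_le_of_ne hs.2 ?_⟩
  · rintro rfl
    rw [Γ.arc_zero v a ha, dist_self] at hd
    exact hρ.1.ne hd
  · rintro rfl
    rw [arc_one ha] at hd
    exact hρ2.ne hd.symm

/-- Congruence passes from two edges through the vertex and then, by continuity and constancy along
the arc, to the whole third edge. -/
lemma holdsAt_qAdm_inner
    (H : IsBranchPrimitive Γ.domain Γ.carrier (fun x => (Γ.weight e x)⁻¹) h g F) {Λ : AddSubgroup ℂ}
    (hΛ : ∀ ρ : ℂ, ρ ^ 3 = 1 → ∀ z ∈ Λ, ρ * z ∈ Λ) {v a b c : V} (hv : T.IsInner v)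
    (ha : T.graph.Adj v a) (hb : T.graph.Adj v b) (hc : T.graph.Adj v c) (hac : Γ.Anticlockwise v a b c)
    (h1 : ∀ s ∈ Ioo (0 : ℝ) 1, HoldsAt Γ.domain Γ.carrier (fun x => (Γ.weight e x)⁻¹) h g F (QAdm Λ)
      (Γ.arc v a s))
    (h2 : ∀ s ∈ Ioo (0 : ℝ) 1, HoldsAt Γ.domain Γ.carrier (fun x => (Γ.weight e x)⁻¹) h g F (QAdm Λ)
      (Γ.arc v b s)) :
    HoldsAt Γ.domain Γ.carrier (fun x => (Γ.weight e x)⁻¹) h g F (QAdm Λ) (Γ.pos v) ∧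
      ∀ s ∈ Ioo (0 : ℝ) 1, HoldsAt Γ.domain Γ.carrier (fun x => (Γ.weight e x)⁻¹) h g F (QAdm Λ)
        (Γ.arc v c s) := by
  obtain ⟨θ₁, θ₂, θ₃, h12, h23, h31, hst, hsa, hsb⟩ := hac.exists_starAt hv ha hb hc
  have hP := H.holdsAt_qAdm_of_star hΛ hst h12 h23 h31 (pos_mem_domain hv)
    (eventually_polar_of_edge ha hsa h1) (eventually_polar_of_edge hb hsb h2)
  refine ⟨hP, fun s hs => ?_⟩
  have hcont := ((Γ.arc_polygonal v c hc).continuousOn 0 ⟨le_rfl, zero_le_one⟩).mono_left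
    (nhdsWithin_mono 0 Ioc_subset_Icc_self)
  rw [nhdsWithin_Ioc_eq_nhdsGT zero_lt_one, Γ.arc_zero v c hc] at hcont
  obtain ⟨s', hs', hs2⟩ := ((hcont.eventually (hP.qAdm_nearby H)).and
    (Ioo_mem_nhdsGT (zero_lt_one (α := ℝ)))).exists
  exact (holdsAt_edge_iff H (actInvariant_qAdm hΛ) hc hs hs2).2
    (hs' (edge_subset_carrier hc ⟨s', Ioo_subset_Icc_self hs2, rfl⟩) (twoSided_of_mem_openEdge hc hs2))

end PlaneEmbedding

/-! ### The cycle at the collapsing vertex -/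

namespace IsLocalModification

variable {V V' : Type*} [Fintype V] [Fintype V'] {T : MarkedBinaryTree V}
  {T' : MarkedBinaryTree V'} {ι : V' ↪ V} {i j : V} {p q : V'} {Γ' : PlaneEmbedding T'}
  {Γ : PlaneEmbedding T} {r : ℝ}
  (hm : IsLocalModification ι i j p q Γ' Γ r) (hd : IsSimpleDecomposition T T' ι i j p q)

include hm hd

lemma pos_i_mem : Γ.pos i ∈ ball (Γ'.pos p) r := by
  rw [← PlaneEmbedding.arc_one hd.adj_i]
  exact hm.leg_i 1 ⟨zero_le_one, le_rfl⟩

lemma pos_j_mem : Γ.pos j ∈ ball (Γ'.pos p) r := by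
  rw [← PlaneEmbedding.arc_one hd.adj_j]
  exact hm.leg_j 1 ⟨zero_le_one, le_rfl⟩

lemma pos_outer {v : V'} (hv : v ≠ p) :
    Γ.pos (ι v) = Γ'.pos v ∧ r < dist (Γ'.pos v) (Γ'.pos p) := by
  obtain ⟨u, hu⟩ := T'.exists_adj v
  have hu' := (hd.adj_iff v u).1 hu
  by_cases he : s(v, u) = s(p, q)
  · rcases Sym2.eq_iff.1 he with ⟨rfl, rfl⟩ | ⟨rfl, rfl⟩
    · exact absurd rfl hv
    · obtain ⟨s₀, hs₀, h1, h2, -⟩ := hm.connecting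
      rw [← Γ.arc_zero _ _ hu', ← Γ'.arc_zero _ _ hu]
      exact ⟨h1 0 ⟨le_rfl, hs₀.1.le⟩, h2 0 ⟨le_rfl, hs₀.1⟩⟩
  · rw [← Γ.arc_zero _ _ hu', ← Γ'.arc_zero _ _ hu]
    exact hm.outer v u hu he 0 ⟨le_rfl, zero_le_one⟩

lemma pos_notMem_ball {k : V} (hki : k ≠ i) (hkj : k ≠ j) (hk : k ≠ ι p) :
    Γ.pos k ∉ ball (Γ'.pos p) r := by
  obtain ⟨v, rfl⟩ := (hd.range k).2 ⟨hki, hkj⟩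
  have hv : v ≠ p := fun h => hk (by rw [h])
  rw [mem_ball, (hm.pos_outer hd hv).1]
  exact (hm.pos_outer hd hv).2.not_gt

open Classical in
/-- The integral over the cycle at the vertex `p`, in terms of a line integral between the two
colliding terminals. -/
theorem integral_cycleA (τ : Bool) {y₀ h F n : ℂ → ℂ}
    (H : IsBranchPrimitive Γ.domain Γ.carrier (fun x => (Γ.weight (T.exponent τ) x)⁻¹) h
      (fun x => Γ.invY τ x (y₀ x)) F) {c : Γ.Loop} (hc : c.IsCycleA y₀ (ι p))
    (hn : DifferentiableOn ℂ n (ball (Γ'.pos p) r))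
    (hn3 : ∀ x ∈ ball (Γ'.pos p) r,
      n x ^ 3 * ∏ k ∈ T'.terminals.erase p, (x - Γ'.pos k) ^ T.exponent τ (ι k) = 1) :
    ∃ c₀ : ℂ, c₀ ^ 3 * (-(Γ.pos j - Γ.pos i) ^ 2) ^ T.exponent τ i = 1 ∧
      c.integral τ h ^ 3 = (zeta τ - zeta τ ^ 2) ^ 3 *
        ((Γ.pos j - Γ.pos i) * c₀ * legIntegral h n (T.exponent τ i) (Γ.pos i) (Γ.pos j)) ^ 3 := by
  set K := Γ.carrier
  set e := T.exponent τ
  set B := ball (Γ'.pos p) r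
  have hei : e i = 1 ∨ e i = 2 := by
    cases τ
    · right; simp [e, MarkedBinaryTree.exponent, MarkedBinaryTree.b, hd.white_i]
    · left; simp [e, MarkedBinaryTree.exponent, hd.a_i]
  have hij : e j = e i := by
    simp [e, MarkedBinaryTree.exponent, MarkedBinaryTree.a, MarkedBinaryTree.b, hd.white_i, hd.white_j]
  have hne : Γ.pos i ≠ Γ.pos j := fun h => hd.ne (Γ.pos_injective h)
  have hiB := hm.pos_i_mem hd
  have hjB := hm.pos_j_mem hd
  have hBD : B \ {Γ.pos i, Γ.pos j} ⊆ Γ.domain := by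
    intro x hx k hk hxk
    by_cases hki : k = i
    · exact hx.2 (Or.inl (hki ▸ hxk))
    by_cases hkj : k = j
    · exact hx.2 (Or.inr (hkj ▸ hxk))
    exact hm.pos_notMem_ball hd hki hkj
      (fun h => T.mem_terminals.1 hk (h ▸ hd.isInner_p)) (hxk ▸ hx.1)
  have hBo : IsOpen (B \ {Γ.pos i, Γ.pos j}) := isOpen_ball.sdiff (by simp : (Set.Finite {Γ.pos i, Γ.pos j})).isClosed
  have hsm : ∀ {l l' : ℂ}, l ∈ B → l ≠ l' → ∃ ε₀ > 0, ball l ε₀ \ {l} ⊆ B \ {l, l'} := by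
    intro l l' hl hll
    obtain ⟨ε₁, hε₁, hs⟩ := Metric.isOpen_iff.1 isOpen_ball l hl
    refine ⟨min ε₁ (dist l' l), lt_min hε₁ (dist_pos.2 hll.symm), fun x hx =>
      ⟨hs (ball_subset_ball (min_le_left _ _) hx.1), ?_⟩⟩
    rintro (rfl | rfl)
    · exact hx.2 rfl
    · exact (lt_min_iff.1 (mem_ball.1 hx.1)).2.false
  obtain ⟨ε₁', hε₁', hs₁⟩ := hsm hiB hne
  obtain ⟨ε₂', hε₂', hs₂⟩ := hsm hjB hne.symm
  rw [pair_comm] at hs₂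
  obtain ⟨ε₁, hε₁, hlt₁, hdom₁, W₁, F₁, hW₁, hF₁⟩ :=
    PlaneEmbedding.exists_endIntegral_of_terminal H hd.terminal_i hei hε₁'
  -- The primitive is normalised to have the value `0` at `i`; then `α` is its value at `j`.
  replace H := H.sub_const F₁
  set F' := fun x => F x - F₁
  replace hF₁ : ∀ x ∈ ball (Γ.pos i) ε₁ \ K, F' x = 0 + W₁ x (Γ.invY τ x (y₀ x)) := fun x hx => by
    simp only [F', hF₁ x hx]
    ring
  obtain ⟨ε₂, hε₂, hlt₂, hdom₂, W₂, α, hW₂, hF₂⟩ :=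
    PlaneEmbedding.exists_endIntegral_of_terminal H hd.terminal_j (hij ▸ hei) hε₂'
  have t₁ : ∀ s ∈ Ioo (0 : ℝ) 1, HoldsAt Γ.domain K (fun x => (Γ.weight e x)⁻¹) h
      (fun x => Γ.invY τ x (y₀ x)) F' (QTerm 0) (Γ.arc (ι p) i s) := fun s hs => by
    rw [PlaneEmbedding.arc_reverse hd.adj_i hs]
    exact PlaneEmbedding.holdsAt_qTerm_edge H hd.terminal_i hε₁ hdom₁ hW₁ hF₁ hd.adj_i.symm
      ⟨by linarith [hs.2], by linarith [hs.1]⟩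
  have t₂ : ∀ s ∈ Ioo (0 : ℝ) 1, HoldsAt Γ.domain K (fun x => (Γ.weight e x)⁻¹) h
      (fun x => Γ.invY τ x (y₀ x)) F' (QTerm α) (Γ.arc (ι p) j s) := fun s hs => by
    rw [PlaneEmbedding.arc_reverse hd.adj_j hs]
    exact PlaneEmbedding.holdsAt_qTerm_edge H hd.terminal_j hε₂ hdom₂ hW₂ hF₂ hd.adj_j.symm
      ⟨by linarith [hs.2], by linarith [hs.1]⟩
  -- The vertex `p` is black, so the cycle passes from sheet `1` to sheet `2` on the edge to `j` and
  -- back on the edge to `i`. The jumps are `(ζ - ζ ^ 2) α` and `0`.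
  have hint : c.integral τ h = (zeta τ - zeta τ ^ 2) * α := by
    obtain ⟨n₁, n₂, a1, a2, hac, s₁, hs₁', s₂, hs₂', J₁, J₂, b1, b2, b3⟩ := hc.integral_eq τ H
    rw [hd.mark_p] at hac
    obtain ⟨rfl, rfl⟩ := hm.orientation.unique hd.isInner_p hd.adj_i hd.adj_j hd.adj_pq a1 a2 hac
    have hw : T.white (ι p) = false := by rw [← hd.white_eq, hd.white_p]
    simp only [MarkedBinaryTree.startSheet, MarkedBinaryTree.midSheet, hw, Bool.false_eq_true, if_false,
      pow_one] at b1 b2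
    obtain ⟨S₁, c1, c1'⟩ := b1.and H (actInvariant_qTerm _) (t₁ s₁ hs₁')
    obtain ⟨S₂, c2, c2'⟩ := b2.and H (actInvariant_qTerm _) (t₂ s₂ hs₂')
    rw [b3, c1.eq_of_qTerm c1', c2.eq_of_qTerm c2']
    ring
  have hΛ : ∀ ρ : ℂ, ρ ^ 3 = 1 → ∀ z ∈ eisensteinMultiples α, ρ * z ∈ eisensteinMultiples α :=
    fun ρ hρ z hz => mul_mem_of_cube_eq_one hρ z hz
  have q₁ := fun s hs => (t₁ s hs).imp fun S => QTerm.qAdm (α := α) (Or.inl rfl)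
  have q₂ := fun s hs => (t₂ s hs).imp fun S => QTerm.qAdm (α := α) (Or.inr rfl)
  obtain ⟨q₀, q₃⟩ := PlaneEmbedding.holdsAt_qAdm_inner H hΛ hd.isInner_p hd.adj_i hd.adj_j hd.adj_pq
    hm.orientation q₁ q₂
  -- Inside the disc the cut consists of the three edges at `p`. Their far ends need no argument:
  -- two are the removed branch points, and `q` lies outside.
  have hadm : ∀ P ∈ B \ {Γ.pos i, Γ.pos j}, P ∈ K →
      HoldsAt (B \ {Γ.pos i, Γ.pos j}) K (fun x => (Γ.weight e x)⁻¹) h (fun x => Γ.invY τ x (y₀ x)) F'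
        (QAdm (eisensteinMultiples α)) P := by
    intro P hP hPK
    refine HoldsAt.restrict (D := Γ.domain) ?_ hBo hP
    have ends : ∀ {k : V}, T.graph.Adj (ι p) k → Γ.pos k ∉ B \ {Γ.pos i, Γ.pos j} →
        (∀ s ∈ Ioo (0 : ℝ) 1, HoldsAt Γ.domain K (fun x => (Γ.weight e x)⁻¹) h
          (fun x => Γ.invY τ x (y₀ x)) F' (QAdm (eisensteinMultiples α)) (Γ.arc (ι p) k s)) →
        P ∈ Γ.edge (ι p) k → HoldsAt Γ.domain K (fun x => (Γ.weight e x)⁻¹) h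
          (fun x => Γ.invY τ x (y₀ x)) F' (QAdm (eisensteinMultiples α)) P := by
      rintro k hk hkB hq ⟨s, hs, rfl⟩
      rcases hs.1.eq_or_lt with rfl | h0
      · rwa [Γ.arc_zero _ _ hk]
      rcases hs.2.eq_or_lt with rfl | h1
      · rw [PlaneEmbedding.arc_one hk] at hP
        exact absurd hP hkB
      · exact hq s ⟨h0, h1⟩
    rcases (hm.mem_carrier_ball_iff hd (ball_subset_closedBall hP.1)).1 hPK with h | h | h
    · rw [PlaneEmbedding.edge_symm hd.adj_pq] at h
      refine ends hd.adj_pq (fun h => hm.pos_notMem_ball hd (hd.ne_i q) (hd.ne_j q) ?_ h.1) q₃ h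
      exact fun h => hd.adj_q.ne (ι.injective h).symm
    · exact ends hd.adj_i (by simp) q₁ h
    · exact ends hd.adj_j (by simp) q₂ h
  have hconn : IsPreconnected ((B \ {Γ.pos i, Γ.pos j}) \ K) := by
    convert hm.isPreconnected_ball_diff hd using 1
    ext x
    refine ⟨fun hx => ⟨hx.1.1, hx.2⟩, fun hx => ⟨⟨hx.1, ?_⟩, hx.2⟩⟩
    rintro (h | h)
    · exact hx.2 (h ▸ Γ.pos_mem_carrier i)
    · exact hx.2 ((mem_singleton_iff.1 h) ▸ Γ.pos_mem_carrier j)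
  obtain ⟨c₀, hc₀, hα⟩ := IsBranchPrimitive.cube_eq_legIntegral hei hne hiB hjB hε₁ hε₂ hn
    (fun x hx hxi hxj => by
      have e1 := hn3 x hx
      have e2 : Γ.weight e x = ((x - Γ.pos i) * (x - Γ.pos j)) ^ e i *
          ∏ k ∈ T'.terminals.erase p, (x - Γ'.pos k) ^ e (ι k) := by
        unfold PlaneEmbedding.weight
        rw [hd.prod_terminals, hij, mul_pow]
        congr 1
        refine Finset.prod_congr rfl fun k hk => ?_
        rw [(hm.pos_outer hd (Finset.ne_of_mem_erase hk)).1]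
      have e3 : ((x - Γ.pos i) * (x - Γ.pos j)) ^ e i ≠ 0 :=
        pow_ne_zero _ (mul_ne_zero (sub_ne_zero.2 hxi) (sub_ne_zero.2 hxj))
      have e4 : Γ.weight e x ≠ 0 := PlaneEmbedding.weight_ne_zero e (hBD ⟨hx, by simp [hxi, hxj]⟩)
      rw [eq_inv_of_mul_eq_one_left e1, inv_mul_eq_div, div_eq_iff e4, e2]
      rw [e2] at e4
      field_simp [(mul_ne_zero_iff.1 e4).2])
    (H.mono hBo hBD) hW₁ hW₂ ((sdiff_subset_sdiff_left (ball_subset_ball hlt₁.le)).trans hs₁)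
    ((sdiff_subset_sdiff_left (ball_subset_ball hlt₂.le)).trans hs₂)
    (fun x hx => by rw [hF₁ x hx, zero_add]) hF₂ hconn hadm
  exact ⟨c₀, hc₀, by rw [hint, mul_pow, hα]⟩

end IsLocalModification

/-! ### The limit of the row of the collapsing vertex -/

/-- Dominated convergence: the segment shrinks to `c`, the regular factor tends to its value there,
and the singular weight does not depend on the segment. -/
lemma tendsto_legIntegral {a : ℕ} (ha : a = 1 ∨ a = 2) {h n : ℂ → ℂ} {c : ℂ} {r : ℝ} (hr : 0 < r)
    (hh : Continuous h) (hn : ContinuousOn n (ball c r)) :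
    Tendsto (fun x : ℂ × ℂ => legIntegral h n a x.1 x.2) (𝓝 (c, c))
      (𝓝 (h c * n c * Complex.betaIntegral (1 - a / 3) (1 - a / 3))) := by
  let w : ℝ → ℂ := fun u => (u : ℂ) ^ (-(a / 3 : ℂ)) * (1 - (u : ℂ)) ^ (-(a / 3 : ℂ))
  have hw : IntervalIntegrable w MeasureTheory.volume 0 1 := intervalIntegrable_beta ha
  have hbeta : h c * n c * Complex.betaIntegral (1 - a / 3) (1 - a / 3) =
      ∫ u in (0 : ℝ)..1, h c * n c * w u := by
    rw [intervalIntegral.integral_const_mul, Complex.betaIntegral]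
    have : (1 - a / 3 - 1 : ℂ) = -(a / 3) := by ring
    simp only [this, w]
  have hcont : ContinuousOn (fun z => h z * n z) (ball c r) := hh.continuousOn.mul hn
  have hseg : ∀ {δ : ℝ} {x : ℂ × ℂ}, x.1 ∈ ball c δ → x.2 ∈ ball c δ → ∀ u ∈ Icc (0 : ℝ) 1,
      x.1 + u * (x.2 - x.1) ∈ ball c δ := by
    intro δ x h1 h2 u hu
    have := convex_ball c δ h1 h2 (sub_nonneg.2 hu.2) hu.1 (by ring)
    convert this using 1
    simp only [Complex.real_smul]
    push_cast
    ring
  have hev : ∀ δ > 0, ∀ᶠ x : ℂ × ℂ in 𝓝 (c, c), x.1 ∈ ball c δ ∧ x.2 ∈ ball c δ := fun δ hδ =>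
    ((continuous_fst.tendsto (c, c)).eventually (ball_mem_nhds c hδ)).and
      ((continuous_snd.tendsto (c, c)).eventually (ball_mem_nhds c hδ))
  obtain ⟨δ, hδ, hδ1⟩ := Metric.continuousAt_iff.1
    (hcont.continuousAt (ball_mem_nhds c hr)) 1 zero_lt_one
  rw [hbeta]
  refine intervalIntegral.tendsto_integral_filter_of_dominated_convergence
    (fun u => (‖h c * n c‖ + 1) * ‖w u‖) ?_ ?_ (hw.norm.const_mul _) ?_
  · filter_upwards [hev r hr] with x hx
    refine MeasureTheory.AEStronglyMeasurable.mul ?_ hw.def'.aestronglyMeasurable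
    rw [uIoc_of_le zero_le_one]
    refine ContinuousOn.aestronglyMeasurable ?_ measurableSet_Ioc
    exact hcont.comp (by fun_prop) fun u hu => hseg hx.1 hx.2 u (Ioc_subset_Icc_self hu)
  · filter_upwards [hev δ hδ] with x hx
    refine Eventually.of_forall fun u hu => ?_
    rw [uIoc_of_le zero_le_one] at hu
    rw [norm_mul]
    refine mul_le_mul_of_nonneg_right ?_ (norm_nonneg _)
    have h1 := hδ1 (hseg hx.1 hx.2 u (Ioc_subset_Icc_self hu))
    rw [dist_eq_norm] at h1
    linarith [norm_le_norm_add_norm_sub' (h (x.1 + u * (x.2 - x.1)) * n (x.1 + u * (x.2 - x.1))) (h c * n c)]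
  · refine Eventually.of_forall fun u _ => Tendsto.mul_const _ ?_
    have : Tendsto (fun x : ℂ × ℂ => x.1 + u * (x.2 - x.1)) (𝓝 (c, c)) (𝓝 c) := by
      have h1 : Continuous fun x : ℂ × ℂ => x.1 + u * (x.2 - x.1) := by fun_prop
      have h2 := h1.tendsto (c, c)
      simp only [sub_self, mul_zero, add_zero] at h2
      exact h2
    exact (hcont.continuousAt (ball_mem_nhds c hr)).tendsto.comp this

lemma exists_differentiableOn_cube_root {c : ℂ} {r : ℝ} {f : ℂ → ℂ} (hf : DifferentiableOn ℂ f (ball c r))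
    (h0 : ∀ x ∈ ball c r, f x ≠ 0) :
    ∃ n : ℂ → ℂ, DifferentiableOn ℂ n (ball c r) ∧ ∀ x, n x ^ 3 = f x := by
  obtain ⟨n, hn, hn3⟩ := exists_cube_root hf.continuousOn h0
  refine ⟨n, fun x hx => ?_, hn3⟩
  have hx' := isOpen_ball.mem_nhds hx
  refine (hasDerivAt_of_cube_eq (hn.continuousAt hx') (fun h => h0 x hx ?_)
    (Eventually.of_forall hn3) (hf.differentiableAt hx').hasDerivAt).differentiableAt.differentiableWithinAt
  rw [← hn3, h, zero_pow (by norm_num)]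

open Classical in
/-- The limit of the entries of the row of the collapsing vertex. -/
theorem tendsto_row_p {V V' : Type*} [Fintype V] [Fintype V'] {T : MarkedBinaryTree V}
    {T' : MarkedBinaryTree V'} {ι : V' ↪ V} {i j : V} {p q : V'}
    (hd : IsSimpleDecomposition T T' ι i j p q) {Γ' : PlaneEmbedding T'} {r : ℝ} (hr : 0 < r)
    {Γ : ℂ → PlaneEmbedding T} {lam : V → ℂ}
    (hi : ∀ᶠ t in 𝓝[≠] (0 : ℂ), (Γ t).pos i = Γ'.pos p + t * (lam i - Γ'.pos p))
    (hj : ∀ᶠ t in 𝓝[≠] (0 : ℂ), (Γ t).pos j = Γ'.pos p + t * (lam j - Γ'.pos p))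
    (hΓ : ∀ᶠ t in 𝓝[≠] (0 : ℂ), IsLocalModification ι i j p q Γ' (Γ t) r)
    (S : ∀ t, (Γ t).CycleSystem) {v : T.Inner} (hv : v.1 = ι p) (τ : Bool) {h : ℂ → ℂ}
    (hF : ∀ᶠ t in 𝓝[≠] (0 : ℂ), ∃ F, IsBranchPrimitive (Γ t).domain (Γ t).carrier
      (fun x => ((Γ t).weight (T.exponent τ) x)⁻¹) h (fun x => (Γ t).invY τ x ((S t).y₀ x)) F)
    (hh : Continuous h) :
    Tendsto (fun t => t * (lam i - lam j) * ((S t).B v).integral τ h ^ 3) (𝓝[≠] 0)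
      (𝓝 (if τ then 0 else betaStar ^ 3 * h (Γ'.pos p) ^ 3 *
        ∏ k ∈ T'.terminals.erase p, ((Γ'.pos p - Γ'.pos k) ^ T.b (ι k))⁻¹)) := by
  have hw : T.white (ι p) = false := by rw [← hd.white_eq, hd.white_p]
  set e := T.exponent τ
  have hei : e i = 1 ∨ e i = 2 := by
    cases τ
    · right; simp [e, MarkedBinaryTree.exponent, MarkedBinaryTree.b, hd.white_i]
    · left; simp [e, MarkedBinaryTree.exponent, hd.a_i]
  obtain ⟨t₀, ht₀⟩ := hΓ.exists
  obtain ⟨n, hn, hn3⟩ := exists_differentiableOn_cube_root (c := Γ'.pos p) (r := r)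
    (f := fun x => (∏ k ∈ T'.terminals.erase p, (x - Γ'.pos k) ^ e (ι k))⁻¹)
    (DifferentiableOn.inv (by fun_prop) fun x hx => Finset.prod_ne_zero_iff.2 fun k hk =>
      pow_ne_zero _ (sub_ne_zero.2 fun hxk => (ht₀.pos_outer hd (Finset.ne_of_mem_erase hk)).2.not_gt
        (hxk ▸ hx)))
    (fun x hx => inv_ne_zero (Finset.prod_ne_zero_iff.2 fun k hk =>
      pow_ne_zero _ (sub_ne_zero.2 fun hxk => (ht₀.pos_outer hd (Finset.ne_of_mem_erase hk)).2.not_gt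
        (hxk ▸ hx))))
  have hn0 : ∀ x ∈ ball (Γ'.pos p) r, ∏ k ∈ T'.terminals.erase p, (x - Γ'.pos k) ^ e (ι k) ≠ 0 :=
    fun x hx => Finset.prod_ne_zero_iff.2 fun k hk =>
      pow_ne_zero _ (sub_ne_zero.2 fun hxk => (ht₀.pos_outer hd (Finset.ne_of_mem_erase hk)).2.not_gt
        (hxk ▸ hx))
  -- With `δ = t (λ_j - λ_i)`, the cube of the line integral contains `δ ^ 3 c₀ ^ 3`, which is `δ⁻¹`
  -- for exponent `2` and `-δ` for exponent `1`. The prefactor `-δ` balances the first case and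
  -- makes the second vanish in the limit.
  have key : ∀ᶠ t in 𝓝[≠] (0 : ℂ), t * (lam i - lam j) * ((S t).B v).integral τ h ^ 3 =
      (if τ then (zeta τ - zeta τ ^ 2) ^ 3 * (t * (lam j - lam i)) ^ 2 else (ω - 1) ^ 3) *
        legIntegral h n (e i) (Γ'.pos p + t * (lam i - Γ'.pos p)) (Γ'.pos p + t * (lam j - Γ'.pos p)) ^ 3 := by
    filter_upwards [hi, hj, hΓ, hF, self_mem_nhdsWithin] with t hi hj hΓ hF ht0
    obtain ⟨F, H⟩ := hF
    obtain ⟨c₀, hc₀, hint⟩ := hΓ.integral_cycleA hd τ H (hv ▸ (S t).isCycleA v) hn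
      (fun x hx => by rw [hn3, inv_mul_cancel₀ (hn0 x hx)])
    -- Passing from `A_v` to `B_v` multiplies the integral by a cube root of unity.
    have hB : ((S t).B v).integral τ h ^ 3 = ((S t).A v).integral τ h ^ 3 := by
      unfold PlaneEmbedding.CycleSystem.B
      rw [PlaneEmbedding.Loop.integral_rho, mul_pow, ← pow_mul, mul_comm _ 3, pow_mul, zeta_cube,
        one_pow, one_mul]
    have hne : (Γ t).pos j - (Γ t).pos i ≠ 0 :=
      sub_ne_zero.2 fun h => hd.ne ((Γ t).pos_injective h).symm
    rw [hB, hint, hi, hj]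
    rw [hi, hj] at hne hc₀
    have hδ : Γ'.pos p + t * (lam j - Γ'.pos p) - (Γ'.pos p + t * (lam i - Γ'.pos p)) =
      t * (lam j - lam i) := by ring
    rw [hδ] at hne hc₀ ⊢
    set δ := t * (lam j - lam i)
    have : t * (lam i - lam j) = -δ := by simp only [δ]; ring
    rw [this]
    generalize legIntegral h n (e i) _ _ = I
    have hz : (ω - ω ^ 2) ^ 3 = -(ω - 1) ^ 3 := by
      linear_combination (-(ω - 1) ^ 3) * omega_cube
    cases τ
    · have h2 : T.exponent false i = 2 := by
        simp [MarkedBinaryTree.exponent, MarkedBinaryTree.b, hd.white_i]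
      rw [h2] at hc₀
      simp only [zeta, Bool.false_eq_true, if_false]
      rw [hz]
      have h3 : δ * (δ ^ 3 * c₀ ^ 3) = 1 := by linear_combination hc₀
      linear_combination ((ω - 1) ^ 3 * I ^ 3) * h3
    · have h2 : T.exponent true i = 1 := by simp [MarkedBinaryTree.exponent, hd.a_i]
      rw [h2] at hc₀
      simp only [if_true]
      linear_combination (zeta true - zeta true ^ 2) ^ 3 * δ ^ 2 * I ^ 3 * hc₀
  refine Tendsto.congr' (EventuallyEq.symm key) ?_
  have hpt : Tendsto (fun t : ℂ => (Γ'.pos p + t * (lam i - Γ'.pos p), Γ'.pos p + t * (lam j - Γ'.pos p)))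
      (𝓝[≠] 0) (𝓝 (Γ'.pos p, Γ'.pos p)) := by
    have h1 : Continuous fun t : ℂ =>
      (Γ'.pos p + t * (lam i - Γ'.pos p), Γ'.pos p + t * (lam j - Γ'.pos p)) := by fun_prop
    have h2 := h1.tendsto 0
    simp only [zero_mul, add_zero] at h2
    exact h2.mono_left nhdsWithin_le_nhds
  have hI := ((tendsto_legIntegral hei hr hh hn.continuousOn).comp hpt).pow 3
  cases τ
  · have h2 : T.exponent false = T.b := by ext; simp [MarkedBinaryTree.exponent]
    have hei2 : e i = 2 := by simp [e, h2, MarkedBinaryTree.b, hd.white_i]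
    simp only [Bool.false_eq_true, if_false]
    have := hI.const_mul ((ω - 1) ^ 3)
    refine this.trans_eq ?_
    congr 1
    rw [mul_pow, mul_pow, hn3, betaStar, mul_pow, hei2, Finset.prod_inv_distrib,
      show (1 - (2 : ℕ) / 3 : ℂ) = 1 / 3 by norm_num]
    simp only [e, h2]
    ring
  · simp only [if_true]
    have h1 : Tendsto (fun t : ℂ => (zeta true - zeta true ^ 2) ^ 3 * (t * (lam j - lam i)) ^ 2)
        (𝓝[≠] 0) (𝓝 0) := by
      have h1 : Continuous fun t : ℂ => (zeta true - zeta true ^ 2) ^ 3 * (t * (lam j - lam i)) ^ 2 := by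
        fun_prop
      have h2 := h1.tendsto 0
      simp only [zero_mul, ne_eq, OfNat.ofNat_ne_zero, not_false_eq_true, zero_pow, mul_zero] at h2
      exact h2.mono_left nhdsWithin_le_nhds
    have := h1.mul hI
    rwa [zero_mul] at this

/-! ### Limits of primitives and of jumps -/

/-- Primitives that converge at one point of a connected open set converge everywhere if the
derivatives are multiplied by factors that tend to `1` uniformly. -/
lemma tendsto_of_hasDerivAt {ι : Type*} {l : Filter ι} {U : Set ℂ} (hU : IsOpen U)
    (hUc : IsPreconnected U) {f F : ℂ → ℂ} {m Ft : ι → ℂ → ℂ} (hf : ContinuousOn f U)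
    (hF : ∀ x ∈ U, HasDerivAt F (f x) x)
    (hFt : ∀ᶠ t in l, ∀ x ∈ U, HasDerivAt (Ft t) (m t x * f x) x)
    (hm : ∀ η > 0, ∀ᶠ t in l, ∀ x ∈ U, ‖m t x - 1‖ ≤ η) {x₀ x : ℂ} (hx₀ : x₀ ∈ U) (hx : x ∈ U)
    (h0 : Tendsto (fun t => Ft t x₀) l (𝓝 (F x₀))) : Tendsto (fun t => Ft t x) l (𝓝 (F x)) := by
  refine (IsPreconnected.eq_of_eventually_eq hUc
    (b := fun x => Tendsto (fun t => Ft t x) l (𝓝 (F x))) (fun x hx => ?_) hx hx₀).mpr h0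
  obtain ⟨ε, hε, hfε⟩ := Metric.eventually_nhds_iff_ball.1
    (((hf.continuousAt (hU.mem_nhds hx)).norm.eventually_lt continuousAt_const
      (lt_add_one ‖f x‖)).and (hU.eventually_mem hx))
  refine mem_nhdsWithin_of_mem_nhds (mem_of_superset (ball_mem_nhds x hε) fun y hy => ?_)
  -- Mean value inequality for `Ft - F` on a disc where `f` is bounded: the derivative `(m - 1) f`
  -- is uniformly small there.
  have hd : Tendsto (fun t => (Ft t y - F y) - (Ft t x - F x)) l (𝓝 0) := by
    rw [Metric.tendsto_nhds]
    intro η hη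
    have hpos : 0 < η / 2 / ((‖f x‖ + 1) * ε) := by positivity
    filter_upwards [hFt, hm _ hpos] with t hFt hm
    have hbound := (convex_ball x ε).norm_image_sub_le_of_norm_hasDerivWithin_le
      (f := fun z => Ft t z - F z) (f' := fun z => m t z * f z - f z) (C := η / 2 / ε)
      (fun z hz => ((hFt z (hfε z hz).2).sub (hF z (hfε z hz).2)).hasDerivWithinAt)
      (fun z hz => by
        rw [show m t z * f z - f z = (m t z - 1) * f z by ring, norm_mul]
        calc ‖m t z - 1‖ * ‖f z‖ ≤ η / 2 / ((‖f x‖ + 1) * ε) * (‖f x‖ + 1) :=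
              mul_le_mul (hm z (hfε z hz).2) (hfε z hz).1.le (norm_nonneg _) hpos.le
          _ = η / 2 / ε := by field_simp)
      (mem_ball_self hε) hy
    rw [dist_zero_right]
    refine hbound.trans_lt ?_
    rw [mem_ball, dist_eq_norm] at hy
    calc η / 2 / ε * ‖y - x‖ ≤ η / 2 / ε * ε := by gcongr
      _ = η / 2 := by field_simp
      _ < η := by linarith
  refine eq_iff_iff.2 ⟨fun h => ?_, fun h => ?_⟩
  · have := (h.sub_const (F y)).sub hd
    simp only [sub_sub_cancel, sub_self] at this
    simpa using this.add_const (F x)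
  · have := (h.sub_const (F x)).add hd
    simp only [add_sub_cancel, sub_self, add_zero] at this
    simpa using this.add_const (F y)

/-- The jump is `±ρ⁻¹` times the difference of the constants, and the coefficient depends only on
the first components. With these fixed, jumps are continuous in the constants. -/
lemma QCross.exists_linear {u₁ u₂ J a₁ a₂ B₁ B₂ : ℂ} (h : QCross u₁ u₂ J {(a₁, B₁), (a₂, B₂)}) :
    ∃ k, J = k * (B₂ - B₁) ∧ ∀ B₁' B₂', QCross u₁ u₂ (k * (B₂' - B₁')) {(a₁, B₁'), (a₂, B₂')} := by
  obtain ⟨ρ, C₁, C₂, hρ, heq, hJ⟩ := h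
  have hρ0 := ne_zero_of_cube_eq_one hρ
  rw [pair_eq_pair_iff] at heq
  rcases heq with ⟨e1, e2⟩ | ⟨e1, e2⟩ <;> rw [Prod.mk.injEq] at e1 e2
  · refine ⟨ρ⁻¹, ?_, fun B₁' B₂' => ⟨ρ, B₁', B₂', hρ, by rw [e1.1, e2.1], by field_simp⟩⟩
    rw [e1.2, e2.2, hJ]
    field_simp
  · refine ⟨-ρ⁻¹, ?_, fun B₁' B₂' => ⟨ρ, B₂', B₁', hρ, by rw [e1.1, e2.1, pair_comm], by field_simp; ring⟩⟩
    rw [e1.2, e2.2, neg_mul, ← mul_neg, neg_sub, hJ]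
    field_simp

/-- One test point on each side, chosen once, serves for all branches whose cut agrees with `K` near
`P`. Values at fixed points are what can be followed as `t` tends to `0`. -/
lemma TwoSided.exists_exactVals {K : Set ℂ} {P : ℂ} (htwo : TwoSided K P) (hPK : P ∈ K) {ε : ℝ}
    (hε : 0 < ε) : ∃ x₁ ∈ ball P ε \ K, ∃ x₂ ∈ ball P ε \ K, ∀ {D K' : Set ℂ} {R h g F Y Φ : ℂ → ℂ},
      IsBranchPrimitive D K' R h g F → ball P ε ⊆ D → IsGerm R h P ε Y Φ →
      (∀ x ∈ ball P ε, x ∈ K' ↔ x ∈ K) →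
      ExactVals K' g F Y Φ P {relVal g F Y Φ x₁, relVal g F Y Φ x₂} := by
  obtain ⟨δ, hδ, hδε, σ₁, σ₂, hσ₁, hσ₂, heq, hcl⟩ := htwo ε hε
  have hbε := ball_subset_ball (x := P) hδε.le
  obtain ⟨hP1, hP2⟩ := hcl _ (mem_ball_self hδ) hPK
  obtain ⟨x₁, hx₁⟩ : σ₁.Nonempty := closure_nonempty_iff.1 ⟨_, hP1⟩
  obtain ⟨x₂, hx₂⟩ : σ₂.Nonempty := closure_nonempty_iff.1 ⟨_, hP2⟩
  have hs1 : σ₁ ⊆ ball P δ \ K := subset_union_left.trans heq.symm.subset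
  have hs2 : σ₂ ⊆ ball P δ \ K := subset_union_right.trans heq.symm.subset
  refine ⟨x₁, ⟨hbε (hs1 hx₁).1, (hs1 hx₁).2⟩, x₂, ⟨hbε (hs2 hx₂).1, (hs2 hx₂).2⟩, ?_⟩
  intro D K' R h g F Y Φ H hsub hG hK
  have hc : ∀ σ : Set ℂ, IsPreconnected σ → σ ⊆ ball P δ \ K → ∀ x ∈ σ, ∀ y ∈ σ,
      relVal g F Y Φ x = relVal g F Y Φ y := fun σ hσ hs x hx y hy =>
    H.relVal_eq_of_isPreconnected hG hσ (fun z hz => hbε (hs hz).1)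
      (fun z hz => ⟨hsub (hbε (hs hz).1), fun hz' => (hs hz).2 ((hK z (hbε (hs hz).1)).1 hz')⟩) hx hy
  refine ⟨?_, ?_⟩
  · filter_upwards [ball_mem_nhds P hδ] with x hx hxK
    have : x ∈ ball P δ \ K := ⟨hx, fun h => hxK ((hK x (hbε hx)).2 h)⟩
    rw [heq] at this
    rcases this with hx | hx
    · exact Or.inl (hc σ₁ hσ₁ hs1 x hx x₁ hx₁)
    · exact Or.inr (hc σ₂ hσ₂ hs2 x hx x₂ hx₂)
  · have hfreq : ∀ σ : Set ℂ, IsPreconnected σ → σ ⊆ ball P δ \ K → P ∈ closure σ → ∀ x₁ ∈ σ,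
        ∃ᶠ x in 𝓝 P, x ∉ K' ∧ relVal g F Y Φ x = relVal g F Y Φ x₁ := by
      intro σ hσ hs hP' x₁ hx₁
      exact (mem_closure_iff_frequently.1 hP').mono fun x hx =>
        ⟨fun h => (hs hx).2 ((hK x (hbε (hs hx).1)).1 h), hc σ hσ hs x hx x₁ hx₁⟩
    rintro v (rfl | rfl)
    · exact hfreq σ₁ hσ₁ hs1 hP1 x₁ hx₁
    · exact hfreq σ₂ hσ₂ hs2 hP2 x₂ hx₂

/-- Convergence of the jumps of primitives across a fixed arc. -/
theorem tendsto_jump {ι : Type*} {l : Filter ι} {O D K : Set ℂ} {R h g F : ℂ → ℂ}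
    {Dt Kt : ι → Set ℂ} {Rt gt Ft m : ι → ℂ → ℂ} (H : IsBranchPrimitive D K R h g F)
    (Ht : ∀ᶠ t in l, IsBranchPrimitive (Dt t) (Kt t) (Rt t) h (gt t) (Ft t)) (hO : IsOpen O)
    (hOK : IsPreconnected (O \ K)) (hKD : O \ K ⊆ D)
    (hDt : ∀ᶠ t in l, ∀ x ∈ O, x ∈ D → x ∈ Dt t) (hKt : ∀ᶠ t in l, ∀ x ∈ O, x ∈ Kt t ↔ x ∈ K)
    (hmc : ∀ᶠ t in l, ContinuousOn (m t) O) (hmR : ∀ᶠ t in l, ∀ x ∈ O, x ∈ D → Rt t x = m t x ^ 3 * R x)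
    (hm1 : ∀ η > 0, ∀ᶠ t in l, ∀ x ∈ O, ‖m t x - 1‖ ≤ η)
    (hgt : ∀ᶠ t in l, ∀ x ∈ O, x ∉ K → gt t x = m t x * g x) {x₀ : ℂ} (hx₀ : x₀ ∈ O \ K)
    (h0 : Tendsto (fun t => Ft t x₀) l (𝓝 (F x₀))) {P : ℂ} (hPO : P ∈ O) (hPD : P ∈ D) (hPK : P ∈ K)
    (htwo : TwoSided K P) {u₁ u₂ : ℂ} (h₁ : u₁ ^ 3 = 1) (h₂ : u₂ ^ 3 = 1) (hu : u₁ ≠ u₂) {J : ℂ}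
    {Jt : ι → ℂ} (hJ : HoldsAt D K R h g F (QCross u₁ u₂ J) P)
    (hJt : ∀ᶠ t in l, HoldsAt (Dt t) (Kt t) (Rt t) h (gt t) (Ft t) (QCross u₁ u₂ (Jt t)) P) :
    Tendsto Jt l (𝓝 J) := by
  obtain ⟨ε, hε, hsub⟩ := Metric.isOpen_iff.1 (hO.inter H.isOpen) P ⟨hPO, hPD⟩
  have hsubO := hsub.trans inter_subset_left
  have hsubD := hsub.trans inter_subset_right
  obtain ⟨x₁, hx₁, x₂, hx₂, hex⟩ := htwo.exists_exactVals hPK hε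
  obtain ⟨Y, Φ, hG⟩ := H.exists_germ hsubD
  have hY0 : ∀ x ∈ ball P ε, Y x ≠ 0 := fun x hx hY => H.ne_zero x (hsubD hx) (by
    rw [← hG.cube x hx, hY, zero_pow (by norm_num)])
  have hQ := (hG.holdsAt_iff H hsubD (mem_ball_self hε) (hex H hsubD hG fun x _ => Iff.rfl)
    (actInvariant_qCross u₁ u₂ J)).1 hJ
  obtain ⟨k, hk, hk'⟩ := hQ.exists_linear
  have hU : IsOpen (O \ K) := hO.sdiff H.isClosed
  have hUt : ∀ᶠ t in l, ∀ x ∈ O \ K, HasDerivAt (Ft t) (m t x * (h x * g x)) x := by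
    filter_upwards [Ht, hDt, hKt, hgt] with t Ht hDt hKt hgt x hx
    have := Ht.hasDerivAt x ⟨hDt x hx.1 (hKD hx), fun h => hx.2 ((hKt x hx.1).1 h)⟩
    rw [hgt x hx.1 hx.2] at this
    exact this.congr_deriv (by ring)
  have hFlim : ∀ x ∈ O \ K, Tendsto (fun t => Ft t x) l (𝓝 (F x)) := fun x hx =>
    tendsto_of_hasDerivAt hU hOK (H.differentiable.continuous.continuousOn.mul
      (H.continuousOn.mono fun z hz => ⟨hKD hz, hz.2⟩))
      (fun z hz => H.hasDerivAt z ⟨hKD hz, hz.2⟩) hUt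
      (fun η hη => (hm1 η hη).mono fun t ht z hz => ht z hz.1) hx₀ hx h0
  -- The germ for `t` is taken to be `m Y`, so that its ratio to the branch `m g` does not depend on
  -- `t`; its primitive is normalised at the test point `x₁`.
  have hgerm : ∀ᶠ t in l, ∃ Φt, IsGerm (Rt t) h P ε (fun x => m t x * Y x) Φt ∧ Φt x₁ = Φ x₁ := by
    filter_upwards [Ht, hDt, hmc, hmR, hm1 (1 / 2) (by norm_num)] with t Ht hDt hmc hmR hm1
    have hbt : ball P ε ⊆ Dt t := fun x hx => hDt x (hsubO hx) (hsubD hx)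
    have hm0 : ∀ x ∈ ball P ε, m t x ≠ 0 := by
      intro x hx h0
      have := hm1 x (hsubO hx)
      rw [h0, zero_sub, norm_neg, norm_one] at this
      norm_num at this
    obtain ⟨Yt, Φt, hGt⟩ := Ht.exists_germ hbt
    obtain ⟨c, hc, hcY⟩ := exists_const_of_cube_eq (convex_ball P ε).isPreconnected
      (u := fun x => m t x * Y x) (v := Yt) ((hmc.mono hsubO).mul hG.continuousOn) hGt.continuousOn
      (fun x hx => by rw [mul_pow, hG.cube x hx, hGt.cube x hx, hmR x (hsubO hx) (hsubD hx)])
      (fun x hx hY => Ht.ne_zero x (hbt hx) (by rw [← hGt.cube x hx, hY, zero_pow (by norm_num)]))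
    have hact := hGt.act (ρ := c) (κ := Φ x₁ - c * Φt x₁) hc
    refine ⟨fun x => c * Φt x + (Φ x₁ - c * Φt x₁), ⟨(hmc.mono hsubO).mul hG.continuousOn, fun x hx => ?_, fun x hx => ?_⟩, ?_⟩
    · rw [hcY x hx, hact.cube x hx]
    · rw [hcY x hx]
      exact hact.hasDerivAt x hx
    · ring
  rcases l.eq_or_neBot with rfl | hl
  · exact tendsto_bot
  obtain ⟨Φt, hΦt⟩ := hgerm.choice
  have hΦlim : Tendsto (fun t => Φt t x₂) l (𝓝 (Φ x₂)) :=
    tendsto_of_hasDerivAt isOpen_ball (convex_ball P ε).isPreconnected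
      (H.differentiable.continuous.continuousOn.mul hG.continuousOn) hG.hasDerivAt
      (hΦt.mono fun t ht x hx => (ht.1.hasDerivAt x hx).congr_deriv (by simp only [Pi.mul_apply]; ring))
      (fun η hη => (hm1 η hη).mono fun t ht z hz => ht z (hsubO hz)) hx₁.1 hx₂.1
      (tendsto_const_nhds.congr' (hΦt.mono fun t ht => ht.2.symm))
  -- The coefficient `k` is the one of the limit: the factors `m` cancel in the ratios at `x₁` and
  -- `x₂`, so the jumps for `t` are given by the same linear expression.
  have hlim : Tendsto (fun t => k * ((Φt t x₂ - Y x₂ / g x₂ * Ft t x₂) -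
      (Φ x₁ - Y x₁ / g x₁ * Ft t x₁))) l (𝓝 J) := by
    rw [hk]
    exact ((hΦlim.sub ((hFlim x₂ ⟨hsubO hx₂.1, hx₂.2⟩).const_mul _)).sub
      (tendsto_const_nhds.sub ((hFlim x₁ ⟨hsubO hx₁.1, hx₁.2⟩).const_mul _))).const_mul k
  refine hlim.congr' ?_
  filter_upwards [hΦt, Ht, hDt, hKt, hgt, hJt, hm1 (1 / 2) (by norm_num)] with t hΦt Ht hDt hKt hgt hJt hm1
  have hbt : ball P ε ⊆ Dt t := fun x hx => hDt x (hsubO hx) (hsubD hx)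
  have hQt := (hΦt.1.holdsAt_iff Ht hbt (mem_ball_self hε) (hex Ht hbt hΦt.1 fun x hx => hKt x (hsubO hx))
    (actInvariant_qCross u₁ u₂ (Jt t))).1 hJt
  have hrel : ∀ x ∈ ball P ε \ K, relVal (gt t) (Ft t) (fun x => m t x * Y x) (Φt t) x =
      (Y x / g x, Φt t x - Y x / g x * Ft t x) := by
    intro x hx
    have hm0 : m t x ≠ 0 := by
      intro h0
      have := hm1 x (hsubO hx.1)
      rw [h0, zero_sub, norm_neg, norm_one] at this
      norm_num at this
    simp only [relVal]
    rw [hgt x (hsubO hx.1) hx.2, mul_div_mul_left _ _ hm0]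
  rw [hrel x₁ hx₁, hrel x₂ hx₂, hΦt.2] at hQt
  exact (hk' _ _).unique h₁ h₂ hu hQt

/-! ### Comparison of the trees outside the disc -/

section OuterFactor

/-- The required factor is a function of `z = t / (x - c)` alone, namely a power of `(1 - α z) (1 -
β z)` with exponent `-e / 3`. Near `z = 0` the principal branch is continuous with value `1`. -/
lemma exists_outer_factor (e : ℕ) (c α β : ℂ) {r : ℝ} (hr : 0 < r) :
    ∃ m : ℂ → ℂ → ℂ, (∀ᶠ t in 𝓝 (0 : ℂ), ContinuousOn (m t) (closedBall c r)ᶜ) ∧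
      (∀ᶠ t in 𝓝 (0 : ℂ), ∀ x ∉ closedBall c r,
        m t x ^ 3 * ((x - (c + t * α)) * (x - (c + t * β))) ^ e = (x - c) ^ (2 * e)) ∧
      ∀ η > 0, ∀ᶠ t in 𝓝 (0 : ℂ), ∀ x ∉ closedBall c r, ‖m t x - 1‖ ≤ η := by
  let ψ : ℂ → ℂ := fun z => (((1 - α * z) * (1 - β * z)) ^ e)⁻¹
  let φ : ℂ → ℂ := fun z => ψ z ^ (1 / 3 : ℂ)
  have hd : Continuous fun z : ℂ => ((1 - α * z) * (1 - β * z)) ^ e := by fun_prop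
  have h0 : ∀ᶠ z in 𝓝 (0 : ℂ), ((1 - α * z) * (1 - β * z)) ^ e ≠ 0 :=
    (hd.tendsto 0).eventually (isOpen_ne.mem_nhds (by simp))
  have hψ : ∀ᶠ z in 𝓝 (0 : ℂ), ContinuousAt ψ z := h0.mono fun z hz => hd.continuousAt.inv₀ hz
  have hψ0 : ψ 0 = 1 := by simp [ψ]
  have hslit : ∀ᶠ z in 𝓝 (0 : ℂ), ψ z ∈ Complex.slitPlane :=
    hψ.self_of_nhds.eventually (Complex.isOpen_slitPlane.mem_nhds (by rw [hψ0]; exact Complex.one_mem_slitPlane))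
  have hφ : ∀ᶠ z in 𝓝 (0 : ℂ), ContinuousAt φ z := by
    filter_upwards [hψ, hslit] with z h1 h2
    exact h1.cpow continuousAt_const h2
  have hφ0 : φ 0 = 1 := by simp [φ, hψ0]
  -- Outside the disc `|t / (x - c)| < |t| / r`, so what holds near `z = 0` holds for small `t`
  -- uniformly in `x`.
  have transfer : ∀ {A : ℂ → Prop}, (∀ᶠ z in 𝓝 (0 : ℂ), A z) →
      ∀ᶠ t in 𝓝 (0 : ℂ), ∀ x ∉ closedBall c r, A (t / (x - c)) := by
    intro A hA
    obtain ⟨ρ, hρ, hA⟩ := Metric.eventually_nhds_iff_ball.1 hA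
    filter_upwards [ball_mem_nhds (0 : ℂ) (mul_pos hρ hr)] with t ht x hx
    rw [mem_closedBall, not_le, dist_eq_norm] at hx
    apply hA
    rw [mem_ball_zero_iff] at ht ⊢
    rw [norm_div, div_lt_iff₀ (hr.trans hx)]
    exact ht.trans (mul_lt_mul_of_pos_left hx hρ)
  have hxc : ∀ x ∉ closedBall c r, x - c ≠ 0 := fun x hx h =>
    hx (by rw [sub_eq_zero.1 h]; exact mem_closedBall_self hr.le)
  refine ⟨fun t x => φ (t / (x - c)), ?_, ?_, fun η hη => ?_⟩
  · filter_upwards [transfer hφ] with t ht x hx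
    have : ContinuousAt (fun x => t / (x - c)) x :=
      continuousAt_const.div (continuousAt_id.sub continuousAt_const) (hxc x hx)
    exact (ContinuousAt.comp (f := fun x => t / (x - c)) (ht x hx) this).continuousWithinAt
  · filter_upwards [transfer h0] with t ht x hx
    have h1 := ht x hx
    have h2 := hxc x hx
    have h3 : φ (t / (x - c)) ^ 3 = ψ (t / (x - c)) := by
      simp only [φ]
      rw [← Complex.cpow_nat_mul]
      norm_num
    rw [h3]
    have h4 : ((x - (c + t * α)) * (x - (c + t * β))) =
        (x - c) ^ 2 * ((1 - α * (t / (x - c))) * (1 - β * (t / (x - c)))) := by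
      field_simp
      ring
    rw [h4, mul_pow, ← pow_mul, mul_comm ((x - c) ^ (2 * e)), ← mul_assoc]
    simp only [ψ]
    rw [inv_mul_cancel₀ h1, one_mul]
  · refine transfer (A := fun z => ‖φ z - 1‖ ≤ η) ?_
    have := hφ.self_of_nhds
    rw [ContinuousAt, hφ0] at this
    filter_upwards [this (closedBall_mem_nhds 1 hη)] with z hz
    rwa [← dist_eq_norm]

end OuterFactor

lemma PlaneEmbedding.eventually_lt_dist_arc {V : Type*} [Fintype V] {T : MarkedBinaryTree V}
    {Γ : PlaneEmbedding T} {v n : V} (hvn : T.graph.Adj v n) {c : ℂ} {r : ℝ}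
    (hv : r < dist (Γ.pos v) c) : ∀ᶠ s in 𝓝[Icc (0 : ℝ) 1] 0, r < dist (Γ.arc v n s) c := by
  have hc := (Γ.arc_polygonal v n hvn).continuousOn 0 ⟨le_rfl, zero_le_one⟩
  refine (hc.dist continuousWithinAt_const).eventually (lt_mem_nhds ?_)
  rwa [Γ.arc_zero v n hvn]

namespace IsLocalModification

variable {V V' : Type*} [Fintype V] [Fintype V'] {T : MarkedBinaryTree V}
  {T' : MarkedBinaryTree V'} {ι : V' ↪ V} {i j : V} {p q : V'} {Γ' : PlaneEmbedding T'}
  {Γ : PlaneEmbedding T} {r : ℝ}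
  (hm : IsLocalModification ι i j p q Γ' Γ r) (hd : IsSimpleDecomposition T T' ι i j p q)

include hm hd

lemma arc_eq_of_lt {u v : V'} (huv : T'.graph.Adj u v) {s : ℝ} (hs : s ∈ Icc (0 : ℝ) 1)
    (hlt : r < dist (Γ'.arc u v s) (Γ'.pos p)) : Γ.arc (ι u) (ι v) s = Γ'.arc u v s := by
  obtain ⟨s₀, hs₀, h1, h2, h3⟩ := hm.connecting
  have key : ∀ s ∈ Icc (0 : ℝ) 1, r < dist (Γ'.arc q p s) (Γ'.pos p) →
      Γ.arc (ι q) (ι p) s = Γ'.arc q p s := by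
    intro s hs hlt
    rcases le_or_gt s s₀ with h | h
    · exact h1 s ⟨hs.1, h⟩
    · exact absurd hlt (h3 s ⟨h, hs.2⟩).2.not_gt
  by_cases he : s(u, v) = s(p, q)
  · rcases Sym2.eq_iff.1 he with ⟨rfl, rfl⟩ | ⟨rfl, rfl⟩
    · rw [Γ'.arc_symm _ _ huv.symm s hs] at hlt ⊢
      rw [Γ.arc_symm _ _ hd.adj_pq.symm s hs]
      exact key _ ⟨by linarith [hs.2], by linarith [hs.1]⟩ hlt
    · exact key s hs hlt
  · exact (hm.outer u v huv he s hs).1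

/-- The direction depends only on the initial piece of the arc, which lies outside the disc for
every vertex other than `p`. So the cyclic order of the edges is the same in both trees. -/
lemma direction_eq {v n : V'} (hv : v ≠ p) (hvn : T'.graph.Adj v n) :
    Γ.direction (ι v) (ι n) = Γ'.direction v n := by
  have hlt := (hm.pos_outer hd hv).2
  refine Filter.EventuallyEq.derivWithin_eq ?_ ?_
  · filter_upwards [PlaneEmbedding.eventually_lt_dist_arc hvn hlt, self_mem_nhdsWithin] with s hs hs'
    exact hm.arc_eq_of_lt hd hvn hs' hs
  · exact hm.arc_eq_of_lt hd hvn ⟨le_rfl, zero_le_one⟩ (by rwa [Γ'.arc_zero v n hvn])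

lemma anticlockwise {v a b c : V'} (hv : v ≠ p) (ha : T'.graph.Adj v a) (hb : T'.graph.Adj v b)
    (hc : T'.graph.Adj v c) (h : Γ'.Anticlockwise v a b c) : Γ.Anticlockwise (ι v) (ι a) (ι b) (ι c) := by
  unfold PlaneEmbedding.Anticlockwise at h ⊢
  rwa [hm.direction_eq hd hv ha, hm.direction_eq hd hv hb, hm.direction_eq hd hv hc]

end IsLocalModification

/-! ### The limits of the rows of the other vertices -/

section Limit

variable {V V' : Type*} [Fintype V] [Fintype V'] {T : MarkedBinaryTree V}
  {T' : MarkedBinaryTree V'} {ι : V' ↪ V} {i j : V} {p q : V'}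

open Classical in
/-- The exponents of the limit of `∏ (x - λ) ^ e_λ`, in which the factors of `i` and `j` are
combined. -/
noncomputable def limitExponent (T : MarkedBinaryTree V) (ι : V' ↪ V) (i : V) (p : V') (τ : Bool)
    (k : V') : ℕ := if k = p then 2 * T.exponent τ i else T.exponent τ (ι k)

/-- The quotient of the limit of `1 / y` by the form `1 / y` of the limit curve. -/
noncomputable def limitFactor (Γ' : PlaneEmbedding T') (p : V') (τ : Bool) (x : ℂ) : ℂ :=
  if τ then 1 else (x - Γ'.pos p)⁻¹

lemma IsSimpleDecomposition.exponent_j (hd : IsSimpleDecomposition T T' ι i j p q) (τ : Bool) :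
    T.exponent τ j = T.exponent τ i := by
  simp [MarkedBinaryTree.exponent, MarkedBinaryTree.a, MarkedBinaryTree.b, hd.white_i, hd.white_j]

lemma IsSimpleDecomposition.sum_limitExponent (hd : IsSimpleDecomposition T T' ι i j p q) (τ : Bool) :
    ∑ k ∈ T'.terminals, limitExponent T ι i p τ k = ∑ v ∈ T.terminals, T.exponent τ v := by
  classical
  have := hd.prod_terminals (M := Multiplicative ℕ) (fun v => Multiplicative.ofAdd (T.exponent τ v))
  have h1 : ∑ v ∈ T.terminals, T.exponent τ v = T.exponent τ i + T.exponent τ j +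
      ∑ k ∈ T'.terminals.erase p, T.exponent τ (ι k) := by
    simpa only [← ofAdd_add, ← ofAdd_sum, EmbeddingLike.apply_eq_iff_eq] using this
  rw [h1, ← Finset.add_sum_erase _ _ hd.mem_terminals_p, hd.exponent_j, ← two_mul]
  congr 1
  · simp [limitExponent]
  · exact Finset.sum_congr rfl fun k hk => by simp [limitExponent, Finset.ne_of_mem_erase hk]

lemma IsSimpleDecomposition.weight_limitExponent (hd : IsSimpleDecomposition T T' ι i j p q)
    (Γ' : PlaneEmbedding T') (τ : Bool) (x : ℂ) [DecidableEq V'] :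
    Γ'.weight (limitExponent T ι i p τ) x = (x - Γ'.pos p) ^ (2 * T.exponent τ i) *
      ∏ k ∈ T'.terminals.erase p, (x - Γ'.pos k) ^ T.exponent τ (ι k) := by
  rw [PlaneEmbedding.weight, ← Finset.mul_prod_erase _ _ hd.mem_terminals_p]
  congr 1
  · simp [limitExponent]
  · exact Finset.prod_congr rfl fun k hk => by simp [limitExponent, Finset.ne_of_mem_erase hk]

/-- At `p` the limit exponent is `2 * 2 = 4` against `b = 1`, which leaves the cube of one factor `x
- λ̃`, or `2 * 1 = 2` against `a = 2`, which leaves nothing. -/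
lemma IsSimpleDecomposition.limitFactor_cube (hd : IsSimpleDecomposition T T' ι i j p q)
    (Γ' : PlaneEmbedding T') (τ : Bool) : ∀ x ∈ Γ'.domain,
    limitFactor Γ' p τ x ^ 3 * Γ'.weight (limitExponent T ι i p τ) x = Γ'.weight (T'.exponent τ) x := by
  classical
  intro x hx
  have hxp := sub_ne_zero.2 (hx p hd.mem_terminals_p)
  have h1 : ∀ k, T.exponent τ (ι k) = T'.exponent τ k := fun k => by
    simp [MarkedBinaryTree.exponent, hd.a_eq, hd.b_eq]
  rw [hd.weight_limitExponent, PlaneEmbedding.weight, ← Finset.mul_prod_erase _ _ hd.mem_terminals_p,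
    ← mul_assoc]
  simp only [h1]
  congr 1
  cases τ
  · simp only [limitFactor, MarkedBinaryTree.exponent, MarkedBinaryTree.b, hd.white_i, hd.white_p,
      Bool.false_eq_true, if_false, if_true]
    field_simp
  · simp [limitFactor, MarkedBinaryTree.exponent, MarkedBinaryTree.a, hd.white_i, hd.white_p]

lemma IsSimpleDecomposition.continuousOn_limitFactor (hd : IsSimpleDecomposition T T' ι i j p q)
    (Γ' : PlaneEmbedding T') (τ : Bool) : ContinuousOn (limitFactor Γ' p τ) Γ'.domain := by
  cases τ
  · rw [show limitFactor Γ' p false = fun x => (x - Γ'.pos p)⁻¹ by ext; simp [limitFactor]]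
    exact ContinuousOn.inv₀ (by fun_prop) fun x hx => sub_ne_zero.2 (hx p hd.mem_terminals_p)
  · rw [show limitFactor Γ' p true = fun _ => 1 by ext; simp [limitFactor]]
    exact continuousOn_const

variable {Γ' : PlaneEmbedding T'} {r : ℝ} {Γ : ℂ → PlaneEmbedding T} {lam : V → ℂ}

/-- The data of the degeneration, as far as analysis is concerned. -/
structure IsDegeneration (ι : V' ↪ V) (i j : V) (p q : V') (Γ' : PlaneEmbedding T') (r : ℝ)
    (Γ : ℂ → PlaneEmbedding T) (lam : V → ℂ) : Prop where
  pos : 0 < r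
  decomposition : IsSimpleDecomposition T T' ι i j p q
  pos_i : ∀ᶠ t in 𝓝[≠] (0 : ℂ), (Γ t).pos i = Γ'.pos p + t * (lam i - Γ'.pos p)
  pos_j : ∀ᶠ t in 𝓝[≠] (0 : ℂ), (Γ t).pos j = Γ'.pos p + t * (lam j - Γ'.pos p)
  modification : ∀ᶠ t in 𝓝[≠] (0 : ℂ), IsLocalModification ι i j p q Γ' (Γ t) r

lemma IsLocalModification.mem_domain {Γ : PlaneEmbedding T}
    (hm : IsLocalModification ι i j p q Γ' Γ r) (hd : IsSimpleDecomposition T T' ι i j p q) {x : ℂ}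
    (hx : x ∉ closedBall (Γ'.pos p) r) (hxd : x ∈ Γ'.domain) : x ∈ Γ.domain := by
  intro k hk hxk
  by_cases hki : k = i
  · exact hx (ball_subset_closedBall (hxk ▸ hki ▸ hm.pos_i_mem hd))
  by_cases hkj : k = j
  · exact hx (ball_subset_closedBall (hxk ▸ hkj ▸ hm.pos_j_mem hd))
  obtain ⟨v, rfl⟩ := (hd.range k).2 ⟨hki, hkj⟩
  have hv : v ≠ p := fun h => T.mem_terminals.1 hk (h ▸ hd.isInner_p)
  refine hxd v (T'.mem_terminals.2 fun h => T.mem_terminals.1 hk ((hd.isInner_iff hv).2 h)) ?_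
  rw [hxk, (hm.pos_outer hd hv).1]

lemma IsLocalModification.weight_eq {Γ : PlaneEmbedding T}
    (hm : IsLocalModification ι i j p q Γ' Γ r) (hd : IsSimpleDecomposition T T' ι i j p q) (τ : Bool)
    (x : ℂ) [DecidableEq V'] : Γ.weight (T.exponent τ) x =
      ((x - Γ.pos i) * (x - Γ.pos j)) ^ T.exponent τ i *
        ∏ k ∈ T'.terminals.erase p, (x - Γ'.pos k) ^ T.exponent τ (ι k) := by
  classical
  unfold PlaneEmbedding.weight
  rw [hd.prod_terminals, hd.exponent_j, mul_pow]
  congr 1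
  refine Finset.prod_congr (by congr!) fun k hk => ?_
  rw [(hm.pos_outer hd (Finset.ne_of_mem_erase hk)).1]

/-- Comparison of the branches on the two curves. -/
lemma IsDegeneration.exists_factor (h : IsDegeneration ι i j p q Γ' r Γ lam)
    (S' : Γ'.CycleSystem) (S : ∀ t, (Γ t).CycleSystem) (τ : Bool) :
    ∃ (m : ℂ → ℂ → ℂ) (κ : ℂ → ℂ), (∀ᶠ t in 𝓝[≠] (0 : ℂ), κ t ^ 3 = 1) ∧
      (∀ᶠ t in 𝓝[≠] (0 : ℂ), ContinuousOn (m t) (closedBall (Γ'.pos p) r)ᶜ) ∧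
      (∀ᶠ t in 𝓝[≠] (0 : ℂ), ∀ x ∉ closedBall (Γ'.pos p) r,
        m t x ^ 3 * (Γ t).weight (T.exponent τ) x = Γ'.weight (limitExponent T ι i p τ) x) ∧
      (∀ η > 0, ∀ᶠ t in 𝓝[≠] (0 : ℂ), ∀ x ∉ closedBall (Γ'.pos p) r, ‖m t x - 1‖ ≤ η) ∧
      ∀ᶠ t in 𝓝[≠] (0 : ℂ), ∀ x ∉ closedBall (Γ'.pos p) r, x ∉ Γ'.carrier →
        κ t * (Γ t).invY τ x ((S t).y₀ x) = m t x * (limitFactor Γ' p τ x * Γ'.invY τ x (S'.y₀ x)) := by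
  classical
  have hd := h.decomposition
  obtain ⟨m, hm1, hm2, hm3⟩ := exists_outer_factor (T.exponent τ i) (Γ'.pos p) (lam i - Γ'.pos p)
    (lam j - Γ'.pos p) h.pos
  have hm1' := hm1.filter_mono (nhdsWithin_le_nhds (s := {0}ᶜ))
  have hm3' := fun η hη => (hm3 η hη).filter_mono (nhdsWithin_le_nhds (s := {0}ᶜ))
  have hw : ∀ᶠ t in 𝓝[≠] (0 : ℂ), ∀ x ∉ closedBall (Γ'.pos p) r,
      m t x ^ 3 * (Γ t).weight (T.exponent τ) x = Γ'.weight (limitExponent T ι i p τ) x := by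
    filter_upwards [hm2.filter_mono nhdsWithin_le_nhds, h.pos_i, h.pos_j, h.modification] with
      t hm2 hi hj hmod x hx
    rw [hmod.weight_eq hd, hd.weight_limitExponent, hi, hj, ← mul_assoc, hm2 x hx]
  -- The two sides have the same cube on a connected set. The constant `κ` accounts for the
  -- independent choices of the sheet `C⁽⁰⁾` for each `t` and for the limit.
  have hκ : ∀ᶠ t in 𝓝[≠] (0 : ℂ), ∃ κ : ℂ, κ ^ 3 = 1 ∧ ∀ x ∉ closedBall (Γ'.pos p) r, x ∉ Γ'.carrier →
      κ * (Γ t).invY τ x ((S t).y₀ x) = m t x * (limitFactor Γ' p τ x * Γ'.invY τ x (S'.y₀ x)) := by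
    filter_upwards [hm1', hw, h.modification] with t hm1 hw hmod
    have hsub : (Γ'.carrier ∪ closedBall (Γ'.pos p) r)ᶜ ⊆ (closedBall (Γ'.pos p) r)ᶜ :=
      compl_subset_compl.2 subset_union_right
    have hsub' : (Γ'.carrier ∪ closedBall (Γ'.pos p) r)ᶜ ⊆ Γ'.carrierᶜ :=
      compl_subset_compl.2 subset_union_left
    have hcar : ∀ x ∈ (Γ'.carrier ∪ closedBall (Γ'.pos p) r)ᶜ, x ∉ (Γ t).carrier := fun x hx hxc =>
      hsub' hx ((hmod.mem_carrier_iff_of_lt hd (by simpa using hsub hx)).1 hxc)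
    have hdom : Γ'.carrierᶜ ⊆ Γ'.domain := PlaneEmbedding.compl_carrier_subset_domain
    obtain ⟨κ, hκ, heq⟩ := exists_const_of_cube_eq (hmod.isPreconnected_compl hd h.pos)
      (u := fun x => m t x * (limitFactor Γ' p τ x * Γ'.invY τ x (S'.y₀ x)))
      (v := fun x => (Γ t).invY τ x ((S t).y₀ x))
      ((hm1.mono hsub).mul (((hd.continuousOn_limitFactor Γ' τ).mono (hsub'.trans hdom)).mul
        ((S'.isBranch.continuousOn_invY τ).mono hsub')))
      (((S t).isBranch.continuousOn_invY τ).mono hcar)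
      (fun x hx => by
        have h1 := S'.isBranch.invY_cube τ x (hsub' hx)
        rw [← hd.limitFactor_cube Γ' τ x (hdom (hsub' hx)), ← hw x (hsub hx)] at h1
        rw [eq_inv_of_mul_eq_one_left ((S t).isBranch.invY_cube τ x (hcar x hx))]
        exact eq_inv_of_mul_eq_one_left (by rw [← h1]; ring))
      (fun x hx h0 => by
        have := (S t).isBranch.invY_cube τ x (hcar x hx)
        rw [h0] at this
        norm_num at this)
    exact ⟨κ, hκ, fun x hx hxc => (heq x (by simp only [mem_compl_iff, mem_union, not_or]; exact ⟨hxc, hx⟩)).symm⟩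
  obtain ⟨κ, hκ⟩ := hκ.choice
  exact ⟨m, κ, hκ.mono fun t ht => ht.1, hm1', hw, hm3', hκ.mono fun t ht => ht.2⟩

end Limit

section Limit

variable {V V' : Type*} [Fintype V] [Fintype V'] {T : MarkedBinaryTree V}
  {T' : MarkedBinaryTree V'} {ι : V' ↪ V} {i j : V} {p q : V'} {Γ' : PlaneEmbedding T'} {r : ℝ}
  {Γ : ℂ → PlaneEmbedding T} {lam : V → ℂ}

lemma PlaneEmbedding.exists_lt_dist_arc {V : Type*} [Fintype V] {T : MarkedBinaryTree V}
    {Γ : PlaneEmbedding T} {v n : V} (hvn : T.graph.Adj v n) {c : ℂ} {r : ℝ}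
    (hv : r < dist (Γ.pos v) c) : ∃ s ∈ Ioo (0 : ℝ) 1, r < dist (Γ.arc v n s) c := by
  have h := (eventually_lt_dist_arc (Γ := Γ) hvn hv).filter_mono (nhdsWithin_mono 0 Ioc_subset_Icc_self)
  rw [nhdsWithin_Ioc_eq_nhdsGT zero_lt_one] at h
  obtain ⟨s, hs, hs'⟩ := (h.and (Ioo_mem_nhdsGT (zero_lt_one (α := ℝ)))).exists
  exact ⟨s, hs', hs⟩

lemma IsSimpleDecomposition.startSheet_eq (hd : IsSimpleDecomposition T T' ι i j p q) (v : V') :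
    T.startSheet (ι v) = T'.startSheet v := by
  simp [MarkedBinaryTree.startSheet, hd.white_eq]

lemma IsSimpleDecomposition.midSheet_eq (hd : IsSimpleDecomposition T T' ι i j p q) (v : V') :
    T.midSheet (ι v) = T'.midSheet v := by
  simp [MarkedBinaryTree.midSheet, hd.white_eq]

/-- Up to a cube root of unity that depends only on the type of the form, the integrals over the
cycles at the vertices other than `p` converge. -/
theorem IsDegeneration.exists_unit (h : IsDegeneration ι i j p q Γ' r Γ lam)
    (S' : Γ'.CycleSystem) (S : ∀ t, (Γ t).CycleSystem) (τ : Bool) :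
    ∃ κ : ℂ → ℂ, (∀ᶠ t in 𝓝[≠] (0 : ℂ), κ t ^ 3 = 1) ∧
      ∀ {f : ℂ → ℂ} {n : ℕ} {C : ℝ}, Differentiable ℂ f → (∀ᶠ z in cocompact ℂ, ‖f z‖ ≤ C * ‖z‖ ^ n) →
      3 * (n + 1) < ∑ v ∈ T.terminals, T.exponent τ v → ∀ {v' : T'.Inner} {v : T.Inner}, v.1 = ι v'.1 →
      Tendsto (fun t => κ t * ((S t).B v).integral τ f) (𝓝[≠] 0)
        (𝓝 ((S'.B v').integral τ fun x => f x * limitFactor Γ' p τ x)) := by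
  obtain ⟨m, κ, hκ, hmc, hmw, hm1, hg⟩ := h.exists_factor S' S τ
  refine ⟨κ, hκ, ?_⟩
  intro f n C hf hC hN v' v hv
  have hd := h.decomposition
  have hvp : v'.1 ≠ p := hd.ne_p_of_isInner v'.2
  set e' := limitExponent T ι i p τ
  obtain ⟨F, H⟩ := PlaneEmbedding.exists_branchPrimitive (Γ := Γ') (e := e')
    (g := fun x => limitFactor Γ' p τ x * Γ'.invY τ x (S'.y₀ x)) hf hC
    (((hd.continuousOn_limitFactor Γ' τ).mono PlaneEmbedding.compl_carrier_subset_domain).mul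
      (S'.isBranch.continuousOn_invY τ))
    (fun x hx => by
      rw [← S'.isBranch.invY_cube τ x hx,
        ← hd.limitFactor_cube Γ' τ x (PlaneEmbedding.compl_carrier_subset_domain hx)]
      ring)
    (by rwa [hd.sum_limitExponent])
  obtain ⟨x₀, hx₀⟩ : (Γ'.carrier ∪ closedBall (Γ'.pos p) r)ᶜ.Nonempty :=
    (cocompact ℂ).nonempty_of_mem
      (Γ'.isCompact_carrier.union (isCompact_closedBall (Γ'.pos p) r)).compl_mem_cocompact
  have hx₀' : x₀ ∈ (closedBall (Γ'.pos p) r)ᶜ \ Γ'.carrier := ⟨fun h => hx₀ (Or.inr h), fun h => hx₀ (Or.inl h)⟩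
  -- All primitives are normalised at the same point `x₀` outside the tree and the disc.
  have hFt : ∀ᶠ t in 𝓝[≠] (0 : ℂ), ∃ Ft, IsBranchPrimitive (Γ t).domain (Γ t).carrier
      (fun x => ((Γ t).weight (T.exponent τ) x)⁻¹) f (fun x => κ t * (Γ t).invY τ x ((S t).y₀ x)) Ft ∧
      Ft x₀ = F x₀ := by
    filter_upwards [hκ] with t hκ
    obtain ⟨Ft, Ht⟩ := PlaneEmbedding.exists_branchPrimitive (Γ := Γ t) (e := T.exponent τ)
      (g := fun x => κ t * (Γ t).invY τ x ((S t).y₀ x)) hf hC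
      (continuousOn_const.mul ((S t).isBranch.continuousOn_invY τ))
      (fun x hx => by rw [mul_pow, hκ, one_mul, (S t).isBranch.invY_cube τ x hx]) hN
    exact ⟨_, Ht.sub_const (Ft x₀ - F x₀), by ring⟩
  obtain ⟨Ft, hFt⟩ := hFt.choice
  obtain ⟨n₁, n₂, a1, a2, hac, s₁, hs₁, s₂, hs₂, J₁, J₂, b1, b2, b3⟩ :=
    (S'.isCycleA v').integral_mul_eq τ (hd.continuousOn_limitFactor Γ' τ) (hd.limitFactor_cube Γ' τ) H
  obtain ⟨t₀, ht₀⟩ := h.modification.exists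
  have hout := (ht₀.pos_outer hd hvp).2
  -- A loop for `t` may cross its edges anywhere, even inside the disc. The jumps are moved to fixed
  -- points close to the vertex, where both trees coincide.
  obtain ⟨s₁', hs₁', hlt₁⟩ := PlaneEmbedding.exists_lt_dist_arc a1 hout
  obtain ⟨s₂', hs₂', hlt₂⟩ := PlaneEmbedding.exists_lt_dist_arc a2 hout
  set u₁ := zeta τ ^ T'.startSheet v'.1 with hu₁
  set u₂ := zeta τ ^ T'.midSheet v'.1 with hu₂
  have hzc : ∀ k : ℕ, (zeta τ ^ k) ^ 3 = 1 := fun k => by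
    rw [← pow_mul, mul_comm, pow_mul, zeta_cube, one_pow]
  rw [PlaneEmbedding.holdsAt_edge_iff H (actInvariant_qCross _ _ _) a1 hs₁ hs₁'] at b1
  rw [PlaneEmbedding.holdsAt_edge_iff H (actInvariant_qCross _ _ _) a2 hs₂ hs₂'] at b2
  have hJ : ∀ᶠ t in 𝓝[≠] (0 : ℂ), ∃ J : ℂ × ℂ,
      HoldsAt (Γ t).domain (Γ t).carrier (fun x => ((Γ t).weight (T.exponent τ) x)⁻¹) f
        (fun x => κ t * (Γ t).invY τ x ((S t).y₀ x)) (Ft t) (QCross u₁ u₂ J.1) (Γ'.arc v' n₁ s₁') ∧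
      HoldsAt (Γ t).domain (Γ t).carrier (fun x => ((Γ t).weight (T.exponent τ) x)⁻¹) f
        (fun x => κ t * (Γ t).invY τ x ((S t).y₀ x)) (Ft t) (QCross u₁ u₂ J.2) (Γ'.arc v' n₂ s₂') ∧
      κ t * ((S t).A v).integral τ f = J.2 - J.1 := by
    filter_upwards [hκ, hFt, h.modification] with t hκ hFt hmod
    obtain ⟨k₁, k₂, c1, c2, hact, r₁, hr₁, r₂, hr₂, L₁, L₂, d1, d2, d3⟩ :=
      ((S t).isCycleA v).integral_mul_eq τ continuousOn_const
        (fun x _ => by rw [hκ, one_mul]) hFt.1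
    have hmk : T'.graph.Adj v'.1 (T'.mark v'.1) := T'.mark_adj _ v'.2
    rw [hv] at c1 c2 hact d1 d2
    rw [hd.mark_eq _ v'.2] at hact
    obtain ⟨rfl, rfl⟩ := (hmod.anticlockwise hd hvp a1 a2 hmk hac).unique
      ((hd.isInner_iff hvp).2 v'.2) ((hd.adj_iff _ _).1 a1) ((hd.adj_iff _ _).1 a2)
      ((hd.adj_iff _ _).1 hmk) c1 c2 hact
    rw [PlaneEmbedding.holdsAt_edge_iff hFt.1 (actInvariant_qCross _ _ _) c1 hr₁ hs₁',
      hmod.arc_eq_of_lt hd a1 (Ioo_subset_Icc_self hs₁') hlt₁, hd.startSheet_eq, hd.midSheet_eq] at d1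
    rw [PlaneEmbedding.holdsAt_edge_iff hFt.1 (actInvariant_qCross _ _ _) c2 hr₂ hs₂',
      hmod.arc_eq_of_lt hd a2 (Ioo_subset_Icc_self hs₂') hlt₂, hd.startSheet_eq, hd.midSheet_eq] at d2
    refine ⟨(L₁, L₂), d1, d2, ?_⟩
    rw [← d3]
    have := ((S t).A v).integral_sub_const_mul (τ := τ) (h := fun _ => 0) (h' := f) continuous_const
      hf.continuous (-κ t)
    simpa [PlaneEmbedding.Loop.integral, mul_comm] using this.symm
  obtain ⟨J, hJ⟩ := hJ.choice
  have jump : ∀ {n' : V'} {s : ℝ} {L : ℂ} {Lt : ℂ → ℂ}, T'.graph.Adj v'.1 n' → s ∈ Ioo (0 : ℝ) 1 →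
      r < dist (Γ'.arc v' n' s) (Γ'.pos p) →
      HoldsAt Γ'.domain Γ'.carrier (fun x => (Γ'.weight e' x)⁻¹) f
        (fun x => limitFactor Γ' p τ x * Γ'.invY τ x (S'.y₀ x)) F (QCross u₁ u₂ L) (Γ'.arc v' n' s) →
      (∀ᶠ t in 𝓝[≠] (0 : ℂ), HoldsAt (Γ t).domain (Γ t).carrier
        (fun x => ((Γ t).weight (T.exponent τ) x)⁻¹) f
        (fun x => κ t * (Γ t).invY τ x ((S t).y₀ x)) (Ft t) (QCross u₁ u₂ (Lt t)) (Γ'.arc v' n' s)) →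
      Tendsto Lt (𝓝[≠] 0) (𝓝 L) := by
    intro n' s L Lt hn' hs hlt hL hLt
    refine tendsto_jump (O := (closedBall (Γ'.pos p) r)ᶜ) H (hFt.mono fun t ht => ht.1)
      isClosed_closedBall.isOpen_compl ?_ (fun x hx => PlaneEmbedding.compl_carrier_subset_domain hx.2)
      (h.modification.mono fun t ht x hx hxd => ht.mem_domain hd hx hxd)
      (h.modification.mono fun t ht x hx => ht.mem_carrier_iff_of_lt hd (by simpa using hx)) hmc ?_ hm1 hg
      hx₀' (tendsto_const_nhds.congr' (hFt.mono fun t ht => ht.2.symm)) (by simpa using hlt)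
      (PlaneEmbedding.arc_mem_domain hn' hs)
      (PlaneEmbedding.edge_subset_carrier hn' ⟨s, Ioo_subset_Icc_self hs, rfl⟩)
      (PlaneEmbedding.twoSided_of_mem_openEdge hn' hs) (hzc _) (hzc _) (T'.zeta_start_ne_mid τ _) hL hLt
    · have := ht₀.isPreconnected_compl hd h.pos
      rwa [compl_union, inter_comm] at this
    · filter_upwards [hmw, h.modification] with t hmw hmod x hx hxd
      have h1 := hmw x hx
      have h2 := PlaneEmbedding.weight_ne_zero e' hxd
      have h3 := PlaneEmbedding.weight_ne_zero (T.exponent τ) (hmod.mem_domain hd hx hxd)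
      rw [← div_eq_mul_inv, eq_div_iff h2, ← h1]
      field_simp
  -- The power of `ρ` that carries `A_v` to `B_v` is the number of the sheet on which `A_v` starts;
  -- colours are preserved, so it is the same factor for both trees.
  have hlim := ((jump a2 hs₂' hlt₂ b2 (hJ.mono fun t ht => ht.2.1)).sub
    (jump a1 hs₁' hlt₁ b1 (hJ.mono fun t ht => ht.1))).const_mul (zeta τ ^ T'.startSheet v'.1)
  rw [← b3] at hlim
  unfold PlaneEmbedding.CycleSystem.B
  rw [PlaneEmbedding.Loop.integral_rho]
  refine hlim.congr' (hJ.mono fun t ht => ?_)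
  simp only
  rw [PlaneEmbedding.Loop.integral_rho, ← ht.2.2, hv,
    show (if T.white (ι v'.1) then 2 else 1) = T'.startSheet v'.1 from hd.startSheet_eq v'.1]
  ring

end Limit

/-! ### Determinants -/

lemma tendsto_zero_of_pow_three {ι : Type*} {l : Filter ι} {f : ι → ℂ}
    (h : Tendsto (fun t => f t ^ 3) l (𝓝 0)) : Tendsto f l (𝓝 0) := by
  rw [Metric.tendsto_nhds] at h ⊢
  intro ε hε
  filter_upwards [h (ε ^ 3) (by positivity)] with t ht
  rw [dist_zero_right] at ht ⊢
  rw [norm_pow] at ht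
  exact lt_of_pow_lt_pow_left₀ 3 hε.le ht

/-- The limit of the cube of a determinant, if all entries but one of a row tend to zero, the row
and the columns being multiplied by suitable factors. -/
lemma tendsto_det_cube {ι : Type*} {l : Filter ι} {n : ℕ} (d : Fin (n + 1))
    (A : ι → Matrix (Fin (n + 1)) (Fin (n + 1)) ℂ) (L : Matrix (Fin n) (Fin (n + 1)) ℂ)
    {κ : Fin (n + 1) → ι → ℂ} (hκ : ∀ k, ∀ᶠ t in l, κ k t ^ 3 = 1) {w : ι → ℂ} {c : ℂ}
    (hd : Tendsto (fun t => w t * A t d d ^ 3) l (𝓝 c))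
    (hd0 : ∀ k, k ≠ d → Tendsto (fun t => w t * A t d k ^ 3) l (𝓝 0))
    (hL : ∀ r k, Tendsto (fun t => κ k t * A t (d.succAbove r) k) l (𝓝 (L r k))) :
    Tendsto (fun t => w t * (A t).det ^ 3) l (𝓝 (c * (L.submatrix id d.succAbove).det ^ 3)) := by
  -- Any cube root of `w` will do, even a discontinuous one, since only the cubes of the entries `a
  -- k` are known to converge.
  let s : ι → ℂ := fun t => w t ^ (1 / 3 : ℂ)
  have hs : ∀ t, s t ^ 3 = w t := fun t => by
    simp only [s]
    rw [← Complex.cpow_nat_mul]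
    norm_num
  let a : Fin (n + 1) → ι → ℂ := fun k t => s t * (κ k t * A t d k)
  have ha : ∀ k, ∀ᶠ t in l, a k t ^ 3 = w t * A t d k ^ 3 := fun k => by
    filter_upwards [hκ k] with t ht
    simp only [a]
    rw [mul_pow, mul_pow, hs, ht, one_mul]
  -- The correcting roots are applied to whole columns, including row `d`; they disappear in the
  -- cube of the determinant.
  let M : ι → Matrix (Fin (n + 1)) (Fin (n + 1)) ℂ := fun t => Matrix.of fun r k => κ k t * A t r k
  have hM : ∀ᶠ t in l, (M t).det ^ 3 = (A t).det ^ 3 := by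
    filter_upwards [eventually_all.2 hκ] with t ht
    simp only [M]
    rw [Matrix.det_mul_row, mul_pow, ← Finset.prod_pow, Finset.prod_congr rfl fun k _ => ht k,
      Finset.prod_const_one, one_mul]
  let D : Fin (n + 1) → ι → ℂ := fun k t => ((M t).submatrix d.succAbove k.succAbove).det
  have hD : ∀ k, Tendsto (D k) l (𝓝 (L.submatrix id k.succAbove).det) := fun k => by
    have hc : Continuous fun B : Matrix (Fin n) (Fin n) ℂ => B.det := continuous_id.matrix_det
    refine (hc.tendsto _).comp (tendsto_pi_nhds.2 fun r => tendsto_pi_nhds.2 fun k' => ?_)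
    exact hL r (k.succAbove k')
  -- Expansion along row `d`; the term of column `d` has sign `(-1) ^ (d + d) = 1`.
  have hexp : ∀ t, s t * (M t).det =
      a d t * D d t + ∑ k ∈ Finset.univ.erase d, (-1) ^ (d + k : ℕ) * (a k t * D k t) := by
    intro t
    rw [Matrix.det_succ_row (M t) d, ← Finset.add_sum_erase _ _ (Finset.mem_univ d), mul_add,
      Finset.mul_sum, ← two_mul, pow_mul]
    simp only [a, D, M, Matrix.of_apply]
    congr 1
    · ring
    · exact Finset.sum_congr rfl fun k _ => by ring
  have hrest : Tendsto (fun t => ∑ k ∈ Finset.univ.erase d, (-1 : ℂ) ^ (d + k : ℕ) * (a k t * D k t)) l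
      (𝓝 0) := by
    rw [show (0 : ℂ) = ∑ k ∈ Finset.univ.erase d, (-1 : ℂ) ^ (d + k : ℕ) *
      (0 * (L.submatrix id k.succAbove).det) by simp]
    refine tendsto_finsetSum _ fun k hk => ((Tendsto.mul ?_ (hD k)).const_mul _)
    exact tendsto_zero_of_pow_three ((hd0 k (Finset.ne_of_mem_erase hk)).congr' ((ha k).mono fun t ht => ht.symm))
  set z := fun t => ∑ k ∈ Finset.univ.erase d, (-1 : ℂ) ^ (d + k : ℕ) * (a k t * D k t)
  have had : Tendsto (fun t => a d t ^ 3) l (𝓝 c) := hd.congr' ((ha d).mono fun t ht => ht.symm)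
  -- The entry itself need not converge, but it is bounded because its cube converges.
  have hbd : (a d) =O[l] fun _ => (1 : ℝ) := by
    refine Asymptotics.IsBigO.of_pow (n := 3) (by norm_num) ?_
    have := had.isBigO_one ℝ
    simpa [Pi.pow_def] using this
  have hX : (fun t => a d t * D d t) =O[l] fun _ => (1 : ℝ) := by
    simpa using hbd.mul ((hD d).isBigO_one ℝ)
  have hz1 : z =o[l] fun _ => (1 : ℝ) := (Asymptotics.isLittleO_one_iff ℝ).2 hrest
  -- For `X = a d * D d` bounded and `z → 0`, the cube of `X + z` differs from `X ^ 3` by `z` times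
  -- this bounded expression.
  have hbig : (fun t => 3 * (a d t * D d t) ^ 2 + 3 * (a d t * D d t) * z t + z t ^ 2) =O[l]
      fun _ => (1 : ℝ) := by
    have h1 := (hX.pow 2).const_mul_left 3
    have h2 := (hX.const_mul_left 3).mul hz1.isBigO
    have h3 := hz1.isBigO.pow 2
    simp only [one_pow, mul_one] at h1 h2 h3
    exact (h1.add h2).add h3
  have hsmall : Tendsto (fun t => z t * (3 * (a d t * D d t) ^ 2 + 3 * (a d t * D d t) * z t + z t ^ 2)) l
      (𝓝 0) := by
    rw [← Asymptotics.isLittleO_one_iff ℝ]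
    simpa using hz1.mul_isBigO hbig
  have hmain := (had.mul ((hD d).pow 3)).add hsmall
  rw [add_zero] at hmain
  refine hmain.congr' (hM.mono fun t ht => ?_)
  simp only
  rw [← ht, ← hs t, ← mul_pow (s t), hexp t]
  ring

/-! ### The limit of the period determinant -/

/-- The polynomial factor of the form number `k`, after the column operations that make the forms
number `k > d` vanish at `c`. -/
noncomputable def formPolynomial (d : ℕ) (c : ℂ) (k : ℕ) (x : ℂ) : ℂ :=
  if k < d then x ^ k else if k = d then 1 else x ^ (k - d - 1) * (x - c)

lemma differentiable_formPolynomial (d : ℕ) (c : ℂ) (k : ℕ) : Differentiable ℂ (formPolynomial d c k) := by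
  unfold formPolynomial
  split_ifs <;> fun_prop

lemma norm_formPolynomial_le (d : ℕ) (c : ℂ) (k : ℕ) :
    ∀ᶠ z in cocompact ℂ, ‖formPolynomial d c k z‖ ≤ 2 * ‖z‖ ^ (if k < d then k else k - d) := by
  filter_upwards [(tendsto_norm_cocompact_atTop (E := ℂ)).eventually_ge_atTop ‖c‖] with z hz
  unfold formPolynomial
  split_ifs with h1 h2
  · rw [norm_pow]
    linarith [pow_nonneg (norm_nonneg z) k]
  · simp [h2]
  · rw [norm_mul, norm_pow, show k - d = k - d - 1 + 1 by omega, pow_succ]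
    have h3 : ‖z - c‖ ≤ 2 * ‖z‖ := (norm_sub_le z c).trans (by linarith)
    calc ‖z‖ ^ (k - d - 1) * ‖z - c‖ ≤ ‖z‖ ^ (k - d - 1) * (2 * ‖z‖) := by gcongr
      _ = _ := by ring

namespace PlaneEmbedding

variable {V : Type*} [Fintype V] {T : MarkedBinaryTree V} {Γ : PlaneEmbedding T}

/-- From each column behind number `d₁`, `c` times the preceding column is subtracted. The columns
up to and including `d₁` are kept: the predecessor of number `d₁`, if there is one, belongs to the
other type of form. -/
lemma CycleSystem.det_periods {n : ℕ} (S : Γ.CycleSystem) (σ : Fin (n + 1) → T.Inner) (c : ℂ) :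
    (Matrix.of fun r k : Fin (n + 1) => (S.B (σ r)).period k).det =
      (Matrix.of fun r k : Fin (n + 1) =>
        (S.B (σ r)).integral (decide ((k : ℕ) < T.d₁)) (formPolynomial T.d₁ c k)).det := by
  refine Matrix.det_eq_of_forall_col_eq_smul_add_pred
    (fun k => if T.d₁ ≤ k then c else 0) (fun r => ?_) (fun r k => ?_)
  · rw [Matrix.of_apply, Matrix.of_apply, Loop.period_eq_integral]
    congr 1
    ext x
    unfold formPolynomial
    simp only [Fin.val_zero]
    rcases T.d₁.eq_zero_or_pos with h | h
    · simp [h]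
    · simp [h]
  · simp only [Matrix.of_apply, Loop.period_eq_integral, Fin.val_succ, Fin.val_castSucc]
    by_cases h1 : (k : ℕ) + 1 < T.d₁
    · simp only [h1, if_true, show ¬ T.d₁ ≤ (k : ℕ) by omega, if_false, zero_mul, add_zero]
      congr 1
      ext x
      simp [formPolynomial, h1]
    by_cases h2 : (k : ℕ) + 1 = T.d₁
    · simp only [h1, if_false, show ¬ T.d₁ ≤ (k : ℕ) by omega, zero_mul, add_zero]
      congr 1
      ext x
      simp [formPolynomial, h2]
    · simp only [h1, show ¬ (k : ℕ) < T.d₁ by omega, if_false, show T.d₁ ≤ (k : ℕ) by omega, if_true]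
      have h3 : formPolynomial T.d₁ c (k + 1) = fun x => x ^ (k + 1 - T.d₁) - c * x ^ (k - T.d₁) := by
        ext x
        simp only [formPolynomial, h1, h2, if_false]
        rw [show (k : ℕ) + 1 - T.d₁ - 1 = k - T.d₁ by omega, show (k : ℕ) + 1 - T.d₁ = k - T.d₁ + 1 by omega]
        ring
      rw [h3, Loop.integral_sub_const_mul _ (by fun_prop) (by fun_prop)]
      ring

lemma Loop.integral_congr (c : Γ.Loop) (τ : Bool) {f g : ℂ → ℂ} (h : ∀ x ∈ Γ.domain, f x = g x) :
    c.integral τ f = c.integral τ g := by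
  unfold Loop.integral
  refine intervalIntegral.integral_congr fun s hs => ?_
  rw [uIcc_of_le zero_le_one] at hs
  rw [h _ (c.avoids s hs)]

end PlaneEmbedding

/-- The degree condition of `exists_branchPrimitive` for all forms of the period matrix: none of
them has a residue at infinity. -/
lemma MarkedBinaryTree.degree_lt {V : Type*} [Fintype V] (T : MarkedBinaryTree V) {k : ℕ} (hk : k < T.genus) :
    3 * ((if k < T.d₁ then k else k - T.d₁) + 1) <
      ∑ v ∈ T.terminals, T.exponent (decide (k < T.d₁)) v := by
  by_cases h : k < T.d₁
  · have := T.sum_a_ge h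
    simp only [h, if_true, decide_true, MarkedBinaryTree.exponent]
    omega
  · have := T.sum_b_ge
    simp only [h, if_false, decide_false, MarkedBinaryTree.exponent, Bool.false_eq_true]
    omega

section Limit

variable {V V' : Type*} [Fintype V] [Fintype V'] {T : MarkedBinaryTree V}
  {T' : MarkedBinaryTree V'} {ι : V' ↪ V} {i j : V} {p q : V'} {Γ' : PlaneEmbedding T'} {r : ℝ}
  {Γ : ℂ → PlaneEmbedding T} {lam : V → ℂ}

/-- Behind the skipped column `d₁` the factor `x - λ̃` of the polynomial cancels the pole of
`limitFactor`, and the degree drops by one; this is again a form of the smaller curve. -/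
lemma IsSimpleDecomposition.integral_limitFactor (hd : IsSimpleDecomposition T T' ι i j p q)
    (c : Γ'.Loop) {n : ℕ} {d : Fin (n + 1)} (hdd : (d : ℕ) = T.d₁) (k : Fin n) :
    c.integral (decide ((d.succAbove k : ℕ) < T.d₁)) (fun x =>
      formPolynomial T.d₁ (Γ'.pos p) (d.succAbove k) x *
        limitFactor Γ' p (decide ((d.succAbove k : ℕ) < T.d₁)) x) = c.period k := by
  rw [c.period_eq_integral, ← hd.d₁_eq]
  rcases lt_or_ge (k : ℕ) T.d₁ with hk | hk
  · have e1 : ((d.succAbove k : Fin (n + 1)) : ℕ) = k := by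
      rw [Fin.succAbove_of_castSucc_lt _ _ (by rw [Fin.lt_def, hdd]; exact hk)]
      rfl
    rw [e1]
    refine PlaneEmbedding.Loop.integral_congr _ _ fun x _ => ?_
    simp only [formPolynomial, limitFactor, hk, if_true, decide_true, mul_one]
  · have e1 : ((d.succAbove k : Fin (n + 1)) : ℕ) = k + 1 := by
      rw [Fin.succAbove_of_le_castSucc _ _ (by rw [Fin.le_def, hdd]; exact hk)]
      rfl
    have h1 : ¬ (k : ℕ) < T.d₁ := hk.not_gt
    have h2 : ¬ (k : ℕ) + 1 < T.d₁ := by omega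
    have h3 : ¬ (k : ℕ) + 1 = T.d₁ := by omega
    rw [e1, decide_eq_false h1, decide_eq_false h2]
    refine PlaneEmbedding.Loop.integral_congr _ _ fun x hx => ?_
    simp only [formPolynomial, limitFactor, h1, h2, h3, if_false, Bool.false_eq_true]
    rw [mul_assoc, mul_inv_cancel₀ (sub_ne_zero.2 (hx p hd.mem_terminals_p)), mul_one]
    congr 1
    omega

open Classical in
theorem IsDegeneration.tendsto_det (h : IsDegeneration ι i j p q Γ' r Γ lam)
    (S' : Γ'.CycleSystem) (S : ∀ t, (Γ t).CycleSystem) {n : ℕ} (hn : T.genus = n + 1)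
    {d : Fin (n + 1)} (hdd : (d : ℕ) = T.d₁) (σ : Fin (n + 1) → T.Inner) (σ' : Fin n → T'.Inner)
    (hσd : (σ d).1 = ι p) (hσ : ∀ k, (σ (d.succAbove k)).1 = ι (σ' k).1) :
    Tendsto (fun t => t * (lam i - lam j) *
        (Matrix.of fun r k : Fin (n + 1) => ((S t).B (σ r)).period k).det ^ 3) (𝓝[≠] 0)
      (𝓝 (betaStar ^ 3 * (∏ k ∈ T'.terminals.erase p, ((Γ'.pos p - Γ'.pos k) ^ T.b (ι k))⁻¹) *
        (Matrix.of fun r k : Fin n => (S'.B (σ' r)).period k).det ^ 3)) := by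
  have hd := h.decomposition
  set f : ℕ → ℂ → ℂ := formPolynomial T.d₁ (Γ'.pos p) with hf
  simp only [PlaneEmbedding.CycleSystem.det_periods _ σ (Γ'.pos p)]
  choose κ hκ hκlim using h.exists_unit S' S
  have hrow := fun k : Fin (n + 1) => tendsto_row_p hd h.pos h.pos_i h.pos_j h.modification S hσd
    (decide ((k : ℕ) < T.d₁)) (h := f k) (Eventually.of_forall fun t =>
      PlaneEmbedding.exists_branchPrimitive (differentiable_formPolynomial _ _ _)
        (norm_formPolynomial_le _ _ _) ((S t).isBranch.continuousOn_invY _)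
        ((S t).isBranch.invY_cube _) (T.degree_lt (by omega)))
    (differentiable_formPolynomial _ _ _).continuous
  have hlim := tendsto_det_cube d
    (fun t => Matrix.of fun r k : Fin (n + 1) =>
      ((S t).B (σ r)).integral (decide ((k : ℕ) < T.d₁)) (f k))
    (Matrix.of fun r k => (S'.B (σ' r)).integral (decide ((k : ℕ) < T.d₁)) fun x =>
      f k x * limitFactor Γ' p (decide ((k : ℕ) < T.d₁)) x)
    (κ := fun k => κ (decide ((k : ℕ) < T.d₁))) (fun k => hκ _)
    (w := fun t => t * (lam i - lam j)) (hrow d) (fun k hk => ?_) (fun r k => ?_)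
  · have hval : (if decide ((d : ℕ) < T.d₁) = true then 0 else betaStar ^ 3 * f d (Γ'.pos p) ^ 3 *
        ∏ k ∈ T'.terminals.erase p, ((Γ'.pos p - Γ'.pos k) ^ T.b (ι k))⁻¹) =
        betaStar ^ 3 * ∏ k ∈ T'.terminals.erase p, ((Γ'.pos p - Γ'.pos k) ^ T.b (ι k))⁻¹ := by
      have hfd : f d (Γ'.pos p) = 1 := by simp [hf, formPolynomial, hdd]
      rw [hfd, if_neg (by simp [hdd]), one_pow, mul_one]
    have hmat : (Matrix.of fun r k : Fin n => (S'.B (σ' r)).period k) =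
        (Matrix.of fun (r : Fin n) (k : Fin (n + 1)) =>
          (S'.B (σ' r)).integral (decide ((k : ℕ) < T.d₁)) fun x =>
            f k x * limitFactor Γ' p (decide ((k : ℕ) < T.d₁)) x).submatrix id d.succAbove := by
      ext r k
      exact (hd.integral_limitFactor _ hdd k).symm
    rw [hval] at hlim
    rw [hmat]
    exact hlim
  -- Columns before `d₁` are of the first type, whose limit is zero; those behind have a polynomial
  -- factor that vanishes at `λ̃`.
  · have hk' : (k : ℕ) ≠ T.d₁ := fun h => hk (Fin.ext (h.trans hdd.symm))
    have hval : (if decide ((k : ℕ) < T.d₁) = true then 0 else betaStar ^ 3 * f k (Γ'.pos p) ^ 3 *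
        ∏ k ∈ T'.terminals.erase p, ((Γ'.pos p - Γ'.pos k) ^ T.b (ι k))⁻¹) = 0 := by
      split_ifs with h1
      · rfl
      · have h2 : ¬ (k : ℕ) < T.d₁ := by simpa using h1
        have h3 : f k (Γ'.pos p) = 0 := by simp [hf, formPolynomial, h2, hk']
        simp [h3]
    have := hrow k
    rw [hval] at this
    exact this
  · exact hκlim _ (differentiable_formPolynomial _ _ _) (norm_formPolynomial_le _ _ _)
      (T.degree_lt (by omega)) (hσ r)

end Limit

end TripleCover

/-! ### The proposition -/

open Classical in
theorem proposition5p2 {V V' : Type*} [Fintype V] [Fintype V']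
    (T : TripleCover.MarkedBinaryTree V) (T' : TripleCover.MarkedBinaryTree V')
    (ι : V' ↪ V) (i j : V) (p q : V')
    (hdec : TripleCover.IsSimpleDecomposition T T' ι i j p q)
    (lam : V → ℂ) (hlam : Set.InjOn lam (T.terminals : Set V))
    (lam₀ : ℂ) (hlam₀ : ∀ k ∈ T.terminals, k ≠ i → k ≠ j → lam₀ ≠ lam k)
    (Γ' : TripleCover.PlaneEmbedding T') (hΓ'p : Γ'.pos p = lam₀)
    (hΓ' : ∀ k ∈ T'.terminals, k ≠ p → Γ'.pos k = lam (ι k))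
    (S' : Γ'.CycleSystem)
    (r : ℝ) (hr : 0 < r)
    (Γ : ℂ → TripleCover.PlaneEmbedding T) (S : ∀ t, (Γ t).CycleSystem)
    (hpos : ∀ᶠ t in 𝓝[≠] (0 : ℂ), ∀ k ∈ T.terminals,
      (Γ t).pos k = TripleCover.movingPoint lam lam₀ i j t k)
    (hΓ : ∀ᶠ t in 𝓝[≠] (0 : ℂ), TripleCover.IsLocalModification ι i j p q Γ' (Γ t) r)
    (σ : Fin T.genus ≃ T.Inner) (σ' : Fin T'.genus ≃ T'.Inner)
    (hσp : ∀ m, (σ m : V) = ι p → (m : ℕ) = T.d₁)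
    (hσ : ∀ m m', (σ m : V) = ι (σ' m') →
      (m : ℕ) = if (m' : ℕ) < T.d₁ then (m' : ℕ) else (m' : ℕ) + 1) :
    Tendsto (fun t : ℂ => t * (lam i - lam j) * ((S t).PB σ).det ^ 3) (𝓝[≠] 0)
      (𝓝 (TripleCover.betaStar ^ 3 *
        (∏ k ∈ T.terminals with k ≠ i ∧ k ≠ j, ((lam₀ - lam k) ^ T.b k)⁻¹) *
        (S'.PB σ').det ^ 3)) := by
  have hdeg : TripleCover.IsDegeneration ι i j p q Γ' r Γ lam := by
    refine ⟨hr, hdec, hpos.mono fun t ht => ?_, hpos.mono fun t ht => ?_, hΓ⟩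
    · rw [ht i hdec.terminal_i, hΓ'p]
      simp [TripleCover.movingPoint]
    · rw [ht j hdec.terminal_j, hΓ'p]
      simp [TripleCover.movingPoint]
  have hgenus := hdec.genus_eq
  let E : Fin (T'.genus + 1) ≃ Fin T.genus := finCongr hgenus.symm
  have hmp : ((σ.symm ⟨ι p, hdec.isInner_p⟩ : Fin T.genus) : ℕ) = T.d₁ := hσp _ (by simp)
  -- Counted from `0`, the place of `p` is `d₁`. The map `d.succAbove` skips it, which is the
  -- ordering prescribed for the other vertices.
  let d : Fin (T'.genus + 1) := E.symm (σ.symm ⟨ι p, hdec.isInner_p⟩)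
  have hd : (d : ℕ) = T.d₁ := hmp
  have key := hdeg.tendsto_det S' S hgenus (d := d) hd (fun m => σ (E m)) σ' (by simp [d]) (fun k => by
    have hin : T.IsInner (ι (σ' k).1) := (hdec.isInner_iff (hdec.ne_p_of_isInner (σ' k).2)).2 (σ' k).2
    have h1 := hσ (σ.symm ⟨_, hin⟩) k (by simp)
    have h2 : E (d.succAbove k) = σ.symm ⟨_, hin⟩ := by
      apply Fin.ext
      rw [h1, show ((E (d.succAbove k) : Fin T.genus) : ℕ) = (d.succAbove k : ℕ) from rfl]
      split_ifs with hk
      · rw [Fin.succAbove_of_castSucc_lt _ _ (by rw [Fin.lt_def, hd]; exact hk)]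
        rfl
      · rw [Fin.succAbove_of_le_castSucc _ _ (by rw [Fin.le_def, hd]; exact not_lt.1 hk)]
        rfl
    simp only [h2, Equiv.apply_symm_apply])
  have hdet : ∀ t, ((S t).PB σ).det =
      (Matrix.of fun r k : Fin (T'.genus + 1) => ((S t).B (σ (E r))).period k).det := fun t => by
    rw [← Matrix.det_submatrix_equiv_self E]
    rfl
  have h1 : T.terminals.filter (fun k => k ≠ i ∧ k ≠ j) = (T'.terminals.erase p).map ι := by
    ext v
    simp only [hdec.terminals_eq, Finset.mem_filter, Finset.mem_insert, Finset.mem_map, Finset.mem_erase]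
    constructor
    · rintro ⟨h | h | h, h1, h2⟩
      · exact absurd h h1
      · exact absurd h h2
      · exact h
    · intro h
      refine ⟨Or.inr (Or.inr h), ?_⟩
      obtain ⟨w, -, rfl⟩ := h
      exact ⟨hdec.ne_i w, hdec.ne_j w⟩
  have hprod : ∏ k ∈ T.terminals with k ≠ i ∧ k ≠ j, ((lam₀ - lam k) ^ T.b k)⁻¹ =
      ∏ k ∈ T'.terminals.erase p, ((Γ'.pos p - Γ'.pos k) ^ T.b (ι k))⁻¹ := by
    rw [h1, Finset.prod_map]
    refine Finset.prod_congr rfl fun k hk => ?_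
    rw [hΓ'p, hΓ' k (Finset.mem_of_mem_erase hk) (Finset.ne_of_mem_erase hk)]
  simp only [hdet]
  rw [hprod]
  exact key
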